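/- **Setting.** Let $M$ be a compact smooth manifold with corners with boundary hypersurfaces $Y_1,\dots,Y_p$ and boundary defining functions $\rho_1,\dots,\rho_p$ (so $\rho_j\ge 0$, $Y_j=\{\rho_j=0\}$, and near each point the $\rho_j$ that vanish there are the boundary coordinates of a corner chart). Let $M^\circ$ be the interior and $\mathcal V_b(M)$ the set of smooth vector fields on $M$ that are tangent to every boundary hypersurface. For real exponents, constant or variable, $\rho^b=\prod_j\rho_j^{b_j}$. For $m\in\mathbb R^p$ put $$\mathcal A^m(M)=\{w\in C^\infty(M^\circ;\mathbb C): W_1\cdots W_r w\in\rho^mL^\infty(M)\ \text{ for all } r\ge 0,\ W_1,\dots,W_r\in\mathcal V_b(M)\},\qquad \mathcal A^{m-}(M)=\bigcap_{m'_j<m_j\,\forall j}\mathcal A^{m'}(M).$$ For each $j$ let $V_j\in\mathcal V_b(M)$ be radial for $Y_j$, that is, equal near $Y_j$ to $\rho_j\partial_{\rho_j}$ for some product decomposition $Y_j\times[0,\delta)_{\rho_j}$ of a neighborhood of $Y_j$. For $\beta\in C^\infty(M;\mathbb R^p)$, the space $\mathcal A_\beta(M)$ consists of the $u\in C^\infty(M^\circ;\mathbb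 C)$ such that for every $m\in\mathbb N_0^p$ $$\Bigl[\prod_{l=1}^p\prod_{k=0}^{m_l-1}(V_l-k)^{k+1}\Bigr](\rho^{-\beta}u)\in\mathcal A^{m-}(M).$$ Each $Y_j$ is itself a manifold with corners, with boundary faces $Y_j\cap Y_i$ ($i\ne j$), defining functions $\rho_i|_{Y_j}$ and the induced multi-index $\beta^{(j)}=(\beta_i|_{Y_j})_{i\ne j}$; the space $\mathcal A_{\beta^{(j)}}(Y_j)$ is defined in the same way, with any radial vector fields on $Y_j$ for these faces. For each $j$ fix a product decomposition $Y_j\times[0,\delta_j)_{\rho_j}$ of an open neighborhood of $Y_j$, with projection $\pi_j$ to $Y_j$. Fix $0<\varepsilon<\min_j\delta_j$ and a real $\chi\in C^\infty([0,\infty))$ with $\chi=1$ on $[0,\varepsilon/2]$ and $\chi=0$ on $[\varepsilon,\infty)$. For a function $b$ on $Y_j$, $\chi(\rho_j)b$ denotes the function $\chi(\rho_j)\,(b\circ\pi_j)$, extended by zero outside the product neighborhood. For functions $a_{k,l}$ on $Y_j$, the expansion $$u\sim\sum_{0\le l\le k<\infty}\rho_j^{\beta_j+k}(\log\rho_j)^l\,a_{k,l}\quad\text{at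 } Y_j$$ means, with $b_{k,l}=\bigl(\prod_{i\ne j}\rho_i^{-\beta_i}\bigr)\big|_{Y_j}\,a_{k,l}$, that for every integer $q>0$ $$\rho^{-\beta}u-\sum_{0\le l\le k\le q-1}\rho_j^{k}(\log\rho_j)^l\,\chi(\rho_j)\,b_{k,l}\in\mathcal A^{q\langle j\rangle-}(M),$$ where $q\langle j\rangle$ is the multi-index with $q$ in the $j$-th place and $0$ elsewhere. **Proposition.** Let $u\in C^\infty(M^\circ;\mathbb C)$. Then $u\in\mathcal A_\beta(M)$ if and only if, for every $j$, there are functions $a_{k,l}\in\mathcal A_{\beta^{(j)}}(Y_j)$, $0\le l\le k<\infty$, such that $u\sim\sum_{0\le l\le k<\infty}\rho_j^{\beta_j+k}(\log\rho_j)^l\,a_{k,l}$ at $Y_j$. -/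

import Mathlib

open Set Filter Topology
open scoped Manifold ContDiff

noncomputable section

namespace Corners

/-- The model with corners `[0,∞)ⁿ`. -/
abbrev Q (n : ℕ) : ModelWithCorners ℝ (EuclideanSpace ℝ (Fin n)) (EuclideanQuadrant n) :=
  modelWithCornersEuclideanQuadrant n

section Spaces

variable {n : ℕ} {ι : Type*}
  {X : Type*} [TopologicalSpace X] [ChartedSpace (EuclideanQuadrant n) X]

/-- The boundary face `Y_j = {ρ_j = 0}`. -/
def face {X : Type*} (ρ : ι → X → ℝ) (j : ι) : Set X := {x | ρ j x = 0}

/-- The interior of `X`: the points that lie on no boundary face. -/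
def inner {X : Type*} (ρ : ι → X → ℝ) : Set X := {x | ∀ k, 0 < ρ k x}

/-- `ρ` is a complete family of boundary defining functions: smooth non-negative functions such
that near each point `x` there is a chart of `X` into `[0,∞)ⁿ` in which the `ρ_j` that vanish at `x`
are distinct coordinates and all the other coordinates are positive (so that the faces through `x`
are exactly the boundary hypersurfaces of `X` at `x`, and the differentials of their defining
functions are independent). -/
structure IsBoundaryDefining (ρ : ι → X → ℝ) : Prop where
  smooth : ∀ j, ContMDiff (Q n) 𝓘(ℝ, ℝ) ∞ (ρ j)
  nonneg : ∀ j x, 0 ≤ ρ j x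
  adapted : ∀ x : X, ∃ φ ∈ IsManifold.maximalAtlas (Q n) ∞ X, x ∈ φ.source ∧
    ∃ e : {j // ρ j x = 0} → Fin n, Function.Injective e ∧
      ∀ y ∈ φ.source, (∀ j : {j // ρ j x = 0}, (φ y).1 (e j) = ρ j y) ∧
        ∀ i, i ∉ Set.range e → 0 < (φ y).1 i

/-- Vector fields on `X` (no smoothness imposed). -/
abbrev VField (n : ℕ) (X : Type*) [TopologicalSpace X] [ChartedSpace (EuclideanQuadrant n) X] :
    Type _ := (x : X) → TangentSpace (Q n) x

/-- The derivative of the function `w` along the vector field `V`. -/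
def lie (V : VField n X) (w : X → ℂ) (x : X) : ℂ := mfderiv (Q n) 𝓘(ℝ, ℂ) w x (V x)

/-- The derivative of the real function `r` along the vector field `V`. -/
def lieReal (V : VField n X) (r : X → ℝ) (x : X) : ℝ := mfderiv (Q n) 𝓘(ℝ, ℝ) r x (V x)

variable [IsManifold (Q n) ∞ X]

/-- Smoothness of a vector field, as a section of the tangent bundle. -/
def SmoothVField (V : VField n X) : Prop :=
  ContMDiff (Q n) (Q n).tangent ∞ (fun x => (⟨x, V x⟩ : TangentBundle (Q n) X))

/-- `𝒱_b(X)`: the smooth vector fields that are tangent to every boundary face. -/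
def bFields (ρ : ι → X → ℝ) : Set (VField n X) :=
  {V | SmoothVField V ∧ ∀ k, ∀ x ∈ face ρ k, lieReal V (ρ k) x = 0}

/-- `V` is a radial vector field for the `j`-th face: an element of `𝒱_b(X)` which near the face is
`ρ_j ∂_{ρ_j}` for a product decomposition. The coordinate field `T = ∂_{ρ_j}` of a product
decomposition near the face is a smooth vector field with `T ρ_j = 1`, and it is tangent to the
other faces, which here follows from `V ∈ 𝒱_b(X)`; conversely the flow of such a field `T` gives a
product decomposition near a compact face. -/
def IsRadial (ρ : ι → X → ℝ) (j : ι) (V : VField n X) : Prop :=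
  V ∈ bFields ρ ∧ ∃ T : VField n X, SmoothVField T ∧
    ∀ᶠ x in 𝓝ˢ (face ρ j), V x = ρ j x • T x ∧ lieReal T (ρ j) x = 1

variable [Fintype ι]

/-- `ρ^b = ∏_k ρ_k^{b_k}`, for variable exponents `b`. -/
def rhoPow {X : Type*} (ρ : ι → X → ℝ) (b : ι → X → ℝ) (x : X) : ℝ := ∏ k, ρ k x ^ b k x

/-- `𝒜^m(X)`: the smooth functions `w` on the interior such that `V_1 ⋯ V_r w ∈ ρ^m L^∞` for all
`r` and all `V_1, …, V_r ∈ 𝒱_b(X)`. (Functions on the interior are represented by functions on `X`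
whose values on the boundary play no role.) -/
def conormal (ρ : ι → X → ℝ) (m : ι → ℝ) : Set (X → ℂ) :=
  {w | ContMDiffOn (Q n) 𝓘(ℝ, ℂ) ∞ w (inner ρ) ∧
    ∀ L : List (VField n X), (∀ V ∈ L, V ∈ bFields ρ) →
      ∃ C : ℝ, ∀ x ∈ inner ρ, ‖L.foldr lie w x‖ ≤ C * rhoPow ρ (fun k _ => m k) x}

/-- `𝒜^{m-}(X)`: the intersection of the `𝒜^{m'}(X)` with `m'_k < m_k` for each `k`. -/
def conormalMinus (ρ : ι → X → ℝ) (m : ι → ℝ) : Set (X → ℂ) :=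
  {w | ∀ m' : ι → ℝ, (∀ k, m' k < m k) → w ∈ conormal (n := n) ρ m'}

/-- The operator `∏_{k<m} (V - k)^{k+1}`. -/
def radialProd (V : VField n X) : ℕ → (X → ℂ) → (X → ℂ)
  | 0, w => w
  | m + 1, w => (fun f x => lie V f x - (m : ℂ) * f x)^[m + 1] (radialProd V m w)

/-- The operator `∏_l ∏_{k<m_l} (V_l - k)^{k+1}`; the product over `l` is the composition in the
order of the labels `l`. -/
def radialOp [LinearOrder ι] (V : ι → VField n X) (m : ι → ℕ) (w : X → ℂ) : X → ℂ :=
  ((Finset.univ : Finset ι).sort (· ≤ ·)).foldr (fun l f => radialProd (V l) (m l) f) w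

/-- `𝒜_β(X)`: polyhomogeneous functions of variable order `β`, with respect to the boundary
defining functions `ρ` and the radial vector fields `V`. -/
def polyhom [LinearOrder ι] (ρ : ι → X → ℝ) (V : ι → VField n X) (β : ι → X → ℝ) :
    Set (X → ℂ) :=
  {u | ContMDiffOn (Q n) 𝓘(ℝ, ℂ) ∞ u (inner ρ) ∧ ∀ m : ι → ℕ,
    radialOp V m (fun x => (rhoPow ρ (fun k y => -β k y) x : ℂ) * u x) ∈
      conormalMinus (n := n) ρ (fun k => (m k : ℝ))}

end Spaces

section Expansions

variable {n d : ℕ} {ι : Type*}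
  {M : Type*} [TopologicalSpace M] [ChartedSpace (EuclideanQuadrant n) M]

/-- Restriction to the face `Y_j` of a family of functions indexed by the faces of `M`; the member
with the label `j` is dropped. Applied to `ρ` it gives the boundary defining functions of the faces
`Y_j ∩ Y_k` of `Y_j`, and applied to the multi-index `β` it gives `β^{(j)}`. -/
def onFace (ρ : ι → M → ℝ) (j : ι) (b : ι → M → ℝ) : {k // k ≠ j} → face ρ j → ℝ :=
  fun k y => b k y

/-- A product decomposition `Y_j × [0,δ)_{ρ_j}` of an open neighborhood `dom` of `Y_j`, given by the
diffeomorphism `emb : Y_j × [0,δ) → dom` with inverse `x ↦ (proj x, ρ_j x)`. -/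
structure Collar (ρ : ι → M → ℝ) (j : ι) [ChartedSpace (EuclideanQuadrant d) (face ρ j)] where
  width : ℝ
  dom : Set M
  proj : M → face ρ j
  emb : face ρ j × ℝ → M
  width_pos : 0 < width
  isOpen_dom : IsOpen dom
  contMDiffOn_proj : ContMDiffOn (Q n) (Q d) ∞ proj dom
  contMDiffOn_emb : ContMDiffOn ((Q d).prod 𝓘(ℝ, ℝ)) (Q n) ∞ emb (univ ×ˢ Ico 0 width)
  emb_zero : ∀ y : face ρ j, emb (y, 0) = y
  emb_mem : ∀ y, ∀ t ∈ Ico 0 width, emb (y, t) ∈ dom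
  rho_lt : ∀ x ∈ dom, ρ j x < width
  proj_emb : ∀ y, ∀ t ∈ Ico 0 width, proj (emb (y, t)) = y
  rho_emb : ∀ y, ∀ t ∈ Ico 0 width, ρ j (emb (y, t)) = t
  emb_proj : ∀ x ∈ dom, emb (proj x, ρ j x) = x

variable {ρ : ι → M → ℝ} {j : ι} [ChartedSpace (EuclideanQuadrant d) (face ρ j)]

open Classical in
/-- The function `χ(ρ_j) b` on `M`, for a function `b` on `Y_j`: the pull-back of `b` to the product
neighborhood times the cutoff `χ(ρ_j)`, and zero outside the product neighborhood. -/
def Collar.extend (c : Collar (n := n) (d := d) ρ j) (χ : ℝ → ℝ) (b : face ρ j → ℂ) (x : M) : ℂ :=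
  if x ∈ c.dom then (χ (ρ j x) : ℂ) * b (c.proj x) else 0

variable [IsManifold (Q n) ∞ M] [Fintype ι] [DecidableEq ι]

/-- The asymptotic expansion `u ∼ ∑_{0 ≤ l ≤ k} ρ_j^{β_j + k} (log ρ_j)^l a_{k,l}` at the face `Y_j`.
The terms are compared after division by the full weight `ρ^β`, so that `a_{k,l}` gets divided by
its own weight `∏_{i ≠ j} ρ_i^{β_i}`, restricted to `Y_j`. -/
def HasExpansion (c : Collar (n := n) (d := d) ρ j) (χ : ℝ → ℝ) (β : ι → M → ℝ) (u : M → ℂ)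
    (a : ℕ → ℕ → face ρ j → ℂ) : Prop :=
  ∀ q : ℕ, 0 < q →
    (fun x => (rhoPow ρ (fun k y => -β k y) x : ℂ) * u x -
      ∑ k ∈ Finset.range q, ∑ l ∈ Finset.range (k + 1),
        ((ρ j x ^ k * Real.log (ρ j x) ^ l : ℝ) : ℂ) *
          c.extend χ (fun y => (rhoPow (onFace ρ j ρ) (fun i z => -onFace ρ j β i z) y : ℂ) *
            a k l y) x) ∈
      conormalMinus (n := n) ρ (fun i => if i = j then (q : ℝ) else 0)

end Expansions

end Corners

end

open Corners

/-! Everything is said about w = ρ^{-β}u, so that β plays no further role. Write P_q(V) = ∏_{k<q}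
(V-k)^{k+1}. The factor V-k has multiplicity k+1 because t∂_t - k acts on t^k p(log t) by
differentiating p: the power k+1 kills t^k (log t)^l exactly for l ≤ k.

The analysis takes place at one face Y_j at a time. For the radial field D = ρ_j∂_{ρ_j} of the
product decomposition, (D-k)f = g is an ordinary differential equation on each fibre, with
homogeneous solution t^k. Bounds of order σ for g pass to f in two cases: for orders up to k one
integrates inwards from ρ_j = ε, and for orders above k one integrates from 0, provided that f =
o(t^k) there (`IsCutoff.bound_of_lt`, `IsCutoff.bound_of_gt`). The other ρ_i change along fibres
only by bounded factors, so their weights are carried along. Commutators of D with 𝒱_b lie in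
ρ_j𝒱_b, so the estimates extend to all derivatives, with a gain of at most one order at a time
(`IsCutoff.mem_of_shifted_mem`).

The multi-face condition splits into single-face conditions: w ∈ 𝒜^{0-}, and P_q(V_j)w ∈ 𝒜^{q⟨j⟩-}
for all j and q (`radialOp_mem_iff`). The condition at Y_j does not depend on the radial field and
is inherited by 𝒱_b-derivatives (`Descendant.iterate_succ`). To combine order m at Y_j with
exponents μ at other faces, note that P_q(D)f lies in 𝒜^{μ-} and in 𝒜^{q⟨j⟩-}, hence by
interpolation in the space with exponents (1-m/q)μ + m⟨j⟩. The superfluous factors D-k with m ≤ k <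
q are integrated away, and q → ∞ (`IsCutoff.radialDecay`).

Decay at Y_j gives an expansion (`IsCutoff.exists_expansion`). If the remainder e after subtracting
the terms with k < q has order q, then P_{q+1}(D)e has order q+1. The factors with k < q are
removed, which leaves (D-q)^{q+1}e of order q+1. The coefficients of ρ_j^q (log ρ_j)^l then appear
from the highest l downwards, as limits along the fibres of ρ_j^{-q}(D-q)^l e divided by l!. These
limits are smooth and conormal on Y_j because all derivatives along lifted fields converge locally
uniformly.

The coefficients are polyhomogeneous on Y_j. Choose the radial fields of the other faces to be
lifts, near Y_j, of radial fields of Y_j. The product R of their operators acts slice by slice, so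
it acts on the coefficients of w. Since Rw has radial decay at Y_j together with the right exponents
at the other faces, it has an expansion with coefficients of those exponents. Uniqueness of
expansions (`coeff_eq_zero`) identifies these with R applied to the coefficients of w.

Conversely, P_q(D) annihilates the first q groups of terms near Y_j and preserves the space of the
remainder. So expansions at all faces give the single-face conditions. -/

set_option linter.unusedSectionVars false

noncomputable section

namespace Corners

section Basic

variable {n : ℕ} {ι : Type*}
  {X : Type*} [TopologicalSpace X] [ChartedSpace (EuclideanQuadrant n) X]

/-! ### Derivatives along vector fields -/

theorem lie_congr {V : VField n X} {f g : X → ℂ} {x : X} (h : f =ᶠ[𝓝 x] g) :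
    lie V f x = lie V g x := by
  unfold lie; rw [h.mfderiv_eq]; rfl

theorem lieReal_congr {V : VField n X} {f g : X → ℝ} {x : X} (h : f =ᶠ[𝓝 x] g) :
    lieReal V f x = lieReal V g x := by
  unfold lieReal; rw [h.mfderiv_eq]; rfl

theorem lie_add {V : VField n X} {f g : X → ℂ} {x : X}
    (hf : MDifferentiableAt (Q n) 𝓘(ℝ, ℂ) f x) (hg : MDifferentiableAt (Q n) 𝓘(ℝ, ℂ) g x) :
    lie V (fun y => f y + g y) x = lie V f x + lie V g x := by
  unfold lie
  have := (hf.hasMFDerivAt.add hg.hasMFDerivAt).mfderiv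
  exact congrArg (fun A => A (V x)) this

theorem lie_sub {V : VField n X} {f g : X → ℂ} {x : X}
    (hf : MDifferentiableAt (Q n) 𝓘(ℝ, ℂ) f x) (hg : MDifferentiableAt (Q n) 𝓘(ℝ, ℂ) g x) :
    lie V (fun y => f y - g y) x = lie V f x - lie V g x := by
  unfold lie
  have := (hf.hasMFDerivAt.sub hg.hasMFDerivAt).mfderiv
  exact congrArg (fun A => A (V x)) this

theorem lie_mul {V : VField n X} {f g : X → ℂ} {x : X}
    (hf : MDifferentiableAt (Q n) 𝓘(ℝ, ℂ) f x) (hg : MDifferentiableAt (Q n) 𝓘(ℝ, ℂ) g x) :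
    lie V (fun y => f y * g y) x = lie V f x * g x + f x * lie V g x := by
  unfold lie
  have := (hf.hasMFDerivAt.mul hg.hasMFDerivAt).mfderiv
  refine (congrArg (fun A => A (V x)) this).trans ?_
  change f x * _ + g x * _ = _
  rw [add_comm, mul_comm (g x)]; rfl

theorem lie_const {V : VField n X} (c : ℂ) (x : X) : lie V (fun _ => c) x = 0 := by
  unfold lie; rw [mfderiv_const]; rfl

theorem lieReal_const {V : VField n X} (c : ℝ) (x : X) : lieReal V (fun _ => c) x = 0 := by
  unfold lieReal; rw [mfderiv_const]; rfl

theorem lieReal_add {V : VField n X} {f g : X → ℝ} {x : X}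
    (hf : MDifferentiableAt (Q n) 𝓘(ℝ, ℝ) f x) (hg : MDifferentiableAt (Q n) 𝓘(ℝ, ℝ) g x) :
    lieReal V (fun y => f y + g y) x = lieReal V f x + lieReal V g x := by
  unfold lieReal
  have := (hf.hasMFDerivAt.add hg.hasMFDerivAt).mfderiv
  exact congrArg (fun A => A (V x)) this

theorem lieReal_mul {V : VField n X} {f g : X → ℝ} {x : X}
    (hf : MDifferentiableAt (Q n) 𝓘(ℝ, ℝ) f x) (hg : MDifferentiableAt (Q n) 𝓘(ℝ, ℝ) g x) :
    lieReal V (fun y => f y * g y) x = lieReal V f x * g x + f x * lieReal V g x := by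
  unfold lieReal
  have := (hf.hasMFDerivAt.mul hg.hasMFDerivAt).mfderiv
  refine (congrArg (fun A => A (V x)) this).trans ?_
  change f x * _ + g x * _ = _
  rw [add_comm, mul_comm (g x)]; rfl

theorem hasMFDerivAt_clm_comp {F G : Type*} [NormedAddCommGroup F] [NormedSpace ℝ F]
    [NormedAddCommGroup G] [NormedSpace ℝ G] (L : F →L[ℝ] G) {g : X → F} {x : X}
    (hg : MDifferentiableAt (Q n) 𝓘(ℝ, F) g x) :
    mfderiv (Q n) 𝓘(ℝ, G) (fun y => L (g y)) x = L.comp (mfderiv (Q n) 𝓘(ℝ, F) g x) :=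
  ((L.hasFDerivAt (x := g x)).hasMFDerivAt.comp x hg.hasMFDerivAt).mfderiv

theorem lie_ofReal {V : VField n X} {g : X → ℝ} {x : X}
    (hg : MDifferentiableAt (Q n) 𝓘(ℝ, ℝ) g x) :
    lie V (fun y => (g y : ℂ)) x = (lieReal V g x : ℂ) := by
  have := hasMFDerivAt_clm_comp Complex.ofRealCLM hg
  exact congrArg (fun A => A (V x)) this

theorem mdiff_ofReal {g : X → ℝ} {x : X}
    (hg : MDifferentiableAt (Q n) 𝓘(ℝ, ℝ) g x) :
    MDifferentiableAt (Q n) 𝓘(ℝ, ℂ) (fun y => (g y : ℂ)) x :=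
  ((Complex.ofRealCLM.hasFDerivAt (x := g x)).hasMFDerivAt.comp x hg.hasMFDerivAt).mdifferentiableAt

theorem lie_real_mul {V : VField n X} {g : X → ℝ} {f : X → ℂ} {x : X}
    (hg : MDifferentiableAt (Q n) 𝓘(ℝ, ℝ) g x) (hf : MDifferentiableAt (Q n) 𝓘(ℝ, ℂ) f x) :
    lie V (fun y => (g y : ℂ) * f y) x = (lieReal V g x : ℂ) * f x + (g x : ℂ) * lie V f x := by
  rw [lie_mul (mdiff_ofReal hg) hf, lie_ofReal hg]

theorem lieReal_comp {V : VField n X} {g : X → ℝ} {φ : ℝ → ℝ} {φ' : ℝ} {x : X}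
    (hg : MDifferentiableAt (Q n) 𝓘(ℝ, ℝ) g x) (hφ : HasDerivAt φ φ' (g x)) :
    lieReal V (fun y => φ (g y)) x = φ' * lieReal V g x := by
  have := ((hφ.hasFDerivAt).hasMFDerivAt.comp x hg.hasMFDerivAt).mfderiv
  refine (congrArg (fun A => A (V x)) this).trans ?_
  change (ContinuousLinearMap.toSpanSingleton ℝ φ') (lieReal V g x) = _
  simp [mul_comm]

theorem lie_field_add (V W : VField n X) (f : X → ℂ) (x : X) :
    lie (fun y => V y + W y) f x = lie V f x + lie W f x := by
  unfold lie; exact map_add _ _ _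

theorem lie_field_smul (g : X → ℝ) (V : VField n X) (f : X → ℂ) (x : X) :
    lie (fun y => g y • V y) f x = (g x : ℂ) * lie V f x := by
  unfold lie
  refine (map_smul (mfderiv (Q n) 𝓘(ℝ, ℂ) f x) (g x) (V x)).trans ?_
  exact Complex.real_smul

theorem lieReal_field_add (V W : VField n X) (f : X → ℝ) (x : X) :
    lieReal (fun y => V y + W y) f x = lieReal V f x + lieReal W f x := by
  unfold lieReal; exact map_add _ _ _

theorem lieReal_field_smul (g : X → ℝ) (V : VField n X) (f : X → ℝ) (x : X) :
    lieReal (fun y => g y • V y) f x = g x * lieReal V f x := by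
  unfold lieReal
  exact map_smul (mfderiv (Q n) 𝓘(ℝ, ℝ) f x) (g x) (V x)

theorem lie_field_congr {V W : VField n X} {x : X} (h : V x = W x) (f : X → ℂ) :
    lie V f x = lie W f x := by
  unfold lie; rw [h]

theorem lieReal_field_congr {V W : VField n X} {x : X} (h : V x = W x) (f : X → ℝ) :
    lieReal V f x = lieReal W f x := by
  unfold lieReal; rw [h]

/-- A function that is smooth on an open set containing the support of the smooth function `a`
becomes globally smooth after multiplication by `a`. -/
theorem contMDiff_mul_of_tsupport {a f : X → ℝ} {U : Set X} (hU : IsOpen U)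
    (ha : ContMDiff (Q n) 𝓘(ℝ, ℝ) ∞ a) (haU : tsupport a ⊆ U)
    (hf : ContMDiffOn (Q n) 𝓘(ℝ, ℝ) ∞ f U) :
    ContMDiff (Q n) 𝓘(ℝ, ℝ) ∞ (fun x => a x * f x) := by
  refine contMDiff_of_tsupport fun x hx => ?_
  have hxU : x ∈ U := haU (tsupport_mul_subset_left hx)
  exact (ha x).mul (hf.contMDiffAt (hU.mem_nhds hxU))

variable [IsManifold (Q n) ∞ X]

instance isManifold_one : IsManifold (Q n) 1 X := IsManifold.of_le (n := ∞) (by norm_cast)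

section Smoothness

variable {F : Type*} [NormedAddCommGroup F] [NormedSpace ℝ F]

/-- The derivative along V is the fibre component of the tangent map of f composed with the section
V, and both are smooth. -/
theorem contMDiffOn_mfderiv_apply {V : VField n X} (hV : SmoothVField V) {f : X → F} {U : Set X}
    (hU : IsOpen U) (hf : ContMDiffOn (Q n) 𝓘(ℝ, F) ∞ f U) :
    ContMDiffOn (Q n) 𝓘(ℝ, F) ∞ (fun x => (mfderiv (Q n) 𝓘(ℝ, F) f x (V x) : F)) U := by
  have h1 := hf.contMDiffOn_tangentMapWithin (m := ∞) le_rfl hU.uniqueMDiffOn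
  have h2 : ContMDiffOn (Q n) 𝓘(ℝ, F).tangent ∞
      (fun x => tangentMapWithin (Q n) 𝓘(ℝ, F) f U ⟨x, V x⟩) U :=
    h1.comp hV.contMDiffOn (fun x hx => hx)
  have h3 := (contMDiff_snd_tangentBundle_modelSpace F 𝓘(ℝ, F) (n := ∞)).comp_contMDiffOn h2
  refine h3.congr fun x hx => ?_
  simp only [Function.comp, tangentMapWithin]
  rw [mfderivWithin_of_isOpen hU hx]

theorem SmoothVField.lie {V : VField n X} (hV : SmoothVField V) {f : X → ℂ} {U : Set X}
    (hU : IsOpen U) (hf : ContMDiffOn (Q n) 𝓘(ℝ, ℂ) ∞ f U) :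
    ContMDiffOn (Q n) 𝓘(ℝ, ℂ) ∞ (lie V f) U := contMDiffOn_mfderiv_apply hV hU hf

theorem SmoothVField.lieReal_on {V : VField n X} (hV : SmoothVField V) {f : X → ℝ} {U : Set X}
    (hU : IsOpen U) (hf : ContMDiffOn (Q n) 𝓘(ℝ, ℝ) ∞ f U) :
    ContMDiffOn (Q n) 𝓘(ℝ, ℝ) ∞ (lieReal V f) U := contMDiffOn_mfderiv_apply hV hU hf

theorem SmoothVField.lieReal {V : VField n X} (hV : SmoothVField V) {f : X → ℝ}
    (hf : ContMDiff (Q n) 𝓘(ℝ, ℝ) ∞ f) :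
    ContMDiff (Q n) 𝓘(ℝ, ℝ) ∞ (lieReal V f) := by
  rw [← contMDiffOn_univ]
  exact contMDiffOn_mfderiv_apply hV isOpen_univ hf.contMDiffOn

end Smoothness

theorem SmoothVField.add {V W : VField n X} (hV : SmoothVField V) (hW : SmoothVField W) :
    SmoothVField (fun x => V x + W x) := ContMDiff.add_section hV hW

theorem SmoothVField.sub {V W : VField n X} (hV : SmoothVField V) (hW : SmoothVField W) :
    SmoothVField (fun x => V x - W x) := ContMDiff.sub_section hV hW

theorem SmoothVField.smul {V : VField n X} (hV : SmoothVField V) {g : X → ℝ}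
    (hg : ContMDiff (Q n) 𝓘(ℝ, ℝ) ∞ g) :
    SmoothVField (fun x => g x • V x) := ContMDiff.smul_section hg hV

theorem ContMDiffOn.smoothVField_smul {V : VField n X} {U : Set X}
    (hV : ContMDiffOn (Q n) (Q n).tangent ∞ (fun x => (⟨x, V x⟩ : TangentBundle (Q n) X)) U)
    (hU : IsOpen U) {g : X → ℝ}
    (hg : ContMDiff (Q n) 𝓘(ℝ, ℝ) ∞ g) (hgU : tsupport g ⊆ U) :
    SmoothVField (fun x => g x • V x) :=
  ContMDiffOn.smul_section_of_tsupport hg.contMDiffOn hU hgU hV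

instance isManifold_two : IsManifold (Q n) 2 X :=
  IsManifold.of_le (n := ∞) (by norm_cast)

instance isManifold_minSmoothness (k : ℕ) : IsManifold (Q n) (minSmoothness ℝ k) X := by
  rw [minSmoothness_of_isRCLikeNormedField]
  exact IsManifold.of_le (n := ∞) (by exact_mod_cast le_top)

instance isManifold_minSmoothness_three : IsManifold (Q n) (minSmoothness ℝ 3) X :=
  isManifold_minSmoothness 3

open VectorField in
theorem SmoothVField.bracket {V W : VField n X} {x : X}
    (hV : ContMDiffAt (Q n) (Q n).tangent ∞ (fun x => (⟨x, V x⟩ : TangentBundle (Q n) X)) x)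
    (hW : ContMDiffAt (Q n) (Q n).tangent ∞ (fun x => (⟨x, W x⟩ : TangentBundle (Q n) X)) x) :
    ContMDiffAt (Q n) (Q n).tangent ∞
      (fun x => (⟨x, mlieBracket (Q n) V W x⟩ : TangentBundle (Q n) X)) x := by
  have : IsManifold (Q n) ((⊤ : ℕ∞) + 1 : WithTop ℕ∞) X := by simpa using (inferInstance : IsManifold (Q n) ∞ X)
  refine ContMDiffAt.mlieBracket_vectorField (m := ⊤) (n := ⊤) hV hW ?_
  rw [minSmoothness_of_isRCLikeNormedField]
  exact le_rfl

open VectorField in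
/-- The commutator of two smooth vector fields acts on functions as a smooth vector field. -/
theorem lieReal_bracket {V W : VField n X} (hV : SmoothVField V) (hW : SmoothVField W)
    {U : Set X} {f : X → ℝ} (hU : IsOpen U) (hUf : ContMDiffOn (Q n) 𝓘(ℝ, ℝ) ∞ f U) {x : X}
    (hxU : x ∈ U) : lieReal V (lieReal W f) x - lieReal W (lieReal V f) x =
      lieReal (mlieBracket (Q n) V W) f x := by
  have hmf : ∀ y ∈ U, MDifferentiableAt (Q n) 𝓘(ℝ, ℝ) f y := fun y hy =>
    (hUf.contMDiffAt (hU.mem_nhds hy)).mdifferentiableAt (by simp)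
  have hVf := ((hV.lieReal_on hU hUf).contMDiffAt (hU.mem_nhds hxU)).mdifferentiableAt (by simp)
  have hWf := ((hW.lieReal_on hU hUf).contMDiffAt (hU.mem_nhds hxU)).mdifferentiableAt (by simp)
  -- The Jacobi identity is applied to V, W and f • Z for a local field Z extending w. By the
  -- Leibniz rule the terms in which f is differentiated twice give ([V,W]-derivative of f) times w.
  -- The mixed terms cancel, and the terms without derivatives of f cancel by the Jacobi identity
  -- for Z.
  have key : ∀ w : TangentSpace (Q n) x,
      (lieReal V (lieReal W f) x - lieReal W (lieReal V f) x
        - lieReal (mlieBracket (Q n) V W) f x) • w = 0 := by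
    intro w
    set Z : VField n X := FiberBundle.extend (EuclideanSpace ℝ (Fin n)) w with hZ
    have hZx : Z x = w := by simp [hZ]
    obtain ⟨U', hU', hZs⟩ : ∃ s ∈ 𝓝 x, ContMDiffOn (Q n) (Q n).tangent ∞
      (fun x => (⟨x, Z x⟩ : TangentBundle (Q n) X)) s := FiberBundle.exists_contMDiffOn_extend _ _ w
    obtain ⟨U'', hU''s, hU''o, hxU''⟩ := mem_nhds_iff.1 hU'
    have hZd : ∀ y ∈ U'', ContMDiffAt (Q n) (Q n).tangent ∞
      (fun x => (⟨x, Z x⟩ : TangentBundle (Q n) X)) y := fun y hy =>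
        (hZs.mono hU''s).contMDiffAt (hU''o.mem_nhds hy)
    have hd : ∀ {Y : VField n X} {y : X}, ContMDiffAt (Q n) (Q n).tangent ∞
      (fun x => (⟨x, Y x⟩ : TangentBundle (Q n) X)) y →
      MDifferentiableAt (Q n) (Q n).tangent
      (fun x => (⟨x, Y x⟩ : TangentBundle (Q n) X)) y := fun h => h.mdifferentiableAt (by simp)
    have h1 : ∀ Y : VField n X, mlieBracket (Q n) Y (f • Z) =ᶠ[𝓝 x]
        (lieReal Y f) • Z + f • mlieBracket (Q n) Y Z := by
      intro Y
      filter_upwards [hU.mem_nhds hxU, hU''o.mem_nhds hxU''] with y hy hy'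
      exact mlieBracket_smul_right (hmf y hy) (hd (hZd y hy'))
    have h2 : ∀ Y Y' : VField n X, SmoothVField Y → SmoothVField Y' →
        MDifferentiableAt (Q n) 𝓘(ℝ, ℝ) (lieReal Y' f) x →
        mlieBracket (Q n) Y (mlieBracket (Q n) Y' (f • Z)) x =
        lieReal Y (lieReal Y' f) x • w + lieReal Y' f x • mlieBracket (Q n) Y Z x +
        (lieReal Y f x • mlieBracket (Q n) Y' Z x +
          f x • mlieBracket (Q n) Y (mlieBracket (Q n) Y' Z) x) := by
      intro Y Y' hY hY' hYf
      rw [Filter.EventuallyEq.mlieBracket_vectorField_eq (V := Y) (V₁ := Y)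
        Filter.EventuallyEq.rfl (h1 Y')]
      have hb : MDifferentiableAt (Q n) (Q n).tangent
        (fun x => (⟨x, mlieBracket (Q n) Y' Z x⟩ : TangentBundle (Q n) X)) x :=
        hd (SmoothVField.bracket (hY' x) (hZd x hxU''))
      have hz := hd (hZd x hxU'')
      rw [mlieBracket_add_right (hYf.smul_section hz) ((hmf x hxU).smul_section hb),
        mlieBracket_smul_right hYf hz, mlieBracket_smul_right (hmf x hxU) hb, ← hZx]
      rfl
    have hle : (minSmoothness ℝ 2 : WithTop ℕ∞) ≤ ∞ := by
      rw [minSmoothness_of_isRCLikeNormedField]; norm_cast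
    have hfZ : ContMDiffAt (Q n) (Q n).tangent ∞
      (fun x => (⟨x, (f • Z) x⟩ : TangentBundle (Q n) X)) x :=
      ContMDiffAt.smul_section (hUf.contMDiffAt (hU.mem_nhds hxU)) (hZd x hxU'')
    have j1 := leibniz_identity_mlieBracket_apply ((hV x).of_le hle) ((hW x).of_le hle)
      (hfZ.of_le hle)
    have j2 := leibniz_identity_mlieBracket_apply ((hV x).of_le hle) ((hW x).of_le hle)
      ((hZd x hxU'').of_le hle)
    rw [h2 V W hV hW hWf, h2 W V hW hV hVf, (h1 _).eq_of_nhds] at j1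
    simp only [Pi.add_apply, Pi.smul_apply', j2, hZx] at j1
    rw [sub_smul, sub_smul]
    rw [smul_add] at j1
    rw [← sub_eq_zero.2 j1]
    abel
  -- If the tangent space is zero, all derivatives vanish. Otherwise a nonzero w may be cancelled.
  rcases subsingleton_or_nontrivial (TangentSpace (Q n) x) with hs | hs
  · have e : ∀ (V : VField n X) (g : X → ℝ), lieReal V g x = 0 := by
      intro V g
      unfold lieReal
      rw [Subsingleton.elim (V x) 0]
      exact map_zero (mfderiv (Q n) 𝓘(ℝ, ℝ) g x)
    rw [e, e, e, sub_zero]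
  · obtain ⟨w, hw⟩ := exists_ne (0 : TangentSpace (Q n) x)
    have := (smul_eq_zero.1 (key w)).resolve_right hw
    linarith

theorem lie_re {V : VField n X} {f : X → ℂ} {x : X}
    (hf : MDifferentiableAt (Q n) 𝓘(ℝ, ℂ) f x) :
    (lie V f x).re = lieReal V (fun y => (f y).re) x :=
  (congrArg (fun A => A (V x)) (hasMFDerivAt_clm_comp Complex.reCLM hf)).symm

theorem lie_im {V : VField n X} {f : X → ℂ} {x : X}
    (hf : MDifferentiableAt (Q n) 𝓘(ℝ, ℂ) f x) :
    (lie V f x).im = lieReal V (fun y => (f y).im) x :=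
  (congrArg (fun A => A (V x)) (hasMFDerivAt_clm_comp Complex.imCLM hf)).symm

theorem mdiffAt_of_contMDiffOn {F : Type*} [NormedAddCommGroup F] [NormedSpace ℝ F] {f : X → F}
    {U : Set X} (hU : IsOpen U) (hf : ContMDiffOn (Q n) 𝓘(ℝ, F) ∞ f U) {x : X} (hx : x ∈ U) :
    MDifferentiableAt (Q n) 𝓘(ℝ, F) f x :=
  (hf.contMDiffAt (hU.mem_nhds hx)).mdifferentiableAt (by simp)

open VectorField in
theorem lie_bracket {V W : VField n X} (hV : SmoothVField V) (hW : SmoothVField W)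
    {U : Set X} {f : X → ℂ} (hU : IsOpen U) (hf : ContMDiffOn (Q n) 𝓘(ℝ, ℂ) ∞ f U) {x : X}
    (hx : x ∈ U) : lie V (lie W f) x - lie W (lie V f) x =
      lie (mlieBracket (Q n) V W) f x := by
  have hd : ∀ y ∈ U, MDifferentiableAt (Q n) 𝓘(ℝ, ℂ) f y := fun y => mdiffAt_of_contMDiffOn hU hf
  have hre : ContMDiffOn (Q n) 𝓘(ℝ, ℝ) ∞ (fun y => (f y).re) U :=
    Complex.reCLM.contMDiff.comp_contMDiffOn hf
  have him : ContMDiffOn (Q n) 𝓘(ℝ, ℝ) ∞ (fun y => (f y).im) U :=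
    Complex.imCLM.contMDiff.comp_contMDiffOn hf
  have hdl : ∀ {Y : VField n X}, SmoothVField Y → MDifferentiableAt (Q n) 𝓘(ℝ, ℂ) (lie Y f) x :=
    fun hY => mdiffAt_of_contMDiffOn hU (hY.lie hU hf) hx
  have ere : ∀ Y : VField n X, (fun y => (lie Y f y).re) =ᶠ[𝓝 x] lieReal Y fun y => (f y).re :=
    fun Y => by filter_upwards [hU.mem_nhds hx] with y hy using lie_re (hd y hy)
  have eim : ∀ Y : VField n X, (fun y => (lie Y f y).im) =ᶠ[𝓝 x] lieReal Y fun y => (f y).im :=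
    fun Y => by filter_upwards [hU.mem_nhds hx] with y hy using lie_im (hd y hy)
  apply Complex.ext
  · rw [Complex.sub_re, lie_re (hdl hW), lie_re (hdl hV), lie_re (hd x hx),
      ← lieReal_bracket hV hW hU hre hx, lieReal_congr (ere W), lieReal_congr (ere V)]
  · rw [Complex.sub_im, lie_im (hdl hW), lie_im (hdl hV), lie_im (hd x hx),
      ← lieReal_bracket hV hW hU him hx, lieReal_congr (eim W), lieReal_congr (eim V)]

end Basic

/-! ### Parametric integrals on convex sets and Hadamard's lemma -/

section Parametric

theorem continuousOn_slice {E G : Type} [NormedAddCommGroup E] [NormedAddCommGroup G]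
    {S : Set E} {F : E × ℝ → G} (hF : ContinuousOn F (S ×ˢ Icc 0 1)) {x : E}
    (hx : x ∈ S) : ContinuousOn (fun s => F (x, s)) (uIcc (0 : ℝ) 1) := by
  rw [uIcc_of_le zero_le_one]
  exact hF.comp (by fun_prop) fun s hs => ⟨hx, hs⟩

variable {E G : Type} [NormedAddCommGroup E] [NormedSpace ℝ E] [NormedAddCommGroup G]
  [NormedSpace ℝ G] [CompleteSpace G] {S : Set E}

omit [CompleteSpace G] in
-- By compactness of [0,1], `F'` varies little in x uniformly in s. The mean value inequality on the
-- convex set S ∩ ball then bounds the linearization error of the integrand uniformly in s.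
theorem hasFDerivWithinAt_parametric_integral (hS : Convex ℝ S) {F : E × ℝ → G}
    {F' : E × ℝ → E →L[ℝ] G} (hF : ContinuousOn F (S ×ˢ Icc 0 1))
    (hF' : ContinuousOn F' (S ×ˢ Icc 0 1))
    (hd : ∀ s ∈ Icc (0 : ℝ) 1, ∀ x ∈ S, HasFDerivWithinAt (fun y => F (y, s)) (F' (x, s)) S x)
    {x : E} (hx : x ∈ S) :
    HasFDerivWithinAt (fun y => ∫ s in (0 : ℝ)..1, F (y, s)) (∫ s in (0 : ℝ)..1, F' (x, s)) S x := by
  rw [hasFDerivWithinAt_iff_isLittleO, Asymptotics.isLittleO_iff]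
  intro c hc
  obtain ⟨v, hv, hvb⟩ := isCompact_Icc.mem_uniformity_of_prod (f := fun y s => F' (y, s)) hF' hx
    (Metric.dist_mem_uniformity hc)
  obtain ⟨r, hr, hrv⟩ := Metric.mem_nhdsWithin_iff.1 hv
  filter_upwards [inter_mem_nhdsWithin S (Metric.ball_mem_nhds x hr)] with y hy
  have hcF := fun {x} hx => continuousOn_slice hF (x := x) hx
  have hcF' := fun {x} hx => continuousOn_slice hF' (x := x) hx
  have e : (∫ s in (0 : ℝ)..1, F (y, s)) - (∫ s in (0 : ℝ)..1, F (x, s))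
      - (∫ s in (0 : ℝ)..1, F' (x, s)) (y - x)
      = ∫ s in (0 : ℝ)..1, (F (y, s) - F (x, s) - F' (x, s) (y - x)) := by
    rw [ContinuousLinearMap.intervalIntegral_apply (hcF' hx).intervalIntegrable,
      intervalIntegral.integral_sub, intervalIntegral.integral_sub]
    · exact (hcF hy.1).intervalIntegrable
    · exact (hcF hx).intervalIntegrable
    · exact ((hcF hy.1).sub (hcF hx)).intervalIntegrable
    · exact ((hcF' hx).clm_apply continuousOn_const).intervalIntegrable
  rw [e]
  have := intervalIntegral.norm_integral_le_of_norm_le_const (a := (0 : ℝ)) (b := 1)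
    (f := fun s => F (y, s) - F (x, s) - F' (x, s) (y - x)) (C := c * ‖y - x‖) ?_
  · simpa using this
  intro s hs
  rw [uIoc_of_le zero_le_one] at hs
  have hs' : s ∈ Icc (0 : ℝ) 1 := ⟨hs.1.le, hs.2⟩
  have hconv : Convex ℝ (S ∩ Metric.ball x r) := hS.inter (convex_ball x r)
  refine hconv.norm_image_sub_le_of_norm_hasFDerivWithin_le' (f := fun y => F (y, s))
    (f' := fun z => F' (z, s)) (fun z hz => (hd s hs' z hz.1).mono inter_subset_left) ?_
    ⟨hx, Metric.mem_ball_self hr⟩ hy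
  intro z hz
  have := hvb z (hrv ⟨hz.2, hz.1⟩) s hs'
  simp only [mem_ofPred_eq, dist_eq_norm] at this
  exact this.le

/-- The derivative of the integral is again a parametric integral, of a function with values in E →L
G. The target therefore has to be general in the induction on k. -/
theorem contDiffOn_parametric_integral_nat (hS : Convex ℝ S) (hSu : UniqueDiffOn ℝ S) (k : ℕ) :
    ∀ {G : Type} [NormedAddCommGroup G] [NormedSpace ℝ G] [CompleteSpace G] {F : E × ℝ → G},
    ContDiffOn ℝ ∞ F (S ×ˢ Icc 0 1) →
    ContDiffOn ℝ k (fun y => ∫ s in (0 : ℝ)..1, F (y, s)) S := by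
  have hu : UniqueDiffOn ℝ (S ×ˢ Icc (0 : ℝ) 1) := hSu.prod (uniqueDiffOn_Icc zero_lt_one)
  have hd : ∀ {G : Type} [NormedAddCommGroup G] [NormedSpace ℝ G] [CompleteSpace G]
      {F : E × ℝ → G}, ContDiffOn ℝ ∞ F (S ×ˢ Icc 0 1) →
      ContDiffOn ℝ ∞ (fun p : E × ℝ => (fderivWithin ℝ F (S ×ˢ Icc 0 1) p).comp
        (ContinuousLinearMap.inl ℝ E ℝ)) (S ×ˢ Icc 0 1) ∧
      ∀ x ∈ S, HasFDerivWithinAt (fun y => ∫ s in (0 : ℝ)..1, F (y, s))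
        (∫ s in (0 : ℝ)..1, (fderivWithin ℝ F (S ×ˢ Icc 0 1) (x, s)).comp
        (ContinuousLinearMap.inl ℝ E ℝ)) S x := by
    intro G _ _ _ F hF
    have h1 : ContDiffOn ℝ ∞ (fun p : E × ℝ => (fderivWithin ℝ F (S ×ˢ Icc 0 1) p).comp
        (ContinuousLinearMap.inl ℝ E ℝ)) (S ×ˢ Icc 0 1) :=
      (hF.fderivWithin hu (m := ∞) le_rfl).clm_comp contDiffOn_const
    refine ⟨h1, fun x hx => ?_⟩
    refine hasFDerivWithinAt_parametric_integral hS hF.continuousOn h1.continuousOn ?_ hx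
    intro s hs y hy
    have h2 := (hF.differentiableOn (by simp) (y, s) ⟨hy, hs⟩).hasFDerivWithinAt
    have h3 := (hasFDerivAt_prodMk_left (𝕜 := ℝ) y s).hasFDerivWithinAt (s := S)
    have h4 : MapsTo (fun z : E => (z, s)) S (S ×ˢ Icc (0 : ℝ) 1) := fun z hz => ⟨hz, hs⟩
    exact h2.comp y h3 h4
  induction k with
  | zero =>
    intro G _ _ _ F hF
    exact contDiffOn_zero.2 fun x hx => ((hd hF).2 x hx).continuousWithinAt
  | succ k ih =>
    intro G _ _ _ F hF
    push_cast
    rw [contDiffOn_succ_iff_hasFDerivWithinAt_of_uniqueDiffOn hSu]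
    exact ⟨by simp, _, ih (hd hF).1, (hd hF).2⟩

theorem contDiffOn_parametric_integral (hS : Convex ℝ S) (hSu : UniqueDiffOn ℝ S)
    {F : E × ℝ → G} (hF : ContDiffOn ℝ ∞ F (S ×ˢ Icc 0 1)) :
    ContDiffOn ℝ ∞ (fun y => ∫ s in (0 : ℝ)..1, F (y, s)) S :=
  contDiffOn_infty.2 fun k => contDiffOn_parametric_integral_nat hS hSu k hF

end Parametric

section Hadamard

variable {n : ℕ}

/-- Scaling of the `i`-th coordinate by the factor `s`. -/
def scaleCoord (i : Fin n) (x : EuclideanSpace ℝ (Fin n)) (s : ℝ) : EuclideanSpace ℝ (Fin n) :=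
  x + ((s - 1) * x i) • EuclideanSpace.single i 1

theorem scaleCoord_apply_self (i : Fin n) (x : EuclideanSpace ℝ (Fin n)) (s : ℝ) :
    scaleCoord i x s i = s * x i := by
  simp [scaleCoord]; ring

theorem scaleCoord_apply_ne {i k : Fin n} (h : k ≠ i) (x : EuclideanSpace ℝ (Fin n)) (s : ℝ) :
    scaleCoord i x s k = x k := by
  simp [scaleCoord, h]

theorem contDiff_scaleCoord (i : Fin n) :
    ContDiff ℝ ∞ (fun p : EuclideanSpace ℝ (Fin n) × ℝ => scaleCoord i p.1 p.2) := by
  unfold scaleCoord; fun_prop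

/-- Hadamard's lemma: a smooth function on a set that is stable under scaling of the `i`-th
coordinate, vanishing where that coordinate vanishes, is divisible by the coordinate. -/
theorem exists_eq_coord_mul {S : Set (EuclideanSpace ℝ (Fin n))} (hS : Convex ℝ S)
    (hSu : UniqueDiffOn ℝ S) (i : Fin n)
    (hsc : ∀ x ∈ S, ∀ s ∈ Icc (0 : ℝ) 1, scaleCoord i x s ∈ S)
    {g : EuclideanSpace ℝ (Fin n) → ℝ} (hg : ContDiffOn ℝ ∞ g S)
    (h0 : ∀ x ∈ S, x i = 0 → g x = 0) :
    ∃ h : EuclideanSpace ℝ (Fin n) → ℝ, ContDiffOn ℝ ∞ h S ∧ ∀ x ∈ S, g x = x i * h x := by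
  set e : EuclideanSpace ℝ (Fin n) := EuclideanSpace.single i 1
  -- The quotient is the integral over s in [0,1] of ∂_i g at the point with i-th coordinate scaled
  -- by s. The fundamental theorem of calculus along s gives g(x) - g(x with x_i = 0) = x_i times
  -- this integral.
  have hF : ContDiffOn ℝ ∞ (fun p : EuclideanSpace ℝ (Fin n) × ℝ =>
      fderivWithin ℝ g S (scaleCoord i p.1 p.2) e) (S ×ˢ Icc 0 1) :=
    ((hg.fderivWithin hSu (m := ∞) le_rfl).comp (contDiff_scaleCoord i).contDiffOn
      fun p hp => hsc p.1 hp.1 p.2 hp.2).clm_apply contDiffOn_const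
  refine ⟨_, contDiffOn_parametric_integral hS hSu hF, fun x hx => ?_⟩
  have hd : ∀ s ∈ Icc (0 : ℝ) 1, HasDerivWithinAt (fun s => g (scaleCoord i x s))
      (x i * fderivWithin ℝ g S (scaleCoord i x s) e) (Icc 0 1) s := by
    intro s hs
    have h1 := (hg.differentiableOn (by simp) _ (hsc x hx s hs)).hasFDerivWithinAt
    have h2 : HasDerivWithinAt (fun s => scaleCoord i x s) (x i • e) (Icc 0 1) s := by
      have : HasDerivAt (fun s : ℝ => (s - 1) * x i) (1 * x i) s :=
        ((hasDerivAt_id s).sub_const 1).mul_const _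
      rw [one_mul] at this
      exact ((this.smul_const e).const_add x).hasDerivWithinAt
    have h3 := h1.comp_hasDerivWithinAt s h2 (fun t ht => hsc x hx t ht)
    rwa [map_smul, smul_eq_mul] at h3
  have hcont : ContinuousOn (fun s => fderivWithin ℝ g S (scaleCoord i x s) e) (Icc 0 1) :=
    hF.continuousOn.comp (f := fun s => (x, s)) (by fun_prop) fun s hs => ⟨hx, hs⟩
  have key := intervalIntegral.integral_eq_sub_of_hasDerivAt_of_le zero_le_one
    (fun s hs => (hd s hs).continuousWithinAt)
    (fun s hs => (hd s ⟨hs.1.le, hs.2.le⟩).hasDerivAt (Icc_mem_nhds hs.1 hs.2))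
    ((continuousOn_const.mul hcont).intervalIntegrable_of_Icc zero_le_one)
  rw [intervalIntegral.integral_const_mul] at key
  rw [key]
  have e1 : scaleCoord i x 1 = x := by simp [scaleCoord]
  rw [e1, h0 (scaleCoord i x 0) (hsc x hx 0 (by simp)) (by simp [scaleCoord_apply_self]), sub_zero]

end Hadamard

/-! ### Density of the interior and division by boundary defining functions -/

section BoundaryDefining

variable {n : ℕ} {ι : Type*} [Finite ι]
  {X : Type*} [TopologicalSpace X] [ChartedSpace (EuclideanQuadrant n) X]
  {ρ : ι → X → ℝ}

theorem isOpen_inner_of_continuous (hρ : ∀ k, Continuous (ρ k)) : IsOpen (inner ρ) := by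
  have : inner ρ = ⋂ k, {x | 0 < ρ k x} := by ext; simp [inner]
  rw [this]
  exact isOpen_iInter_of_finite fun k => isOpen_lt continuous_const (hρ k)

omit [Finite ι] in
theorem IsBoundaryDefining.continuous (hρ : IsBoundaryDefining (n := n) ρ) (k : ι) :
    Continuous (ρ k) := (hρ.smooth k).continuous

theorem IsBoundaryDefining.isOpen_inner (hρ : IsBoundaryDefining (n := n) ρ) : IsOpen (inner ρ) :=
  isOpen_inner_of_continuous hρ.continuous

omit [Finite ι] in
theorem IsBoundaryDefining.isClosed_face (hρ : IsBoundaryDefining (n := n) ρ) (k : ι) :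
    IsClosed (face ρ k) := isClosed_eq (hρ.continuous k) continuous_const

omit [Finite ι] in
theorem IsBoundaryDefining.pos_of_notMem (hρ : IsBoundaryDefining (n := n) ρ) {k : ι} {x : X}
    (hx : x ∉ face ρ k) : 0 < ρ k x := lt_of_le_of_ne (hρ.nonneg k x) (Ne.symm hx)

/-- Near a point there are points at which exactly the defining functions outside of a given set
`K`, among those that vanish at the point, vanish. -/
theorem IsBoundaryDefining.mem_closure (hρ : IsBoundaryDefining (n := n) ρ) (x : X) (K : Set ι) :
    x ∈ closure {y | ∀ k, ρ k y = 0 ↔ (ρ k x = 0 ∧ k ∉ K)} := by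
  classical
  obtain ⟨φ, -, hxφ, e, he, hφ⟩ := hρ.adapted x
  -- In the adapted chart the point is moved by |t| in the coordinates that represent ρ_k with k in
  -- K. The absolute value keeps it in the quadrant for all t, so continuity at 0 can be used on
  -- both sides.
  set z : ℝ → EuclideanSpace ℝ (Fin n) := fun t =>
    WithLp.toLp 2 fun i => (φ x).1 i + if ∃ k, e k = i ∧ (k : ι) ∈ K then |t| else 0 with hz
  have hzc : Continuous z := by
    refine (PiLp.continuous_toLp 2 _).comp (continuous_pi fun i => ?_)
    split_ifs <;> fun_prop
  have hz0 : ∀ t i, 0 ≤ z t i := fun t i => by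
    simp only [hz]
    have := (φ x).2 i
    split_ifs <;> positivity
  set y : ℝ → EuclideanQuadrant n := fun t => ⟨z t, hz0 t⟩
  have hyc : Continuous y := hzc.subtype_mk _
  have hy0 : y 0 = φ x := by
    apply Subtype.ext; ext i; simp [y, hz]
  have hyt : ∀ᶠ t in 𝓝 (0 : ℝ), y t ∈ φ.target :=
    hyc.continuousAt.eventually_mem (by rw [hy0]; exact φ.open_target.mem_nhds (φ.map_source hxφ))
  have hlim : Tendsto (fun t => φ.symm (y t)) (𝓝 0) (𝓝 x) := by
    have h1 : ContinuousAt φ.symm (y 0) := by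
      rw [hy0]; exact φ.continuousAt_symm (φ.map_source hxφ)
    have h2 := h1.tendsto.comp hyc.continuousAt.tendsto
    rwa [hy0, φ.left_inv hxφ] at h2
  have hpos : ∀ k, ρ k x ≠ 0 → ∀ᶠ t in 𝓝 (0 : ℝ), ρ k (φ.symm (y t)) ≠ 0 := fun k hk =>
    ((hρ.continuous k).continuousAt.tendsto.comp hlim).eventually_ne hk
  have hall : ∀ᶠ t in 𝓝 (0 : ℝ), ∀ k, ρ k x ≠ 0 → ρ k (φ.symm (y t)) ≠ 0 := by
    rw [eventually_all]; intro k
    by_cases hk : ρ k x = 0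
    · simp [hk]
    · filter_upwards [hpos k hk] with t ht _ using ht
  refine mem_closure_of_tendsto (f := fun t => φ.symm (y t)) (b := 𝓝[>] 0)
    (hlim.mono_left nhdsWithin_le_nhds) ?_
  filter_upwards [nhdsWithin_le_nhds hall, nhdsWithin_le_nhds hyt, self_mem_nhdsWithin] with
    t ht hyt (ht0 : 0 < t) k
  constructor
  · intro hk
    have hkx : ρ k x = 0 := by
      by_contra h; exact ht k h hk
    refine ⟨hkx, fun hkK => ?_⟩
    have := (hφ _ (φ.map_target hyt)).1 ⟨k, hkx⟩
    rw [φ.right_inv hyt] at this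
    simp only [y, hz] at this
    rw [if_pos ⟨⟨k, hkx⟩, rfl, hkK⟩, hk, abs_of_pos ht0] at this
    have h0 := (φ x).2 (e ⟨k, hkx⟩)
    linarith
  · rintro ⟨hkx, hkK⟩
    have := (hφ _ (φ.map_target hyt)).1 ⟨k, hkx⟩
    rw [φ.right_inv hyt] at this
    simp only [y, hz] at this
    rw [if_neg, (hφ x hxφ).1 ⟨k, hkx⟩] at this
    · simp only [hkx, add_zero] at this; exact this.symm
    · rintro ⟨k', hk', hk'K⟩
      rw [he hk'] at hk'K
      exact hkK hk'K

theorem IsBoundaryDefining.dense_inner (hρ : IsBoundaryDefining (n := n) ρ) :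
    Dense (inner ρ) := fun x => by
  refine closure_mono ?_ (hρ.mem_closure x univ)
  intro y hy k
  exact hρ.pos_of_notMem (k := k) fun h => ((hy k).1 h).2 trivial

/-- This serves to extend identities by continuity from Y_i without Y_j to all of Y_i. -/
theorem IsBoundaryDefining.mem_closure_face (hρ : IsBoundaryDefining (n := n) ρ) {i j : ι}
    (hij : i ≠ j) {x : X} (hx : x ∈ face ρ i) : x ∈ closure (face ρ i \ face ρ j) := by
  refine closure_mono ?_ (hρ.mem_closure x {j})
  intro y hy
  exact ⟨(hy i).2 ⟨hx, hij⟩, fun h => ((hy j).1 h).2 rfl⟩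

omit [Finite ι] in
-- Off the face one divides. At a point of the face ρ_i is a coordinate of the adapted chart, and
-- Hadamard's lemma applies.
theorem exists_local_eq_mul (hρ : IsBoundaryDefining (n := n) ρ) {i : ι} {g : X → ℝ}
    (hg : ContMDiff (Q n) 𝓘(ℝ, ℝ) ∞ g) (h0 : ∀ x ∈ face ρ i, g x = 0) (x : X) :
    ∃ U ∈ 𝓝 x, ∃ h : X → ℝ, ContMDiffOn (Q n) 𝓘(ℝ, ℝ) ∞ h U ∧ ∀ y ∈ U, g y = ρ i y * h y := by
  by_cases hx : ρ i x = 0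
  swap
  · refine ⟨{y | ρ i y ≠ 0}, (hρ.continuous i).continuousAt.eventually_ne hx,
      fun y => g y / ρ i y, ?_, fun y hy => ?_⟩
    · exact hg.contMDiffOn.div₀ (hρ.smooth i).contMDiffOn fun y hy => hy
    · rw [mul_div_cancel₀ _ hy]
  obtain ⟨φ, hφM, hxφ, e, he, hφ⟩ := hρ.adapted x
  set k := e ⟨i, hx⟩
  have hk0 : ∀ y ∈ φ.source, (φ y).1 k = ρ i y := fun y hy => (hφ y hy).1 ⟨i, hx⟩
  set R : Set (EuclideanSpace ℝ (Fin n)) := {z | ∀ l, 0 ≤ z l} with hR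
  have htar : (φ.extend (Q n)).target ∈ 𝓝[R] (φ x).1 := by
    have := φ.extend_target_mem_nhdsWithin (I := Q n) hxφ
    have hr : range (Q n) = R := range_euclideanQuadrant n
    rw [hr] at this
    exact this
  obtain ⟨r, hr, hrt⟩ := Metric.mem_nhdsWithin_iff.1 htar
  -- The centre has vanishing k-th coordinate, so scaling this coordinate by s ∈ [0,1] does not
  -- increase the distance to the centre. The half ball is therefore admissible in Hadamard's lemma.
  set S := Metric.ball (φ x).1 r ∩ R with hS
  have hRc : Convex ℝ R := EuclideanQuadrant.convex
  have hRu : UniqueDiffOn ℝ R := by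
    have := (Q n).uniqueDiffOn
    have hr : range (Q n) = R := range_euclideanQuadrant n
    rwa [hr] at this
  have hSc : Convex ℝ S := (convex_ball _ _).inter hRc
  have hSu : UniqueDiffOn ℝ S := by
    rw [hS, inter_comm]; exact hRu.inter Metric.isOpen_ball
  have hG : ContDiffOn ℝ ∞ (fun z => g ((φ.extend (Q n)).symm z)) S := by
    rw [← contMDiffOn_iff_contDiffOn]
    refine hg.comp_contMDiffOn ((contMDiffOn_extend_symm hφM).mono ?_)
    rwa [← φ.extend_target']
  have hck : (φ x).1 k = 0 := by rw [hk0 x hxφ, hx]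
  have hsc : ∀ z ∈ S, ∀ s ∈ Icc (0 : ℝ) 1, scaleCoord k z s ∈ S := by
    rintro z ⟨hzb, hzR⟩ s ⟨hs0, hs1⟩
    refine ⟨lt_of_le_of_lt ?_ (Metric.mem_ball.1 hzb), fun l => ?_⟩
    · rw [EuclideanSpace.dist_eq, EuclideanSpace.dist_eq]
      refine Real.sqrt_le_sqrt (Finset.sum_le_sum fun l _ => ?_)
      refine pow_le_pow_left₀ dist_nonneg ?_ 2
      by_cases hl : l = k
      · subst hl
        rw [scaleCoord_apply_self, hck, dist_zero_right, dist_zero_right, norm_mul,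
          Real.norm_of_nonneg hs0]
        exact mul_le_of_le_one_left (norm_nonneg _) hs1
      · rw [scaleCoord_apply_ne hl]
    · by_cases hl : l = k
      · subst hl; rw [scaleCoord_apply_self]; exact mul_nonneg hs0 (hzR _)
      · rw [scaleCoord_apply_ne hl]; exact hzR l
  have hval : ∀ z ∈ S, (φ.extend (Q n)).symm z ∈ φ.source ∧
      φ.extend (Q n) ((φ.extend (Q n)).symm z) = z := fun z hz => by
    refine ⟨?_, (φ.extend (Q n)).right_inv (hrt hz)⟩
    rw [← φ.extend_source (I := Q n)]
    exact (φ.extend (Q n)).map_target (hrt hz)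
  have hcoord : ∀ y ∈ φ.source, φ.extend (Q n) y k = ρ i y := hk0
  obtain ⟨h, hh, hgh⟩ := exists_eq_coord_mul hSc hSu k hsc hG (by
    intro z hz hzk
    refine h0 _ ?_
    have := hcoord _ (hval z hz).1
    rw [(hval z hz).2, hzk] at this
    exact this.symm)
  refine ⟨φ.extend (Q n) ⁻¹' S ∩ φ.source, ?_, fun y => h (φ.extend (Q n) y), ?_, ?_⟩
  · refine inter_mem ?_ (φ.open_source.mem_nhds hxφ)
    have hc : ContinuousAt (φ.extend (Q n)) x := φ.continuousAt_extend hxφ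
    have : φ.extend (Q n) ⁻¹' (Metric.ball (φ x).1 r) ∈ 𝓝 x :=
      hc.preimage_mem_nhds (Metric.ball_mem_nhds _ hr)
    filter_upwards [this] with y hy
    exact ⟨hy, (φ y).2⟩
  · rw [← contMDiffOn_iff_contDiffOn] at hh
    exact hh.comp ((φ.contMDiffOn_extend hφM).mono inter_subset_right) fun y hy => hy.1
  · rintro y ⟨hyS, hys⟩
    have := hgh _ hyS
    rw [hcoord y hys] at this
    rw [← this, φ.extend_left_inv hys]

variable [T2Space X] [SigmaCompactSpace X] [IsManifold (Q n) ∞ X]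

omit [Finite ι] in
/-- A smooth function that vanishes on a boundary face is divisible by the defining function. -/
theorem exists_eq_mul (hρ : IsBoundaryDefining (n := n) ρ) {i : ι} {g : X → ℝ}
    (hg : ContMDiff (Q n) 𝓘(ℝ, ℝ) ∞ g) (h0 : ∀ x ∈ face ρ i, g x = 0) :
    ∃ h : X → ℝ, ContMDiff (Q n) 𝓘(ℝ, ℝ) ∞ h ∧ ∀ x, g x = ρ i x * h x := by
  -- The admissible values of the quotient at x form a convex set, so local quotients can be glued
  -- by a partition of unity.
  obtain ⟨h, hh⟩ := exists_contMDiffMap_forall_mem_convex_of_local (Q n) (n := ⊤)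
    (t := fun x => {c : ℝ | g x = ρ i x * c})
    (fun x a ha b hb s t hs ht hst => by
      simp only [mem_ofPred_eq, smul_eq_mul] at *
      calc g x = s * g x + t * g x := by rw [← add_mul, hst, one_mul]
        _ = s * (ρ i x * a) + t * (ρ i x * b) := by rw [← ha, ← hb]
        _ = _ := by ring)
    (fun x => exists_local_eq_mul hρ hg h0 x)
  exact ⟨h, h.contMDiff, hh⟩

end BoundaryDefining

/-! ### Radial fields modulo multiples of the defining function -/

section BFields

variable {n : ℕ} {ι : Type*}
  {X : Type*} [TopologicalSpace X] [ChartedSpace (EuclideanQuadrant n) X]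
  [IsManifold (Q n) ∞ X] {ρ : ι → X → ℝ}

/-- A weak form of `IsRadial`, in which the derivative of the defining function is prescribed only
on the face. -/
def IsWeaklyRadial (ρ : ι → X → ℝ) (j : ι) (V : VField n X) : Prop :=
  V ∈ bFields ρ ∧ ∃ T : VField n X, SmoothVField T ∧
    (∀ᶠ x in 𝓝ˢ (face ρ j), V x = ρ j x • T x) ∧ ∀ x ∈ face ρ j, lieReal T (ρ j) x = 1

/-- The weak form is the one that survives the lifting of radial fields from a face. The pulled-back
defining function is ρ_i times a positive function, so the derivative of ρ_i along the lifted
transversal field is normalized only on the face itself. -/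
theorem IsRadial.isWeaklyRadial {j : ι} {V : VField n X} (h : IsRadial ρ j V) :
    IsWeaklyRadial ρ j V := by
  obtain ⟨hV, T, hT, h⟩ := h
  exact ⟨hV, T, hT, h.mono fun x hx => hx.1, fun x hx => (h.self_of_nhdsSet x hx).2⟩

theorem IsWeaklyRadial.eq_zero {j : ι} {V : VField n X} (h : IsWeaklyRadial ρ j V) {x : X}
    (hx : x ∈ face ρ j) : V x = 0 := by
  obtain ⟨-, T, -, h, -⟩ := h
  rw [h.self_of_nhdsSet x hx, show ρ j x = 0 from hx]
  exact zero_smul ℝ (T x)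

theorem lieReal_of_eq_zero {V : VField n X} {x : X} (h : V x = 0) (f : X → ℝ) :
    lieReal V f x = 0 := by
  unfold lieReal; rw [h]; exact map_zero (mfderiv (Q n) 𝓘(ℝ, ℝ) f x)

theorem add_mem_bFields {V W : VField n X} (hV : V ∈ bFields ρ) (hW : W ∈ bFields ρ) :
    (fun x => V x + W x) ∈ bFields ρ :=
  ⟨hV.1.add hW.1, fun k x hx => by rw [lieReal_field_add, hV.2 k x hx, hW.2 k x hx, add_zero]⟩

theorem smul_mem_bFields {V : VField n X} (hV : V ∈ bFields ρ) {g : X → ℝ}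
    (hg : ContMDiff (Q n) 𝓘(ℝ, ℝ) ∞ g) : (fun x => g x • V x) ∈ bFields ρ :=
  ⟨hV.1.smul hg, fun k x hx => by rw [lieReal_field_smul, hV.2 k x hx, mul_zero]⟩

omit [IsManifold (Q n) ∞ X] in
theorem contMDiff_mdiff {f : X → ℝ} (hf : ContMDiff (Q n) 𝓘(ℝ, ℝ) ∞ f) (x : X) :
    MDifferentiableAt (Q n) 𝓘(ℝ, ℝ) f x := (hf x).mdifferentiableAt (by simp)

theorem lieReal_field_sub (V W : VField n X) (f : X → ℝ) (x : X) :
    lieReal (fun y => V y - W y) f x = lieReal V f x - lieReal W f x := by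
  unfold lieReal; exact map_sub _ _ _

omit [IsManifold (Q n) ∞ X] in
/-- Division of a smooth function that vanishes near a face. -/
theorem contMDiff_div_of_eventually (hρ : IsBoundaryDefining (n := n) ρ) {j : ι} {g : X → ℝ}
    (hg : ContMDiff (Q n) 𝓘(ℝ, ℝ) ∞ g) (h0 : ∀ᶠ x in 𝓝ˢ (face ρ j), g x = 0) (N : ℕ) :
    ContMDiff (Q n) 𝓘(ℝ, ℝ) ∞ (fun x => g x / ρ j x ^ N) := by
  intro x
  by_cases hx : x ∈ face ρ j
  · have : (fun x => g x / ρ j x ^ N) =ᶠ[𝓝 x] fun _ => 0 := by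
      filter_upwards [(eventually_nhdsSet_iff_forall.1 h0 x hx)] with y hy
      rw [hy, zero_div]
    exact contMDiffAt_const.congr_of_eventuallyEq this
  · exact (hg x).div₀ ((hρ.smooth j x).pow N) (pow_ne_zero _ hx)

theorem div_mul_pow_of_eventually {j : ι} {g : X → ℝ}
    (h0 : ∀ᶠ x in 𝓝ˢ (face ρ j), g x = 0) (N : ℕ) (x : X) :
    ρ j x ^ N * (g x / ρ j x ^ N) = g x := by
  by_cases hx : x ∈ face ρ j
  · rw [h0.self_of_nhdsSet x hx]; simp
  · exact mul_div_cancel₀ _ (pow_ne_zero _ hx)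

variable [T2Space X] [CompactSpace X]

theorem exists_cutoff {s U : Set X} (hs : IsClosed s) (hU : IsOpen U) (hsU : s ⊆ U) :
    ∃ ψ : X → ℝ, ContMDiff (Q n) 𝓘(ℝ, ℝ) ∞ ψ ∧ (∀ᶠ x in 𝓝ˢ s, ψ x = 1) ∧ tsupport ψ ⊆ U ∧
      ∀ x, ψ x ∈ Icc (0 : ℝ) 1 := by
  obtain ⟨f, hf0, hf1, hf⟩ := exists_contMDiffMap_zero_one_nhds_of_isClosed (Q n) (n := ⊤)
    hU.isClosed_compl hs (disjoint_compl_left_iff_subset.2 hsU)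
  refine ⟨f, f.contMDiff, hf1, fun x hx => ?_, hf⟩
  by_contra hxU
  exact notMem_tsupport_iff_eventuallyEq.2 (eventually_nhdsSet_iff_forall.1 hf0 x hxU) hx

theorem exists_cutoff_face (hρ : IsBoundaryDefining (n := n) ρ) (j : ι) {P : X → Prop}
    (hP : ∀ᶠ x in 𝓝ˢ (face ρ j), P x) :
    ∃ ψ : X → ℝ, ContMDiff (Q n) 𝓘(ℝ, ℝ) ∞ ψ ∧ (∀ᶠ x in 𝓝ˢ (face ρ j), ψ x = 1) ∧
      (∀ x, ψ x ≠ 0 → P x) ∧ ∀ᶠ x in 𝓝ˢ (face ρ j), 1 - ψ x = 0 := by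
  obtain ⟨U, hU, hUs, hUP⟩ := eventually_nhdsSet_iff_exists.1 hP
  obtain ⟨ψ, h1, h2, h3, -⟩ := exists_cutoff (n := n) (hρ.isClosed_face j) hU hUs
  exact ⟨ψ, h1, h2, fun x hx => hUP x (h3 (subset_tsupport _ hx)),
    h2.mono fun x hx => by rw [hx, sub_self]⟩

/-- A field that is tangent to a face differentiates functions vanishing on the face to functions
vanishing on the face. -/
theorem lieReal_eq_zero_of_face (hρ : IsBoundaryDefining (n := n) ρ) {V : VField n X}
    (hV : V ∈ bFields ρ) {k : ι} {g : X → ℝ} (hg : ContMDiff (Q n) 𝓘(ℝ, ℝ) ∞ g)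
    (h0 : ∀ x ∈ face ρ k, g x = 0) {x : X} (hx : x ∈ face ρ k) : lieReal V g x = 0 := by
  obtain ⟨h, hh, hgh⟩ := exists_eq_mul hρ hg h0
  rw [show g = fun x => ρ k x * h x from funext hgh,
    lieReal_mul (contMDiff_mdiff (hρ.smooth k) x) (contMDiff_mdiff hh x), hV.2 k x hx,
    show ρ k x = 0 from hx]
  ring

/-- The logarithmic derivative of ρ_k along a field of 𝒱_b is smooth. This is why powers and
logarithms of ρ_k are conormal. -/
theorem exists_lieReal_rho (hρ : IsBoundaryDefining (n := n) ρ) {V : VField n X}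
    (hV : V ∈ bFields ρ) (k : ι) : ∃ h : X → ℝ, ContMDiff (Q n) 𝓘(ℝ, ℝ) ∞ h ∧
      ∀ x, lieReal V (ρ k) x = ρ k x * h x :=
  exists_eq_mul hρ (hV.1.lieReal (hρ.smooth k)) (hV.2 k)

/-- Near the face Vρ_j = ρ_j Tρ_j, and Tρ_j - 1 is divisible by ρ_j. Consequently V-(q+1) acts on
ρ_j f as ρ_j(V-q)f up to an error with two factors ρ_j. -/
theorem IsWeaklyRadial.exists_lieReal_rho (hρ : IsBoundaryDefining (n := n) ρ) {j : ι}
    {V : VField n X} (hV : IsWeaklyRadial ρ j V) : ∃ h : X → ℝ, ContMDiff (Q n) 𝓘(ℝ, ℝ) ∞ h ∧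
      ∀ x, lieReal V (ρ j) x = ρ j x + ρ j x ^ 2 * h x := by
  obtain ⟨hVb, T, hT, hVT, hT1⟩ := hV
  obtain ⟨ψ, hψ, -, hψP, hψ0⟩ := exists_cutoff_face hρ j hVT
  obtain ⟨h1, hh1, e1⟩ := exists_eq_mul hρ (i := j)
    (((hT.lieReal (hρ.smooth j)).sub contMDiff_const : ContMDiff (Q n) 𝓘(ℝ, ℝ) ∞
      (fun x => lieReal T (ρ j) x - 1))) fun x hx => by rw [hT1 x hx, sub_self]
  have h0 : ∀ᶠ x in 𝓝ˢ (face ρ j), (1 - ψ x) * (lieReal V (ρ j) x - ρ j x) = 0 :=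
    hψ0.mono fun x hx => by rw [hx, zero_mul]
  have hs : ContMDiff (Q n) 𝓘(ℝ, ℝ) ∞ (fun x => (1 - ψ x) * (lieReal V (ρ j) x - ρ j x)) :=
    (contMDiff_const.sub hψ).mul ((hVb.1.lieReal (hρ.smooth j)).sub (hρ.smooth j))
  refine ⟨_, (hψ.mul hh1).add (contMDiff_div_of_eventually hρ hs h0 2), fun x => ?_⟩
  have e2 := div_mul_pow_of_eventually h0 2 x
  simp only [Pi.add_apply, Pi.mul_apply]
  rw [mul_add, e2]
  by_cases hx : ψ x = 0
  · rw [hx]; ring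
  · have e3 : lieReal V (ρ j) x = ρ j x * lieReal T (ρ j) x := by
      rw [← lieReal_field_smul]; exact lieReal_field_congr (hψP x hx) _
    have e1 := e1 x
    rw [e3, show lieReal T (ρ j) x = ρ j x * h1 x + 1 by linarith]
    ring

theorem IsWeaklyRadial.exists_lieReal (hρ : IsBoundaryDefining (n := n) ρ) {j : ι}
    {V : VField n X} (hV : IsWeaklyRadial ρ j V) {g : X → ℝ}
    (hg : ContMDiff (Q n) 𝓘(ℝ, ℝ) ∞ g) : ∃ h : X → ℝ, ContMDiff (Q n) 𝓘(ℝ, ℝ) ∞ h ∧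
      ∀ x, lieReal V g x = ρ j x * h x :=
  exists_eq_mul hρ (hV.1.1.lieReal hg) fun _ hx => lieReal_of_eq_zero (hV.eq_zero hx) g

variable [Finite ι]

/-- Division of a vector field by a defining function. -/
theorem exists_eq_rho_smul (hρ : IsBoundaryDefining (n := n) ρ) {j : ι} {Y T : VField n X}
    (hY : SmoothVField Y) (hT : SmoothVField T)
    (hYT : ∀ᶠ x in 𝓝ˢ (face ρ j), Y x = ρ j x • T x)
    (hYk : ∀ k, k ≠ j → ∀ x ∈ face ρ k, lieReal Y (ρ k) x = 0)
    (hTj : ∀ x ∈ face ρ j, lieReal T (ρ j) x = 0) :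
    ∃ W ∈ bFields ρ, ∀ x, Y x = ρ j x • W x := by
  obtain ⟨ψ, hψ, hψ1, hψP, hψ0⟩ := exists_cutoff_face hρ j hYT
  set r : X → ℝ := fun x => (1 - ψ x) / ρ j x ^ 1
  have hr : ContMDiff (Q n) 𝓘(ℝ, ℝ) ∞ r :=
    contMDiff_div_of_eventually hρ (contMDiff_const.sub hψ) hψ0 1
  have er : ∀ x, ρ j x * r x = 1 - ψ x := fun x => by
    have := div_mul_pow_of_eventually hψ0 1 x
    simpa [r] using this
  -- Near the face T is the quotient. Away from it one divides by ρ_j, and ψ interpolates.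
  set W : VField n X := fun x => ψ x • T x + r x • Y x with hW
  have hWs : SmoothVField W := (hT.smul hψ).add (hY.smul hr)
  have hWY : ∀ x, Y x = ρ j x • W x := fun x => by
    simp only [hW]
    rw [smul_add, smul_smul, smul_smul, er]
    by_cases hx : ψ x = 0
    · rw [hx, mul_zero, zero_smul, sub_zero, zero_add, one_smul]
    · rw [mul_comm, mul_smul, ← hψP x hx, ← add_smul, add_sub_cancel, one_smul]
  refine ⟨W, ⟨hWs, fun k x hx => ?_⟩, hWY⟩
  by_cases hk : k = j
  · subst hk
    have h1 : lieReal W (ρ k) x = ψ x * lieReal T (ρ k) x + r x * lieReal Y (ρ k) x := by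
      rw [← lieReal_field_smul, ← lieReal_field_smul, ← lieReal_field_add]
    have h2 : r x = 0 := by
      have := hψ0.self_of_nhdsSet x hx
      simp only [r, this, zero_div]
    rw [h1, hTj x hx, h2]; ring
  -- Tangency of Y = ρ_j W to Y_k gives tangency of W only where ρ_j ≠ 0. The rest follows by
  -- density.
  · have hcl := hρ.mem_closure_face hk hx
    have hc : Continuous (lieReal W (ρ k)) := (hWs.lieReal (hρ.smooth k)).continuous
    refine closure_minimal (t := {y | lieReal W (ρ k) y = 0}) ?_
      (isClosed_eq hc continuous_const) hcl
    rintro y ⟨hyk, hyj⟩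
    have h1 := hYk k hk y hyk
    rw [lieReal_field_congr (W := fun x => ρ j x • W x) (hWY y), lieReal_field_smul] at h1
    exact (mul_eq_zero.1 h1).resolve_left hyj

/-- Radial vector fields for the same face differ by a multiple of the defining function. -/
theorem IsWeaklyRadial.exists_sub (hρ : IsBoundaryDefining (n := n) ρ) {j : ι}
    {V V' : VField n X} (hV : IsWeaklyRadial ρ j V) (hV' : IsWeaklyRadial ρ j V') :
    ∃ W ∈ bFields ρ, ∀ x, V x - V' x = ρ j x • W x := by
  obtain ⟨hVb, T, hT, hVT, hT1⟩ := hV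
  obtain ⟨hVb', T', hT', hVT', hT1'⟩ := hV'
  refine exists_eq_rho_smul hρ (hVb.1.sub hVb'.1) (hT.sub hT') ?_ ?_ ?_
  · filter_upwards [hVT, hVT'] with x h h'
    rw [h, h', smul_sub]
  · intro k _ x hx
    rw [lieReal_field_sub, hVb.2 k x hx, hVb'.2 k x hx, sub_zero]
  · intro x hx
    rw [lieReal_field_sub, hT1 x hx, hT1' x hx, sub_self]

open VectorField in
/-- The commutator of a radial field with a field in `𝒱_b` is a multiple of the defining
function. -/
theorem IsWeaklyRadial.exists_commutator (hρ : IsBoundaryDefining (n := n) ρ) {j : ι}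
    {V W : VField n X} (hV : IsWeaklyRadial ρ j V) (hW : W ∈ bFields ρ) :
    ∃ B : VField n X, B ∈ bFields ρ ∧ ∀ (U : Set X) (f : X → ℂ), IsOpen U → ContMDiffOn (Q n) 𝓘(ℝ, ℂ) ∞ f U →
      ∀ x ∈ U, lie V (lie W f) x = lie W (lie V f) x + (ρ j x : ℂ) * lie B f x := by
  obtain ⟨hVb, T, hT, hVT, hT1⟩ := hV
  obtain ⟨h, hh, eh⟩ := Corners.exists_lieReal_rho hρ hW j
  have hbr : ∀ {V W : VField n X}, SmoothVField V → SmoothVField W →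
      SmoothVField (n := n) (X := X) (mlieBracket (Q n) V W) := fun hV hW x => SmoothVField.bracket (hV x) (hW x)
  have hmd : ∀ {f : X → ℝ}, ContMDiff (Q n) 𝓘(ℝ, ℝ) ∞ f → ∀ x,
    MDifferentiableAt (Q n) 𝓘(ℝ, ℝ) f x := fun hf x => contMDiff_mdiff hf x
  have hex : ∃ B : VField n X, B ∈ bFields ρ ∧ ∀ x, mlieBracket (Q n) V W x = ρ j x • B x := by
    -- Near the face [ρ_j T, W] = ρ_j [T, W] - (Wρ_j) T = ρ_j([T, W] - hT), where Wρ_j = ρ_j h.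
    refine exists_eq_rho_smul hρ (j := j) (Y := mlieBracket (Q n) V W)
      (T := fun x => mlieBracket (Q n) T W x - h x • T x) (hbr hVb.1 hW.1)
      ((hbr hT hW.1).sub (hT.smul hh)) ?_ ?_ ?_
    · obtain ⟨U, hU, hUs, hUP⟩ := eventually_nhdsSet_iff_exists.1 hVT
      filter_upwards [hU.mem_nhdsSet.2 hUs] with x hx
      have h1 : V =ᶠ[𝓝 x] (ρ j) • T := by
        filter_upwards [hU.mem_nhds hx] with y hy using hUP y hy
      rw [Filter.EventuallyEq.mlieBracket_vectorField_eq h1 (Filter.EventuallyEq.rfl (f := W)),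
        mlieBracket_smul_left (hmd (hρ.smooth j) x) ((hT x).mdifferentiableAt (by simp)), smul_sub,
        smul_smul, ← eh x, sub_eq_add_neg, add_comm, ← neg_smul]
      rfl
    · intro k hk x hx
      rw [← lieReal_bracket hVb.1 hW.1 isOpen_univ (hρ.smooth k).contMDiffOn (mem_univ x),
        lieReal_eq_zero_of_face hρ hVb (hW.1.lieReal (hρ.smooth k)) (hW.2 k) hx,
        lieReal_eq_zero_of_face hρ hW (hVb.1.lieReal (hρ.smooth k)) (hVb.2 k) hx, sub_zero]
    -- The quotient is tangent to Y_j. There [T, W]ρ_j = T(ρ_j h) - W(Tρ_j) = h, since Tρ_j = 1 on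
    -- the face and W is tangent to it, and hTρ_j = h as well.
    · intro x hx
      have hx0 : ρ j x = 0 := hx
      have h3 : lieReal W (lieReal T (ρ j)) x = 0 := by
        have h4 := lieReal_eq_zero_of_face hρ hW
          ((hT.lieReal (hρ.smooth j)).sub contMDiff_const : ContMDiff (Q n) 𝓘(ℝ, ℝ) ∞
          (fun x => lieReal T (ρ j) x - 1)) (k := j) (fun x hx => by rw [hT1 x hx, sub_self]) hx
        have h5 := lieReal_add (V := W) (x := x) (f := fun x => lieReal T (ρ j) x - 1)
          (g := fun _ => 1) (hmd ((hT.lieReal (hρ.smooth j)).sub contMDiff_const) x)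
          mdifferentiableAt_const
        rw [h4, lieReal_const, add_zero] at h5
        simpa using h5
      rw [lieReal_field_sub, lieReal_field_smul, hT1 x hx,
        ← lieReal_bracket hT hW.1 isOpen_univ (hρ.smooth j).contMDiffOn (mem_univ x), h3,
        show lieReal W (ρ j) = fun x => ρ j x * h x from funext eh,
        lieReal_mul (hmd (hρ.smooth j) x) (hmd hh x), hT1 x hx, hx0]
      ring
  obtain ⟨B, hB, hVB⟩ := hex
  refine ⟨B, hB, fun U f hU hf x hx => ?_⟩
  rw [← lie_field_smul, ← lie_field_congr (V := mlieBracket (Q n) V W)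
    (W := fun y => ρ j y • B y) (hVB x), ← lie_bracket hVb.1 hW.1 hU hf hx]
  ring

end BFields

/-! ### Weights with constant exponents -/

section RhoPow

variable {ι : Type*} [Fintype ι] {X : Type*} {ρ : ι → X → ℝ}

/-- `ρ^m` for constant exponents. -/
abbrev rp (ρ : ι → X → ℝ) (m : ι → ℝ) (x : X) : ℝ := rhoPow ρ (fun k _ => m k) x

theorem rp_pos (m : ι → ℝ) {x : X} (hx : x ∈ inner ρ) : 0 < rp ρ m x :=
  Finset.prod_pos fun k _ => Real.rpow_pos_of_pos (hx k) _

theorem rp_add (m m' : ι → ℝ) {x : X} (hx : x ∈ inner ρ) :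
    rp ρ (m + m') x = rp ρ m x * rp ρ m' x := by
  simp only [rhoPow, ← Finset.prod_mul_distrib]
  exact Finset.prod_congr rfl fun k _ => Real.rpow_add (hx k) _ _

theorem rp_zero (x : X) : rp ρ 0 x = 1 := by simp [rhoPow]

theorem rp_smul (t : ℝ) (m : ι → ℝ) {x : X} (hx : x ∈ inner ρ) :
    rp ρ (t • m) x = rp ρ m x ^ t := by
  simp only [rhoPow]
  rw [← Real.finsetProd_rpow _ _ fun k _ => (Real.rpow_pos_of_pos (hx k) _).le]
  exact Finset.prod_congr rfl fun k _ => by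
    rw [← Real.rpow_mul (hx k).le, Pi.smul_apply, smul_eq_mul, mul_comm]

theorem rp_single [DecidableEq ι] (j : ι) (a : ℝ) (x : X) :
    rp ρ (Pi.single j a) x = ρ j x ^ a := by
  simp only [rhoPow]
  rw [Finset.prod_eq_single j]
  · simp
  · intro k _ hk; simp [hk]
  · simp

/-- On a compact space larger exponents give smaller weights, up to a constant. -/
theorem exists_rp_le {m m' : ι → ℝ} (hmm : m' ≤ m) (hb : ∀ k, ∃ R, ∀ x, ρ k x ≤ R) :
    ∃ C : ℝ, 0 ≤ C ∧ ∀ x ∈ inner ρ, rp ρ m x ≤ C * rp ρ m' x := by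
  choose R hR using hb
  refine ⟨∏ k, max (R k) 0 ^ (m k - m' k),
    Finset.prod_nonneg fun k _ => Real.rpow_nonneg (le_max_right _ _) _, fun x hx => ?_⟩
  have : rp ρ m x = rp ρ (m - m') x * rp ρ m' x := by rw [← rp_add _ _ hx, sub_add_cancel]
  rw [this]
  refine mul_le_mul_of_nonneg_right ?_ (rp_pos _ hx).le
  exact Finset.prod_le_prod (fun k _ => (Real.rpow_pos_of_pos (hx k) _).le) fun k _ =>
    Real.rpow_le_rpow (hx k).le ((hR k x).trans (le_max_left _ _)) (sub_nonneg.2 (hmm k))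

end RhoPow

/-! ### Conormal functions: algebra, interpolation, powers and logarithms -/

section Conormal

variable {n : ℕ} {ι : Type*} [Fintype ι]
  {X : Type*} [TopologicalSpace X] [ChartedSpace (EuclideanQuadrant n) X]
  [IsManifold (Q n) ∞ X] {ρ : ι → X → ℝ}

/-- Smoothness in the interior. -/
abbrev SmoothIn (n : ℕ) {X : Type*} [TopologicalSpace X] [ChartedSpace (EuclideanQuadrant n) X]
    (ρ : ι → X → ℝ) (w : X → ℂ) : Prop := ContMDiffOn (Q n) 𝓘(ℝ, ℂ) ∞ w (inner ρ)

theorem contMDiffOn_mul_complex {f g : X → ℂ} {U : Set X} (hf : ContMDiffOn (Q n) 𝓘(ℝ, ℂ) ∞ f U)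
    (hg : ContMDiffOn (Q n) 𝓘(ℝ, ℂ) ∞ g U) :
    ContMDiffOn (Q n) 𝓘(ℝ, ℂ) ∞ (fun x => f x * g x) U :=
  (contDiff_mul (𝕜 := ℝ) (𝔸 := ℂ)).contMDiff.comp_contMDiffOn (hf.prodMk_space hg)

theorem SmoothIn.mdiff {w : X → ℂ} (hI : IsOpen (inner ρ)) (hw : SmoothIn n ρ w) {x : X}
    (hx : x ∈ inner ρ) : MDifferentiableAt (Q n) 𝓘(ℝ, ℂ) w x := mdiffAt_of_contMDiffOn hI hw hx

theorem lie_eqOn {f g : X → ℂ} {U : Set X} (hU : IsOpen U) (V : VField n X) (h : EqOn f g U) :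
    EqOn (lie V f) (lie V g) U := fun _ hx => lie_congr (h.eventuallyEq_of_mem (hU.mem_nhds hx))

theorem foldr_lie_eqOn {f g : X → ℂ} {U : Set X} (hU : IsOpen U) (h : EqOn f g U)
    (L : List (VField n X)) : EqOn (L.foldr lie f) (L.foldr lie g) U := by
  induction L with
  | nil => exact h
  | cons V L ih => exact lie_eqOn hU V ih

theorem conormal.bound {m : ι → ℝ} {w : X → ℂ} (hw : w ∈ conormal (n := n) ρ m) :
    ∃ C : ℝ, 0 ≤ C ∧ ∀ x ∈ inner ρ, ‖w x‖ ≤ C * rp ρ m x := by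
  obtain ⟨C, hC⟩ := hw.2 [] (by simp)
  refine ⟨max C 0, le_max_right _ _, fun x hx => (hC x hx).trans ?_⟩
  exact mul_le_mul_of_nonneg_right (le_max_left _ _) (rp_pos _ hx).le

theorem conormal.lie (hI : IsOpen (inner ρ)) {m : ι → ℝ} {w : X → ℂ}
    (hw : w ∈ conormal (n := n) ρ m) {V : VField n X} (hV : V ∈ bFields ρ) :
    lie V w ∈ conormal (n := n) ρ m := by
  refine ⟨hV.1.lie hI hw.1, fun L hL => ?_⟩
  have := hw.2 (L ++ [V]) (by
    intro W hW
    rcases List.mem_append.1 hW with h | h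
    · exact hL W h
    · rw [List.mem_singleton.1 h]; exact hV)
  simpa only [List.foldr_append, List.foldr_cons, List.foldr_nil] using this

theorem conormal.congr (hI : IsOpen (inner ρ)) {m : ι → ℝ} {w w' : X → ℂ}
    (hw : w ∈ conormal (n := n) ρ m) (h : EqOn w' w (inner ρ)) : w' ∈ conormal (n := n) ρ m := by
  refine ⟨hw.1.congr h, fun L hL => ?_⟩
  obtain ⟨C, hC⟩ := hw.2 L hL
  exact ⟨C, fun x hx => by rw [foldr_lie_eqOn hI h L hx]; exact hC x hx⟩

/-- A class of functions that is stable under differentiation along fields in `𝒱_b` and whose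
members are bounded by multiples of `ρ^m` consists of conormal functions. -/
theorem subset_conormal {m : ι → ℝ} {S : Set (X → ℂ)} (hs : ∀ w ∈ S, SmoothIn n ρ w)
    (hl : ∀ w ∈ S, ∀ V : VField n X, V ∈ bFields ρ → Corners.lie V w ∈ S)
    (hb : ∀ w ∈ S, ∃ C : ℝ, ∀ x ∈ inner ρ, ‖w x‖ ≤ C * rp ρ m x) :
    S ⊆ conormal (n := n) ρ m := by
  intro w hw
  refine ⟨hs w hw, fun L hL => hb _ ?_⟩
  induction L with
  | nil => exact hw
  | cons V L ih =>
    exact hl _ (ih fun W hW => hL W (List.mem_cons_of_mem _ hW)) V (hL V List.mem_cons_self)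

theorem conormal.add (hI : IsOpen (inner ρ)) {m : ι → ℝ} {a b : X → ℂ}
    (ha : a ∈ conormal (n := n) ρ m) (hb : b ∈ conormal (n := n) ρ m) :
    (fun x => a x + b x) ∈ conormal (n := n) ρ m := by
  refine subset_conormal (S := {f | ∃ a ∈ conormal (n := n) ρ m, ∃ b ∈ conormal (n := n) ρ m,
    EqOn f (fun x => a x + b x) (inner ρ)}) ?_ ?_ ?_ ⟨a, ha, b, hb, fun _ _ => rfl⟩
  · rintro f ⟨a, ha, b, hb, h⟩
    exact (ha.1.add hb.1).congr h
  · rintro f ⟨a, ha, b, hb, h⟩ V hV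
    refine ⟨_, conormal.lie hI ha hV, _, conormal.lie hI hb hV, fun x hx => ?_⟩
    rw [lie_eqOn hI V h hx, lie_add (SmoothIn.mdiff hI ha.1 hx) (SmoothIn.mdiff hI hb.1 hx)]
  · rintro f ⟨a, ha, b, hb, h⟩
    obtain ⟨C, -, hC⟩ := conormal.bound ha
    obtain ⟨C', -, hC'⟩ := conormal.bound hb
    refine ⟨C + C', fun x hx => ?_⟩
    rw [h hx, add_mul]
    exact (norm_add_le _ _).trans (add_le_add (hC x hx) (hC' x hx))

/-- Finite sums of products of elements of two sets of functions, up to equality in `U`. -/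
inductive ProdSum (A B : Set (X → ℂ)) (U : Set X) : (X → ℂ) → Prop
  | mul {a b} : a ∈ A → b ∈ B → ProdSum A B U (fun x => a x * b x)
  | add {f g} : ProdSum A B U f → ProdSum A B U g → ProdSum A B U (fun x => f x + g x)
  | congr {f g} : ProdSum A B U f → EqOn g f U → ProdSum A B U g

theorem ProdSum.smoothIn {A B : Set (X → ℂ)} (hA : ∀ a ∈ A, SmoothIn n ρ a)
    (hB : ∀ b ∈ B, SmoothIn n ρ b) {f : X → ℂ} (hf : ProdSum A B (inner ρ) f) :
    SmoothIn n ρ f := by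
  induction hf with
  | mul ha hb => exact contMDiffOn_mul_complex (hA _ ha) (hB _ hb)
  | add _ _ hf hg => exact hf.add hg
  | congr _ h hf => exact hf.congr h

/-- By the Leibniz rule the finite sums of products are stable under differentiation along 𝒱_b. -/
theorem conormal.mul (hI : IsOpen (inner ρ)) {m m' : ι → ℝ} {a b : X → ℂ}
    (ha : a ∈ conormal (n := n) ρ m) (hb : b ∈ conormal (n := n) ρ m') :
    (fun x => a x * b x) ∈ conormal (n := n) ρ (m + m') := by
  have hsm : ∀ {f}, ProdSum (conormal (n := n) ρ m) (conormal (n := n) ρ m') (inner ρ) f →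
    SmoothIn n ρ f := fun hf => hf.smoothIn (fun a ha => ha.1) (fun b hb => hb.1)
  refine subset_conormal (S := {f | ProdSum (conormal (n := n) ρ m) (conormal (n := n) ρ m')
    (inner ρ) f}) (fun f hf => hsm hf) ?_ ?_ (ProdSum.mul ha hb)
  · intro f hf V hV
    induction hf with
    | @mul a b ha hb =>
      refine ProdSum.congr (.add (.mul (conormal.lie hI ha hV) hb)
        (.mul ha (conormal.lie hI hb hV))) fun x hx => ?_
      exact lie_mul (SmoothIn.mdiff hI ha.1 hx) (SmoothIn.mdiff hI hb.1 hx)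
    | add hf hg ihf ihg =>
      exact ProdSum.congr (.add ihf ihg) fun x hx =>
        lie_add (SmoothIn.mdiff hI (hsm hf) hx) (SmoothIn.mdiff hI (hsm hg) hx)
    | congr _ h ih => exact .congr ih (lie_eqOn hI V h)
  · intro f hf
    induction hf with
    | @mul a b ha hb =>
      obtain ⟨C, hC0, hC⟩ := conormal.bound ha
      obtain ⟨C', hC0', hC'⟩ := conormal.bound hb
      refine ⟨C * C', fun x hx => ?_⟩
      rw [norm_mul, rp_add _ _ hx, mul_mul_mul_comm]
      exact mul_le_mul (hC x hx) (hC' x hx) (norm_nonneg _) (mul_nonneg hC0 (rp_pos _ hx).le)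
    | add _ _ ihf ihg =>
      obtain ⟨C, hC⟩ := ihf
      obtain ⟨C', hC'⟩ := ihg
      refine ⟨C + C', fun x hx => ?_⟩
      rw [add_mul]
      exact (norm_add_le _ _).trans (add_le_add (hC x hx) (hC' x hx))
    | congr _ h ih =>
      obtain ⟨C, hC⟩ := ih
      exact ⟨C, fun x hx => by rw [h hx]; exact hC x hx⟩

/-- Logarithmic convexity of the conormal spaces in the exponent. -/
theorem conormal.interpolate {m m' : ι → ℝ} {w : X → ℂ}
    (hw : w ∈ conormal (n := n) ρ m) (hw' : w ∈ conormal (n := n) ρ m') {θ : ℝ}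
    (h0 : 0 ≤ θ) (h1 : θ ≤ 1) : w ∈ conormal (n := n) ρ (θ • m + (1 - θ) • m') := by
  refine ⟨hw.1, fun L hL => ?_⟩
  obtain ⟨C, hC⟩ := hw.2 L hL
  obtain ⟨C', hC'⟩ := hw'.2 L hL
  refine ⟨max C 0 ^ θ * max C' 0 ^ (1 - θ), fun x hx => ?_⟩
  have e1 : ‖L.foldr Corners.lie w x‖ ≤ max C 0 * rp ρ m x :=
    (hC x hx).trans (mul_le_mul_of_nonneg_right (le_max_left _ _) (rp_pos _ hx).le)
  have e2 : ‖L.foldr Corners.lie w x‖ ≤ max C' 0 * rp ρ m' x :=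
    (hC' x hx).trans (mul_le_mul_of_nonneg_right (le_max_left _ _) (rp_pos _ hx).le)
  have e3 := rp_add (θ • m) ((1 - θ) • m') hx
  rw [rp_smul _ _ hx, rp_smul _ _ hx] at e3
  change _ ≤ _ * rp ρ (θ • m + (1 - θ) • m') x
  rw [e3, mul_mul_mul_comm, ← Real.mul_rpow (le_max_right _ _) (rp_pos _ hx).le,
    ← Real.mul_rpow (le_max_right _ _) (rp_pos _ hx).le]
  set A := ‖L.foldr Corners.lie w x‖ with hA
  have hA0 : 0 ≤ A := norm_nonneg _
  -- Interpolation needs no analysis here: the same derivative has two pointwise bounds, and their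
  -- geometric mean is again a pointwise bound.
  calc A = A ^ θ * A ^ (1 - θ) := by
        rw [← Real.rpow_add_of_nonneg hA0 h0 (sub_nonneg.2 h1)]; simp
    _ ≤ _ := mul_le_mul (Real.rpow_le_rpow hA0 e1 h0)
        (Real.rpow_le_rpow hA0 e2 (sub_nonneg.2 h1)) (Real.rpow_nonneg hA0 _)
        (Real.rpow_nonneg (hA0.trans e1) _)

variable [CompactSpace X]

theorem IsBoundaryDefining.bounded (hρ : IsBoundaryDefining (n := n) ρ) (k : ι) :
    ∃ R, ∀ x, ρ k x ≤ R := by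
  obtain ⟨R, hR⟩ := (isCompact_range (hρ.continuous k)).bddAbove
  exact ⟨R, fun x => hR ⟨x, rfl⟩⟩

theorem conormal.mono (hb : ∀ k, ∃ R, ∀ x, ρ k x ≤ R) {m m' : ι → ℝ}
    (h : m' ≤ m) {w : X → ℂ} (hw : w ∈ conormal (n := n) ρ m) : w ∈ conormal (n := n) ρ m' := by
  obtain ⟨K, hK, hKb⟩ := exists_rp_le h hb
  refine ⟨hw.1, fun L hL => ?_⟩
  obtain ⟨C, hC⟩ := hw.2 L hL
  refine ⟨max C 0 * K, fun x hx => (hC x hx).trans ?_⟩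
  rw [mul_assoc]
  exact mul_le_mul (le_max_left _ _) (hKb x hx) (rp_pos _ hx).le (le_max_right _ _)

theorem ofReal_mem_conormal {g : X → ℝ} (hg : ContMDiff (Q n) 𝓘(ℝ, ℝ) ∞ g) :
    (fun x => (g x : ℂ)) ∈ conormal (n := n) ρ 0 := by
  refine subset_conormal (S := {w | ∃ g : X → ℝ, ContMDiff (Q n) 𝓘(ℝ, ℝ) ∞ g ∧
    w = fun x => (g x : ℂ)}) ?_ ?_ ?_ ⟨g, hg, rfl⟩
  · rintro w ⟨g, hg, rfl⟩
    exact (Complex.ofRealCLM.contMDiff.comp hg).contMDiffOn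
  · rintro w ⟨g, hg, rfl⟩ V hV
    exact ⟨_, hV.1.lieReal hg, funext fun x => lie_ofReal (contMDiff_mdiff hg x)⟩
  · rintro w ⟨g, hg, rfl⟩
    obtain ⟨C, hC⟩ := (isCompact_range hg.continuous.norm).bddAbove
    refine ⟨C, fun x _ => ?_⟩
    rw [rp_zero, mul_one, Complex.norm_real]
    exact hC ⟨x, rfl⟩

variable [T2Space X]

theorem contMDiffOn_rpow (hρ : IsBoundaryDefining (n := n) ρ) (j : ι) (a : ℝ) :
    ContMDiffOn (Q n) 𝓘(ℝ, ℝ) ∞ (fun x => ρ j x ^ a) (inner ρ) := by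
  intro x hx
  have h1 : ContMDiffAt 𝓘(ℝ, ℝ) 𝓘(ℝ, ℝ) ∞ (fun t : ℝ => t ^ a) (ρ j x) :=
    (Real.contDiffAt_rpow_const_of_ne (hx j).ne').contMDiffAt
  exact (h1.comp x (hρ.smooth j x)).contMDiffWithinAt

theorem contMDiffOn_log (hρ : IsBoundaryDefining (n := n) ρ) (j : ι) :
    ContMDiffOn (Q n) 𝓘(ℝ, ℝ) ∞ (fun x => Real.log (ρ j x)) (inner ρ) := by
  intro x hx
  have h1 : ContMDiffAt 𝓘(ℝ, ℝ) 𝓘(ℝ, ℝ) ∞ Real.log (ρ j x) :=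
    (Real.contDiffAt_log.2 (hx j).ne').contMDiffAt
  exact (h1.comp x (hρ.smooth j x)).contMDiffWithinAt

theorem lieReal_rpow (hρ : IsBoundaryDefining (n := n) ρ) (V : VField n X) (j : ι) (a : ℝ)
    {x : X} (hx : x ∈ inner ρ) :
    lieReal V (fun x => ρ j x ^ a) x = a * ρ j x ^ (a - 1) * lieReal V (ρ j) x :=
  lieReal_comp (contMDiff_mdiff (hρ.smooth j) x) (Real.hasDerivAt_rpow_const (Or.inl (hx j).ne'))

theorem lieReal_log (hρ : IsBoundaryDefining (n := n) ρ) (V : VField n X) (j : ι)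
    {x : X} (hx : x ∈ inner ρ) :
    lieReal V (fun x => Real.log (ρ j x)) x = (ρ j x)⁻¹ * lieReal V (ρ j) x :=
  lieReal_comp (contMDiff_mdiff (hρ.smooth j) x) (Real.hasDerivAt_log (hx j).ne')

variable [DecidableEq ι]

/-- The functions g ρ_j^a with g smooth form a stable class, because the logarithmic derivative of
ρ_j along 𝒱_b is smooth. -/
theorem rpow_mem_conormal (hρ : IsBoundaryDefining (n := n) ρ) (j : ι) (a : ℝ) :
    (fun x => ((ρ j x ^ a : ℝ) : ℂ)) ∈ conormal (n := n) ρ (Pi.single j a) := by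
  have hI := hρ.isOpen_inner
  have hr := contMDiffOn_rpow hρ j a
  refine subset_conormal (S := {w | ∃ g : X → ℝ, ContMDiff (Q n) 𝓘(ℝ, ℝ) ∞ g ∧
    EqOn w (fun x => ((g x * ρ j x ^ a : ℝ) : ℂ)) (inner ρ)}) ?_ ?_ ?_
    ⟨fun _ => 1, contMDiff_const, fun x _ => by simp⟩
  · rintro w ⟨g, hg, h⟩
    exact (Complex.ofRealCLM.contMDiff.comp_contMDiffOn (hg.contMDiffOn.mul hr)).congr h
  · rintro w ⟨g, hg, h⟩ V hV
    obtain ⟨k, hk, ek⟩ := exists_lieReal_rho hρ hV j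
    refine ⟨fun x => lieReal V g x + a * g x * k x,
      (hV.1.lieReal hg).add ((contMDiff_const.mul hg).mul hk), fun x hx => ?_⟩
    have h1 : MDifferentiableAt (Q n) 𝓘(ℝ, ℝ) (fun x => g x * ρ j x ^ a) x :=
      mdiffAt_of_contMDiffOn hI (hg.contMDiffOn.mul hr) hx
    rw [lie_eqOn hI V h hx, lie_ofReal h1,
      lieReal_mul (contMDiff_mdiff hg x) (mdiffAt_of_contMDiffOn hI hr hx), lieReal_rpow hρ V j a hx,
      ek]
    congr 1
    rw [Real.rpow_sub_one (hx j).ne']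
    field_simp [(hx j).ne']
  · rintro w ⟨g, hg, h⟩
    obtain ⟨C, hC⟩ := (isCompact_range hg.continuous.norm).bddAbove
    refine ⟨C, fun x hx => ?_⟩
    rw [h hx, rp_single, Complex.norm_real, norm_mul,
      Real.norm_of_nonneg (Real.rpow_pos_of_pos (hx j) a).le]
    exact mul_le_mul_of_nonneg_right (hC ⟨x, rfl⟩) (Real.rpow_pos_of_pos (hx j) a).le

theorem exists_abs_log_le {R ε : ℝ} (hε : 0 < ε) :
    ∃ C : ℝ, 0 ≤ C ∧ ∀ t, 0 < t → t ≤ R → |Real.log t| ≤ C * t ^ (-ε) := by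
  refine ⟨1 / ε + max (Real.log R) 0 * max R 0 ^ ε, by positivity, fun t ht htR => ?_⟩
  have htp : 0 < t ^ (-ε) := Real.rpow_pos_of_pos ht _
  rcases le_total t 1 with h | h
  · have h1 := (Real.abs_log_mul_self_rpow_lt t ε ht h hε).le
    rw [abs_mul, abs_of_pos (Real.rpow_pos_of_pos ht ε)] at h1
    have h2 : |Real.log t| ≤ 1 / ε * t ^ (-ε) := by
      rw [Real.rpow_neg ht.le, ← div_eq_mul_inv, le_div_iff₀ (Real.rpow_pos_of_pos ht ε)]
      exact h1
    refine h2.trans (mul_le_mul_of_nonneg_right ?_ htp.le)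
    exact le_add_of_nonneg_right (by positivity)
  · have h0 : 0 ≤ Real.log t := Real.log_nonneg h
    rw [abs_of_nonneg h0]
    have hR : 0 < R := ht.trans_le htR
    have h1 : Real.log t ≤ max (Real.log R) 0 := (Real.log_le_log ht htR).trans (le_max_left _ _)
    have h2 : 1 ≤ max R 0 ^ ε * t ^ (-ε) := by
      rw [Real.rpow_neg ht.le, ← div_eq_mul_inv, one_le_div (Real.rpow_pos_of_pos ht ε)]
      exact Real.rpow_le_rpow ht.le (htR.trans (le_max_left _ _)) hε.le
    calc Real.log t ≤ max (Real.log R) 0 * (max R 0 ^ ε * t ^ (-ε)) :=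
          h1.trans (le_mul_of_one_le_right (le_max_right _ _) h2)
      _ ≤ _ := by
          rw [← mul_assoc, add_mul]
          exact le_add_of_nonneg_left (by positivity)

theorem log_mem_conormal (hρ : IsBoundaryDefining (n := n) ρ) (j : ι) {ε : ℝ} (hε : 0 < ε) :
    (fun x => (Real.log (ρ j x) : ℂ)) ∈ conormal (n := n) ρ (Pi.single j (-ε)) := by
  have hI := hρ.isOpen_inner
  have hr := contMDiffOn_log hρ j
  -- Differentiating the logarithm yields a smooth function, so the stable class is g log ρ_j + g'
  -- with g and g' smooth.
  refine subset_conormal (S := {w | ∃ g g' : X → ℝ, ContMDiff (Q n) 𝓘(ℝ, ℝ) ∞ g ∧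
    ContMDiff (Q n) 𝓘(ℝ, ℝ) ∞ g' ∧
    EqOn w (fun x => ((g x * Real.log (ρ j x) + g' x : ℝ) : ℂ)) (inner ρ)}) ?_ ?_ ?_
    ⟨fun _ => 1, fun _ => 0, contMDiff_const, contMDiff_const, fun x _ => by simp⟩
  · rintro w ⟨g, g', hg, hg', h⟩
    exact (Complex.ofRealCLM.contMDiff.comp_contMDiffOn
      ((hg.contMDiffOn.mul hr).add hg'.contMDiffOn)).congr h
  · rintro w ⟨g, g', hg, hg', h⟩ V hV
    obtain ⟨k, hk, ek⟩ := exists_lieReal_rho hρ hV j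
    refine ⟨lieReal V g, fun x => g x * k x + lieReal V g' x, hV.1.lieReal hg,
      (hg.mul hk).add (hV.1.lieReal hg'), fun x hx => ?_⟩
    have h1 : MDifferentiableAt (Q n) 𝓘(ℝ, ℝ) (fun x => g x * Real.log (ρ j x)) x :=
      mdiffAt_of_contMDiffOn hI (hg.contMDiffOn.mul hr) hx
    have h2 : MDifferentiableAt (Q n) 𝓘(ℝ, ℝ) (fun x => g x * Real.log (ρ j x) + g' x) x :=
      mdiffAt_of_contMDiffOn hI ((hg.contMDiffOn.mul hr).add hg'.contMDiffOn) hx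
    rw [lie_eqOn hI V h hx, lie_ofReal h2, lieReal_add h1 (contMDiff_mdiff hg' x),
      lieReal_mul (contMDiff_mdiff hg x) (mdiffAt_of_contMDiffOn hI hr hx), lieReal_log hρ V j hx,
      ek, inv_mul_cancel_left₀ (hx j).ne']
    congr 1; ring
  · rintro w ⟨g, g', hg, hg', h⟩
    obtain ⟨C, hC⟩ := (isCompact_range hg.continuous.norm).bddAbove
    obtain ⟨C', hC'⟩ := (isCompact_range hg'.continuous.norm).bddAbove
    obtain ⟨R, hR⟩ := hρ.bounded j
    obtain ⟨K, hK0, hK⟩ := exists_abs_log_le (R := R) hε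
    refine ⟨C * K + C' * max R 0 ^ ε, fun x hx => ?_⟩
    have hC0 : 0 ≤ C := (norm_nonneg _).trans (hC ⟨x, rfl⟩)
    have hC0' : 0 ≤ C' := (norm_nonneg _).trans (hC' ⟨x, rfl⟩)
    rw [h hx, rp_single, Complex.norm_real]
    have h2 : 1 ≤ max R 0 ^ ε * ρ j x ^ (-ε) := by
      rw [Real.rpow_neg (hx j).le, ← div_eq_mul_inv, one_le_div (Real.rpow_pos_of_pos (hx j) ε)]
      exact Real.rpow_le_rpow (hx j).le ((hR x).trans (le_max_left _ _)) hε.le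
    calc ‖g x * Real.log (ρ j x) + g' x‖ ≤ ‖g x‖ * |Real.log (ρ j x)| + ‖g' x‖ := by
          rw [← Real.norm_eq_abs, ← norm_mul]; exact norm_add_le _ _
      _ ≤ C * (K * ρ j x ^ (-ε)) + C' * (max R 0 ^ ε * ρ j x ^ (-ε)) := by
          refine add_le_add (mul_le_mul (hC ⟨x, rfl⟩) (hK _ (hx j) (hR x)) (abs_nonneg _) hC0) ?_
          exact (hC' ⟨x, rfl⟩).trans (le_mul_of_one_le_right hC0' h2)
      _ = _ := by ring

end Conormal

/-! ### The spaces 𝒜^{m-} -/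

section ConormalMinus

variable {n : ℕ} {ι : Type*} [Fintype ι]
  {X : Type*} [TopologicalSpace X] [ChartedSpace (EuclideanQuadrant n) X]
  [IsManifold (Q n) ∞ X] {ρ : ι → X → ℝ}

theorem conormal.const_mul (hI : IsOpen (inner ρ)) {m : ι → ℝ} {w : X → ℂ}
    (hw : w ∈ conormal (n := n) ρ m) (c : ℂ) : (fun x => c * w x) ∈ conormal (n := n) ρ m := by
  refine subset_conormal (S := {f | ∃ a ∈ conormal (n := n) ρ m,
    EqOn f (fun x => c * a x) (inner ρ)}) ?_ ?_ ?_ ⟨w, hw, fun _ _ => rfl⟩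
  · rintro f ⟨a, ha, h⟩
    exact (contMDiffOn_mul_complex contMDiffOn_const ha.1).congr h
  · rintro f ⟨a, ha, h⟩ V hV
    refine ⟨_, conormal.lie hI ha hV, fun x hx => ?_⟩
    rw [lie_eqOn hI V h hx, lie_mul mdifferentiableAt_const (SmoothIn.mdiff hI ha.1 hx), lie_const,
      zero_mul, zero_add]
  · rintro f ⟨a, ha, h⟩
    obtain ⟨C, -, hC⟩ := conormal.bound ha
    refine ⟨‖c‖ * C, fun x hx => ?_⟩
    rw [h hx, norm_mul, mul_assoc]
    exact mul_le_mul_of_nonneg_left (hC x hx) (norm_nonneg _)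

theorem conormalMinus.smooth {m : ι → ℝ} {w : X → ℂ} (hw : w ∈ conormalMinus (n := n) ρ m) :
    SmoothIn n ρ w := (hw (fun k => m k - 1) fun k => by simp).1

theorem conormalMinus.congr (hI : IsOpen (inner ρ)) {m : ι → ℝ} {w w' : X → ℂ}
    (hw : w ∈ conormalMinus (n := n) ρ m) (h : EqOn w' w (inner ρ)) :
    w' ∈ conormalMinus (n := n) ρ m := fun m' hm' => conormal.congr hI (hw m' hm') h

theorem conormalMinus.lie (hI : IsOpen (inner ρ)) {m : ι → ℝ} {w : X → ℂ}
    (hw : w ∈ conormalMinus (n := n) ρ m) {V : VField n X} (hV : V ∈ bFields ρ) :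
    lie V w ∈ conormalMinus (n := n) ρ m := fun m' hm' => conormal.lie hI (hw m' hm') hV

theorem conormalMinus.add (hI : IsOpen (inner ρ)) {m : ι → ℝ} {a b : X → ℂ}
    (ha : a ∈ conormalMinus (n := n) ρ m) (hb : b ∈ conormalMinus (n := n) ρ m) :
    (fun x => a x + b x) ∈ conormalMinus (n := n) ρ m :=
  fun m' hm' => conormal.add hI (ha m' hm') (hb m' hm')

theorem conormalMinus.const_mul (hI : IsOpen (inner ρ)) {m : ι → ℝ} {w : X → ℂ}
    (hw : w ∈ conormalMinus (n := n) ρ m) (c : ℂ) :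
    (fun x => c * w x) ∈ conormalMinus (n := n) ρ m :=
  fun m' hm' => conormal.const_mul hI (hw m' hm') c

theorem conormalMinus.sub (hI : IsOpen (inner ρ)) {m : ι → ℝ} {a b : X → ℂ}
    (ha : a ∈ conormalMinus (n := n) ρ m) (hb : b ∈ conormalMinus (n := n) ρ m) :
    (fun x => a x - b x) ∈ conormalMinus (n := n) ρ m :=
  conormalMinus.congr hI (conormalMinus.add hI ha (conormalMinus.const_mul hI hb (-1)))
    fun x _ => by ring

theorem zero_mem_conormal (m : ι → ℝ) :
    (fun _ => 0 : X → ℂ) ∈ conormal (n := n) ρ m := by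
  refine subset_conormal (S := {fun _ => 0}) ?_ ?_ ?_ rfl
  · rintro w rfl; exact contMDiffOn_const
  · rintro w rfl V hV; exact funext fun x => lie_const 0 x
  · rintro w rfl; exact ⟨0, fun x _ => by simp⟩

theorem zero_mem_conormalMinus (m : ι → ℝ) :
    (fun _ => 0 : X → ℂ) ∈ conormalMinus (n := n) ρ m := fun m' _ => zero_mem_conormal m'

theorem conormalMinus.sum (hI : IsOpen (inner ρ)) {m : ι → ℝ} {A : Type*} (s : Finset A)
    {f : A → X → ℂ} (hf : ∀ a ∈ s, f a ∈ conormalMinus (n := n) ρ m) :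
    (fun x => ∑ a ∈ s, f a x) ∈ conormalMinus (n := n) ρ m := by
  classical
  induction s using Finset.induction_on with
  | empty => simpa using zero_mem_conormalMinus m
  | insert a s ha ih =>
    simp only [Finset.sum_insert ha]
    exact conormalMinus.add hI (hf a (Finset.mem_insert_self a s))
      (ih fun b hb => hf b (Finset.mem_insert_of_mem hb))

theorem conormalMinus.mul (hI : IsOpen (inner ρ)) {m m' : ι → ℝ} {a b : X → ℂ}
    (ha : a ∈ conormalMinus (n := n) ρ m) (hb : b ∈ conormalMinus (n := n) ρ m') :
    (fun x => a x * b x) ∈ conormalMinus (n := n) ρ (m + m') := by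
  intro μ hμ
  -- The gap between μ and m + m' is split evenly between the two factors.
  have e : μ = (fun k => m k - (m k + m' k - μ k) / 2) +
      fun k => m' k - (m k + m' k - μ k) / 2 := by
    funext k; simp only [Pi.add_apply]; ring
  rw [e]
  refine conormal.mul hI (ha _ fun k => ?_) (hb _ fun k => ?_) <;>
  · have := hμ k
    simp only [Pi.add_apply] at this
    linarith

theorem conormalMinus.interpolate {m m' : ι → ℝ} {w : X → ℂ}
    (hw : w ∈ conormalMinus (n := n) ρ m) (hw' : w ∈ conormalMinus (n := n) ρ m') {θ : ℝ}
    (h0 : 0 ≤ θ) (h1 : θ ≤ 1) : w ∈ conormalMinus (n := n) ρ (θ • m + (1 - θ) • m') := by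
  intro μ hμ
  set δ : ι → ℝ := fun k => (θ • m + (1 - θ) • m') k - μ k with hδ
  have e : μ = θ • (m - δ) + (1 - θ) • (m' - δ) := by
    funext k
    simp only [hδ, Pi.add_apply, Pi.smul_apply, Pi.sub_apply, smul_eq_mul]; ring
  rw [e]
  have hδ0 : ∀ k, 0 < δ k := fun k => sub_pos.2 (hμ k)
  exact conormal.interpolate (hw _ fun k => sub_lt_self _ (hδ0 k))
    (hw' _ fun k => sub_lt_self _ (hδ0 k)) h0 h1

variable [CompactSpace X] [T2Space X]

theorem conormalMinus.mono {m m' : ι → ℝ}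
    (h : m' ≤ m) {w : X → ℂ} (hw : w ∈ conormalMinus (n := n) ρ m) :
    w ∈ conormalMinus (n := n) ρ m' :=
  fun μ hμ => hw μ fun k => (hμ k).trans_le (h k)

theorem conormal.minus (hρ : IsBoundaryDefining (n := n) ρ) {m : ι → ℝ} {w : X → ℂ}
    (hw : w ∈ conormal (n := n) ρ m) : w ∈ conormalMinus (n := n) ρ m :=
  fun _ hμ => conormal.mono hρ.bounded (fun k => (hμ k).le) hw

theorem conormal.ofReal_mul (hρ : IsBoundaryDefining (n := n) ρ) {m : ι → ℝ} {w : X → ℂ}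
    (hw : w ∈ conormal (n := n) ρ m) {g : X → ℝ}
    (hg : ContMDiff (Q n) 𝓘(ℝ, ℝ) ∞ g) :
    (fun x => (g x : ℂ) * w x) ∈ conormal (n := n) ρ m := by
  have := conormal.mul hρ.isOpen_inner (ofReal_mem_conormal hg) hw
  rwa [zero_add] at this

theorem conormalMinus.ofReal_mul (hρ : IsBoundaryDefining (n := n) ρ) {m : ι → ℝ} {w : X → ℂ}
    (hw : w ∈ conormalMinus (n := n) ρ m) {g : X → ℝ}
    (hg : ContMDiff (Q n) 𝓘(ℝ, ℝ) ∞ g) :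
    (fun x => (g x : ℂ) * w x) ∈ conormalMinus (n := n) ρ m :=
  fun μ hμ => conormal.ofReal_mul hρ (hw μ hμ) hg

variable [DecidableEq ι]

/-- A logarithm loses less than any power, so in the spaces with a minus sign logarithmic factors
cost nothing. -/
theorem log_mem_conormalMinus (hρ : IsBoundaryDefining (n := n) ρ) (j : ι) :
    (fun x => (Real.log (ρ j x) : ℂ)) ∈ conormalMinus (n := n) ρ 0 := by
  intro μ hμ
  refine conormal.mono hρ.bounded ?_ (log_mem_conormal hρ j (ε := - μ j) (neg_pos.2 (hμ j)))
  intro k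
  rw [neg_neg]
  by_cases hk : k = j
  · subst hk; simp
  · rw [Pi.single_eq_of_ne hk]; exact (hμ k).le

theorem conormalMinus.rpow_mul (hρ : IsBoundaryDefining (n := n) ρ) {m : ι → ℝ} {w : X → ℂ}
    (hw : w ∈ conormalMinus (n := n) ρ m) (j : ι) (a : ℝ) :
    (fun x => ((ρ j x ^ a : ℝ) : ℂ) * w x) ∈ conormalMinus (n := n) ρ (m + Pi.single j a) := by
  rw [add_comm]
  exact conormalMinus.mul hρ.isOpen_inner (conormal.minus hρ (rpow_mem_conormal hρ j a)) hw

theorem conormalMinus.pow_mul (hρ : IsBoundaryDefining (n := n) ρ) {m : ι → ℝ} {w : X → ℂ}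
    (hw : w ∈ conormalMinus (n := n) ρ m) (j : ι) (a : ℕ) :
    (fun x => ((ρ j x ^ a : ℝ) : ℂ) * w x) ∈
      conormalMinus (n := n) ρ (m + Pi.single j (a : ℝ)) := by
  have := conormalMinus.rpow_mul hρ hw j a
  simpa only [Real.rpow_natCast] using this

theorem conormalMinus.rho_mul (hρ : IsBoundaryDefining (n := n) ρ) {m : ι → ℝ} {w : X → ℂ}
    (hw : w ∈ conormalMinus (n := n) ρ m) (j : ι) :
    (fun x => (ρ j x : ℂ) * w x) ∈ conormalMinus (n := n) ρ (m + Pi.single j 1) := by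
  have := conormalMinus.pow_mul hρ hw j 1
  simpa only [pow_one, Nat.cast_one] using this

theorem conormalMinus.log_pow_mul (hρ : IsBoundaryDefining (n := n) ρ) {m : ι → ℝ} {w : X → ℂ}
    (hw : w ∈ conormalMinus (n := n) ρ m) (j : ι) (l : ℕ) :
    (fun x => ((Real.log (ρ j x) ^ l : ℝ) : ℂ) * w x) ∈ conormalMinus (n := n) ρ m := by
  induction l with
  | zero => simpa using hw
  | succ l ih =>
    have := conormalMinus.mul hρ.isOpen_inner (log_mem_conormalMinus hρ j) ih
    rw [zero_add] at this
    refine conormalMinus.congr hρ.isOpen_inner this fun x _ => ?_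
    rw [pow_succ]; push_cast; ring

/-- Functions that vanish near a face may be given any exponent there. -/
theorem conormalMinus.of_eventually (hρ : IsBoundaryDefining (n := n) ρ) {m : ι → ℝ} {w : X → ℂ}
    (hw : w ∈ conormalMinus (n := n) ρ m) {j : ι}
    (h0 : ∀ᶠ x in 𝓝ˢ (face ρ j), w x = 0) (N : ℕ) :
    w ∈ conormalMinus (n := n) ρ (m + Pi.single j (N : ℝ)) := by
  obtain ⟨ψ, hψ, -, hψP, hψ0⟩ := exists_cutoff_face hρ j h0
  -- Since w vanishes where ψ ≠ 0, one has w = ρ_j^N · ((1-ψ)/ρ_j^N) · w, and the middle factor is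
  -- smooth.
  have h1 := conormalMinus.ofReal_mul hρ (conormalMinus.pow_mul hρ hw j N)
    (contMDiff_div_of_eventually hρ (contMDiff_const.sub hψ) hψ0 N)
  refine conormalMinus.congr hρ.isOpen_inner h1 fun x _ => ?_
  have h2 := div_mul_pow_of_eventually hψ0 N x
  simp only [← mul_assoc, ← Complex.ofReal_mul]
  rw [mul_comm ((1 - ψ x) / ρ j x ^ N), h2]
  by_cases hx : ψ x = 0
  · simp [hx]
  · simp [hψP x hx]

end ConormalMinus

/-! ### The operators V - c -/

section Shifted

variable {n : ℕ} {ι : Type*} [Fintype ι]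
  {X : Type*} [TopologicalSpace X] [ChartedSpace (EuclideanQuadrant n) X]
  [IsManifold (Q n) ∞ X] {ρ : ι → X → ℝ}

/-- The operator `V - c`. -/
def shifted (V : VField n X) (c : ℂ) (f : X → ℂ) (x : X) : ℂ := lie V f x - c * f x

theorem radialProd_succ (V : VField n X) (q : ℕ) (w : X → ℂ) :
    radialProd V (q + 1) w = (shifted V (q : ℂ))^[q + 1] (radialProd V q w) := rfl

theorem radialOp_zero [LinearOrder ι] (V : ι → VField n X) (w : X → ℂ) :
    radialOp V 0 w = w := by
  have : ∀ L : List ι, L.foldr (fun l f => radialProd (V l) ((0 : ι → ℕ) l) f) w = w := by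
    intro L
    induction L with
    | nil => rfl
    | cons i L ih => rw [List.foldr_cons, ih]; rfl
  exact this _

theorem shifted_eqOn {f g : X → ℂ} {U : Set X} (hU : IsOpen U) (V : VField n X) (c : ℂ)
    (h : EqOn f g U) : EqOn (shifted V c f) (shifted V c g) U := fun x hx => by
  simp only [shifted]; rw [lie_eqOn hU V h hx, h hx]

theorem shifted_iterate_eqOn {f g : X → ℂ} {U : Set X} (hU : IsOpen U) (V : VField n X) (c : ℂ)
    (h : EqOn f g U) (i : ℕ) : EqOn ((shifted V c)^[i] f) ((shifted V c)^[i] g) U := by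
  induction i with
  | zero => exact h
  | succ i ih => simp only [Function.iterate_succ_apply']; exact shifted_eqOn hU V c ih

theorem radialProd_eqOn {f g : X → ℂ} {U : Set X} (hU : IsOpen U) (V : VField n X)
    (h : EqOn f g U) (q : ℕ) : EqOn (radialProd V q f) (radialProd V q g) U := by
  induction q with
  | zero => exact h
  | succ q ih => exact shifted_iterate_eqOn hU V _ ih _

theorem shifted_add {V : VField n X} {c : ℂ} {f g : X → ℂ} {x : X}
    (hf : MDifferentiableAt (Q n) 𝓘(ℝ, ℂ) f x) (hg : MDifferentiableAt (Q n) 𝓘(ℝ, ℂ) g x) :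
    shifted V c (fun y => f y + g y) x = shifted V c f x + shifted V c g x := by
  simp only [shifted]; rw [lie_add hf hg]; ring

theorem lie_shifted {Y V : VField n X} {c : ℂ} {f : X → ℂ} {x : X}
    (hf : MDifferentiableAt (Q n) 𝓘(ℝ, ℂ) f x)
    (hVf : MDifferentiableAt (Q n) 𝓘(ℝ, ℂ) (lie V f) x) :
    lie Y (shifted V c f) x = lie Y (lie V f) x - c * lie Y f x := by
  have h : MDifferentiableAt (Q n) 𝓘(ℝ, ℂ) (fun y => c * f y) x :=
    mdifferentiableAt_const.mul hf
  refine (lie_sub hVf h).trans ?_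
  rw [lie_mul mdifferentiableAt_const hf, lie_const, zero_mul, zero_add]

theorem smoothIn_shifted (hI : IsOpen (inner ρ)) {V : VField n X} (hV : SmoothVField V) (c : ℂ)
    {f : X → ℂ} (hf : SmoothIn n ρ f) : SmoothIn n ρ (shifted V c f) :=
  (hV.lie hI hf).sub (contMDiffOn_mul_complex contMDiffOn_const hf)

/-- If `A T = T B` modulo errors from a class that is stable under `A`, then
`A^i T = T B^i` modulo such errors. -/
theorem iterate_shifted_mod (hI : IsOpen (inner ρ)) {V V' : VField n X} (c c' : ℂ)
    {T : (X → ℂ) → X → ℂ} {P E : (X → ℂ) → Prop}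
    (hP : ∀ f, P f → P (shifted V c f)) (hTs : ∀ f, P f → SmoothIn n ρ (T f))
    (hEs : ∀ e, E e → SmoothIn n ρ e) (hE : ∀ e, E e → E (shifted V' c' e))
    (hEadd : ∀ e e', E e → E e' → E (fun x => e x + e' x)) (hE0 : E fun _ => 0)
    (hstep : ∀ f, P f → ∃ e, E e ∧
      EqOn (shifted V' c' (T f)) (fun x => T (shifted V c f) x + e x) (inner ρ))
    {f : X → ℂ} (hf : P f) (i : ℕ) :
    ∃ e, E e ∧
      EqOn ((shifted V' c')^[i] (T f)) (fun x => T ((shifted V c)^[i] f) x + e x) (inner ρ) := by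
  induction i with
  | zero => exact ⟨_, hE0, fun x _ => by simp⟩
  | succ i ih =>
    obtain ⟨e, he, h⟩ := ih
    have hPi : P ((shifted V c)^[i] f) := by
      clear h
      induction i with
      | zero => exact hf
      | succ i ih => rw [Function.iterate_succ_apply']; exact hP _ ih
    obtain ⟨e', he', h'⟩ := hstep _ hPi
    refine ⟨_, hEadd _ _ he' (hE _ he), fun x hx => ?_⟩
    simp only [Function.iterate_succ_apply']
    rw [shifted_eqOn hI V' c' h hx,
      shifted_add (SmoothIn.mdiff hI (hTs _ hPi) hx) (SmoothIn.mdiff hI (hEs _ he) hx), h' hx]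
    ring

end Shifted

/-! ### Independence of the radial field and stability under 𝒱_b -/

section Descendants

variable {n : ℕ} {ι : Type*} [Fintype ι]
  {X : Type*} [TopologicalSpace X] [ChartedSpace (EuclideanQuadrant n) X]
  [IsManifold (Q n) ∞ X] {ρ : ι → X → ℝ}

/-- The functions obtained from `∏_{k<q} (V - k)^{k+1} w`, `q ∈ ℕ`, by differentiations along
`𝒱_b`, multiplications by smooth functions, and by `ρ_j`, which raises the order `q` by one. -/
inductive Descendant (ρ : ι → X → ℝ) (j : ι) (V : VField n X) (w : X → ℂ) : ℕ → (X → ℂ) → Prop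
  | base (q) : Descendant ρ j V w q (radialProd V q w)
  | lie {q f} {Y : VField n X} : Y ∈ bFields ρ → Descendant ρ j V w q f →
      Descendant ρ j V w q (lie Y f)
  | mul {q f} {g : X → ℝ} : ContMDiff (Q n) 𝓘(ℝ, ℝ) ∞ g → Descendant ρ j V w q f →
      Descendant ρ j V w q (fun x => (g x : ℂ) * f x)
  | rho {q f} : Descendant ρ j V w q f → Descendant ρ j V w (q + 1) (fun x => (ρ j x : ℂ) * f x)
  | add {q f g} : Descendant ρ j V w q f → Descendant ρ j V w q g →
      Descendant ρ j V w q (fun x => f x + g x)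
  | congr {q f g} : Descendant ρ j V w q f → EqOn g f (inner ρ) → Descendant ρ j V w q g

variable {j : ι} {V V' : VField n X} {w : X → ℂ}

theorem smoothIn_radialProd (hI : IsOpen (inner ρ)) (hV : SmoothVField V) (hw : SmoothIn n ρ w)
    (q : ℕ) : SmoothIn n ρ (radialProd V q w) := by
  have h : ∀ (c : ℂ) {f : X → ℂ}, SmoothIn n ρ f → ∀ i, SmoothIn n ρ ((shifted V c)^[i] f) := by
    intro c f hf i
    induction i with
    | zero => exact hf
    | succ i ih => rw [Function.iterate_succ_apply']; exact smoothIn_shifted hI hV c ih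
  induction q with
  | zero => exact hw
  | succ q ih => exact h _ ih _

theorem smoothIn_ofReal_mul {g : X → ℝ} {U : Set X} (hg : ContMDiffOn (Q n) 𝓘(ℝ, ℝ) ∞ g U)
    {f : X → ℂ} (hf : ContMDiffOn (Q n) 𝓘(ℝ, ℂ) ∞ f U) :
    ContMDiffOn (Q n) 𝓘(ℝ, ℂ) ∞ (fun x => (g x : ℂ) * f x) U :=
  contMDiffOn_mul_complex (Complex.ofRealCLM.contMDiff.comp_contMDiffOn hg) hf

theorem Descendant.smoothIn (hρ : IsBoundaryDefining (n := n) ρ) (hV : SmoothVField V)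
    (hw : SmoothIn n ρ w) {q : ℕ} {f : X → ℂ} (hf : Descendant ρ j V w q f) :
    SmoothIn n ρ f := by
  have hI := hρ.isOpen_inner
  induction hf with
  | base q => exact smoothIn_radialProd hI hV hw q
  | lie hY _ ih => exact hY.1.lie hI ih
  | mul hg _ ih => exact smoothIn_ofReal_mul hg.contMDiffOn ih
  | rho _ ih => exact smoothIn_ofReal_mul (hρ.smooth j).contMDiffOn ih
  | add _ _ h1 h2 => exact h1.add h2
  | congr _ h ih => exact ih.congr h

theorem Descendant.shifted {q : ℕ} {f : X → ℂ} (hf : Descendant ρ j V w q f) {Y : VField n X}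
    (hY : Y ∈ bFields ρ) (c : ℕ) : Descendant ρ j V w q (shifted Y c f) := by
  refine .congr (.add (.lie hY hf) (.mul (g := fun _ => -(c : ℝ)) contMDiff_const hf))
    fun x _ => ?_
  simp only [Corners.shifted]; push_cast; ring

theorem Descendant.shifted_iterate {q : ℕ} {f : X → ℂ} (hf : Descendant ρ j V w q f)
    {Y : VField n X} (hY : Y ∈ bFields ρ) (c i : ℕ) :
    Descendant ρ j V w q ((Corners.shifted Y (c : ℂ))^[i] f) := by
  induction i with
  | zero => exact hf
  | succ i ih => rw [Function.iterate_succ_apply']; exact ih.shifted hY c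

theorem Descendant.mem_conormalMinus [CompactSpace X] [T2Space X] [DecidableEq ι]
    (hρ : IsBoundaryDefining (n := n) ρ) {μ : ι → ℝ}
    (hw : ∀ q : ℕ, radialProd V q w ∈ conormalMinus (n := n) ρ (μ + Pi.single j (q : ℝ)))
    {q : ℕ} {f : X → ℂ} (hf : Descendant ρ j V w q f) :
    f ∈ conormalMinus (n := n) ρ (μ + Pi.single j (q : ℝ)) := by
  have hI := hρ.isOpen_inner
  induction hf with
  | base q => exact hw q
  | lie hY _ ih => exact conormalMinus.lie hI ih hY
  | mul hg _ ih => exact conormalMinus.ofReal_mul hρ ih hg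
  | rho _ ih =>
    have := conormalMinus.rho_mul hρ ih j
    rwa [add_assoc, ← Pi.single_add, ← Nat.cast_one (R := ℝ), ← Nat.cast_add] at this
  | add _ _ h1 h2 => exact conormalMinus.add hI h1 h2
  | congr _ h ih => exact conormalMinus.congr hI ih h

variable [CompactSpace X] [T2Space X]

/-- The radial operators for any radial field raise the order of descendants. -/
theorem Descendant.iterate_succ (hρ : IsBoundaryDefining (n := n) ρ)
    (hV : IsWeaklyRadial ρ j V) (hV' : IsWeaklyRadial ρ j V') (hw : SmoothIn n ρ w)
    {q : ℕ} {f : X → ℂ} (hf : Descendant ρ j V w q f) :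
    Descendant ρ j V w (q + 1) ((Corners.shifted V' (q : ℂ))^[q + 1] f) := by
  have hI := hρ.isOpen_inner
  have hs : ∀ {q f}, Descendant ρ j V w q f → SmoothIn n ρ f := fun h => h.smoothIn hρ hV.1.1 hw
  have hz : ∀ q, Descendant ρ j V w q fun _ => 0 := fun q =>
    .congr (.mul (g := fun _ => 0) contMDiff_const (.base q)) fun x _ => by simp
  -- Each case except sums and equality commutes V' - c' with one operation T, where the error has
  -- order q. The target is then reached for the main term T(Y - c)^i f by the base constructor or
  -- by the induction hypothesis.
  have key : ∀ (T : (X → ℂ) → X → ℂ) (Y : VField n X) (q c c' i : ℕ) (f : X → ℂ),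
      Y ∈ bFields ρ → Descendant ρ j V w c f →
      (∀ f, Descendant ρ j V w c f → SmoothIn n ρ (T f)) →
      (∀ f, Descendant ρ j V w c f → ∃ e, Descendant ρ j V w q e ∧
        EqOn (Corners.shifted V' (c' : ℂ) (T f)) (fun x => T (Corners.shifted Y (c : ℂ) f) x + e x)
          (inner ρ)) →
      Descendant ρ j V w q (T ((Corners.shifted Y (c : ℂ))^[i] f)) →
      Descendant ρ j V w q ((Corners.shifted V' (c' : ℂ))^[i] (T f)) := by
    intro T Y q c c' i f hY hf hT hstep hfin
    obtain ⟨e, he, h⟩ := iterate_shifted_mod hI (V := Y) (V' := V') (c : ℂ) (c' : ℂ) (T := T)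
      (P := Descendant ρ j V w c) (E := Descendant ρ j V w q) (fun f hf => hf.shifted hY c) hT
      (fun e he => hs he) (fun e he => he.shifted hV'.1 c') (fun e e' => .add) (hz q) hstep hf i
    exact .congr (.add hfin he) h
  induction hf with
  | base q =>
    -- Here T is the identity: V' - V is ρ_j times a field of 𝒱_b, and ρ_j raises the order by one.
    obtain ⟨W, hW, h⟩ := hV'.exists_sub hρ hV
    refine key id V (q + 1) q q (q + 1) _ hV.1 (.base q) (fun f hf => hs hf) (fun f hf => ?_)
      (.base (q + 1))
    refine ⟨_, .rho (.lie hW hf), fun x hx => ?_⟩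
    simp only [Corners.shifted, id]
    rw [← lie_field_smul, ← lie_field_congr (V := fun y => V' y - V y)
      (W := fun y => ρ j y • W y) (h x)]
    have : Corners.lie V' f x = Corners.lie V f x + Corners.lie (fun y => V' y - V y) f x := by
      rw [← lie_field_add]
      exact lie_field_congr (by simp) _
    rw [this]; ring
  | @lie q f Y hY hf ih =>
    obtain ⟨B, hB, h⟩ := hV'.exists_commutator hρ hY
    refine key (Corners.lie Y) V' (q + 1) q q (q + 1) f hV'.1 hf (fun f hf => hY.1.lie hI (hs hf))
      (fun f hf => ?_) (.lie hY ih)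
    refine ⟨_, .rho (.lie hB hf), fun x hx => ?_⟩
    have hd := SmoothIn.mdiff hI (hs hf) hx
    have h1 := lie_shifted (Y := Y) (c := (q : ℂ)) hd
      (SmoothIn.mdiff hI (hV'.1.1.lie hI (hs hf)) hx)
    simp only [Corners.shifted] at h1 ⊢
    rw [h1]
    rw [h _ f hI (hs hf) x hx]
    ring
  | @mul q f g hg hf ih =>
    obtain ⟨k, hk, ek⟩ := hV'.exists_lieReal hρ hg
    refine key (fun f x => (g x : ℂ) * f x) V' (q + 1) q q (q + 1) f hV'.1 hf
      (fun f hf => smoothIn_ofReal_mul hg.contMDiffOn (hs hf)) (fun f hf => ?_) (.mul hg ih)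
    refine ⟨_, .rho (.mul hk hf), fun x hx => ?_⟩
    simp only [Corners.shifted]
    rw [lie_real_mul (contMDiff_mdiff hg x) (SmoothIn.mdiff hI (hs hf) hx), ek]
    push_cast; ring
  | @rho q f hf ih =>
    -- Multiplication by ρ_j turns V' - (q+1) into V' - q. Of the q+2 factors V' - q, the first q+1
    -- raise the order of f to q+1 by induction, and the outer ρ_j supplies the last unit.
    obtain ⟨k, hk, ek⟩ := hV'.exists_lieReal_rho hρ
    refine key (fun f x => (ρ j x : ℂ) * f x) V' (q + 1 + 1) q (q + 1) (q + 1 + 1) f hV'.1 hf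
      (fun f hf => smoothIn_ofReal_mul (hρ.smooth j).contMDiffOn (hs hf)) (fun f hf => ?_) ?_
    · refine ⟨_, .rho (.rho (.mul hk hf)), fun x hx => ?_⟩
      simp only [Corners.shifted]
      rw [lie_real_mul (contMDiff_mdiff (hρ.smooth j) x) (SmoothIn.mdiff hI (hs hf) hx), ek]
      push_cast; ring
    · refine .rho ?_
      rw [Function.iterate_succ_apply']
      exact ih.shifted hV'.1 q
  | @add q f g hf hg ihf ihg =>
    have h : ∀ i, EqOn ((Corners.shifted V' (q : ℂ))^[i] fun x => f x + g x)
        (fun x => (Corners.shifted V' (q : ℂ))^[i] f x + (Corners.shifted V' (q : ℂ))^[i] g x)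
        (inner ρ) := by
      intro i
      induction i with
      | zero => exact fun _ _ => rfl
      | succ i ih =>
        intro x hx
        simp only [Function.iterate_succ_apply']
        rw [shifted_eqOn hI _ _ ih hx]
        exact shifted_add (SmoothIn.mdiff hI (hs (hf.shifted_iterate hV'.1 q i)) hx)
          (SmoothIn.mdiff hI (hs (hg.shifted_iterate hV'.1 q i)) hx)
    exact .congr (.add ihf ihg) (h _)
  | congr _ h ih => exact .congr ih (shifted_iterate_eqOn hI _ _ h _)

variable [DecidableEq ι]

/-- `w` has the decay required of polyhomogeneous functions at the face `Y_j` alone, relative to the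
weight `ρ^μ`. -/
def RadialDecay (ρ : ι → X → ℝ) (j : ι) (V : VField n X) (μ : ι → ℝ) (w : X → ℂ) : Prop :=
  ∀ q : ℕ, radialProd V q w ∈ conormalMinus (n := n) ρ (μ + Pi.single j (q : ℝ))

variable {μ : ι → ℝ}

/-- By induction P_q(V')f is a descendant of order q. With f = w this is the independence of the
radial field, and with f = P_m(Y)w it shows that operators belonging to other faces do not destroy
the decay at Y_j. -/
theorem RadialDecay.descendant (hρ : IsBoundaryDefining (n := n) ρ)
    (hV : IsWeaklyRadial ρ j V) (hV' : IsWeaklyRadial ρ j V') (hw : RadialDecay ρ j V μ w)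
    {f : X → ℂ} (hf : Descendant ρ j V w 0 f) : RadialDecay ρ j V' μ f := by
  have hws : SmoothIn n ρ w := conormalMinus.smooth (hw 0)
  intro q
  refine Descendant.mem_conormalMinus hρ hw ?_
  induction q with
  | zero => exact hf
  | succ q ih => exact ih.iterate_succ hρ hV hV' hws

theorem RadialDecay.of_radial (hρ : IsBoundaryDefining (n := n) ρ)
    (hV : IsWeaklyRadial ρ j V) (hV' : IsWeaklyRadial ρ j V') (hw : RadialDecay ρ j V μ w) :
    RadialDecay ρ j V' μ w := hw.descendant hρ hV hV' (.base 0)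

theorem RadialDecay.radialProd (hρ : IsBoundaryDefining (n := n) ρ)
    (hV : IsWeaklyRadial ρ j V) (hw : RadialDecay ρ j V μ w) {Y : VField n X} (hY : Y ∈ bFields ρ)
    (m : ℕ) : RadialDecay ρ j V μ (radialProd Y m w) := by
  refine hw.descendant hρ hV hV ?_
  induction m with
  | zero => exact .base 0
  | succ m ih => exact ih.shifted_iterate hY m (m + 1)

end Descendants

/-! ### Push-forward of sections along a parametrization -/

section Pushforward

variable {n : ℕ} {M : Type*} [TopologicalSpace M] [ChartedSpace (EuclideanQuadrant n) M]
  [IsManifold (Q n) ∞ M]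
  {E' H' N : Type*} [NormedAddCommGroup E'] [NormedSpace ℝ E'] [TopologicalSpace H']
  {I' : ModelWithCorners ℝ E' H'} [TopologicalSpace N] [ChartedSpace H' N] [IsManifold I' ∞ N]
  {F : Type*} [NormedAddCommGroup F] [NormedSpace ℝ F]

/-- All tangent spaces are copies of the model space, so a vector can be kept fixed while its base
point is replaced by an equal one. -/
theorem totalSpace_eq {x y : M} (h : x = y) (v : EuclideanSpace ℝ (Fin n)) :
    (⟨x, v⟩ : TangentBundle (Q n) M) = ⟨y, v⟩ := by subst h; rfl

theorem mfderiv_point_eq {x y : M} (h : x = y) (f : M → F) (v : EuclideanSpace ℝ (Fin n)) :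
    mfderiv (Q n) 𝓘(ℝ, F) f x v = mfderiv (Q n) 𝓘(ℝ, F) f y v := by subst h; rfl

/-- The push-forward of a smooth section along a parametrization is smooth. -/
theorem contMDiffOn_pushforward {e : N → M} {s : Set N} (hs : UniqueMDiffOn I' s)
    (he : ContMDiffOn I' (Q n) ∞ e s) {G : M → N} {U : Set M} (hGs : MapsTo G U s)
    (heG : ∀ x ∈ U, e (G x) = x) (v : ∀ x : M, TangentSpace I' (G x))
    (hv : ContMDiffOn (Q n) I'.tangent ∞ (fun x => (⟨G x, v x⟩ : TangentBundle I' N)) U) :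
    ContMDiffOn (Q n) (Q n).tangent ∞
      (fun x => (⟨x, mfderivWithin I' (Q n) e s (G x) (v x)⟩ : TangentBundle (Q n) M)) U := by
  have h1 := (he.contMDiffOn_tangentMapWithin (m := ∞) (by simp) hs).comp hv
    (fun x hx => hGs hx)
  refine h1.congr fun x hx => ?_
  exact totalSpace_eq (heG x hx).symm _

theorem mfderiv_pushforward {e : N → M} {s : Set N} (hs : UniqueMDiffOn I' s)
    (he : ContMDiffOn I' (Q n) ∞ e s) {p : N} (hp : p ∈ s) {f : M → F}
    (hf : MDifferentiableAt (Q n) 𝓘(ℝ, F) f (e p)) (v : TangentSpace I' p) :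
    mfderiv (Q n) 𝓘(ℝ, F) f (e p) (mfderivWithin I' (Q n) e s p v) =
      mfderivWithin I' 𝓘(ℝ, F) (f ∘ e) s p v := by
  rw [mfderiv_comp_mfderivWithin p hf ((he p hp).mdifferentiableWithinAt (by simp)) (hs p hp)]
  rfl

theorem mfderivWithin_mfderiv_inverse {e : N → M} {s : Set N} 
    (he : ContMDiffOn I' (Q n) ∞ e s) {G : M → N} {U : Set M} (hU : IsOpen U)
    (hG : ContMDiffOn (Q n) I' ∞ G U) (hGs : MapsTo G U s)
    (heG : ∀ x ∈ U, e (G x) = x) {x : M} (hx : x ∈ U) (V : TangentSpace (Q n) x) :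
    mfderivWithin I' (Q n) e s (G x) (mfderiv (Q n) I' G x V) = V := by
  have h1 : HasMFDerivWithinAt I' (Q n) e s (G x) _ :=
    ((he _ (hGs hx)).mdifferentiableWithinAt (by simp)).hasMFDerivWithinAt
  have h2 : HasMFDerivAt (Q n) I' G x _ :=
    ((hG.contMDiffAt (hU.mem_nhds hx)).mdifferentiableAt (by simp)).hasMFDerivAt
  have h3 : HasMFDerivWithinAt (Q n) (Q n) (e ∘ G) U x _ := h1.comp x h2.hasMFDerivWithinAt hGs
  have h4 : HasMFDerivAt (Q n) (Q n) (e ∘ G) x _ := h3.hasMFDerivAt (hU.mem_nhds hx)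
  have h5 : HasMFDerivAt (Q n) (Q n) (id : M → M) x
      (ContinuousLinearMap.id ℝ (TangentSpace (Q n) x)) := hasMFDerivAt_id x
  have h6 : (e ∘ G) =ᶠ[𝓝 x] id := by
    filter_upwards [hU.mem_nhds hx] with y hy using heG y hy
  have h7 := hasMFDerivAt_unique (h5.congr_of_eventuallyEq h6) h4
  exact (congrArg (fun A => A V) h7).symm

end Pushforward

/-! ### Vector fields on the product neighborhood -/

section CollarLift

variable {n d : ℕ} {ι : Type*}
  {M : Type*} [TopologicalSpace M] [ChartedSpace (EuclideanQuadrant n) M]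
  [IsManifold (Q n) ∞ M] {ρ : ι → M → ℝ} {j : ι} [ChartedSpace (EuclideanQuadrant d) (face ρ j)]
  [IsManifold (Q d) ∞ (face ρ j)] {F : Type*} [NormedAddCommGroup F] [NormedSpace ℝ F]

namespace Collar

variable (c : Collar (n := n) (d := d) ρ j)

/-- The parameter domain of the product decomposition. -/
abbrev cyl : Set (face ρ j × ℝ) := univ ×ˢ Ico 0 c.width

theorem uniqueMDiffOn_cyl : UniqueMDiffOn ((Q d).prod 𝓘(ℝ, ℝ)) c.cyl :=
  uniqueMDiffOn_univ.prod (uniqueDiffOn_Ico 0 c.width).uniqueMDiffOn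

/-- The field on the product neighborhood with the components `Z` along the face and `τ ∂_t` along
the fibres. -/
def push (Z : VField d (face ρ j)) (τ : ℝ) : VField n M := fun x =>
  mfderivWithin ((Q d).prod 𝓘(ℝ, ℝ)) (Q n) c.emb c.cyl (c.proj x, ρ j x)
    ((Z (c.proj x), τ) : EuclideanSpace ℝ (Fin d) × ℝ)

variable (hρ : IsBoundaryDefining (n := n) ρ)

include hρ

theorem mapsTo_cyl : MapsTo (fun x => (c.proj x, ρ j x)) c.dom c.cyl :=
  fun x hx => ⟨mem_univ _, hρ.nonneg j x, c.rho_lt x hx⟩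

theorem contMDiffOn_push {Z : VField d (face ρ j)} (hZ : SmoothVField Z) (τ : ℝ) :
    ContMDiffOn (Q n) (Q n).tangent ∞
      (fun x => (⟨x, c.push Z τ x⟩ : TangentBundle (Q n) M)) c.dom := by
  refine contMDiffOn_pushforward c.uniqueMDiffOn_cyl c.contMDiffOn_emb (c.mapsTo_cyl hρ)
    (c.emb_proj) (fun x => ((Z (c.proj x), τ) : EuclideanSpace ℝ (Fin d) × ℝ)) ?_
  have h1 : ContMDiffOn (Q n) (Q d).tangent ∞
      (fun x => (⟨c.proj x, Z (c.proj x)⟩ : TangentBundle (Q d) (face ρ j))) c.dom :=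
    ContMDiff.comp_contMDiffOn hZ c.contMDiffOn_proj
  have h2 : ContMDiff 𝓘(ℝ, ℝ) 𝓘(ℝ, ℝ).tangent ∞
      (fun t : ℝ => (⟨t, τ⟩ : TangentBundle 𝓘(ℝ, ℝ) ℝ)) :=
    contMDiff_vectorSpace_iff_contDiff.2 contDiff_const
  have h3 := h2.comp_contMDiffOn (hρ.smooth j).contMDiffOn (s := c.dom)
  exact contMDiff_equivTangentBundleProd_symm.comp_contMDiffOn (h1.prodMk h3)

theorem mfderiv_push (Z : VField d (face ρ j)) (τ : ℝ) {x : M} (hx : x ∈ c.dom) {f : M → F}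
    (hf : MDifferentiableAt (Q n) 𝓘(ℝ, F) f x) :
    mfderiv (Q n) 𝓘(ℝ, F) f x (c.push Z τ x) =
      mfderivWithin ((Q d).prod 𝓘(ℝ, ℝ)) 𝓘(ℝ, F) (f ∘ c.emb) c.cyl (c.proj x, ρ j x)
        ((Z (c.proj x), τ) : EuclideanSpace ℝ (Fin d) × ℝ) := by
  have h := c.emb_proj x hx
  have := mfderiv_pushforward c.uniqueMDiffOn_cyl c.contMDiffOn_emb (c.mapsTo_cyl hρ hx)
    (f := f) (by simpa only [h] using hf) ((Z (c.proj x), τ) : EuclideanSpace ℝ (Fin d) × ℝ)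
  exact (mfderiv_point_eq h.symm f _).trans this

/-- The cylinder has the edge t = 0, so derivatives of f ∘ emb are derivatives within it. They may
be computed from any g that is differentiable on the full product and agrees with f ∘ emb on the
cylinder. -/
theorem mfderiv_push_congr (Z : VField d (face ρ j)) (τ : ℝ) {x : M} (hx : x ∈ c.dom) {f : M → F}
    (hf : MDifferentiableAt (Q n) 𝓘(ℝ, F) f x) {g : face ρ j × ℝ → F}
    {g' : (EuclideanSpace ℝ (Fin d) × ℝ) →L[ℝ] F}
    (hg : HasMFDerivAt ((Q d).prod 𝓘(ℝ, ℝ)) 𝓘(ℝ, F) g (c.proj x, ρ j x) g')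
    (hfg : ∀ y, ∀ t ∈ Ico 0 c.width, f (c.emb (y, t)) = g (y, t)) :
    mfderiv (Q n) 𝓘(ℝ, F) f x (c.push Z τ x) = g' (Z (c.proj x), τ) := by
  rw [c.mfderiv_push hρ Z τ hx hf]
  have h1 := HasMFDerivWithinAt.congr_mono (f₁ := f ∘ c.emb)
    (hg.hasMFDerivWithinAt (s := c.cyl)) (fun p hp => hfg p.1 p.2 hp.2)
    (hfg _ _ (c.mapsTo_cyl hρ hx).2) subset_rfl
  rw [h1.mfderivWithin (c.uniqueMDiffOn_cyl _ (c.mapsTo_cyl hρ hx))]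
  rfl

theorem lieReal_push_rho (Z : VField d (face ρ j)) (τ : ℝ) {x : M} (hx : x ∈ c.dom) :
    lieReal (c.push Z τ) (ρ j) x = τ :=
  c.mfderiv_push_congr hρ Z τ hx (contMDiff_mdiff (hρ.smooth j) x)
    (hasMFDerivAt_snd (c.proj x, ρ j x)) (fun y t ht => c.rho_emb y t ht)

theorem mdiff_proj {x : M} (hx : x ∈ c.dom) : MDifferentiableAt (Q n) (Q d) c.proj x :=
  (c.contMDiffOn_proj.contMDiffAt (c.isOpen_dom.mem_nhds hx)).mdifferentiableAt (by simp)

theorem mfderiv_push_proj (Z : VField d (face ρ j)) (τ : ℝ) {x : M} (hx : x ∈ c.dom)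
    {b : face ρ j → F} (hb : MDifferentiableAt (Q d) 𝓘(ℝ, F) b (c.proj x)) :
    mfderiv (Q n) 𝓘(ℝ, F) (fun x => b (c.proj x)) x (c.push Z τ x) =
      mfderiv (Q d) 𝓘(ℝ, F) b (c.proj x) (Z (c.proj x)) :=
  c.mfderiv_push_congr hρ Z τ hx (hb.comp x (c.mdiff_proj hρ hx))
    (g := b ∘ Prod.fst) (hb.hasMFDerivAt.comp (c.proj x, ρ j x) (hasMFDerivAt_fst _))
    (fun y t ht => congrArg b (c.proj_emb y t ht))

theorem lie_push_proj (Z : VField d (face ρ j)) (τ : ℝ) {x : M} (hx : x ∈ c.dom)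
    {b : face ρ j → ℂ} (hb : MDifferentiableAt (Q d) 𝓘(ℝ, ℂ) b (c.proj x)) :
    lie (c.push Z τ) (fun x => b (c.proj x)) x = lie Z b (c.proj x) :=
  c.mfderiv_push_proj hρ Z τ hx hb

theorem lieReal_push_proj (Z : VField d (face ρ j)) (τ : ℝ) {x : M} (hx : x ∈ c.dom)
    {b : face ρ j → ℝ} (hb : MDifferentiableAt (Q d) 𝓘(ℝ, ℝ) b (c.proj x)) :
    lieReal (c.push Z τ) (fun x => b (c.proj x)) x = lieReal Z b (c.proj x) :=
  c.mfderiv_push_proj hρ Z τ hx hb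

theorem hasMFDerivWithinAt_emb {y : face ρ j} {t : ℝ} (ht : t ∈ Ico 0 c.width) {f : M → F}
    (hf : MDifferentiableAt (Q n) 𝓘(ℝ, F) f (c.emb (y, t))) :
    HasMFDerivWithinAt ((Q d).prod 𝓘(ℝ, ℝ)) 𝓘(ℝ, F) (f ∘ c.emb) c.cyl (y, t)
      (mfderivWithin ((Q d).prod 𝓘(ℝ, ℝ)) 𝓘(ℝ, F) (f ∘ c.emb) c.cyl (y, t)) :=
  (hf.comp_mdifferentiableWithinAt (y, t)
    ((c.contMDiffOn_emb (y, t) ⟨mem_univ _, ht⟩).mdifferentiableWithinAt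
      (by simp))).hasMFDerivWithinAt

theorem mfderiv_push_emb (Z : VField d (face ρ j)) (τ : ℝ) {y : face ρ j} {t : ℝ}
    (ht : t ∈ Ico 0 c.width) {f : M → F}
    (hf : MDifferentiableAt (Q n) 𝓘(ℝ, F) f (c.emb (y, t))) :
    mfderiv (Q n) 𝓘(ℝ, F) f (c.emb (y, t)) (c.push Z τ (c.emb (y, t))) =
      mfderivWithin ((Q d).prod 𝓘(ℝ, ℝ)) 𝓘(ℝ, F) (f ∘ c.emb) c.cyl (y, t)
        ((Z y, τ) : EuclideanSpace ℝ (Fin d) × ℝ) := by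
  refine Eq.trans ?_ (mfderiv_pushforward c.uniqueMDiffOn_cyl c.contMDiffOn_emb
    (p := (y, t)) ⟨mem_univ _, ht⟩ hf ((Z y, τ) : EuclideanSpace ℝ (Fin d) × ℝ))
  -- The base point is made a variable, since the type of the derivative depends on it.
  have h : ∀ p : face ρ j × ℝ, (c.proj (c.emb (y, t)), ρ j (c.emb (y, t))) = p →
      c.push Z τ (c.emb (y, t)) = (mfderivWithin ((Q d).prod 𝓘(ℝ, ℝ)) (Q n) c.emb c.cyl p
        ((Z p.1, τ) : EuclideanSpace ℝ (Fin d) × ℝ) : EuclideanSpace ℝ (Fin n)) := by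
    rintro _ rfl; rfl
  exact congrArg _ (h (y, t) (by rw [c.proj_emb y t ht, c.rho_emb y t ht]))

theorem hasDerivWithinAt_emb {y : face ρ j} {t : ℝ} (ht : t ∈ Ico 0 c.width) {f : M → F}
    (hf : MDifferentiableAt (Q n) 𝓘(ℝ, F) f (c.emb (y, t))) :
    HasDerivWithinAt (fun s => f (c.emb (y, s)))
      (mfderiv (Q n) 𝓘(ℝ, F) f (c.emb (y, t)) (c.push 0 1 (c.emb (y, t)))) (Ico 0 c.width) t := by
  have h1 := c.hasMFDerivWithinAt_emb hρ ht hf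
  have h2 : HasMFDerivWithinAt 𝓘(ℝ, ℝ) ((Q d).prod 𝓘(ℝ, ℝ)) (fun s : ℝ => (y, s))
      (Ico 0 c.width) t (ContinuousLinearMap.inr ℝ (EuclideanSpace ℝ (Fin d)) ℝ) :=
    ((hasMFDerivAt_const y t).prodMk (hasMFDerivAt_id t)).hasMFDerivWithinAt
  have h3 := h1.comp t h2 (fun s hs => ⟨mem_univ _, hs⟩)
  have key : ∀ A : EuclideanSpace ℝ (Fin d) × ℝ →L[ℝ] F,
      HasFDerivWithinAt (fun s => f (c.emb (y, s)))
        (A.comp (ContinuousLinearMap.inr ℝ (EuclideanSpace ℝ (Fin d)) ℝ)) (Ico 0 c.width) t →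
      HasDerivWithinAt (fun s => f (c.emb (y, s))) (A (0, 1)) (Ico 0 c.width) t :=
    fun A hA => hA.hasDerivWithinAt
  rw [c.mfderiv_push_emb hρ 0 1 ht hf]
  exact key _ (hasMFDerivWithinAt_iff_hasFDerivWithinAt.1 h3)

theorem mfderiv_slice (Z : VField d (face ρ j)) {y : face ρ j} {t : ℝ} (ht : t ∈ Ico 0 c.width)
    {f : M → F} (hf : MDifferentiableAt (Q n) 𝓘(ℝ, F) f (c.emb (y, t))) :
    mfderiv (Q d) 𝓘(ℝ, F) (fun z => f (c.emb (z, t))) y (Z y) =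
      mfderiv (Q n) 𝓘(ℝ, F) f (c.emb (y, t)) (c.push Z 0 (c.emb (y, t))) := by
  have h1 := c.hasMFDerivWithinAt_emb hρ ht hf
  have h2 : HasMFDerivAt (Q d) ((Q d).prod 𝓘(ℝ, ℝ)) (fun z : face ρ j => (z, t)) y
      (ContinuousLinearMap.inl ℝ (EuclideanSpace ℝ (Fin d)) ℝ) :=
    (hasMFDerivAt_id y).prodMk (hasMFDerivAt_const t y)
  have hm : MapsTo (fun z : face ρ j => (z, t)) univ c.cyl := fun z _ => ⟨mem_univ _, ht⟩
  have h3 := h1.comp y (h2.hasMFDerivWithinAt (s := univ)) hm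
  rw [hasMFDerivWithinAt_univ] at h3
  rw [c.mfderiv_push_emb hρ Z 0 ht hf]
  refine (congrArg (fun A => A (Z y)) h3.mfderiv).trans ?_
  rfl

theorem lie_slice (Z : VField d (face ρ j)) {y : face ρ j} {t : ℝ} (ht : t ∈ Ico 0 c.width)
    {f : M → ℂ} (hf : MDifferentiableAt (Q n) 𝓘(ℝ, ℂ) f (c.emb (y, t))) :
    lie Z (fun z => f (c.emb (z, t))) y = lie (c.push Z 0) f (c.emb (y, t)) :=
  c.mfderiv_slice hρ Z ht hf

/-- Decomposition of a tangent vector in the product neighborhood. -/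
theorem push_mfderiv_proj {x : M} (hx : x ∈ c.dom) (V : VField n M) (Z : VField d (face ρ j))
    (hZ : Z (c.proj x) = mfderiv (Q n) (Q d) c.proj x (V x)) :
    c.push Z (lieReal V (ρ j) x) x = V x := by
  have h := mfderivWithin_mfderiv_inverse c.contMDiffOn_emb c.isOpen_dom
    (c.contMDiffOn_proj.prodMk (hρ.smooth j).contMDiffOn) (c.mapsTo_cyl hρ) c.emb_proj hx (V x)
  have h1 : HasMFDerivAt (Q n) ((Q d).prod 𝓘(ℝ, ℝ)) (fun x => (c.proj x, ρ j x)) x _ :=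
    (c.mdiff_proj hρ hx).hasMFDerivAt.prodMk (contMDiff_mdiff (hρ.smooth j) x).hasMFDerivAt
  rw [h1.mfderiv] at h
  refine Eq.trans ?_ h
  unfold push
  rw [hZ]
  rfl

end Collar

end CollarLift

/-! ### Geometry of the product neighborhood: lifted fields and defining functions along fibres -/

section CollarGeometry

variable {n d : ℕ} {ι : Type*} [Finite ι]
  {M : Type*} [TopologicalSpace M] [ChartedSpace (EuclideanQuadrant n) M]
  [IsManifold (Q n) ∞ M] {ρ : ι → M → ℝ} {j : ι} [ChartedSpace (EuclideanQuadrant d) (face ρ j)]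
  [IsManifold (Q d) ∞ (face ρ j)]

namespace Collar

/-- The closed part `ρ_j ≤ ε` of the product neighborhood. -/
def slab (c : Collar (n := n) (d := d) ρ j) (ε : ℝ) : Set M := {x | x ∈ c.dom ∧ ρ j x ≤ ε}

variable (c : Collar (n := n) (d := d) ρ j) (hρ : IsBoundaryDefining (n := n) ρ)

theorem face_subset_dom : face ρ j ⊆ c.dom := fun x hx => by
  have := c.emb_mem ⟨x, hx⟩ 0 ⟨le_rfl, c.width_pos⟩
  rwa [c.emb_zero] at this

theorem face_subset_slab {ε : ℝ} (hε : 0 ≤ ε) : face ρ j ⊆ c.slab ε := fun x hx =>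
  ⟨c.face_subset_dom hx, by rw [show ρ j x = 0 from hx]; exact hε⟩

theorem emb_mem_slab {ε : ℝ} (hε : ε < c.width) (y : face ρ j) {t : ℝ} (ht : t ∈ Icc 0 ε) :
    c.emb (y, t) ∈ c.slab ε := by
  have h : t ∈ Ico 0 c.width := ⟨ht.1, ht.2.trans_lt hε⟩
  exact ⟨c.emb_mem y t h, by rw [c.rho_emb y t h]; exact ht.2⟩

section Coe

include c

theorem contMDiff_coe : ContMDiff (Q d) (Q n) ∞ (fun y : face ρ j => (y : M)) := by
  have h1 : ContMDiff (Q d) ((Q d).prod 𝓘(ℝ, ℝ)) ∞ (fun y : face ρ j => (y, (0 : ℝ))) :=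
    contMDiff_id.prodMk contMDiff_const
  have h2 := c.contMDiffOn_emb.comp (h1.contMDiffOn (s := univ))
    (fun y _ => ⟨mem_univ _, le_rfl, c.width_pos⟩)
  exact (contMDiffOn_univ.1 h2).congr fun y => (c.emb_zero y).symm

end Coe

theorem contMDiffOn_comp_proj {F : Type*} [NormedAddCommGroup F] [NormedSpace ℝ F] {b : M → F}
    (hb : ContMDiff (Q n) 𝓘(ℝ, F) ∞ b) :
    ContMDiffOn (Q n) 𝓘(ℝ, F) ∞ (fun x => b (c.proj x)) c.dom :=
  (hb.comp c.contMDiff_coe).comp_contMDiffOn c.contMDiffOn_proj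

theorem hasDerivAt_emb (hρ : IsBoundaryDefining (n := n) ρ)
    {F : Type*} [NormedAddCommGroup F] [NormedSpace ℝ F] {y : face ρ j} {t : ℝ}
    (ht : t ∈ Ioo 0 c.width) {f : M → F} (hf : MDifferentiableAt (Q n) 𝓘(ℝ, F) f (c.emb (y, t))) :
    HasDerivAt (fun s => f (c.emb (y, s)))
      (mfderiv (Q n) 𝓘(ℝ, F) f (c.emb (y, t)) (c.push 0 1 (c.emb (y, t)))) t :=
  (c.hasDerivWithinAt_emb hρ ⟨ht.1.le, ht.2⟩ hf).hasDerivAt (Ico_mem_nhds ht.1 ht.2)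

theorem continuousOn_emb {ε : ℝ} (hε : ε < c.width) (y : face ρ j) {F : Type*} [TopologicalSpace F]
    {f : M → F} (hf : Continuous f) : ContinuousOn (fun t => f (c.emb (y, t))) (Icc 0 ε) :=
  (hf.comp_continuousOn c.contMDiffOn_emb.continuousOn).comp
    (Continuous.prodMk_right y).continuousOn
    fun _ ht => ⟨mem_univ _, ht.1, ht.2.trans_lt hε⟩

/-- A smooth function that localizes to the product neighborhood. -/
structure IsCutoff (c : Collar (n := n) (d := d) ρ j) (ε : ℝ) (η : M → ℝ) : Prop where
  smooth : ContMDiff (Q n) 𝓘(ℝ, ℝ) ∞ η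
  tsupport_subset : tsupport η ⊆ c.dom
  eq_one : ∀ᶠ x in 𝓝ˢ (c.slab ε), η x = 1

/-- The global field that equals `c.push Z τ` where the cutoff is one. -/
def lift (η : M → ℝ) (Z : VField d (face ρ j)) (τ : ℝ) : VField n M := fun x => η x • c.push Z τ x

variable {c}

theorem IsCutoff.eq_zero {ε : ℝ} {η : M → ℝ} (hη : c.IsCutoff ε η) {x : M} (hx : x ∉ c.dom) :
    η x = 0 := by
  by_contra h
  exact hx (hη.tsupport_subset (subset_tsupport _ h))

theorem IsCutoff.lift_eq {ε : ℝ} {η : M → ℝ} (hη : c.IsCutoff ε η) (Z : VField d (face ρ j))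
    (τ : ℝ) {x : M} (hx : x ∈ c.slab ε) : c.lift η Z τ x = c.push Z τ x := by
  unfold lift; rw [hη.eq_one.self_of_nhdsSet x hx]; exact one_smul ℝ (c.push Z τ x)

theorem IsCutoff.smooth_lift (hρ : IsBoundaryDefining (n := n) ρ) {ε : ℝ} {η : M → ℝ}
    (hη : c.IsCutoff ε η) {Z : VField d (face ρ j)} (hZ : SmoothVField Z) (τ : ℝ) :
    SmoothVField (c.lift η Z τ) :=
  Corners.ContMDiffOn.smoothVField_smul (c.contMDiffOn_push hρ hZ τ) c.isOpen_dom hη.smooth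
    hη.tsupport_subset

theorem smoothVField_zero {m : ℕ} {X : Type*} [TopologicalSpace X]
    [ChartedSpace (EuclideanQuadrant m) X] [IsManifold (Q m) ∞ X] :
    SmoothVField (0 : VField m X) := Bundle.contMDiff_zeroSection ℝ (TangentSpace (Q m))

/-- Along a fibre ρ_i ≥ 0, so a zero at an interior parameter t > 0 is a minimum and the fibre
derivative vanishes there. Points with t = 0 are reached by density. -/
theorem IsCutoff.lieReal_lift_other (hρ : IsBoundaryDefining (n := n) ρ) {ε : ℝ} {η : M → ℝ}
    (hη : c.IsCutoff ε η) {i : ι} (hi : i ≠ j) {x : M} (hxi : x ∈ face ρ i) :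
    lieReal (c.lift η 0 1) (ρ i) x = 0 := by
  refine closure_minimal (t := {z | lieReal (c.lift η 0 1) (ρ i) z = 0}) ?_
    (isClosed_eq ((hη.smooth_lift hρ smoothVField_zero 1).lieReal (hρ.smooth i)).continuous
      continuous_const) (hρ.mem_closure_face hi hxi)
  rintro x ⟨hxi, hxj⟩
  change lieReal (c.lift η 0 1) (ρ i) x = 0
  unfold lift
  rw [lieReal_field_smul]
  by_cases hx : x ∈ c.dom
  · have ht : ρ j x ∈ Ioo 0 c.width := ⟨(hρ.nonneg j x).lt_of_ne' hxj, c.rho_lt x hx⟩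
    have he := c.emb_proj x hx
    have hd := c.hasDerivAt_emb hρ ht (f := ρ i) (y := c.proj x) (contMDiff_mdiff (hρ.smooth i) _)
    have hmin : IsLocalMin (fun s => ρ i (c.emb (c.proj x, s))) (ρ j x) := by
      refine Eventually.of_forall fun s => ?_
      simp only [he]
      rw [show ρ i x = 0 from hxi]
      exact hρ.nonneg i _
    have := hmin.hasDerivAt_eq_zero hd
    rw [he] at this
    exact mul_eq_zero_of_right _ this
  · rw [hη.eq_zero hx, zero_mul]

variable [CompactSpace M] [T2Space M]

theorem isCompact_slab (hρ : IsBoundaryDefining (n := n) ρ) {ε : ℝ} (hε : ε < c.width) :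
    IsCompact (c.slab ε) := by
  have hc : CompactSpace (face ρ j) := isCompact_iff_compactSpace.1 (hρ.isClosed_face j).isCompact
  have h : c.slab ε = c.emb '' (univ ×ˢ Icc 0 ε) := by
    refine Subset.antisymm (fun x hx => ⟨(c.proj x, ρ j x), ⟨mem_univ _, hρ.nonneg j x, hx.2⟩,
      c.emb_proj x hx.1⟩) ?_
    rintro _ ⟨⟨y, t⟩, ⟨-, ht⟩, rfl⟩
    exact c.emb_mem_slab hε y ht
  rw [h]
  exact (isCompact_univ.prod isCompact_Icc).image_of_continuousOn
    (c.contMDiffOn_emb.continuousOn.mono (prod_mono_right fun t ht => ⟨ht.1, ht.2.trans_lt hε⟩))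

theorem exists_isCutoff (hρ : IsBoundaryDefining (n := n) ρ) {ε : ℝ} (hε : ε < c.width) :
    ∃ η, c.IsCutoff ε η := by
  obtain ⟨η, h1, h2, h3, -⟩ := exists_cutoff (n := n) (isCompact_slab hρ hε).isClosed c.isOpen_dom
    fun x hx => hx.1
  exact ⟨η, h1, h3, h2⟩

/-- Along the fibres the other defining functions change by bounded factors only. -/
theorem exists_rho_emb_le (hρ : IsBoundaryDefining (n := n) ρ) {ε : ℝ} (hε : ε < c.width)
    {i : ι} (hi : i ≠ j) : ∃ C : ℝ, 1 ≤ C ∧ ∀ y : face ρ j, ∀ t ∈ Icc 0 ε,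
      ρ i (c.emb (y, t)) ≤ C * ρ i y ∧ ρ i y ≤ C * ρ i (c.emb (y, t)) := by
  obtain ⟨η, hη⟩ := exists_isCutoff hρ hε
  -- The fibre derivative of ρ_i vanishes on Y_i, hence equals ρ_i k with k bounded. The comparison
  -- is Gronwall's inequality for this equation.
  obtain ⟨k, hk, ek⟩ := exists_eq_mul hρ ((hη.smooth_lift hρ smoothVField_zero 1).lieReal
    (hρ.smooth i)) fun x hx => hη.lieReal_lift_other hρ hi hx
  obtain ⟨K, hK⟩ := (isCompact_range hk.continuous.norm).bddAbove
  have hK : ∀ x, |k x| ≤ K := fun x => hK ⟨x, rfl⟩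
  refine ⟨max 1 (Real.exp (K * ε)), le_max_left _ _, fun y t ht => ?_⟩
  have hK0 : 0 ≤ K := (abs_nonneg _).trans (hK y)
  have hd : ∀ s ∈ Ioo 0 ε, HasDerivAt (fun s => ρ i (c.emb (y, s)))
      (ρ i (c.emb (y, s)) * k (c.emb (y, s))) s := fun s hs => by
    have h1 := c.hasDerivAt_emb hρ (y := y) (t := s) ⟨hs.1, hs.2.trans hε⟩ (f := ρ i)
      (contMDiff_mdiff (hρ.smooth i) _)
    rw [← ek]
    refine h1.congr_deriv ?_
    exact (lieReal_field_congr (hη.lift_eq 0 1 (c.emb_mem_slab hε y ⟨hs.1.le, hs.2.le⟩)) _).symm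
  have hc := c.continuousOn_emb hε y (hρ.continuous i)
  -- For σ = 1 this says that ρ_i e^{Ks} increases, for σ = -1 that ρ_i e^{-Ks} decreases.
  have hmono : ∀ σ : ℝ, (σ = 1 ∨ σ = -1) → MonotoneOn
      (fun s => σ * (ρ i (c.emb (y, s)) * Real.exp (σ * K * s))) (Icc 0 ε) := by
    intro σ hσ
    have hdσ : ∀ s ∈ Ioo 0 ε, HasDerivAt
        (fun s => σ * (ρ i (c.emb (y, s)) * Real.exp (σ * K * s)))
        (σ * (ρ i (c.emb (y, s)) * k (c.emb (y, s)) * Real.exp (σ * K * s) +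
          ρ i (c.emb (y, s)) * (Real.exp (σ * K * s) * (σ * K * 1)))) s := fun s hs =>
      ((hd s hs).mul (((hasDerivAt_id s).const_mul (σ * K)).exp)).const_mul σ
    refine monotoneOn_of_deriv_nonneg (convex_Icc 0 ε) ?_ ?_ ?_
    · exact continuousOn_const.mul (hc.mul (by fun_prop))
    · rw [interior_Icc]
      exact fun s hs => (hdσ s hs).differentiableAt.differentiableWithinAt
    · rw [interior_Icc]
      intro s hs
      rw [(hdσ s hs).deriv]
      have h1 : 0 ≤ σ * k (c.emb (y, s)) + K := by
        have := abs_le.1 (hK (c.emb (y, s)))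
        rcases hσ with rfl | rfl <;> linarith [this.1, this.2]
      have h2 : σ * σ = 1 := by rcases hσ with rfl | rfl <;> norm_num
      have h3 := mul_nonneg (mul_nonneg (hρ.nonneg i (c.emb (y, s)))
        (Real.exp_pos (σ * K * s)).le) h1
      calc 0 ≤ _ := h3
        _ = _ := by linear_combination (-(ρ i (c.emb (y, s)) * Real.exp (σ * K * s) * K)) * h2
  have h0 : (0 : ℝ) ∈ Icc 0 ε := ⟨le_rfl, ht.1.trans ht.2⟩
  have e1 := hmono 1 (Or.inl rfl) h0 ht ht.1
  have e2 := hmono (-1) (Or.inr rfl) h0 ht ht.1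
  simp only [c.emb_zero, mul_zero, Real.exp_zero, mul_one, one_mul] at e1 e2
  have hexp : Real.exp (K * t) ≤ max 1 (Real.exp (K * ε)) :=
    (Real.exp_le_exp.2 (mul_le_mul_of_nonneg_left ht.2 hK0)).trans (le_max_right _ _)
  have hp := Real.exp_pos (K * t)
  constructor
  · have h1 : ρ i (c.emb (y, t)) * Real.exp (-1 * K * t) ≤ ρ i y := by linarith
    have h2 : Real.exp (-1 * K * t) * Real.exp (K * t) = 1 := by rw [← Real.exp_add]; simp
    calc ρ i (c.emb (y, t)) = ρ i (c.emb (y, t)) * Real.exp (-1 * K * t) * Real.exp (K * t) := by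
          rw [mul_assoc, h2, mul_one]
      _ ≤ ρ i y * Real.exp (K * t) := mul_le_mul_of_nonneg_right h1 hp.le
      _ ≤ _ := by rw [mul_comm]; exact mul_le_mul_of_nonneg_right hexp (hρ.nonneg i _)
  · calc ρ i y ≤ ρ i (c.emb (y, t)) * Real.exp (K * t) := e1
      _ ≤ _ := by rw [mul_comm]; exact mul_le_mul_of_nonneg_right hexp (hρ.nonneg i _)

theorem proj_mem_inner (hρ : IsBoundaryDefining (n := n) ρ) {x : M} (hx : x ∈ c.dom)
    {i : ι} (hi : i ≠ j) (hxi : 0 < ρ i x) : 0 < ρ i (c.proj x) := by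
  obtain ⟨C, hC, h⟩ := c.exists_rho_emb_le hρ (c.rho_lt x hx) hi
  have := (h (c.proj x) (ρ j x) ⟨hρ.nonneg j x, le_rfl⟩).1
  rw [c.emb_proj x hx] at this
  exact pos_of_mul_pos_right (hxi.trans_le this) (by linarith)

/-- The defining function `ρ_i` pulled back from the face equals `ρ_i` times a positive smooth
function. -/
theorem exists_rho_proj (hρ : IsBoundaryDefining (n := n) ρ) {ε : ℝ} (hε : ε < c.width)
    {i : ι} (hi : i ≠ j) : ∃ g : M → ℝ, ContMDiff (Q n) 𝓘(ℝ, ℝ) ∞ g ∧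
      ∀ᶠ x in 𝓝ˢ (c.slab ε), ρ i (c.proj x) = ρ i x * g x ∧ 0 < g x := by
  obtain ⟨ε', h1, h2⟩ := exists_between hε
  obtain ⟨C, hC, h⟩ := c.exists_rho_emb_le hρ h2 hi
  have hcmp : ∀ x ∈ c.slab ε', ρ i x ≤ C * ρ i (c.proj x) ∧ ρ i (c.proj x) ≤ C * ρ i x := by
    intro x hx
    have := h (c.proj x) (ρ j x) ⟨hρ.nonneg j x, hx.2⟩
    rwa [c.emb_proj x hx.1] at this
  have hop : IsOpen (c.dom ∩ {x | ρ j x < ε'}) :=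
    c.isOpen_dom.inter (isOpen_lt (hρ.continuous j) continuous_const)
  obtain ⟨ζ, hζ, hζ1, hζs, -⟩ := exists_cutoff (n := n) (isCompact_slab hρ hε).isClosed hop
    fun x hx => ⟨hx.1, hx.2.trans_lt h1⟩
  -- By the comparison along fibres ρ_i ∘ π vanishes on Y_i, so after cutting off it is divisible by
  -- ρ_i.
  obtain ⟨g, hg, eg⟩ := exists_eq_mul hρ (i := i) (contMDiff_mul_of_tsupport hop hζ hζs
    ((c.contMDiffOn_comp_proj (hρ.smooth i)).mono inter_subset_left)) (fun x hx => by
      by_cases hz : ζ x = 0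
      · rw [hz, zero_mul]
      · have hxs := hζs (subset_tsupport _ hz)
        have := (hcmp x ⟨hxs.1, hxs.2.le⟩).2
        rw [show ρ i x = 0 from hx, mul_zero] at this
        rw [le_antisymm this (hρ.nonneg i _), mul_zero])
  refine ⟨g, hg, ?_⟩
  obtain ⟨U, hU, hUs, hUP⟩ := eventually_nhdsSet_iff_exists.1 hζ1
  -- In the interior ρ_i can be cancelled in the comparison ρ_i ≤ C ρ_i g. By density the lower
  -- bound for the quotient holds up to the boundary.
  have hlow : ∀ x ∈ U, 1 ≤ C * g x := by
    intro x hx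
    have hcl : x ∈ closure (U ∩ inner ρ) := hρ.dense_inner.open_subset_closure_inter hU hx
    refine closure_minimal (t := {x | 1 ≤ C * g x}) ?_
      (isClosed_le continuous_const (continuous_const.mul hg.continuous)) hcl
    rintro z ⟨hzU, hzI⟩
    have hz1 := hUP z hzU
    have hzs := hζs (subset_tsupport ζ (by rw [Function.mem_support, hz1]; exact one_ne_zero))
    have h3 := (hcmp z ⟨hzs.1, hzs.2.le⟩).1
    have h4 := eg z
    rw [hz1, one_mul] at h4
    rw [h4] at h3
    have h5 := hzI i
    have : ρ i z * 1 ≤ ρ i z * (C * g z) := by linarith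
    exact le_of_mul_le_mul_left this h5
  filter_upwards [hU.mem_nhdsSet.2 hUs] with x hx
  have h4 := eg x
  rw [hUP x hx, one_mul] at h4
  exact ⟨h4, pos_of_mul_pos_right (zero_lt_one.trans_le (hlow x hx)) (by linarith)⟩

/-- Lifts of fields that are tangent to the faces of the face are tangent to the faces. -/
theorem IsCutoff.lieReal_lift (hρ : IsBoundaryDefining (n := n) ρ) {ε : ℝ} {η : M → ℝ}
    (hη : c.IsCutoff ε η) {Z : VField d (face ρ j)}
    (hZ : Z ∈ bFields (onFace ρ j ρ)) {i : ι} (hi : i ≠ j) {x : M} (hxi : x ∈ face ρ i) :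
    lieReal (c.lift η Z 0) (ρ i) x = 0 := by
  unfold lift
  rw [lieReal_field_smul]
  by_cases hx : x ∈ c.dom
  · obtain ⟨ε', h1, h2⟩ := exists_between (c.rho_lt x hx)
    obtain ⟨g, hg, h⟩ := c.exists_rho_proj hρ h2 hi
    have h := eventually_nhdsSet_iff_forall.1 h x ⟨hx, h1.le⟩
    have hy : ρ i (c.proj x) = 0 := by
      rw [h.self_of_nhds.1, show ρ i x = 0 from hxi, zero_mul]
    have hsm : ContMDiff (Q d) 𝓘(ℝ, ℝ) ∞ (fun y : face ρ j => ρ i y) :=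
      (hρ.smooth i).comp c.contMDiff_coe
    -- The lift differentiates ρ_i ∘ π = ρ_i g to (Zρ_i) ∘ π, which is 0 here. At ρ_i = 0 the
    -- product rule leaves g times the derivative of ρ_i, and g > 0.
    have e1 := c.lieReal_push_proj hρ Z 0 hx (b := fun y : face ρ j => ρ i y)
      (contMDiff_mdiff hsm _)
    have e2 : lieReal Z (fun y : face ρ j => ρ i y) (c.proj x) = 0 := hZ.2 ⟨i, hi⟩ (c.proj x) hy
    rw [e2, lieReal_congr (h.mono fun z hz => hz.1),
      lieReal_mul (contMDiff_mdiff (hρ.smooth i) x) (contMDiff_mdiff hg x),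
      show ρ i x = 0 from hxi, zero_mul, add_zero] at e1
    rw [(mul_eq_zero.1 e1).resolve_right h.self_of_nhds.2.ne', mul_zero]
  · rw [hη.eq_zero hx, zero_mul]

theorem IsCutoff.lift_mem_bFields (hρ : IsBoundaryDefining (n := n) ρ) {ε : ℝ} {η : M → ℝ}
    (hη : c.IsCutoff ε η) {Z : VField d (face ρ j)} (hZ : Z ∈ bFields (onFace ρ j ρ)) :
    c.lift η Z 0 ∈ bFields ρ := by
  refine ⟨hη.smooth_lift hρ hZ.1 0, fun i x hx => ?_⟩
  by_cases hi : i = j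
  · subst hi
    unfold lift
    rw [lieReal_field_smul, c.lieReal_push_rho hρ Z 0 (c.face_subset_dom hx), mul_zero]
  · exact hη.lieReal_lift hρ hZ hi hx

/-- The radial field of the product decomposition. -/
def radial (c : Collar (n := n) (d := d) ρ j) (η : M → ℝ) : VField n M :=
  fun x => ρ j x • c.lift η 0 1 x

theorem IsCutoff.isWeaklyRadial (hρ : IsBoundaryDefining (n := n) ρ) {ε : ℝ} {η : M → ℝ}
    (hη : c.IsCutoff ε η) (hε : 0 ≤ ε) : IsWeaklyRadial ρ j (c.radial η) := by
  have hs := hη.smooth_lift hρ smoothVField_zero 1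
  refine ⟨⟨hs.smul (hρ.smooth j), fun i x hx => ?_⟩, c.lift η 0 1, hs, Eventually.of_forall
    fun _ => rfl, fun x hx => ?_⟩
  · unfold radial
    rw [lieReal_field_smul]
    by_cases hi : i = j
    · subst hi
      rw [show ρ i x = 0 from hx, zero_mul]
    · rw [hη.lieReal_lift_other hρ hi hx, mul_zero]
  · rw [lieReal_field_congr (hη.lift_eq 0 1 (c.face_subset_slab hε hx)),
      c.lieReal_push_rho hρ 0 1 (c.face_subset_dom hx)]

theorem IsCutoff.lie_radial {ε : ℝ} {η : M → ℝ}
    (hη : c.IsCutoff ε η) {x : M} (hx : x ∈ c.slab ε) (f : M → ℂ) :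
    lie (c.radial η) f x = (ρ j x : ℂ) * lie (c.push 0 1) f x := by
  unfold radial
  rw [lie_field_smul, lie_field_congr (hη.lift_eq 0 1 hx)]

end Collar

end CollarGeometry

/-! ### The radial equation on a half line -/

section OneDimensional

/-- An estimate for solutions of `s φ' - k φ = O(s^σ)`. -/
theorem norm_rpow_smul_sub_le {φ φ' : ℝ → ℂ} {k σ C a b : ℝ} (ha : 0 < a) (hσ : σ ≠ k)
    (hφ : ∀ s ∈ Icc a b, HasDerivAt φ (φ' s) s)
    (hC : ∀ s ∈ Icc a b, ‖(s : ℂ) * φ' s - k * φ s‖ ≤ C * s ^ σ) (hab : a ≤ b) :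
    ‖b ^ (-k) • φ b - a ^ (-k) • φ a‖ ≤ C / (σ - k) * (b ^ (σ - k) - a ^ (σ - k)) := by
  -- The integrating factor s^{-k} gives (s^{-k}φ)' = s^{-k-1}(sφ' - kφ), bounded by C s^{σ-k-1}.
  -- The condition σ ≠ k keeps the primitive of this bound a power.
  have hd : ∀ s ∈ Icc a b, HasDerivAt (fun s => s ^ (-k) • φ s - a ^ (-k) • φ a)
      (s ^ (-k) • φ' s + (-k * s ^ (-k - 1)) • φ s) s := fun s hs =>
    ((Real.hasDerivAt_rpow_const (Or.inl (ha.trans_le hs.1).ne')).smul (hφ s hs)).sub_const _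
  have hB : ∀ s ∈ Icc a b, HasDerivAt (fun s => C / (σ - k) * (s ^ (σ - k) - a ^ (σ - k)))
      (C * s ^ (σ - k - 1)) s := fun s hs => by
    refine (((Real.hasDerivAt_rpow_const (p := σ - k)
      (Or.inl (ha.trans_le hs.1).ne')).sub_const _).const_mul (C / (σ - k))).congr_deriv ?_
    field_simp [sub_ne_zero.2 hσ]
  refine image_norm_le_of_norm_deriv_right_le_deriv_boundary' (a := a) (b := b)
    (f := fun s => s ^ (-k) • φ s - a ^ (-k) • φ a)
    (B := fun s => C / (σ - k) * (s ^ (σ - k) - a ^ (σ - k)))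
    (fun s hs => (hd s hs).continuousAt.continuousWithinAt)
    (fun s hs => (hd s (Ico_subset_Icc_self hs)).hasDerivWithinAt) (by simp)
    (fun s hs => (hB s hs).continuousAt.continuousWithinAt)
    (fun s hs => (hB s (Ico_subset_Icc_self hs)).hasDerivWithinAt) (fun s hs => ?_)
    ⟨hab, le_rfl⟩
  have hs0 : 0 < s := ha.trans_le hs.1
  have e1 : s ^ (-k) • φ' s + (-k * s ^ (-k - 1)) • φ s =
      s ^ (-k - 1) • ((s : ℂ) * φ' s - k * φ s) := by
    have : s ^ (-k) = s ^ (-k - 1) * s := by rw [Real.rpow_sub_one hs0.ne']; field_simp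
    rw [this]
    simp only [Complex.real_smul]
    push_cast; ring
  rw [e1, norm_smul, Real.norm_of_nonneg (Real.rpow_pos_of_pos hs0 _).le]
  calc s ^ (-k - 1) * ‖(s : ℂ) * φ' s - k * φ s‖ ≤ s ^ (-k - 1) * (C * s ^ σ) :=
        mul_le_mul_of_nonneg_left (hC s (Ico_subset_Icc_self hs)) (Real.rpow_pos_of_pos hs0 _).le
    _ = C * s ^ (σ - k - 1) := by
        rw [mul_left_comm, ← Real.rpow_add hs0]; congr 2; ring

end OneDimensional

/-! ### Bounds for solutions of the radial equation on the manifold -/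

section RadialEquation

variable {n d : ℕ} {ι : Type*} [Fintype ι] [DecidableEq ι]
  {M : Type*} [TopologicalSpace M] [ChartedSpace (EuclideanQuadrant n) M]
  [IsManifold (Q n) ∞ M] [CompactSpace M] [T2Space M]
  {ρ : ι → M → ℝ} {j : ι} [ChartedSpace (EuclideanQuadrant d) (face ρ j)]
  [IsManifold (Q d) ∞ (face ρ j)] {c : Collar (n := n) (d := d) ρ j} {ε : ℝ} {η : M → ℝ}

namespace Collar

/-- The exponents on the face. -/
abbrev restr (j : ι) (σ : ι → ℝ) : {k // k ≠ j} → ℝ := fun k => σ k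

theorem rpow_le_mul_rpow {a b C s : ℝ} (ha : 0 < a) (hb : 0 < b) (hC : 1 ≤ C) (h : a ≤ C * b)
    (h' : b ≤ C * a) : a ^ s ≤ C ^ |s| * b ^ s := by
  have hC0 : 0 < C := by linarith
  rcases le_total 0 s with hs | hs
  · rw [abs_of_nonneg hs, ← Real.mul_rpow hC0.le hb.le]
    exact Real.rpow_le_rpow ha.le h hs
  · rw [abs_of_nonpos hs]
    have h1 : (C * a) ^ s ≤ b ^ s := Real.rpow_le_rpow_of_nonpos hb h' hs
    rw [Real.mul_rpow hC0.le ha.le] at h1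
    rw [Real.rpow_neg hC0.le, inv_mul_eq_div, le_div_iff₀ (Real.rpow_pos_of_pos hC0 s), mul_comm]
    exact h1

theorem emb_mem_inner (hρ : IsBoundaryDefining (n := n) ρ) {y : face ρ j}
    (hy : y ∈ inner (onFace ρ j ρ)) {t : ℝ} (ht : t ∈ Ioo 0 c.width) :
    c.emb (y, t) ∈ inner ρ := by
  intro i
  by_cases hi : i = j
  · subst hi; rw [c.rho_emb y t ⟨ht.1.le, ht.2⟩]; exact ht.1
  · obtain ⟨C, hC, h⟩ := c.exists_rho_emb_le hρ ht.2 hi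
    have := (h y t ⟨ht.1.le, le_rfl⟩).2
    exact pos_of_mul_pos_right ((hy ⟨i, hi⟩).trans_le this) (by linarith)

theorem proj_mem (hρ : IsBoundaryDefining (n := n) ρ) {x : M} (hx : x ∈ c.dom)
    (hxI : x ∈ inner ρ) : c.proj x ∈ inner (onFace ρ j ρ) := fun i =>
  c.proj_mem_inner hρ hx i.2 (hxI i)

/-- Along the fibres the weights are comparable with powers of `ρ_j`. -/
theorem exists_rp_emb_le (hρ : IsBoundaryDefining (n := n) ρ) (hε : ε < c.width) (σ : ι → ℝ) :
    ∃ K : ℝ, 0 < K ∧ ∀ y ∈ inner (onFace ρ j ρ), ∀ t ∈ Ioc 0 ε,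
      rp ρ σ (c.emb (y, t)) ≤ K * (t ^ σ j * rp (onFace ρ j ρ) (restr j σ) y) ∧
      t ^ σ j * rp (onFace ρ j ρ) (restr j σ) y ≤ K * rp ρ σ (c.emb (y, t)) := by
  choose! C hC h using fun i (hi : i ≠ j) => c.exists_rho_emb_le hρ hε hi
  refine ⟨∏ i : {k // k ≠ j}, C i ^ |σ i|, Finset.prod_pos fun i _ =>
    Real.rpow_pos_of_pos (zero_lt_one.trans_le (hC i i.2)) _, fun y hy t ht => ?_⟩
  have htw : t ∈ Ioo 0 c.width := ⟨ht.1, ht.2.trans_lt hε⟩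
  have hI := emb_mem_inner (c := c) hρ hy htw
  have e : rp ρ σ (c.emb (y, t)) =
      t ^ σ j * ∏ i : {k // k ≠ j}, ρ i (c.emb (y, t)) ^ σ i := by
    simp only [rhoPow]
    rw [Fintype.prod_eq_mul_prod_subtype_ne _ j, c.rho_emb y t ⟨ht.1.le, htw.2⟩]
  rw [e, mul_left_comm, mul_left_comm _ (t ^ σ j)]
  have ht0 := (Real.rpow_pos_of_pos ht.1 (σ j)).le
  simp only [rhoPow, ← Finset.prod_mul_distrib]
  constructor <;> refine mul_le_mul_of_nonneg_left (Finset.prod_le_prod (fun i _ => ?_)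
    fun i _ => ?_) ht0
  · exact (Real.rpow_pos_of_pos (hI i) _).le
  · exact rpow_le_mul_rpow (hI i) (hy i) (hC i i.2) (h i i.2 y t ⟨ht.1.le, ht.2⟩).1
      (h i i.2 y t ⟨ht.1.le, ht.2⟩).2
  · exact (Real.rpow_pos_of_pos (hy i) _).le
  · exact rpow_le_mul_rpow (hy i) (hI i) (hC i i.2) (h i i.2 y t ⟨ht.1.le, ht.2⟩).2
      (h i i.2 y t ⟨ht.1.le, ht.2⟩).1

theorem slab_mem_nhdsSet (hρ : IsBoundaryDefining (n := n) ρ) (hε : 0 < ε) :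
    c.slab ε ∈ 𝓝ˢ (face ρ j) := by
  have hop : IsOpen (c.dom ∩ {x | ρ j x < ε}) :=
    c.isOpen_dom.inter (isOpen_lt (hρ.continuous j) continuous_const)
  exact mem_of_superset (hop.mem_nhdsSet.2 fun x hx =>
    ⟨c.face_subset_dom hx, by rw [mem_ofPred_eq, show ρ j x = 0 from hx]; exact hε⟩)
    fun x hx => ⟨hx.1, hx.2.le⟩

theorem exists_le_rho (hρ : IsBoundaryDefining (n := n) ρ) (hε : 0 < ε) :
    ∃ c₀ : ℝ, 0 < c₀ ∧ ∀ x, x ∉ c.slab ε → c₀ ≤ ρ j x := by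
  have hop : IsOpen (c.dom ∩ {x | ρ j x < ε}) :=
    c.isOpen_dom.inter (isOpen_lt (hρ.continuous j) continuous_const)
  rcases (c.dom ∩ {x | ρ j x < ε})ᶜ.eq_empty_or_nonempty with h | h
  · refine ⟨1, one_pos, fun x hx => ?_⟩
    have : x ∈ c.dom ∩ {x | ρ j x < ε} := by
      by_contra h'; exact (h ▸ (show x ∈ (c.dom ∩ {x | ρ j x < ε})ᶜ from h') : x ∈ (∅ : Set M))
    exact absurd ⟨this.1, this.2.le⟩ hx
  · obtain ⟨x₀, hx₀, hmin⟩ := hop.isClosed_compl.isCompact.exists_isMinOn h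
      (hρ.continuous j).continuousOn
    refine ⟨ρ j x₀, (hρ.nonneg j x₀).lt_of_ne' fun h0 => hx₀ ?_, fun x hx => hmin ?_⟩
    · exact ⟨c.face_subset_dom h0, by rw [mem_ofPred_eq, h0]; exact hε⟩
    · exact fun h' => hx ⟨h'.1, h'.2.le⟩

theorem IsCutoff.hasDerivAt_fibre (hρ : IsBoundaryDefining (n := n) ρ) (hε : ε < c.width)
    (hη : c.IsCutoff ε η) {f : M → ℂ} (hf : SmoothIn n ρ f) {y : face ρ j}
    (hy : y ∈ inner (onFace ρ j ρ)) {t : ℝ} (ht : t ∈ Ioc 0 ε) :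
    ∃ φ', HasDerivAt (fun s => f (c.emb (y, s))) φ' t ∧
      (t : ℂ) * φ' = lie (c.radial η) f (c.emb (y, t)) := by
  have htw : t ∈ Ioo 0 c.width := ⟨ht.1, ht.2.trans_lt hε⟩
  refine ⟨_, c.hasDerivAt_emb hρ htw (SmoothIn.mdiff hρ.isOpen_inner hf (emb_mem_inner hρ hy htw)),
    ?_⟩
  rw [hη.lie_radial (c.emb_mem_slab hε y ⟨ht.1.le, ht.2⟩), c.rho_emb y t ⟨ht.1.le, htw.2⟩]
  rfl

/-- The basic estimate along the fibres. -/
theorem IsCutoff.exists_fibre_estimate (hρ : IsBoundaryDefining (n := n) ρ) (hε : ε < c.width)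
    (hη : c.IsCutoff ε η) {f : M → ℂ} (hf : SmoothIn n ρ f) {k : ℝ} {σ : ι → ℝ} (hσ : σ j ≠ k)
    {B : ℝ} (hB : ∀ x ∈ inner ρ, ‖shifted (c.radial η) (k : ℂ) f x‖ ≤ B * rp ρ σ x) :
    ∃ C : ℝ, 0 ≤ C ∧ ∀ y ∈ inner (onFace ρ j ρ), ∀ s t, 0 < s → s ≤ t → t ≤ ε →
      ‖t ^ (-k) • f (c.emb (y, t)) - s ^ (-k) • f (c.emb (y, s))‖ ≤
        C * rp (onFace ρ j ρ) (restr j σ) y / (σ j - k) * (t ^ (σ j - k) - s ^ (σ j - k)) := by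
  obtain ⟨K, hK, h⟩ := exists_rp_emb_le (c := c) hρ hε σ
  refine ⟨max B 0 * K, mul_nonneg (le_max_right _ _) hK.le, fun y hy s t hs hst htε => ?_⟩
  have hmem : ∀ r ∈ Icc s t, r ∈ Ioc 0 ε := fun r hr => ⟨hs.trans_le hr.1, hr.2.trans htε⟩
  choose! φ' h1 h2 using fun r (hr : r ∈ Icc s t) =>
    hη.hasDerivAt_fibre hρ hε hf hy (hmem r hr)
  refine norm_rpow_smul_sub_le hs hσ h1 (fun r hr => ?_) hst
  rw [h2 r hr]
  have hI := emb_mem_inner (c := c) hρ hy ⟨(hmem r hr).1, (hmem r hr).2.trans_lt hε⟩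
  calc _ ≤ B * rp ρ σ (c.emb (y, r)) := hB _ hI
    _ ≤ max B 0 * rp ρ σ (c.emb (y, r)) :=
        mul_le_mul_of_nonneg_right (le_max_left _ _) (rp_pos _ hI).le
    _ ≤ max B 0 * (K * (r ^ σ j * rp (onFace ρ j ρ) (restr j σ) y)) :=
        mul_le_mul_of_nonneg_left (h y hy r (hmem r hr)).1 (le_max_right _ _)
    _ = _ := by ring

theorem rp_sub_single {σ : ι → ℝ} (a : ℝ) {x : M} (hx : x ∈ inner ρ) :
    rp ρ (σ - Pi.single j a) x = rp ρ σ x * ρ j x ^ (-a) := by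
  rw [sub_eq_add_neg, rp_add _ _ hx, ← Pi.single_neg, rp_single]

/-- A bound on the slab extends to the whole interior. -/
theorem exists_bound_of_slab (hρ : IsBoundaryDefining (n := n) ρ) (hε : 0 < ε) (hεc : ε < c.width)
    {f : M → ℂ} {σ : ι → ℝ} {a A C : ℝ} (ha : 0 ≤ a)
    (hA : ∀ x ∈ inner ρ, ‖f x‖ ≤ A * rp ρ (σ - Pi.single j a) x)
    (hC : ∀ y ∈ inner (onFace ρ j ρ), ∀ t ∈ Ioc 0 ε,
      ‖f (c.emb (y, t))‖ ≤ C * (t ^ σ j * rp (onFace ρ j ρ) (restr j σ) y)) :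
    ∃ C' : ℝ, ∀ x ∈ inner ρ, ‖f x‖ ≤ C' * rp ρ σ x := by
  obtain ⟨K, hK, h⟩ := exists_rp_emb_le (c := c) hρ hεc σ
  obtain ⟨c₀, hc₀, hc⟩ := exists_le_rho (c := c) hρ hε
  refine ⟨max (max C 0 * K) (max A 0 * c₀ ^ (-a)), fun x hx => ?_⟩
  have hrp := (rp_pos σ hx).le
  by_cases hs : x ∈ c.slab ε
  · have hy := proj_mem hρ hs.1 hx
    have ht : ρ j x ∈ Ioc 0 ε := ⟨hx j, hs.2⟩
    have h1 := hC _ hy _ ht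
    have h2 := (h _ hy _ ht).2
    rw [c.emb_proj x hs.1] at h1 h2
    have hnn : 0 ≤ ρ j x ^ σ j * rp (onFace ρ j ρ) (restr j σ) (c.proj x) :=
      mul_nonneg (Real.rpow_pos_of_pos ht.1 _).le (rp_pos _ hy).le
    calc ‖f x‖ ≤ max C 0 * (ρ j x ^ σ j * rp (onFace ρ j ρ) (restr j σ) (c.proj x)) :=
          h1.trans (mul_le_mul_of_nonneg_right (le_max_left _ _) hnn)
      _ ≤ max C 0 * (K * rp ρ σ x) := mul_le_mul_of_nonneg_left h2 (le_max_right _ _)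
      _ = max C 0 * K * rp ρ σ x := by ring
      _ ≤ _ := mul_le_mul_of_nonneg_right (le_max_left _ _) hrp
  · have h1 := hA x hx
    rw [rp_sub_single a hx] at h1
    have h2 : ρ j x ^ (-a) ≤ c₀ ^ (-a) :=
      Real.rpow_le_rpow_of_nonpos hc₀ (hc x hs) (neg_nonpos.2 ha)
    have hnn : 0 ≤ rp ρ σ x * ρ j x ^ (-a) := mul_nonneg hrp (Real.rpow_pos_of_pos (hx j) _).le
    calc ‖f x‖ ≤ max A 0 * (rp ρ σ x * ρ j x ^ (-a)) :=
          h1.trans (mul_le_mul_of_nonneg_right (le_max_left _ _) hnn)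
      _ ≤ max A 0 * (rp ρ σ x * c₀ ^ (-a)) :=
          mul_le_mul_of_nonneg_left (mul_le_mul_of_nonneg_left h2 hrp) (le_max_right _ _)
      _ = max A 0 * c₀ ^ (-a) * rp ρ σ x := by ring
      _ ≤ _ := mul_le_mul_of_nonneg_right (le_max_right _ _) hrp

/-- Integration from ρ_j = ε inwards. For σ_j < k the homogeneous solution t^k is O(t^{σ_j}), so the
initial value at ε does no harm and is controlled by the a priori bound. -/
theorem IsCutoff.bound_of_lt (hρ : IsBoundaryDefining (n := n) ρ) (hε : 0 < ε) (hεc : ε < c.width)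
    (hη : c.IsCutoff ε η) {f : M → ℂ} (hf : SmoothIn n ρ f) {k : ℝ} {σ : ι → ℝ} {a A B : ℝ}
    (ha : 0 ≤ a) (hA : ∀ x ∈ inner ρ, ‖f x‖ ≤ A * rp ρ (σ - Pi.single j a) x)
    (hB : ∀ x ∈ inner ρ, ‖shifted (c.radial η) (k : ℂ) f x‖ ≤ B * rp ρ σ x)
    (hσ : σ j < k) : ∃ C' : ℝ, ∀ x ∈ inner ρ, ‖f x‖ ≤ C' * rp ρ σ x := by
  obtain ⟨C, hC0, hC⟩ := hη.exists_fibre_estimate hρ hεc hf hσ.ne hB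
  obtain ⟨K, hK, hKe⟩ := exists_rp_emb_le (c := c) hρ hεc σ
  have hks : 0 < k - σ j := sub_pos.2 hσ
  -- This constant bounds the initial term ε^{-k} f(y, ε), by the a priori bound and the comparison
  -- of weights at t = ε.
  set A' := ε ^ (-k) * (max A 0 * K * ε ^ (σ j) * ε ^ (-a)) with hA'
  have hA'0 : 0 ≤ A' := by positivity
  refine exists_bound_of_slab hρ hε hεc ha hA (C := A' * ε ^ (k - σ j) + C / (k - σ j))
    fun y hy t ht => ?_
  set P := rp (onFace ρ j ρ) (restr j σ) y with hP
  have hP0 : 0 ≤ P := (rp_pos _ hy).le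
  have hI := emb_mem_inner (c := c) hρ hy ⟨hε, hεc⟩
  have h1 := hC y hy t ε ht.1 ht.2 le_rfl
  have h2 : ‖ε ^ (-k) • f (c.emb (y, ε))‖ ≤ A' * P := by
    rw [norm_smul, Real.norm_of_nonneg (Real.rpow_pos_of_pos hε _).le, hA', mul_assoc]
    refine mul_le_mul_of_nonneg_left ?_ (Real.rpow_pos_of_pos hε _).le
    have h3 := hA _ hI
    rw [rp_sub_single a hI, c.rho_emb y ε ⟨hε.le, hεc⟩] at h3
    have h4 := (hKe y hy ε ⟨hε, le_rfl⟩).1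
    have h5 : 0 ≤ ε ^ (-a) := (Real.rpow_pos_of_pos hε _).le
    calc _ ≤ A * (rp ρ σ (c.emb (y, ε)) * ε ^ (-a)) := h3
      _ ≤ max A 0 * (rp ρ σ (c.emb (y, ε)) * ε ^ (-a)) :=
          mul_le_mul_of_nonneg_right (le_max_left _ _) (mul_nonneg (rp_pos _ hI).le h5)
      _ ≤ max A 0 * (K * (ε ^ σ j * P) * ε ^ (-a)) :=
          mul_le_mul_of_nonneg_left (mul_le_mul_of_nonneg_right h4 h5) (le_max_right _ _)
      _ = _ := by ring
  have h3 : ‖t ^ (-k) • f (c.emb (y, t))‖ ≤ A' * P + C * P / (k - σ j) * t ^ (σ j - k) := by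
    have h4 : C * P / (σ j - k) * (ε ^ (σ j - k) - t ^ (σ j - k)) ≤
        C * P / (k - σ j) * t ^ (σ j - k) := by
      have h5 : C * P / (σ j - k) = -(C * P / (k - σ j)) := by
        rw [← neg_sub k, div_neg]
      rw [h5]
      have h6 : 0 ≤ C * P / (k - σ j) * ε ^ (σ j - k) := by positivity
      linarith
    have h5 := norm_sub_norm_le (t ^ (-k) • f (c.emb (y, t))) (ε ^ (-k) • f (c.emb (y, ε)))
    rw [norm_sub_rev] at h5
    linarith
  rw [norm_smul, Real.norm_of_nonneg (Real.rpow_pos_of_pos ht.1 _).le] at h3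
  have h4 : ‖f (c.emb (y, t))‖ = t ^ k * (t ^ (-k) * ‖f (c.emb (y, t))‖) := by
    rw [← mul_assoc, ← Real.rpow_add ht.1, add_neg_cancel, Real.rpow_zero, one_mul]
  rw [h4]
  have h5 : t ^ k * t ^ (σ j - k) = t ^ σ j := by rw [← Real.rpow_add ht.1]; congr 1; ring
  have h6 : t ^ k ≤ ε ^ (k - σ j) * t ^ σ j := by
    have : t ^ k = t ^ (k - σ j) * t ^ σ j := by rw [← Real.rpow_add ht.1]; congr 1; ring
    rw [this]
    exact mul_le_mul_of_nonneg_right (Real.rpow_le_rpow ht.1.le ht.2 hks.le)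
      (Real.rpow_pos_of_pos ht.1 _).le
  calc t ^ k * (t ^ (-k) * ‖f (c.emb (y, t))‖)
      ≤ t ^ k * (A' * P + C * P / (k - σ j) * t ^ (σ j - k)) :=
        mul_le_mul_of_nonneg_left h3 (Real.rpow_pos_of_pos ht.1 _).le
    _ = t ^ k * (A' * P) + C * P / (k - σ j) * t ^ σ j := by
        rw [mul_add, ← h5]; ring
    _ ≤ ε ^ (k - σ j) * t ^ σ j * (A' * P) + C * P / (k - σ j) * t ^ σ j := by
        have := mul_le_mul_of_nonneg_right h6 (mul_nonneg hA'0 hP0)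
        linarith
    _ = _ := by ring

/-- Integration from 0. For σ_j > k a multiple of t^k would be too large, and the limit hypothesis
excludes it. -/
theorem IsCutoff.bound_of_gt (hρ : IsBoundaryDefining (n := n) ρ) (hε : 0 < ε) (hεc : ε < c.width)
    (hη : c.IsCutoff ε η) {f : M → ℂ} (hf : SmoothIn n ρ f) {k : ℝ} {σ : ι → ℝ} {a A B : ℝ}
    (ha : 0 ≤ a) (hA : ∀ x ∈ inner ρ, ‖f x‖ ≤ A * rp ρ (σ - Pi.single j a) x)
    (hB : ∀ x ∈ inner ρ, ‖shifted (c.radial η) (k : ℂ) f x‖ ≤ B * rp ρ σ x)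
    (hσ : k < σ j)
    (hlim : ∀ y ∈ inner (onFace ρ j ρ),
      Tendsto (fun t : ℝ => t ^ (-k) • f (c.emb (y, t))) (𝓝[>] 0) (𝓝 0)) :
    ∃ C' : ℝ, ∀ x ∈ inner ρ, ‖f x‖ ≤ C' * rp ρ σ x := by
  obtain ⟨C, hC0, hC⟩ := hη.exists_fibre_estimate hρ hεc hf hσ.ne' hB
  have hks : 0 < σ j - k := sub_pos.2 hσ
  refine exists_bound_of_slab hρ hε hεc ha hA (C := C / (σ j - k)) fun y hy t ht => ?_
  set P := rp (onFace ρ j ρ) (restr j σ) y with hP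
  have hP0 : 0 ≤ P := (rp_pos _ hy).le
  have h3 : ‖t ^ (-k) • f (c.emb (y, t))‖ ≤ C * P / (σ j - k) * t ^ (σ j - k) := by
    have h1 : Tendsto (fun s : ℝ => ‖t ^ (-k) • f (c.emb (y, t)) - s ^ (-k) • f (c.emb (y, s))‖)
        (𝓝[>] 0) (𝓝 ‖t ^ (-k) • f (c.emb (y, t)) - 0‖) :=
      (tendsto_const_nhds.sub (hlim y hy)).norm
    rw [sub_zero] at h1
    refine le_of_tendsto h1 ?_
    filter_upwards [Ioc_mem_nhdsGT ht.1] with s hs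
    refine (hC y hy s t hs.1 hs.2 ht.2).trans ?_
    refine mul_le_mul_of_nonneg_left ?_ (by positivity)
    linarith [Real.rpow_pos_of_pos hs.1 (σ j - k)]
  rw [norm_smul, Real.norm_of_nonneg (Real.rpow_pos_of_pos ht.1 _).le] at h3
  have h4 : ‖f (c.emb (y, t))‖ = t ^ k * (t ^ (-k) * ‖f (c.emb (y, t))‖) := by
    rw [← mul_assoc, ← Real.rpow_add ht.1, add_neg_cancel, Real.rpow_zero, one_mul]
  rw [h4]
  have h5 : t ^ k * t ^ (σ j - k) = t ^ σ j := by rw [← Real.rpow_add ht.1]; congr 1; ring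
  calc t ^ k * (t ^ (-k) * ‖f (c.emb (y, t))‖) ≤ t ^ k * (C * P / (σ j - k) * t ^ (σ j - k)) :=
        mul_le_mul_of_nonneg_left h3 (Real.rpow_pos_of_pos ht.1 _).le
    _ = _ := by rw [← h5]; ring

end Collar

end RadialEquation

/-! ### Removing factors D - k in the conormal spaces -/

section Regularity

variable {n d : ℕ} {ι : Type*} [Fintype ι] [DecidableEq ι]
  {M : Type*} [TopologicalSpace M] [ChartedSpace (EuclideanQuadrant n) M]
  [IsManifold (Q n) ∞ M] [CompactSpace M] [T2Space M]
  {ρ : ι → M → ℝ} {j : ι}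

theorem IsWeaklyRadial.exists_shifted_lie (hρ : IsBoundaryDefining (n := n) ρ)
    {V W : VField n M} (hV : IsWeaklyRadial ρ j V) (hW : W ∈ bFields ρ) (k : ℂ) :
    ∃ B : VField n M, B ∈ bFields ρ ∧ ∀ f : M → ℂ, SmoothIn n ρ f →
      EqOn (shifted V k (lie W f))
        (fun x => lie W (shifted V k f) x + (ρ j x : ℂ) * lie B f x) (inner ρ) := by
  obtain ⟨B, hB, h⟩ := hV.exists_commutator hρ hW
  have hI := hρ.isOpen_inner
  refine ⟨B, hB, fun f hf x hx => ?_⟩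
  have h1 := lie_shifted (Y := W) (V := V) (c := k) (SmoothIn.mdiff hI hf hx)
    (SmoothIn.mdiff hI (hV.1.1.lie hI hf) hx)
  simp only [shifted] at h1 ⊢
  rw [h1, h _ f hI hf x hx]
  ring

theorem conormalMinus.shifted (hρ : IsBoundaryDefining (n := n) ρ) {μ : ι → ℝ} {f : M → ℂ}
    (hf : f ∈ conormalMinus (n := n) ρ μ) {V : VField n M} (hV : V ∈ bFields ρ) (k : ℂ) :
    shifted V k f ∈ conormalMinus (n := n) ρ μ :=
  conormalMinus.sub hρ.isOpen_inner (conormalMinus.lie hρ.isOpen_inner hf hV)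
    (conormalMinus.const_mul hρ.isOpen_inner hf k)

theorem conormalMinus.shifted_iterate (hρ : IsBoundaryDefining (n := n) ρ) {μ : ι → ℝ} {f : M → ℂ}
    (hf : f ∈ conormalMinus (n := n) ρ μ) {V : VField n M} (hV : V ∈ bFields ρ) (k : ℂ) (i : ℕ) :
    (Corners.shifted V k)^[i] f ∈ conormalMinus (n := n) ρ μ := by
  induction i with
  | zero => exact hf
  | succ i ih => rw [Function.iterate_succ_apply']; exact conormalMinus.shifted hρ ih hV k

theorem conormalMinus.radialProd (hρ : IsBoundaryDefining (n := n) ρ) {μ : ι → ℝ} {f : M → ℂ}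
    (hf : f ∈ conormalMinus (n := n) ρ μ) {V : VField n M} (hV : V ∈ bFields ρ) (q : ℕ) :
    radialProd V q f ∈ conormalMinus (n := n) ρ μ := by
  induction q with
  | zero => exact hf
  | succ q ih => exact conormalMinus.shifted_iterate hρ ih hV _ _

variable [ChartedSpace (EuclideanQuadrant d) (face ρ j)]
  [IsManifold (Q d) ∞ (face ρ j)] {c : Collar (n := n) (d := d) ρ j} {ε : ℝ} {η : M → ℝ}

namespace Collar

/-- Functions `g ∈ 𝒜^{ν-}` with `(D - k) g ∈ 𝒜^{(ν + s e_j)-}` form a class that is stable under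
`𝒱_b`. -/
theorem IsCutoff.shifted_lie_mem (hρ : IsBoundaryDefining (n := n) ρ) (hε : 0 ≤ ε)
    (hη : c.IsCutoff ε η) {k : ℂ} {ν : ι → ℝ} {s : ℝ} (hs : s ≤ 1) {g : M → ℂ}
    (hg : g ∈ conormalMinus (n := n) ρ ν)
    (hg' : shifted (c.radial η) k g ∈ conormalMinus (n := n) ρ (ν + Pi.single j s))
    {W : VField n M} (hW : W ∈ bFields ρ) :
    shifted (c.radial η) k (lie W g) ∈ conormalMinus (n := n) ρ (ν + Pi.single j s) := by
  have hI := hρ.isOpen_inner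
  obtain ⟨B, hB, h⟩ := (hη.isWeaklyRadial hρ hε).exists_shifted_lie hρ hW k
  refine conormalMinus.congr hI (conormalMinus.add hI (conormalMinus.lie hI hg' hW) ?_)
    (h g (conormalMinus.smooth hg))
  refine conormalMinus.mono ?_ (conormalMinus.rho_mul hρ (conormalMinus.lie hI hg hB) j)
  exact add_le_add_right (Pi.single_mono j hs) ν

/-- The two alternatives are the two directions of integration. The gain s is limited to 1 because
the commutator with a field of 𝒱_b contributes exactly one factor ρ_j, and this is what keeps the
class of admissible g stable. -/
theorem IsCutoff.mem_of_shifted_mem (hρ : IsBoundaryDefining (n := n) ρ) (hε : 0 < ε)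
    (hεc : ε < c.width) (hη : c.IsCutoff ε η) {k : ℝ} {ν : ι → ℝ} {s : ℝ} (hs0 : 0 ≤ s)
    (hs : s ≤ 1) (hk : ν j + s ≤ k ∨ k < ν j) {g : M → ℂ}
    (hg : g ∈ conormalMinus (n := n) ρ ν)
    (hg' : shifted (c.radial η) (k : ℂ) g ∈ conormalMinus (n := n) ρ (ν + Pi.single j s)) :
    g ∈ conormalMinus (n := n) ρ (ν + Pi.single j s) := by
  have hI := hρ.isOpen_inner
  intro m hm
  have hmj : m j < ν j + s := by simpa using hm j
  have hmi : ∀ i, i ≠ j → m i < ν i := fun i hi => by simpa [hi] using hm i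
  refine subset_conormal (S := {g | g ∈ conormalMinus (n := n) ρ ν ∧
    Corners.shifted (c.radial η) (k : ℂ) g ∈ conormalMinus (n := n) ρ (ν + Pi.single j s)})
    (fun g hg => conormalMinus.smooth hg.1) (fun g hg W hW => ⟨conormalMinus.lie hI hg.1 hW,
      hη.shifted_lie_mem hρ hε.le hs hg.1 hg.2 hW⟩) ?_ ⟨hg, hg'⟩
  rintro g ⟨hg, hg'⟩
  have hlt : ∀ σ : ι → ℝ, (∀ i, σ i < (ν + Pi.single j s : ι → ℝ) i) →
      ∀ i, (σ - Pi.single j s : ι → ℝ) i < ν i := fun σ hσ i => by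
    have := hσ i
    simp only [Pi.add_apply, Pi.sub_apply] at this ⊢
    linarith
  rcases hk with hk | hk
  · obtain ⟨A, -, hA⟩ := conormal.bound (hg _ (hlt m hm))
    obtain ⟨B, -, hB⟩ := conormal.bound (hg' m hm)
    exact hη.bound_of_lt hρ hε hεc (conormalMinus.smooth hg) hs0 hA hB (hmj.trans_le hk)
  -- Integration from 0 needs an exponent above k. The midpoint of k and ν_j is above k and still
  -- allowed for g itself: with τ it shows that t^{-k}g → 0, and σ raises m_j to at least this
  -- value.
  · set σ : ι → ℝ := Function.update m j (max (m j) ((k + ν j) / 2)) with hσ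
    set τ : ι → ℝ := Function.update m j ((k + ν j) / 2) with hτ
    have hσlt : ∀ i, σ i < (ν + Pi.single j s : ι → ℝ) i := fun i => by
      by_cases hi : i = j
      · subst hi
        simp only [hσ, Function.update_self, Pi.add_apply, Pi.single_eq_same]
        exact max_lt hmj (by linarith)
      · simp only [hσ, Function.update_of_ne hi]; exact hm i
    have hτlt : ∀ i, τ i < ν i := fun i => by
      by_cases hi : i = j
      · subst hi
        simp only [hτ, Function.update_self]; linarith
      · simp only [hτ, Function.update_of_ne hi]; exact hmi i hi
    have hmσ : m ≤ σ := fun i => by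
      by_cases hi : i = j
      · subst hi; simp [hσ]
      · simp [hσ, hi]
    obtain ⟨A, -, hA⟩ := conormal.bound (hg _ (hlt σ hσlt))
    obtain ⟨B, -, hB⟩ := conormal.bound (hg' σ hσlt)
    obtain ⟨A', hA'0, hA'⟩ := conormal.bound (hg τ hτlt)
    obtain ⟨K, hK, hKe⟩ := exists_rp_emb_le (c := c) hρ hεc τ
    obtain ⟨C, hC⟩ := hη.bound_of_gt hρ hε hεc (conormalMinus.smooth hg) hs0 hA hB
      (by simp only [hσ, Function.update_self]; exact lt_max_of_lt_right (by linarith))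
      (fun y hy => by
        have h0 : Tendsto (fun t : ℝ => A' * (K * rp (onFace ρ j ρ) (restr j τ) y) *
            t ^ (τ j - k)) (𝓝[>] 0) (𝓝 0) := by
          have h1 : 0 < τ j - k := by simp only [hτ, Function.update_self]; linarith
          have h2 : Tendsto (fun t : ℝ => t ^ (τ j - k)) (𝓝[>] 0) (𝓝 (0 ^ (τ j - k))) :=
            (Real.continuousAt_rpow_const _ _ (Or.inr h1.le)).tendsto.mono_left nhdsWithin_le_nhds
          rw [Real.zero_rpow h1.ne'] at h2
          simpa only [mul_zero] using h2.const_mul (A' * (K * rp (onFace ρ j ρ) (restr j τ) y))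
        refine squeeze_zero_norm' ?_ h0
        filter_upwards [Ioc_mem_nhdsGT hε] with t ht
        rw [norm_smul, Real.norm_of_nonneg (Real.rpow_pos_of_pos ht.1 _).le]
        have h1 := hA' _ (emb_mem_inner (c := c) hρ hy ⟨ht.1, ht.2.trans_lt hεc⟩)
        have h2 := (hKe y hy t ht).1
        calc _ ≤ t ^ (-k) * (A' * (K * (t ^ τ j * rp (onFace ρ j ρ) (restr j τ) y))) :=
              mul_le_mul_of_nonneg_left (h1.trans (mul_le_mul_of_nonneg_left h2 hA'0))
                (Real.rpow_pos_of_pos ht.1 _).le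
          _ = _ := by
              have : t ^ (τ j - k) = t ^ (-k) * t ^ τ j := by
                rw [← Real.rpow_add ht.1]; congr 1; ring
              rw [this]; ring)
    obtain ⟨R, hR, hRe⟩ := exists_rp_le hmσ hρ.bounded
    refine ⟨max C 0 * R, fun x hx => (hC x hx).trans ?_⟩
    rw [mul_assoc]
    exact mul_le_mul (le_max_left _ _) (hRe x hx) (rp_pos _ hx).le (le_max_right _ _)

theorem IsCutoff.mem_of_iterate_shifted_mem (hρ : IsBoundaryDefining (n := n) ρ) (hε : 0 < ε)
    (hεc : ε < c.width) (hη : c.IsCutoff ε η) {k : ℝ} {ν : ι → ℝ} {s : ℝ} (hs0 : 0 ≤ s)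
    (hs : s ≤ 1) (hk : ν j + s ≤ k ∨ k < ν j) (l : ℕ) {g : M → ℂ}
    (hg : g ∈ conormalMinus (n := n) ρ ν)
    (hg' : (shifted (c.radial η) (k : ℂ))^[l] g ∈ conormalMinus (n := n) ρ (ν + Pi.single j s)) :
    g ∈ conormalMinus (n := n) ρ (ν + Pi.single j s) := by
  induction l generalizing g with
  | zero => exact hg'
  | succ l ih =>
    rw [Function.iterate_succ_apply] at hg'
    exact hη.mem_of_shifted_mem hρ hε hεc hs0 hs hk hg
      (ih (conormalMinus.shifted hρ hg (hη.isWeaklyRadial hρ hε.le).1 _) hg')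

/-- Removal of factors `D - k` with `k` at least the final order. -/
theorem IsCutoff.mem_of_iterate_shifted_mem_nat (hρ : IsBoundaryDefining (n := n) ρ) (hε : 0 < ε)
    (hεc : ε < c.width) (hη : c.IsCutoff ε η) {k m : ℕ} (hk : m ≤ k) {ν : ι → ℝ} (hν : ν j = 0)
    (l : ℕ) {g : M → ℂ} (hg : g ∈ conormalMinus (n := n) ρ ν)
    (hg' : (shifted (c.radial η) (k : ℂ))^[l] g ∈
      conormalMinus (n := n) ρ (ν + Pi.single j (m : ℝ))) :
    g ∈ conormalMinus (n := n) ρ (ν + Pi.single j (m : ℝ)) := by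
  -- The order is raised one unit at a time. Every intermediate order is at most m ≤ k, so the
  -- integration is always inwards from ε.
  have h : ∀ i ≤ m, g ∈ conormalMinus (n := n) ρ (ν + Pi.single j (i : ℝ)) := by
    intro i
    induction i with
    | zero => intro _; simpa using hg
    | succ i ih =>
      intro hi
      have hik : ((i + 1 : ℕ) : ℝ) ≤ k := by exact_mod_cast hi.trans hk
      have e : ν + Pi.single j ((i + 1 : ℕ) : ℝ) = ν + Pi.single j (i : ℝ) + Pi.single j 1 := by
        rw [add_assoc, ← Pi.single_add]; push_cast; rfl
      rw [e]
      refine hη.mem_of_iterate_shifted_mem hρ hε hεc (k := k) zero_le_one le_rfl (Or.inl ?_) l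
        (ih (by omega)) ?_
      · simp only [Pi.add_apply, hν, Pi.single_eq_same]
        push_cast at hik; linarith
      · rw [← e]
        refine conormalMinus.mono ?_ hg'
        exact add_le_add_right (Pi.single_mono j (by exact_mod_cast hi)) ν
  exact h m le_rfl

/-- The superfluous factors have indices m, …, m+r-1, all at least the final order m, and are
removed from the top down. -/
theorem IsCutoff.mem_of_radialProd_mem (hρ : IsBoundaryDefining (n := n) ρ) (hε : 0 < ε)
    (hεc : ε < c.width) (hη : c.IsCutoff ε η) {m : ℕ} {ν : ι → ℝ} (hν : ν j = 0)
    (r : ℕ) {g : M → ℂ} (hg : g ∈ conormalMinus (n := n) ρ ν)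
    (hg' : radialProd (c.radial η) (m + r) g ∈
      conormalMinus (n := n) ρ (ν + Pi.single j (m : ℝ))) :
    radialProd (c.radial η) m g ∈ conormalMinus (n := n) ρ (ν + Pi.single j (m : ℝ)) := by
  induction r with
  | zero => exact hg'
  | succ r ih =>
    refine ih (hη.mem_of_iterate_shifted_mem_nat hρ hε hεc (k := m + r) (by omega) hν (m + r + 1)
      (conormalMinus.radialProd hρ hg (hη.isWeaklyRadial hρ hε.le).1 _) ?_)
    simpa only [radialProd_succ, ← add_assoc] using hg'

/-- Decay at the other faces is inherited by the radial derivatives. -/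
theorem IsCutoff.radialDecay (hρ : IsBoundaryDefining (n := n) ρ) (hε : 0 < ε)
    (hεc : ε < c.width) (hη : c.IsCutoff ε η) {μ : ι → ℝ} (hμ0 : 0 ≤ μ) (hμ : μ j = 0)
    {f : M → ℂ} (hf : f ∈ conormalMinus (n := n) ρ μ)
    (hdec : RadialDecay ρ j (c.radial η) 0 f) : RadialDecay ρ j (c.radial η) μ f := by
  have hI := hρ.isOpen_inner
  have hV := (hη.isWeaklyRadial hρ hε.le).1
  intro m m' hm'
  -- Interpolation at θ = m/q costs the fraction m/q of μ. Since m' lies strictly below μ + m⟨j⟩, a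
  -- large q makes the loss harmless.
  have hev : ∀ᶠ q : ℕ in atTop, m < q ∧ ∀ i, m' i < ((1 - (m : ℝ) / q) • μ +
      Pi.single j (m : ℝ) : ι → ℝ) i := by
    refine (eventually_gt_atTop m).and (eventually_all.2 fun i => ?_)
    have h1 : Tendsto (fun q : ℕ => ((1 - (m : ℝ) / q) • μ + Pi.single j (m : ℝ) : ι → ℝ) i) atTop
        (𝓝 (((1 - 0 : ℝ) • μ + Pi.single j (m : ℝ) : ι → ℝ) i)) := by
      simp only [Pi.add_apply, Pi.smul_apply, smul_eq_mul]
      exact ((tendsto_const_nhds.sub (tendsto_const_div_atTop_nhds_zero_nat _)).mul_const _).add_const _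
    refine h1.eventually_const_lt ?_
    simpa using hm' i
  obtain ⟨q, hmq, hq⟩ := hev.exists
  have hq0 : (0 : ℝ) < q := by exact_mod_cast (Nat.zero_le m).trans_lt hmq
  have hθ0 : 0 ≤ (m : ℝ) / q := by positivity
  have hθ1 : (m : ℝ) / q ≤ 1 := by
    rw [div_le_one hq0]; exact_mod_cast hmq.le
  set ν : ι → ℝ := (1 - (m : ℝ) / q) • μ with hν
  have hνμ : ν ≤ μ := fun i => by
    simp only [hν, Pi.smul_apply, smul_eq_mul]
    have := hμ0 i
    simp only [Pi.zero_apply] at this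
    nlinarith
  -- P_q f has order q at Y_j without decay elsewhere, and exponents μ without decay at Y_j. The
  -- parameter is chosen so that exactly order m remains at Y_j.
  have h1 := conormalMinus.interpolate (hdec q) (conormalMinus.radialProd hρ hf hV q) hθ0 hθ1
  have e : ((m : ℝ) / q) • (0 + Pi.single j (q : ℝ) : ι → ℝ) + (1 - (m : ℝ) / q) • μ =
      ν + Pi.single j (m : ℝ) := by
    rw [add_comm, zero_add, ← Pi.single_smul, smul_eq_mul, div_mul_cancel₀ _ hq0.ne']
  rw [e] at h1
  refine hη.mem_of_radialProd_mem hρ hε hεc (m := m) (by simp [hν, hμ]) (q - m)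
    (conormalMinus.mono hνμ hf) ?_ m' hq
  rwa [Nat.add_sub_cancel' hmq.le]

end Collar

end Regularity

/-! ### Reduction of polyhomogeneity to single faces -/

section Polyhom

variable {n d : ℕ} {ι : Type*} [Fintype ι] [DecidableEq ι]
  {M : Type*} [TopologicalSpace M] [ChartedSpace (EuclideanQuadrant n) M]
  [IsManifold (Q n) ∞ M] [CompactSpace M] [T2Space M]
  {ρ : ι → M → ℝ}

theorem foldr_radialProd_of_eq_zero (V : ι → VField n M) (j : ι) (m : ι → ℕ)
    (hm : ∀ i, i ≠ j → m i = 0) (w : M → ℂ) (L : List ι) (hL : L.Nodup) :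
    L.foldr (fun l f => radialProd (V l) (m l) f) w =
      if j ∈ L then radialProd (V j) (m j) w else w := by
  induction L with
  | nil => simp
  | cons i L ih =>
    rw [List.foldr_cons, ih hL.of_cons]
    by_cases hi : i = j
    · subst hi
      rw [if_neg (List.nodup_cons.1 hL).1, if_pos List.mem_cons_self]
    · rw [hm i hi]
      simp [radialProd, Ne.symm hi]

variable [∀ j, ChartedSpace (EuclideanQuadrant d) (face ρ j)]
  [∀ j, IsManifold (Q d) ∞ (face ρ j)]

/-- The induction over the faces carries the radial decay at all faces along. At a new face this
decay is combined with the exponents already gained at the faces in L. -/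
theorem foldr_radialProd_mem (hρ : IsBoundaryDefining (n := n) ρ)
    (c : ∀ j, Collar (n := n) (d := d) ρ j) {V : ι → VField n M}
    (hV : ∀ j, IsWeaklyRadial ρ j (V j)) {w : M → ℂ} (hw0 : w ∈ conormalMinus (n := n) ρ 0)
    (hw : ∀ j, RadialDecay ρ j (V j) 0 w)
    (m : ι → ℕ) (L : List ι) (hL : L.Nodup) :
    L.foldr (fun l f => radialProd (V l) (m l) f) w ∈
        conormalMinus (n := n) ρ (fun i => if i ∈ L then (m i : ℝ) else 0) ∧
      ∀ j, RadialDecay ρ j (V j) 0 (L.foldr (fun l f => radialProd (V l) (m l) f) w) := by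
  induction L with
  | nil => exact ⟨by simp only [List.not_mem_nil, if_false]; exact hw0, hw⟩
  | cons i L ih =>
    obtain ⟨h1, h2⟩ := ih hL.of_cons
    have hi := (List.nodup_cons.1 hL).1
    simp only [List.foldr_cons]
    refine ⟨?_, fun j => (h2 j).radialProd hρ (hV j) (hV i).1 (m i)⟩
    obtain ⟨ε, hε, hεc⟩ := exists_between (c i).width_pos
    obtain ⟨η, hη⟩ := Collar.exists_isCutoff (c := c i) hρ hεc
    have hD := hη.isWeaklyRadial hρ hε.le
    have h3 := hη.radialDecay hρ hε hεc (μ := fun i => if i ∈ L then (m i : ℝ) else 0)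
      (fun k => by dsimp only; split_ifs <;> simp) (by simp [hi]) h1
      ((h2 i).of_radial hρ (hV i) hD)
    have h4 := h3.of_radial hρ hD (hV i) (m i)
    refine conormalMinus.mono (fun k => ?_) h4
    by_cases hk : k = i
    · subst hk; simp [hi]
    · simp [hk]

/-- Polyhomogeneity may be tested one face at a time. -/
theorem radialOp_mem_iff [LinearOrder ι] (hρ : IsBoundaryDefining (n := n) ρ)
    (c : ∀ j, Collar (n := n) (d := d) ρ j) {V : ι → VField n M}
    (hV : ∀ j, IsWeaklyRadial ρ j (V j)) {w : M → ℂ} :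
    (∀ m : ι → ℕ, radialOp V m w ∈ conormalMinus (n := n) ρ (fun k => (m k : ℝ))) ↔
      w ∈ conormalMinus (n := n) ρ 0 ∧ ∀ j, RadialDecay ρ j (V j) 0 w := by
  constructor
  · intro h
    have key : ∀ j (q : ℕ), radialProd (V j) q w ∈
        conormalMinus (n := n) ρ (0 + Pi.single j (q : ℝ)) := by
      intro j q
      have h1 := h (Pi.single j q)
      unfold radialOp at h1
      rw [foldr_radialProd_of_eq_zero V j _ (fun i hi => by simp [hi]) w _ (Finset.sort_nodup _ _),
        if_pos (by simp), Pi.single_eq_same] at h1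
      refine conormalMinus.mono (fun k => ?_) h1
      by_cases hk : k = j
      · subst hk; simp
      · simp [hk]
    refine ⟨?_, key⟩
    have h1 := h 0
    rw [radialOp_zero] at h1
    simp only [Pi.zero_apply, Nat.cast_zero] at h1
    exact h1
  · rintro ⟨h0, h⟩ m
    have := (foldr_radialProd_mem hρ c hV h0 h m _ (Finset.sort_nodup Finset.univ (· ≤ ·))).1
    simp only [Finset.mem_sort, Finset.mem_univ, if_true] at this
    exact this

end Polyhom

/-! ### Coordinate fields of a chart -/

section CoordinateFields

variable {n : ℕ} {X : Type*} [TopologicalSpace X] [ChartedSpace (EuclideanQuadrant n) X]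
  [IsManifold (Q n) ∞ X] {F : Type*} [NormedAddCommGroup F] [NormedSpace ℝ F]

/-- The coordinate fields of a chart. -/
def coordField (φ : OpenPartialHomeomorph X (EuclideanQuadrant n)) (i : Fin n) : VField n X :=
  fun x => mfderivWithin 𝓘(ℝ, EuclideanSpace ℝ (Fin n)) (Q n) (φ.extend (Q n)).symm
    (φ.extend (Q n)).target (φ.extend (Q n) x) (EuclideanSpace.single i (1 : ℝ))

/-- The coordinate functions of a chart. -/
def coordFun (φ : OpenPartialHomeomorph X (EuclideanQuadrant n)) (i : Fin n) (x : X) : ℝ :=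
  φ.extend (Q n) x i

/-- The `i`-th coordinate as a continuous linear map. -/
abbrev coordCLM (i : Fin n) : EuclideanSpace ℝ (Fin n) →L[ℝ] ℝ := EuclideanSpace.proj i

variable {φ : OpenPartialHomeomorph X (EuclideanQuadrant n)}

theorem uniqueDiffOn_extend_target : UniqueDiffOn ℝ (φ.extend (Q n)).target := by
  rw [φ.extend_target]
  exact (Q n).uniqueDiffOn_preimage φ.open_target

theorem mapsTo_extend : MapsTo (φ.extend (Q n)) φ.source (φ.extend (Q n)).target := fun x hx =>
  (φ.extend (Q n)).map_source (by rwa [φ.extend_source])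

theorem extend_symm_extend : ∀ x ∈ φ.source, (φ.extend (Q n)).symm (φ.extend (Q n) x) = x :=
  fun _ hx => φ.extend_left_inv hx

variable (hφ : φ ∈ IsManifold.maximalAtlas (Q n) ∞ X)

include hφ

theorem contMDiffOn_extend_symm' : ContMDiffOn 𝓘(ℝ, EuclideanSpace ℝ (Fin n)) (Q n) ∞
    (φ.extend (Q n)).symm (φ.extend (Q n)).target := by
  rw [φ.extend_target']
  exact contMDiffOn_extend_symm hφ

theorem contMDiffOn_coordField (i : Fin n) : ContMDiffOn (Q n) (Q n).tangent ∞
    (fun x => (⟨x, coordField φ i x⟩ : TangentBundle (Q n) X)) φ.source := by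
  refine contMDiffOn_pushforward uniqueDiffOn_extend_target.uniqueMDiffOn
    (contMDiffOn_extend_symm' hφ) mapsTo_extend extend_symm_extend
    (fun _ => EuclideanSpace.single i (1 : ℝ)) ?_
  have h2 : ContMDiff 𝓘(ℝ, EuclideanSpace ℝ (Fin n)) 𝓘(ℝ, EuclideanSpace ℝ (Fin n)).tangent ∞
      (fun t => (⟨t, EuclideanSpace.single i (1 : ℝ)⟩ :
        TangentBundle 𝓘(ℝ, EuclideanSpace ℝ (Fin n)) (EuclideanSpace ℝ (Fin n)))) :=
    contMDiff_vectorSpace_iff_contDiff.2 contDiff_const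
  exact h2.comp_contMDiffOn (φ.contMDiffOn_extend hφ)

theorem mfderiv_coordField (i : Fin n) {x : X} (hx : x ∈ φ.source) {f : X → F}
    (hf : MDifferentiableAt (Q n) 𝓘(ℝ, F) f x) :
    mfderiv (Q n) 𝓘(ℝ, F) f x (coordField φ i x) =
      fderivWithin ℝ (fun z => f ((φ.extend (Q n)).symm z)) (φ.extend (Q n)).target
        (φ.extend (Q n) x) (EuclideanSpace.single i (1 : ℝ)) := by
  have h := extend_symm_extend x hx
  have := mfderiv_pushforward uniqueDiffOn_extend_target.uniqueMDiffOn
    (contMDiffOn_extend_symm' hφ) (mapsTo_extend hx) (f := f) (by simpa only [h] using hf)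
    (EuclideanSpace.single i (1 : ℝ))
  rw [mfderivWithin_eq_fderivWithin] at this
  exact (mfderiv_point_eq h.symm f _).trans this

theorem contMDiffOn_coordFun (i : Fin n) :
    ContMDiffOn (Q n) 𝓘(ℝ, ℝ) ∞ (coordFun φ i) φ.source :=
  (coordCLM i).contMDiff.comp_contMDiffOn
    (φ.contMDiffOn_extend hφ)

theorem lieReal_coordField (i l : Fin n) {x : X} (hx : x ∈ φ.source) :
    lieReal (coordField φ i) (coordFun φ l) x = if l = i then 1 else 0 := by
  have hu := uniqueDiffOn_extend_target (φ := φ) _ (mapsTo_extend hx)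
  refine (mfderiv_coordField hφ i hx
    (mdiffAt_of_contMDiffOn φ.open_source (contMDiffOn_coordFun hφ l) hx)).trans ?_
  have h1 : HasFDerivWithinAt (fun z => coordFun φ l ((φ.extend (Q n)).symm z))
      (coordCLM l) (φ.extend (Q n)).target
      (φ.extend (Q n) x) := by
    refine (coordCLM l).hasFDerivWithinAt.congr (fun z hz => ?_) ?_
    · unfold coordFun; rw [(φ.extend (Q n)).right_inv hz]; rfl
    · unfold coordFun; rw [(φ.extend (Q n)).right_inv (mapsTo_extend hx)]; rfl
  rw [h1.fderivWithin hu]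
  change (EuclideanSpace.single i (1 : ℝ)) l = _
  simp

theorem eq_sum_coordField (V : VField n X) {x : X} (hx : x ∈ φ.source) :
    V x = ∑ i, lieReal V (coordFun φ i) x • coordField φ i x := by
  have h := mfderivWithin_mfderiv_inverse (contMDiffOn_extend_symm' hφ) φ.open_source
    (φ.contMDiffOn_extend hφ) mapsTo_extend extend_symm_extend hx (V x)
  have hG : MDifferentiableAt (Q n) 𝓘(ℝ, EuclideanSpace ℝ (Fin n)) (φ.extend (Q n)) x :=
    mdiffAt_of_contMDiffOn φ.open_source (φ.contMDiffOn_extend hφ) hx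
  set u : EuclideanSpace ℝ (Fin n) :=
    mfderiv (Q n) 𝓘(ℝ, EuclideanSpace ℝ (Fin n)) (φ.extend (Q n)) x (V x) with hu
  have hi : ∀ i, lieReal V (coordFun φ i) x = u i := fun i =>
    congrArg (fun A : TangentSpace (Q n) x →L[ℝ] ℝ => A (V x))
      (hasMFDerivAt_clm_comp (coordCLM i) hG)
  have e : u = ∑ i, u i • EuclideanSpace.single i (1 : ℝ) := by
    ext l
    simp [Finset.sum_apply, Pi.single_apply]
  have key : ∀ A : EuclideanSpace ℝ (Fin n) →L[ℝ] EuclideanSpace ℝ (Fin n),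
      A u = ∑ i, u i • A (EuclideanSpace.single i (1 : ℝ)) := fun A => by
    conv_lhs => rw [e]
    simp only [map_sum, map_smul]
  simp only [hi]
  exact h.symm.trans (key _)

end CoordinateFields

/-! ### Generators of 𝒱_b -/

section Generators

variable {n : ℕ} {ι : Type*} [Fintype ι]
  {X : Type*} [TopologicalSpace X] [ChartedSpace (EuclideanQuadrant n) X]
  [IsManifold (Q n) ∞ X] [CompactSpace X] [T2Space X] {ρ : ι → X → ℝ}

theorem sum_dite_zero {α β : Type*} [Fintype α] [AddCommMonoid β] {p : α → Prop} [DecidablePred p]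
    (f : ∀ a, p a → β) :
    ∑ a, (if h : p a then f a h else 0) = ∑ a : {a // p a}, f a a.2 := by
  rw [Finset.sum_dite, Finset.sum_const_zero, add_zero]
  exact (Equiv.subtypeEquivRight <| by simp).sum_comp fun x : {x // p x} => f x x.2

theorem zero_mem_bFields : (0 : VField n X) ∈ bFields ρ :=
  ⟨Collar.smoothVField_zero, fun k _ _ => lieReal_of_eq_zero (V := (0 : VField n X)) rfl (ρ k)⟩

/-- Locally, tangent vectors are combinations of values of fields from `𝒱_b`, with coefficients
that are given by the differentials of smooth functions and of the `log ρ_k`. -/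
theorem exists_local_generators (hρ : IsBoundaryDefining (n := n) ρ) (x₀ : X) :
    ∃ U, IsOpen U ∧ x₀ ∈ U ∧ ∃ (F : Fin n → X → ℝ) (Z : Fin n → VField n X) (Z' : ι → VField n X),
      (∀ i, ContMDiff (Q n) 𝓘(ℝ, ℝ) ∞ (F i)) ∧ (∀ i, Z i ∈ bFields ρ) ∧
      (∀ k, Z' k ∈ bFields ρ) ∧
      ∀ x ∈ U, ∀ V : VField n X, (∀ k, x ∈ face ρ k → lieReal V (ρ k) x = 0) →
        V x = ∑ i, lieReal V (F i) x • Z i x + ∑ k, (lieReal V (ρ k) x / ρ k x) • Z' k x := by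
  classical
  obtain ⟨φ, hφM, hxφ, e, he, hφ⟩ := hρ.adapted x₀
  -- On this neighborhood no face occurs except those through x₀. Only their defining functions need
  -- to be coordinates.
  set W : Set X := φ.source ∩ ⋂ k, {x | ρ k x₀ ≠ 0 → ρ k x ≠ 0} with hW
  have hWo : IsOpen W := by
    refine φ.open_source.inter (isOpen_iInter_of_finite fun k => ?_)
    by_cases h : ρ k x₀ = 0
    · simp [h]
    · simpa [h] using isOpen_ne_fun (hρ.continuous k) continuous_const
  have hxW : x₀ ∈ W := ⟨hxφ, mem_iInter.2 fun k h => h⟩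
  obtain ⟨ψ, hψ, hψ1, hψW, -⟩ := exists_cutoff (n := n) (isClosed_singleton (x := x₀)) hWo
    (by simpa using hxW)
  have hψW' : ∀ x, ψ x ≠ 0 → x ∈ W := fun x hx => hψW (subset_tsupport _ hx)
  rw [nhdsSet_singleton] at hψ1
  obtain ⟨U, hUP, hU, hxU⟩ := eventually_nhds_iff.1 hψ1
  have hUW : U ⊆ W := fun x hx => hψW' x (by rw [hUP x hx]; exact one_ne_zero)
  have hcoord : ∀ (k : {k // ρ k x₀ = 0}), ∀ x ∈ φ.source, coordFun φ (e k) x = ρ k x :=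
    fun k x hx => (hφ x hx).1 k
  have hlie : ∀ (V : VField n X) (k : {k // ρ k x₀ = 0}), ∀ x ∈ φ.source,
      lieReal V (coordFun φ (e k)) x = lieReal V (ρ k) x := fun V k x hx =>
    lieReal_congr (by
      filter_upwards [φ.open_source.mem_nhds hx] with y hy using hcoord k y hy)
  have hcf : ∀ i, SmoothVField (fun x => ψ x • coordField φ i x) := fun i =>
    Corners.ContMDiffOn.smoothVField_smul (contMDiffOn_coordField hφM i) φ.open_source hψ
      (hψW.trans inter_subset_left)
  have htan : ∀ (i : Fin n) (l : ι), ∀ x ∈ face ρ l, (∀ h : ρ l x₀ = 0, e ⟨l, h⟩ ≠ i) →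
      lieReal (fun x => ψ x • coordField φ i x) (ρ l) x = 0 := by
    intro i l x hx hl
    rw [lieReal_field_smul]
    by_cases h0 : ψ x = 0
    · rw [h0, zero_mul]
    · have hxW := hψW' x h0
      have hl0 : ρ l x₀ = 0 := by
        by_contra h; exact mem_iInter.1 hxW.2 l h hx
      rw [← hlie _ ⟨l, hl0⟩ x hxW.1, lieReal_coordField hφM _ _ hxW.1, if_neg (hl hl0), mul_zero]
  refine ⟨U, hU, hxU, fun i x => ψ x * coordFun φ i x,
    fun i => if i ∈ range e then 0 else fun x => ψ x • coordField φ i x,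
    fun k => if h : ρ k x₀ = 0 then fun x => ρ k x • ψ x • coordField φ (e ⟨k, h⟩) x else 0,
    fun i => ?_, fun i => ?_, fun k => ?_, fun x hx V hV => ?_⟩
  · exact contMDiff_mul_of_tsupport φ.open_source hψ (hψW.trans inter_subset_left)
      (contMDiffOn_coordFun hφM i)
  · dsimp only
    split_ifs with hi
    · exact zero_mem_bFields
    · exact ⟨hcf i, fun l x hx => htan i l x hx fun h heq => hi ⟨_, heq⟩⟩
  · dsimp only
    split_ifs with hk
    · refine ⟨(hcf _).smul (hρ.smooth k), fun l x hx => ?_⟩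
      rw [lieReal_field_smul]
      by_cases hlk : l = k
      · subst hlk; rw [show ρ l x = 0 from hx, zero_mul]
      · rw [htan _ l x hx fun h heq => hlk (congrArg Subtype.val (he heq)), mul_zero]
    · exact zero_mem_bFields
  · have hxW := hUW hx
    have hψx : ψ =ᶠ[𝓝 x] fun _ => 1 := by
      filter_upwards [hU.mem_nhds hx] with y hy using hUP y hy
    have hF : ∀ i, lieReal V (fun x => ψ x * coordFun φ i x) x = lieReal V (coordFun φ i) x :=
      fun i => lieReal_congr (by filter_upwards [hψx] with y hy; rw [hy, one_mul])
    simp only [hF]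
    conv_lhs => rw [eq_sum_coordField hφM V hxW.1]
    have h2 : ∀ k, (lieReal V (ρ k) x / ρ k x) •
        (if h : ρ k x₀ = 0 then fun x => ρ k x • ψ x • coordField φ (e ⟨k, h⟩) x else 0 :
          VField n X) x = if h : ρ k x₀ = 0 then
            lieReal V (coordFun φ (e ⟨k, h⟩)) x • coordField φ (e ⟨k, h⟩) x else 0 := by
      intro k
      split_ifs with h
      · beta_reduce
        rw [hUP x hx, one_smul, smul_smul, hlie V ⟨k, h⟩ x hxW.1]
        by_cases hk : ρ k x = 0
        · rw [hk, mul_zero, hV k hk]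
        · rw [div_mul_cancel₀ _ hk]
      · exact smul_zero _
    have h1 : ∀ i, lieReal V (coordFun φ i) x •
        (if i ∈ range e then 0 else fun x => ψ x • coordField φ i x : VField n X) x =
        if i ∈ range e then 0 else lieReal V (coordFun φ i) x • coordField φ i x := by
      intro i
      split_ifs with h
      · exact smul_zero _
      · beta_reduce
        rw [hUP x hx, one_smul]
    simp only [h1, h2]
    rw [sum_dite_zero]
    rw [← Finset.sum_image (s := Finset.univ) (g := e)
      (f := fun i => lieReal V (coordFun φ i) x • coordField φ i x) (fun a _ b _ h => he h)]
    rw [← Finset.sum_compl_add_sum (Finset.univ.image e)]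
    congr 1
    rw [← Finset.sum_compl_add_sum (Finset.univ.image e) (fun i => if i ∈ range e then _ else _)]
    rw [Finset.sum_eq_zero (s := Finset.univ.image e), add_zero]
    · refine Finset.sum_congr rfl fun i hi => ?_
      rw [if_neg]
      simpa using hi
    · intro i hi
      rw [if_pos]
      simpa using hi

/-- A partition of unity over finitely many charts. The coefficients Vρ_k/ρ_k do not depend on the
chart, so the fields that belong to them can be averaged into a single one for each k. -/
theorem exists_generators (hρ : IsBoundaryDefining (n := n) ρ) :
    ∃ (s : Finset (X × Fin n)) (F : X × Fin n → X → ℝ) (Z : X × Fin n → VField n X)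
      (Z' : ι → VField n X),
      (∀ a, ContMDiff (Q n) 𝓘(ℝ, ℝ) ∞ (F a)) ∧ (∀ a, Z a ∈ bFields ρ) ∧
      (∀ k, Z' k ∈ bFields ρ) ∧
      ∀ x, ∀ V : VField n X, (∀ k, x ∈ face ρ k → lieReal V (ρ k) x = 0) →
        V x = ∑ a ∈ s, lieReal V (F a) x • Z a x + ∑ k, (lieReal V (ρ k) x / ρ k x) • Z' k x := by
  classical
  choose U hU hxU F Z Z' hF hZ hZ' hV using exists_local_generators hρ
  obtain ⟨t, ht⟩ := isCompact_univ.elim_finite_subcover U hU fun x _ => mem_iUnion.2 ⟨x, hxU x⟩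
  have ht' : univ ⊆ ⋃ i : t, U i := fun x hx => by
    obtain ⟨y, hy, hxy⟩ := mem_iUnion₂.1 (ht hx)
    exact mem_iUnion.2 ⟨⟨y, hy⟩, hxy⟩
  obtain ⟨f, hf⟩ := SmoothPartitionOfUnity.exists_isSubordinate (Q n) isClosed_univ
    (fun i : t => U i) (fun i => hU i) ht'
  set ψ : X → X → ℝ := fun y x => if h : y ∈ t then f ⟨y, h⟩ x else 0 with hψ
  have hψs : ∀ y, ContMDiff (Q n) 𝓘(ℝ, ℝ) ∞ (ψ y) := fun y => by
    by_cases h : y ∈ t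
    · simpa [hψ, h] using (f ⟨y, h⟩).contMDiff
    · simpa [hψ, h] using contMDiff_const
  have hψU : ∀ y x, ψ y x ≠ 0 → x ∈ U y := fun y x hx => by
    by_cases h : y ∈ t
    · simp only [hψ, h, dif_pos] at hx
      exact hf ⟨y, h⟩ (subset_tsupport _ hx)
    · simp [hψ, h] at hx
  have hsum : ∀ x, ∑ y ∈ t, ψ y x = 1 := fun x => by
    have h1 := f.sum_eq_one (mem_univ x)
    rw [finsum_eq_sum_of_fintype] at h1
    rw [← h1, ← Finset.sum_coe_sort t]
    exact Finset.sum_congr rfl fun y _ => by simp [hψ]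
  refine ⟨t ×ˢ Finset.univ, fun a => F a.1 a.2, fun a x => ψ a.1 x • Z a.1 a.2 x,
    fun k x => ∑ y ∈ t, ψ y x • Z' y k x, fun a => hF _ _, fun a => smul_mem_bFields (hZ _ _)
    (hψs _), fun k => ?_, fun x V hx => ?_⟩
  · have : ∀ s : Finset X, (fun x => ∑ y ∈ s, ψ y x • Z' y k x : VField n X) ∈ bFields ρ := by
      intro s
      induction s using Finset.induction_on with
      | empty =>
        simp only [Finset.sum_empty]
        exact zero_mem_bFields
      | insert a s ha ih =>
        simp only [Finset.sum_insert ha]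
        exact add_mem_bFields (smul_mem_bFields (hZ' a k) (hψs a)) ih
    exact this t
  · have h1 : ∀ y ∈ t, ψ y x • V x = ψ y x • (∑ i, lieReal V (F y i) x • Z y i x +
        ∑ k, (lieReal V (ρ k) x / ρ k x) • Z' y k x) := fun y _ => by
      by_cases h : ψ y x = 0
      · rw [h, zero_smul, zero_smul]
      · rw [← hV y x (hψU y x h) V hx]
    calc V x = ∑ y ∈ t, ψ y x • V x := by rw [← Finset.sum_smul, hsum, one_smul]
      _ = _ := by
        rw [Finset.sum_congr rfl h1]
        simp only [smul_add, Finset.sum_add_distrib, Finset.smul_sum, Finset.sum_product]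
        congr 1
        · exact Finset.sum_congr rfl fun y _ => Finset.sum_congr rfl fun i _ => smul_comm _ _ _
        · rw [Finset.sum_comm]
          exact Finset.sum_congr rfl fun y _ => Finset.sum_congr rfl fun i _ => smul_comm _ _ _

end Generators

/-! ### Generators of 𝒱_b in the product neighborhood -/

section SlabGenerators

variable {n d : ℕ} {ι : Type*} [Fintype ι] [DecidableEq ι]
  {M : Type*} [TopologicalSpace M] [ChartedSpace (EuclideanQuadrant n) M]
  [IsManifold (Q n) ∞ M] [CompactSpace M] [T2Space M]
  {ρ : ι → M → ℝ} {j : ι} [ChartedSpace (EuclideanQuadrant d) (face ρ j)]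
  [IsManifold (Q d) ∞ (face ρ j)] {c : Collar (n := n) (d := d) ρ j} {ε : ℝ} {η : M → ℝ}

namespace Collar

/-- The field on the face induced by a field on the manifold. -/
def restrField (c : Collar (n := n) (d := d) ρ j) (X : VField n M) : VField d (face ρ j) := fun y =>
  (mfderiv (Q n) (Q d) c.proj (y : M) (X y) : EuclideanSpace ℝ (Fin d))

theorem proj_coe (c : Collar (n := n) (d := d) ρ j) (y : face ρ j) : c.proj (y : M) = y := by
  have := c.proj_emb y 0 ⟨le_rfl, c.width_pos⟩
  rwa [c.emb_zero] at this

theorem coe_mem_dom (c : Collar (n := n) (d := d) ρ j) (y : face ρ j) : (y : M) ∈ c.dom :=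
  c.face_subset_dom y.2

theorem smooth_restrField {X : VField n M} (hX : SmoothVField X) :
    SmoothVField (c.restrField X) := by
  have h1 := c.contMDiffOn_proj.contMDiffOn_tangentMapWithin (m := ∞) (by simp)
    c.isOpen_dom.uniqueMDiffOn
  have h2 : ContMDiff (Q d) (Q n).tangent ∞
      (fun y : face ρ j => (⟨(y : M), X y⟩ : TangentBundle (Q n) M)) :=
    ContMDiff.comp (g := fun x => (⟨x, X x⟩ : TangentBundle (Q n) M)) hX c.contMDiff_coe
  have h3 := h1.comp (h2.contMDiffOn (s := univ)) (fun y _ => c.coe_mem_dom y)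
  refine contMDiffOn_univ.1 (h3.congr fun y _ => ?_)
  have h4 : tangentMapWithin (Q n) (Q d) c.proj c.dom (⟨(y : M), X y⟩ : TangentBundle (Q n) M) =
      ⟨c.proj y, c.restrField X y⟩ := by
    simp only [tangentMapWithin, restrField]
    rw [mfderivWithin_of_isOpen c.isOpen_dom (c.coe_mem_dom y)]
  exact (totalSpace_eq (c.proj_coe y).symm _).trans h4.symm

theorem lieReal_restrField (hρ : IsBoundaryDefining (n := n) ρ) (X : VField n M) {b : face ρ j → ℝ}
    {y : face ρ j} (hb : MDifferentiableAt (Q d) 𝓘(ℝ, ℝ) b y) :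
    lieReal (c.restrField X) b y = lieReal X (fun x => b (c.proj x)) y := by
  have hb' : MDifferentiableAt (Q d) 𝓘(ℝ, ℝ) b (c.proj (y : M)) := by rwa [c.proj_coe]
  have h := mfderiv_comp (y : M) hb' (c.mdiff_proj hρ (c.coe_mem_dom y))
  have h1 : lieReal X (fun x => b (c.proj x)) y =
      (mfderiv (Q d) 𝓘(ℝ, ℝ) b (c.proj (y : M)) : EuclideanSpace ℝ (Fin d) →L[ℝ] ℝ)
        (c.restrField X y) := congrArg (fun A => A (X y)) h
  rw [h1]
  exact mfderiv_point_eq (c.proj_coe y).symm b _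

theorem restrField_mem_bFields (hρ : IsBoundaryDefining (n := n) ρ) {X : VField n M}
    (hX : X ∈ bFields ρ) : c.restrField X ∈ bFields (onFace ρ j ρ) := by
  refine ⟨smooth_restrField hX.1, fun i y hy => ?_⟩
  have hsm : ContMDiff (Q d) 𝓘(ℝ, ℝ) ∞ (fun y : face ρ j => ρ i y) :=
    (hρ.smooth i).comp c.contMDiff_coe
  refine (lieReal_restrField hρ X (b := fun y : face ρ j => ρ i y) (contMDiff_mdiff hsm y)).trans ?_
  obtain ⟨g, hg, h⟩ := c.exists_rho_proj hρ c.width_pos i.2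
  have h := eventually_nhdsSet_iff_forall.1 h y (c.face_subset_slab le_rfl y.2)
  have hy0 : ρ i (y : M) = 0 := hy
  rw [lieReal_congr (h.mono fun z hz => hz.1),
    lieReal_mul (contMDiff_mdiff (hρ.smooth i) _) (contMDiff_mdiff hg _), hX.2 i y hy0, hy0]
  ring

theorem push_add (Z Z' : VField d (face ρ j)) (τ τ' : ℝ) (x : M) :
    c.push (Z + Z') (τ + τ') x = c.push Z τ x + c.push Z' τ' x :=
  map_add (mfderivWithin ((Q d).prod 𝓘(ℝ, ℝ)) (Q n) c.emb c.cyl (c.proj x, ρ j x))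
    ((Z (c.proj x), τ) : EuclideanSpace ℝ (Fin d) × ℝ) (Z' (c.proj x), τ')

theorem push_smul (a : ℝ) (Z : VField d (face ρ j)) (τ : ℝ) (x : M) :
    c.push (a • Z) (a * τ) x = a • c.push Z τ x :=
  map_smul (mfderivWithin ((Q d).prod 𝓘(ℝ, ℝ)) (Q n) c.emb c.cyl (c.proj x, ρ j x)) a
    ((Z (c.proj x), τ) : EuclideanSpace ℝ (Fin d) × ℝ)

theorem push_sum {A : Type*} (s : Finset A) (a : A → ℝ) (Z : A → VField d (face ρ j)) (x : M) :
    c.push (∑ i ∈ s, a i • Z i) 0 x = ∑ i ∈ s, a i • c.push (Z i) 0 x := by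
  classical
  induction s using Finset.induction_on with
  | empty =>
    simp only [Finset.sum_empty]
    exact map_zero (mfderivWithin ((Q d).prod 𝓘(ℝ, ℝ)) (Q n) c.emb c.cyl (c.proj x, ρ j x))
  | insert i s hi ih =>
    rw [Finset.sum_insert hi, Finset.sum_insert hi, ← ih, ← push_smul, mul_zero, ← push_add,
      add_zero]

theorem map_sum_smul {E F : Type*} [NormedAddCommGroup E] [NormedSpace ℝ E] [NormedAddCommGroup F]
    [NormedSpace ℝ F] (T : E →L[ℝ] F) {A : Type*} (s : Finset A) (a : A → ℝ) (v : A → E) :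
    T (∑ i ∈ s, a i • v i) = ∑ i ∈ s, a i • T (v i) := by
  simp only [map_sum, map_smul]

/-- In the product neighborhood the fields of `𝒱_b` are combinations of finitely many lifts and of
the radial field. -/
theorem IsCutoff.exists_slab_generators (hρ : IsBoundaryDefining (n := n) ρ)
    (hεc : ε < c.width) (hη : c.IsCutoff ε η) :
    ∃ (s : Finset ((M × Fin n) ⊕ ι)) (R : (M × Fin n) ⊕ ι → VField d (face ρ j)),
      (∀ a, R a ∈ bFields (onFace ρ j ρ)) ∧ ∀ X : VField n M, X ∈ bFields ρ →
      ∃ (A : (M × Fin n) ⊕ ι → M → ℝ) (A₀ : M → ℝ), (∀ a, ContMDiff (Q n) 𝓘(ℝ, ℝ) ∞ (A a)) ∧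
        ContMDiff (Q n) 𝓘(ℝ, ℝ) ∞ A₀ ∧ ∀ x ∈ c.slab ε, x ∈ inner ρ → ∀ f : M → ℂ,
          lie X f x = ∑ a ∈ s, (A a x : ℂ) * lie (c.push (R a) 0) f x +
            (A₀ x : ℂ) * lie (c.radial η) f x := by
  obtain ⟨s, F, Z, Z', hF, hZ, hZ', hgen⟩ := exists_generators hρ
  refine ⟨s.disjSum Finset.univ, Sum.elim (fun a => c.restrField (Z a))
    (fun k => c.restrField (Z' k)), ?_, fun X hX => ?_⟩
  · rintro (a | k)
    · exact restrField_mem_bFields hρ (hZ a)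
    · exact restrField_mem_bFields hρ (hZ' k)
  obtain ⟨A₀, hA₀, eA₀⟩ := exists_lieReal_rho hρ hX j
  have hB : ∀ k, ∃ B : M → ℝ, ContMDiff (Q n) 𝓘(ℝ, ℝ) ∞ B ∧ ∀ x ∈ c.slab ε, x ∈ inner ρ →
      B x = lieReal X (fun z => ρ k (c.proj z)) x / ρ k (c.proj x) := by
    intro k
    -- For k = j the function ρ_j ∘ π is identically zero, and so is the quotient by it.
    by_cases hk : k = j
    · refine ⟨fun _ => 0, contMDiff_const, fun x hx _ => ?_⟩
      have h0 : ρ k (c.proj x) = 0 := by rw [hk]; exact (c.proj x).2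
      rw [h0, div_zero]
    · obtain ⟨g, hg, h⟩ := c.exists_rho_proj hρ hεc hk
      obtain ⟨W, hW, hsW, hWP⟩ := eventually_nhdsSet_iff_exists.1 h
      obtain ⟨ζ, hζ, hζ1, hζW, -⟩ := exists_cutoff (n := n) (isCompact_slab hρ hεc).isClosed hW hsW
      obtain ⟨h₁, hh₁, eh₁⟩ := exists_lieReal_rho hρ hX k
      -- Where ρ_k ∘ π = ρ_k g, its logarithmic derivative is the sum of those of ρ_k and of g. Both
      -- are smooth up to the boundary.
      refine ⟨fun x => h₁ x + ζ x * (lieReal X g x / g x), hh₁.add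
        (contMDiff_mul_of_tsupport hW hζ hζW ((hX.1.lieReal hg).contMDiffOn.div₀ hg.contMDiffOn
          fun x hx => (hWP x hx).2.ne')), fun x hx hxI => ?_⟩
      have hxW := hsW hx
      have h1 : (fun z => ρ k (c.proj z)) =ᶠ[𝓝 x] fun z => ρ k z * g z := by
        filter_upwards [hW.mem_nhds hxW] with z hz using (hWP z hz).1
      change h₁ x + ζ x * (lieReal X g x / g x) = _
      rw [lieReal_congr h1, (hWP x hxW).1, lieReal_mul (contMDiff_mdiff (hρ.smooth k) x)
        (contMDiff_mdiff hg x), eh₁, hζ1.self_of_nhdsSet x hx]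
      have h2 := (hWP x hxW).2.ne'
      have h3 := (hxI k).ne'
      field_simp
  choose B hBs hBe using hB
  refine ⟨Sum.elim (fun a => lieReal X (fun z => η z * F a (c.proj z))) B, A₀, ?_, hA₀,
    fun x hx hxI f => ?_⟩
  · rintro (a | k)
    · exact hX.1.lieReal (contMDiff_mul_of_tsupport c.isOpen_dom hη.smooth hη.tsupport_subset
        (c.contMDiffOn_comp_proj (hF a)))
    · exact hBs k
  set y := c.proj x with hy
  have hyI := proj_mem hρ hx.1 hxI
  -- The component u of X along the face is regarded as a vector v tangent to M at y = π(x). The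
  -- global generators decompose v there, and the differential of π takes the decomposition back to
  -- the face. The coefficients become derivatives of F ∘ π and log(ρ_k ∘ π) along X.
  set u : EuclideanSpace ℝ (Fin d) := mfderiv (Q n) (Q d) c.proj x (X x) with hu
  set v : EuclideanSpace ℝ (Fin n) :=
    mfderiv (Q d) (Q n) (fun y : face ρ j => (y : M)) y u with hv
  have hcoe : MDifferentiableAt (Q d) (Q n) (fun y : face ρ j => (y : M)) y :=
    (c.contMDiff_coe y).mdifferentiableAt (by simp)
  have hlie : ∀ g : M → ℝ, ContMDiff (Q n) 𝓘(ℝ, ℝ) ∞ g →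
      lieReal (fun _ => v) g (y : M) = lieReal X (fun z => g (c.proj z)) x := by
    intro g hg
    have h1 := mfderiv_comp y (contMDiff_mdiff hg (y : M)) hcoe
    have h2 := mfderiv_comp x (g := fun y : face ρ j => g y)
      (contMDiff_mdiff (hg.comp c.contMDiff_coe) y) (c.mdiff_proj hρ hx.1)
    have h3 : lieReal X (fun z => g (c.proj z)) x =
        mfderiv (Q d) 𝓘(ℝ, ℝ) (fun y : face ρ j => g y) y u := congrArg (fun A => A (X x)) h2
    rw [h3]
    exact (congrArg (fun A : TangentSpace (Q d) y →L[ℝ] ℝ => A u) h1).symm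
  have hv1 := hgen (y : M) (fun _ => v) (fun k hk => by
    by_cases hkj : k = j
    · subst hkj
      rw [hlie _ (hρ.smooth k)]
      have : (fun z => ρ k (c.proj z : M)) = fun _ => 0 := funext fun z => (c.proj z).2
      rw [this, lieReal_const]
    · exact absurd hk (hyI ⟨k, hkj⟩).ne')
  have hproj : (mfderiv (Q n) (Q d) c.proj (y : M) v : EuclideanSpace ℝ (Fin d)) = u := by
    have h1 : HasMFDerivAt (Q d) (Q d) (fun z : face ρ j => c.proj (z : M)) y _ :=
      (c.mdiff_proj hρ (c.coe_mem_dom y)).hasMFDerivAt.comp y hcoe.hasMFDerivAt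
    have h2 : HasMFDerivAt (Q d) (Q d) (fun z : face ρ j => c.proj (z : M)) y
        (ContinuousLinearMap.id ℝ (EuclideanSpace ℝ (Fin d))) :=
      (hasMFDerivAt_id y).congr_of_eventuallyEq (Eventually.of_forall fun z => c.proj_coe z)
    exact (congrArg (fun A : EuclideanSpace ℝ (Fin d) →L[ℝ] EuclideanSpace ℝ (Fin d) => A u)
      (hasMFDerivAt_unique h2 h1)).symm
  set R : (M × Fin n) ⊕ ι → VField d (face ρ j) := Sum.elim (fun a => c.restrField (Z a))
    (fun k => c.restrField (Z' k)) with hR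
  set A : (M × Fin n) ⊕ ι → M → ℝ :=
    Sum.elim (fun a => lieReal X (fun z => η z * F a (c.proj z))) B with hA
  have hAa : ∀ a, A (Sum.inl a) x = lieReal (fun _ => v) (F a) (y : M) := by
    intro a
    rw [hlie _ (hF a)]
    refine lieReal_congr ?_
    filter_upwards [eventually_nhdsSet_iff_forall.1 hη.eq_one x hx] with z hz
    rw [hz, one_mul]
  have hAk : ∀ k, A (Sum.inr k) x = lieReal (fun _ => v) (ρ k) (y : M) / ρ k y := by
    intro k
    rw [hlie _ (hρ.smooth k)]
    exact hBe k x hx hxI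
  have hu1 : u = ∑ a ∈ s.disjSum Finset.univ, A a x • (R a y : EuclideanSpace ℝ (Fin d)) := by
    rw [Finset.sum_disjSum]
    simp only [hAa, hAk]
    rw [← hproj]
    have key : ∀ T : EuclideanSpace ℝ (Fin n) →L[ℝ] EuclideanSpace ℝ (Fin d), T v =
        ∑ a ∈ s, lieReal (fun _ => v) (F a) (y : M) • T (Z a y) +
        ∑ k, (lieReal (fun _ => v) (ρ k) (y : M) / ρ k y) • T (Z' k y) := fun T =>
      (congrArg T hv1).trans ((map_add T _ _).trans
        (congrArg₂ (· + ·) (map_sum_smul T s _ _) (map_sum_smul T Finset.univ _ _)))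
    exact key _
  have hX1 := c.push_mfderiv_proj hρ hx.1 X (∑ a ∈ s.disjSum Finset.univ, A a x • R a) (by
    rw [Finset.sum_apply]; exact hu1.symm)
  have hX2 : X x = ∑ a ∈ s.disjSum Finset.univ, A a x • c.push (R a) 0 x +
      A₀ x • c.radial η x := by
    rw [← hX1, ← push_sum]
    have h1 : c.radial η x = ρ j x • c.push 0 1 x := by
      unfold radial; rw [hη.lift_eq 0 1 hx]
    rw [h1, smul_smul, mul_comm, ← eA₀, ← push_smul, ← push_add, mul_one, zero_add, smul_zero,
      add_zero]
  have key : ∀ T : EuclideanSpace ℝ (Fin n) →L[ℝ] ℂ, T (X x) =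
      ∑ a ∈ s.disjSum Finset.univ, A a x • T (c.push (R a) 0 x) + A₀ x • T (c.radial η x) :=
    fun T => (congrArg T hX2).trans ((map_add T _ _).trans
      (congrArg₂ (· + ·) (map_sum_smul T _ _ _) (map_smul T _ _)))
  have := key (mfderiv (Q n) 𝓘(ℝ, ℂ) f x)
  simp only [Complex.real_smul] at this
  exact this

end Collar

end SlabGenerators

/-! ### Pull-backs of conormal functions from a face -/

section Extension

variable {n d : ℕ} {ι : Type*} [Fintype ι] [DecidableEq ι]
  {M : Type*} [TopologicalSpace M] [ChartedSpace (EuclideanQuadrant n) M]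
  [IsManifold (Q n) ∞ M] [CompactSpace M] [T2Space M]
  {ρ : ι → M → ℝ} {j : ι} [ChartedSpace (EuclideanQuadrant d) (face ρ j)]
  [IsManifold (Q d) ∞ (face ρ j)] {c : Collar (n := n) (d := d) ρ j} {ε : ℝ} {η : M → ℝ}
  {χ : ℝ → ℝ}

theorem IsBoundaryDefining.isOpen_inner_onFace (hρ : IsBoundaryDefining (n := n) ρ) (j : ι) :
    IsOpen (inner (onFace ρ j ρ)) := by
  have : inner (onFace ρ j ρ) = ⋂ i : {k // k ≠ j}, {y : face ρ j | 0 < ρ i y} := by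
    ext y; simp [inner, onFace]
  rw [this]
  exact isOpen_iInter_of_finite fun i =>
    isOpen_lt continuous_const ((hρ.continuous i).comp continuous_subtype_val)

/-- The radial cutoff profiles. -/
structure IsProfile (ε : ℝ) (χ : ℝ → ℝ) : Prop where
  smooth : ContDiffOn ℝ ∞ χ (Ici 0)
  one : ∀ t ∈ Icc 0 (ε / 2), χ t = 1
  zero : ∀ t ∈ Ici ε, χ t = 0

namespace Collar

open Classical in
/-- The cutoff `χ(ρ_j)`. -/
def bump (c : Collar (n := n) (d := d) ρ j) (χ : ℝ → ℝ) (x : M) : ℝ :=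
  if x ∈ c.dom then χ (ρ j x) else 0

theorem extend_eq (χ : ℝ → ℝ) (b : face ρ j → ℂ) (x : M) :
    c.extend χ b x = (c.bump χ x : ℂ) * b (c.proj x) := by
  unfold extend bump
  split_ifs <;> simp

theorem bump_eq_zero (hχ : IsProfile ε χ) {x : M} (hx : x ∉ c.slab ε) : c.bump χ x = 0 := by
  unfold bump
  split_ifs with h
  · exact hχ.zero _ (not_le.1 fun h' => hx ⟨h, h'⟩).le
  · rfl

theorem bump_emb (χ : ℝ → ℝ) (y : face ρ j) {t : ℝ} (ht : t ∈ Ico 0 c.width) :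
    c.bump χ (c.emb (y, t)) = χ t := by
  unfold bump
  rw [if_pos (c.emb_mem y t ht), c.rho_emb y t ht]

theorem contMDiff_bump (hρ : IsBoundaryDefining (n := n) ρ) (hεc : ε < c.width)
    (hχ : IsProfile ε χ) : ContMDiff (Q n) 𝓘(ℝ, ℝ) ∞ (c.bump χ) := by
  intro x
  by_cases hx : x ∈ c.slab ε
  · have h1 : ContMDiffOn (Q n) 𝓘(ℝ, ℝ) ∞ (fun x => χ (ρ j x)) univ :=
      hχ.smooth.contMDiffOn.comp (hρ.smooth j).contMDiffOn fun x _ => hρ.nonneg j x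
    refine ((contMDiffOn_univ.1 h1) x).congr_of_eventuallyEq ?_
    filter_upwards [c.isOpen_dom.mem_nhds hx.1] with z hz
    exact if_pos hz
  · refine (contMDiffAt_const (c := (0 : ℝ))).congr_of_eventuallyEq ?_
    filter_upwards [(isCompact_slab hρ hεc).isClosed.isOpen_compl.mem_nhds hx] with z hz
    exact bump_eq_zero hχ hz

theorem eventually_bump_eq_one (hρ : IsBoundaryDefining (n := n) ρ) (hε : 0 < ε)
    (hχ : IsProfile ε χ) : ∀ᶠ x in 𝓝ˢ (face ρ j), c.bump χ x = 1 := by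
  filter_upwards [slab_mem_nhdsSet (c := c) hρ (half_pos hε)] with x hx
  unfold bump
  rw [if_pos hx.1, hχ.one _ ⟨hρ.nonneg j x, hx.2⟩]

theorem IsCutoff.smoothIn_comp_proj (hρ : IsBoundaryDefining (n := n) ρ) (hη : c.IsCutoff ε η)
    {b : face ρ j → ℂ} (hb : SmoothIn d (onFace ρ j ρ) b) :
    SmoothIn n ρ (fun x => (η x : ℂ) * b (c.proj x)) := by
  have hI := hρ.isOpen_inner
  intro x hx
  by_cases h : x ∈ c.dom
  · have hop : IsOpen (inner ρ ∩ c.dom) := hI.inter c.isOpen_dom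
    have h1 : ContMDiffOn (Q n) 𝓘(ℝ, ℂ) ∞ (fun x => b (c.proj x)) (inner ρ ∩ c.dom) :=
      ContMDiffOn.comp hb (c.contMDiffOn_proj.mono inter_subset_right)
        fun z hz => proj_mem hρ hz.2 hz.1
    have h2 := smoothIn_ofReal_mul (U := inner ρ ∩ c.dom) hη.smooth.contMDiffOn h1
    exact (h2.contMDiffAt (hop.mem_nhds ⟨hx, h⟩)).contMDiffWithinAt
  · have h1 : (fun x => (η x : ℂ) * b (c.proj x)) =ᶠ[𝓝 x] fun _ => 0 := by
      have : x ∉ tsupport η := fun h' => h (hη.tsupport_subset h')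
      filter_upwards [(isClosed_tsupport η).isOpen_compl.mem_nhds this] with z hz
      rw [image_eq_zero_of_notMem_tsupport hz]; simp
    exact ((contMDiffAt_const (c := (0 : ℂ))).congr_of_eventuallyEq h1).contMDiffWithinAt

theorem IsCutoff.comp_proj_eventuallyEq (hη : c.IsCutoff ε η) (b : face ρ j → ℂ) {x : M}
    (hx : x ∈ c.slab ε) :
    (fun x => (η x : ℂ) * b (c.proj x)) =ᶠ[𝓝 x] fun x => b (c.proj x) := by
  filter_upwards [eventually_nhdsSet_iff_forall.1 hη.eq_one x hx] with z hz
  rw [hz]; simp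

theorem lie_push_comp_proj (hρ : IsBoundaryDefining (n := n) ρ) {b : face ρ j → ℂ}
    (hb : SmoothIn d (onFace ρ j ρ) b) (Z : VField d (face ρ j)) (τ : ℝ) {x : M} (hx : x ∈ c.dom)
    (hxI : x ∈ inner ρ) :
    lie (c.push Z τ) (fun x => b (c.proj x)) x = lie Z b (c.proj x) :=
  c.lie_push_proj hρ Z τ hx (SmoothIn.mdiff (hρ.isOpen_inner_onFace j) hb (proj_mem hρ hx hxI))

theorem lie_zero_field {k : ℕ} {X : Type*} [TopologicalSpace X]
    [ChartedSpace (EuclideanQuadrant k) X] (f : X → ℂ) (x : X) : lie (0 : VField k X) f x = 0 :=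
  map_zero (mfderiv (Q k) 𝓘(ℝ, ℂ) f x)

/-- Pull-backs of conormal functions on the face are conormal. -/
theorem bump_mul_mem_conormal (hρ : IsBoundaryDefining (n := n) ρ) (hεc : ε < c.width)
    {κ : M → ℝ} (hκ : ContMDiff (Q n) 𝓘(ℝ, ℝ) ∞ κ) (hκ0 : ∀ x, x ∉ c.slab ε → κ x = 0)
    {σ : ι → ℝ} (hσ : σ j = 0) {b : face ρ j → ℂ}
    (hb : b ∈ conormal (n := d) (onFace ρ j ρ) (restr j σ)) :
    (fun x => (κ x : ℂ) * b (c.proj x)) ∈ conormal (n := n) ρ σ := by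
  obtain ⟨η, hη⟩ := exists_isCutoff hρ hεc
  have hI := hρ.isOpen_inner
  have hIY := hρ.isOpen_inner_onFace j
  obtain ⟨s, R, hR, hgen⟩ := hη.exists_slab_generators hρ hεc
  -- The stable class consists of sums of g · (b ∘ π) with g smooth and supported in the slab. A
  -- field of 𝒱_b either differentiates g or acts on b through the fields R_i of the face, and the
  -- radial component annihilates b ∘ π.
  set A : Set (M → ℂ) := {a | ∃ g : M → ℝ, ContMDiff (Q n) 𝓘(ℝ, ℝ) ∞ g ∧
    (∀ x, x ∉ c.slab ε → g x = 0) ∧ a = fun x => (g x : ℂ)} with hA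
  set B : Set (M → ℂ) := {f | ∃ b ∈ conormal (n := d) (onFace ρ j ρ) (restr j σ),
    f = fun x => (η x : ℂ) * b (c.proj x)} with hB
  have hAs : ∀ a ∈ A, SmoothIn n ρ a := by
    rintro _ ⟨g, hg, -, rfl⟩
    exact (Complex.ofRealCLM.contMDiff.comp hg).contMDiffOn
  have hBs : ∀ f ∈ B, SmoothIn n ρ f := by
    rintro _ ⟨b, hb, rfl⟩
    exact hη.smoothIn_comp_proj hρ hb.1
  have hsm : ∀ {f}, ProdSum A B (inner ρ) f → SmoothIn n ρ f := fun hf => hf.smoothIn hAs hBs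
  refine subset_conormal (S := {f | ProdSum A B (inner ρ) f}) (fun f hf => hsm hf) ?_ ?_ ?_
  · intro f hf X hX
    obtain ⟨C, C₀, hC, hC₀, e⟩ := hgen X hX
    induction hf with
    | @mul a f ha hf =>
      have ha' := hAs a ha
      obtain ⟨g, hg, hg0, rfl⟩ := ha
      have hf' := hBs f hf
      have hfB := hf
      obtain ⟨b, hb, rfl⟩ := hf
      have hsum : ∀ t : Finset ((M × Fin n) ⊕ ι), ProdSum A B (inner ρ) (fun x => ∑ i ∈ t,
          ((g x * C i x : ℝ) : ℂ) * ((η x : ℂ) * lie (R i) b (c.proj x))) := by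
        intro t
        classical
        induction t using Finset.induction_on with
        | empty =>
          refine .congr (.mul (a := fun x => ((0 : ℝ) : ℂ))
            ⟨fun _ => 0, contMDiff_const, fun _ _ => rfl, rfl⟩ hfB) fun x _ => by simp
        | insert i t hi ih =>
          refine .congr (.add (.mul (a := fun x => ((g x * C i x : ℝ) : ℂ))
            ⟨_, hg.mul (hC i), fun x hx => by simp [hg0 x hx], rfl⟩
            ⟨_, conormal.lie hIY hb (hR i), rfl⟩) ih) fun x _ => ?_
          rw [Finset.sum_insert hi]
      refine .congr (.add (.mul (a := fun x => ((lieReal X g x : ℝ) : ℂ))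
        ⟨_, hX.1.lieReal hg, fun x hx => ?_, rfl⟩ ⟨b, hb, rfl⟩) (hsum s)) fun x hx => ?_
      · have : g =ᶠ[𝓝 x] fun _ => 0 := by
          filter_upwards [(isCompact_slab hρ hεc).isClosed.isOpen_compl.mem_nhds hx] with z hz
          exact hg0 z hz
        rw [lieReal_congr this, lieReal_const]
      · rw [lie_mul (SmoothIn.mdiff hI ha' hx) (SmoothIn.mdiff hI hf' hx),
          lie_ofReal (contMDiff_mdiff hg x)]
        congr 1
        by_cases hxs : x ∈ c.slab ε
        · have hev := hη.comp_proj_eventuallyEq b hxs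
          rw [lie_congr hev, e x hxs hx, hη.lie_radial hxs,
            lie_push_comp_proj hρ hb.1 0 1 hxs.1 hx, lie_zero_field, mul_zero, mul_zero, add_zero,
            Finset.mul_sum]
          refine Finset.sum_congr rfl fun i _ => ?_
          rw [lie_push_comp_proj hρ hb.1 (R i) 0 hxs.1 hx, hη.eq_one.self_of_nhdsSet x hxs]
          push_cast; ring
        · simp [hg0 x hxs]
    | add hf hg ihf ihg =>
      exact ProdSum.congr (.add ihf ihg) fun x hx =>
        lie_add (SmoothIn.mdiff hI (hsm hf) hx) (SmoothIn.mdiff hI (hsm hg) hx)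
    | congr _ h ih => exact .congr ih (lie_eqOn hI X h)
  · intro f hf
    induction hf with
    | @mul a f ha hf =>
      obtain ⟨g, hg, hg0, rfl⟩ := ha
      obtain ⟨b, hb, rfl⟩ := hf
      obtain ⟨K, hK, hKe⟩ := exists_rp_emb_le (c := c) hρ hεc σ
      obtain ⟨D, hD0, hD⟩ := conormal.bound hb
      obtain ⟨G, hG⟩ := (isCompact_range hg.continuous.norm).bddAbove
      have hG0 : ∀ x, ‖g x‖ ≤ G := fun x => hG ⟨x, rfl⟩
      refine ⟨G * D * K, fun x hx => ?_⟩
      have hGn : 0 ≤ G := (norm_nonneg _).trans (hG0 x)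
      change ‖(g x : ℂ) * ((η x : ℂ) * b (c.proj x))‖ ≤ _
      by_cases hxs : x ∈ c.slab ε
      · have hy := proj_mem hρ hxs.1 hx
        have h1 := (hKe _ hy (ρ j x) ⟨hx j, hxs.2⟩).2
        rw [c.emb_proj x hxs.1, hσ, Real.rpow_zero, one_mul] at h1
        rw [hη.eq_one.self_of_nhdsSet x hxs, Complex.ofReal_one, one_mul, norm_mul,
          Complex.norm_real, mul_assoc, mul_assoc]
        refine mul_le_mul (hG0 x) ((hD _ hy).trans (mul_le_mul_of_nonneg_left h1 hD0))
          (norm_nonneg _) hGn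
      · rw [hg0 x hxs]
        simp only [Complex.ofReal_zero, zero_mul, norm_zero]
        exact mul_nonneg (mul_nonneg (mul_nonneg hGn hD0) hK.le) (rp_pos _ hx).le
    | add _ _ ihf ihg =>
      obtain ⟨C, hC⟩ := ihf
      obtain ⟨C', hC'⟩ := ihg
      refine ⟨C + C', fun x hx => ?_⟩
      rw [add_mul]
      exact (norm_add_le _ _).trans (add_le_add (hC x hx) (hC' x hx))
    | congr _ h ih =>
      obtain ⟨C, hC⟩ := ih
      exact ⟨C, fun x hx => by rw [h hx]; exact hC x hx⟩
  · refine .congr (.mul (a := fun x => (κ x : ℂ)) ⟨κ, hκ, hκ0, rfl⟩ ⟨b, hb, rfl⟩) fun x _ => ?_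
    by_cases hxs : x ∈ c.slab ε
    · simp [hη.eq_one.self_of_nhdsSet x hxs]
    · simp [hκ0 x hxs]

theorem extend_mem_conormalMinus (hρ : IsBoundaryDefining (n := n) ρ) (hεc : ε < c.width)
    (hχ : IsProfile ε χ) {σ : ι → ℝ} (hσ : σ j = 0) {b : face ρ j → ℂ}
    (hb : b ∈ conormalMinus (n := d) (onFace ρ j ρ) (restr j σ)) :
    c.extend χ b ∈ conormalMinus (n := n) ρ σ := by
  intro m hm
  -- The pull-back has exponent exactly 0 at Y_j. The required m_j is negative, so it follows by
  -- monotonicity.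
  have h1 := bump_mul_mem_conormal (c := c) hρ hεc (contMDiff_bump hρ hεc hχ)
    (fun x hx => bump_eq_zero hχ hx) (σ := Function.update m j 0) (by simp) (b := b) (hb _ fun k => by
      simp only [restr, Function.update_of_ne k.2]; exact hm k)
  have h2 : c.extend χ b = fun x => (c.bump χ x : ℂ) * b (c.proj x) :=
    funext fun x => c.extend_eq χ b x
  rw [h2]
  refine conormal.mono hρ.bounded (fun k => ?_) h1
  by_cases hk : k = j
  · subst hk
    have := hm k
    rw [Function.update_self]; linarith
  · rw [Function.update_of_ne hk]

end Collar

end Extension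

/-! ### Smoothness of limits -/

section UniformLimits

/-- Differentiation of uniform limits on convex sets. -/
theorem hasFDerivWithinAt_of_tendstoUniformlyOn {E G : Type*} [NormedAddCommGroup E]
    [NormedSpace ℝ E] [NormedAddCommGroup G] [NormedSpace ℝ G] {s : Set E} (hs : Convex ℝ s)
    {f : ℕ → E → G} {f' : ℕ → E → E →L[ℝ] G} {g : E → G} {g' : E → E →L[ℝ] G}
    (hf : ∀ k, ∀ x ∈ s, HasFDerivWithinAt (f k) (f' k x) s x)
    (hf' : TendstoUniformlyOn f' g' atTop s)
    (hfg : ∀ x ∈ s, Tendsto (fun k => f k x) atTop (𝓝 (g x))) {x : E} (hx : x ∈ s) :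
    HasFDerivWithinAt g (g' x) s x := by
  refine HasFDerivWithinAt.of_isLittleO (Asymptotics.isLittleO_iff.2 fun δ hδ => ?_)
  obtain ⟨N, hN⟩ := eventually_atTop.1 (Metric.tendstoUniformlyOn_iff.1 hf' (δ / 4) (by linarith))
  have h1 := Asymptotics.isLittleO_iff.1 (hasFDerivWithinAt_iff_isLittleO.1 (hf N x hx))
    (show 0 < δ / 4 by linarith)
  filter_upwards [h1, self_mem_nhdsWithin] with y hy hys
  -- For k ≥ N the derivative of f_k - f_N has norm at most δ/2. The mean value inequality is
  -- uniform in k, and k → ∞ replaces f_k by g.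
  have h2 : ‖g y - f N y - (g x - f N x)‖ ≤ δ / 2 * ‖y - x‖ := by
    have h3 : Tendsto (fun k => ‖f k y - f N y - (f k x - f N x)‖) atTop
        (𝓝 ‖g y - f N y - (g x - f N x)‖) :=
      (((hfg y hys).sub tendsto_const_nhds).sub ((hfg x hx).sub tendsto_const_nhds)).norm
    refine le_of_tendsto h3 (eventually_atTop.2 ⟨N, fun k hk => ?_⟩)
    refine hs.norm_image_sub_le_of_norm_hasFDerivWithin_le (f := fun z => f k z - f N z)
      (fun z hz => (hf k z hz).sub (hf N z hz)) (fun z hz => ?_) hx hys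
    have e1 := hN k hk z hz
    have e2 := hN N le_rfl z hz
    have e3 := dist_triangle_left (f' k z) (f' N z) (g' z)
    rw [dist_eq_norm (f' k z)] at e3
    linarith
  have h4 : ‖(f' N x - g' x) (y - x)‖ ≤ δ / 4 * ‖y - x‖ := by
    refine (ContinuousLinearMap.le_opNorm _ _).trans
      (mul_le_mul_of_nonneg_right ?_ (norm_nonneg _))
    have := hN N le_rfl x hx
    rw [dist_comm, dist_eq_norm] at this
    exact this.le
  have e : g y - g x - g' x (y - x) = (g y - f N y - (g x - f N x)) +
      (f N y - f N x - f' N x (y - x)) + (f' N x - g' x) (y - x) := by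
    rw [sub_apply]; abel
  rw [e]
  refine (norm_add₃_le).trans ?_
  linarith

/-- The linear form with given components. -/
def gradL (n : ℕ) : (Fin n → ℂ) →L[ℝ] EuclideanSpace ℝ (Fin n) →L[ℝ] ℂ :=
  LinearMap.toContinuousLinearMap
    { toFun := fun p => ∑ i, (coordCLM i).smulRight (p i)
      map_add' := fun p q => by
        ext v; simp [Finset.sum_add_distrib]
      map_smul' := fun a p => by
        ext v; simp [Finset.mul_sum, mul_left_comm] }

theorem eq_gradL {n : ℕ} (A : EuclideanSpace ℝ (Fin n) →L[ℝ] ℂ) :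
    A = gradL n fun i => A (EuclideanSpace.single i 1) := by
  ext v
  have e : v = ∑ i, v i • EuclideanSpace.single i (1 : ℝ) := by
    ext l
    simp [Finset.sum_apply, Pi.single_apply]
  have h : A v = ∑ i, v i • A (EuclideanSpace.single i 1) := by
    conv_lhs => rw [e]
    simp only [map_sum, map_smul]
  rw [h]
  change _ = (∑ i, (coordCLM i).smulRight (A (EuclideanSpace.single i 1))) v
  simp

theorem tendstoUniformlyOn_gradL {n : ℕ} {α : Type*} {s : Set α} {p : ℕ → α → Fin n → ℂ}
    {q : α → Fin n → ℂ} (h : ∀ i, TendstoUniformlyOn (fun k x => p k x i) (fun x => q x i) atTop s) :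
    TendstoUniformlyOn (fun k x => gradL n (p k x)) (fun x => gradL n (q x)) atTop s := by
  refine (gradL n).uniformContinuous.comp_tendstoUniformlyOn ?_
  rw [Metric.tendstoUniformlyOn_iff]
  intro δ hδ
  filter_upwards [eventually_all.2 fun i => Metric.tendstoUniformlyOn_iff.1 (h i) δ hδ] with k hk
  exact fun x hx => (dist_pi_lt_iff hδ).2 fun i => hk i x hx

variable {n : ℕ} {ι : Type*} {X : Type*} [TopologicalSpace X]
  [ChartedSpace (EuclideanQuadrant n) X] [IsManifold (Q n) ∞ X] [CompactSpace X] [T2Space X]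
  {ρ : ι → X → ℝ}

theorem smul_mem_bFields_of_tsupport {ζ : X → ℝ} (hζ : ContMDiff (Q n) 𝓘(ℝ, ℝ) ∞ ζ) {U : Set X}
    (hU : IsOpen U) (hζU : tsupport ζ ⊆ U) (hζI : tsupport ζ ⊆ inner ρ) {Z : VField n X}
    (hZ : ContMDiffOn (Q n) (Q n).tangent ∞ (fun x => (⟨x, Z x⟩ : TangentBundle (Q n) X)) U) :
    (fun x => ζ x • Z x : VField n X) ∈ bFields ρ := by
  refine ⟨Corners.ContMDiffOn.smoothVField_smul hZ hU hζ hζU, fun k x hx => ?_⟩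
  have h0 : ζ x = 0 := by
    by_contra h
    exact (hζI (subset_tsupport _ h) k).ne' hx
  rw [lieReal_field_smul, h0, zero_mul]

/-- Limits of sequences of smooth functions whose derivatives along `𝒱_b` converge. -/
theorem smooth_limit (hI : IsOpen (inner ρ)) {T : Set ((ℕ → X → ℂ) × (X → ℂ))}
    (hs : ∀ p ∈ T, ∀ k, ContMDiffOn (Q n) 𝓘(ℝ, ℂ) ∞ (p.1 k) (inner ρ))
    (hc : ∀ p ∈ T, ∀ K ⊆ inner ρ, IsCompact K → TendstoUniformlyOn p.1 p.2 atTop K)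
    (hl : ∀ p ∈ T, ∀ Z : VField n X, Z ∈ bFields ρ →
      ∃ g, ((fun k => lie Z (p.1 k), g) : (ℕ → X → ℂ) × (X → ℂ)) ∈ T)
    {p : (ℕ → X → ℂ) × (X → ℂ)} (hp : p ∈ T) :
    ContMDiffOn (Q n) 𝓘(ℝ, ℂ) ∞ p.2 (inner ρ) ∧ ∀ x ∈ inner ρ, ∀ Z : VField n X,
      Tendsto (fun k => lie Z (p.1 k) x) atTop (𝓝 (lie Z p.2 x)) := by
  suffices h : ∀ x₀ ∈ inner ρ, ContMDiffAt (Q n) 𝓘(ℝ, ℂ) ∞ p.2 x₀ ∧ ∀ Z : VField n X,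
      Tendsto (fun k => lie Z (p.1 k) x₀) atTop (𝓝 (lie Z p.2 x₀)) from
    ⟨fun x hx => (h x hx).1.contMDiffWithinAt, fun x hx => (h x hx).2⟩
  intro x₀ hx₀
  set φ := chartAt (EuclideanQuadrant n) x₀ with hφdef
  have hφ : φ ∈ IsManifold.maximalAtlas (Q n) ∞ X := IsManifold.chart_mem_maximalAtlas x₀
  have hxφ : x₀ ∈ φ.source := mem_chart_source _ x₀
  set ψ := φ.extend (Q n) with hψ
  have hnhds : ψ.target ∩ ψ.symm ⁻¹' inner ρ ∈ 𝓝[range (Q n)] (ψ x₀) := by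
    refine inter_mem (φ.extend_target_mem_nhdsWithin hxφ) ?_
    have := φ.extend_preimage_mem_nhdsWithin (I := Q n) (s := univ) hxφ
      (mem_nhdsWithin_of_mem_nhds (hI.mem_nhds hx₀))
    rwa [preimage_univ, univ_inter] at this
  obtain ⟨r₀, hr₀, hsub⟩ := Metric.mem_nhdsWithin_iff.1 hnhds
  -- K is compact in the chart and provides uniform convergence. The smaller s is convex and
  -- relatively open, as needed for differentiation.
  set K := Metric.closedBall (ψ x₀) (r₀ / 2) ∩ range (Q n) with hK
  set s := range (Q n) ∩ Metric.ball (ψ x₀) (r₀ / 2) with hsdef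
  have hKsub : K ⊆ ψ.target ∩ ψ.symm ⁻¹' inner ρ := fun z hz =>
    hsub ⟨Metric.closedBall_subset_ball (half_lt_self hr₀) hz.1, hz.2⟩
  have hsK : s ⊆ K := fun z hz => ⟨Metric.ball_subset_closedBall hz.2, hz.1⟩
  have hKc : IsCompact K := (isCompact_closedBall _ _).inter_right (Q n).isClosed_range
  have hK' : IsCompact (ψ.symm '' K) :=
    hKc.image_of_continuousOn (φ.continuousOn_extend_symm.mono fun z hz => (hKsub hz).1)
  have hK'I : ψ.symm '' K ⊆ inner ρ := by rintro _ ⟨z, hz, rfl⟩; exact (hKsub hz).2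
  have hK'φ : ψ.symm '' K ⊆ φ.source := by
    rintro _ ⟨z, hz, rfl⟩
    have := ψ.map_target (hKsub hz).1
    rwa [φ.extend_source] at this
  have hsconv : Convex ℝ s := (Q n).convex_range.inter (convex_ball _ _)
  have hsu : UniqueDiffOn ℝ s := (Q n).uniqueDiffOn.inter Metric.isOpen_ball
  have hx₀s : ψ x₀ ∈ s := ⟨φ.extend_target_subset_range (ψ.map_source (by rwa [φ.extend_source])),
    Metric.mem_ball_self (half_pos hr₀)⟩
  have hstar : s ⊆ ψ.target := fun z hz => (hKsub (hsK hz)).1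
  obtain ⟨ζ, hζ, hζ1, hζs, -⟩ := exists_cutoff (n := n) hK'.isClosed (hI.inter φ.open_source)
    (subset_inter hK'I hK'φ)
  -- Cut off inside the interior, the coordinate fields belong to 𝒱_b, so the hypotheses on T apply
  -- to them.
  set Z : Fin n → VField n X := fun i x => ζ x • coordField φ i x with hZdef
  have hZ : ∀ i, Z i ∈ bFields ρ := fun i => smul_mem_bFields_of_tsupport hζ φ.open_source
    (hζs.trans inter_subset_right) (hζs.trans inter_subset_left) (contMDiffOn_coordField hφ i)
  have hZlie : ∀ i (f : X → ℂ), ∀ x ∈ ψ.symm '' K, lie (Z i) f x = lie (coordField φ i) f x := by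
    intro i f x hx
    rw [hZdef, lie_field_smul, hζ1.self_of_nhdsSet x hx, Complex.ofReal_one, one_mul]
  choose! D hD using hl
  have hfd : ∀ f : X → ℂ, ContMDiffOn (Q n) 𝓘(ℝ, ℂ) ∞ f (inner ρ) → ∀ z ∈ s,
      HasFDerivWithinAt (fun z => f (ψ.symm z))
        (gradL n fun i => lie (Z i) f (ψ.symm z)) s z := by
    intro f hf z hz
    have hzt := hstar hz
    have hzx : ψ.symm z ∈ ψ.symm '' K := ⟨z, hsK hz, rfl⟩
    have hd : MDifferentiableAt (Q n) 𝓘(ℝ, ℂ) f (ψ.symm z) :=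
      mdiffAt_of_contMDiffOn hI hf (hK'I hzx)
    have h1 : MDifferentiableWithinAt 𝓘(ℝ, EuclideanSpace ℝ (Fin n)) 𝓘(ℝ, ℂ)
        (fun z => f (ψ.symm z)) ψ.target z := hd.comp_mdifferentiableWithinAt z
      ((contMDiffOn_extend_symm' hφ z hzt).mdifferentiableWithinAt (by simp))
    have h2 := (mdifferentiableWithinAt_iff_differentiableWithinAt.1 h1).hasFDerivWithinAt
    rw [eq_gradL (fderivWithin ℝ (fun z => f (ψ.symm z)) ψ.target z)] at h2
    refine (h2.mono hstar).congr_fderiv ?_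
    congr 1
    funext i
    rw [hZlie i f _ hzx]
    have h3 := mfderiv_coordField hφ i (hK'φ hzx) hd
    rw [ψ.right_inv hzt] at h3
    exact h3.symm
  have hlim : ∀ p ∈ T, ∀ z ∈ s, HasFDerivWithinAt (fun z => p.2 (ψ.symm z))
      (gradL n fun i => D p (Z i) (ψ.symm z)) s z := by
    intro p hp z hz
    refine hasFDerivWithinAt_of_tendstoUniformlyOn hsconv
      (f := fun k z => p.1 k (ψ.symm z))
      (f' := fun k z => gradL n fun i => lie (Z i) (p.1 k) (ψ.symm z))
      (g' := fun z => gradL n fun i => D p (Z i) (ψ.symm z))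
      (fun k z hz => hfd _ (hs p hp k) z hz) (tendstoUniformlyOn_gradL fun i => ?_)
      (fun z hz => ?_) hz
    · exact ((hc _ (hD p hp _ (hZ i)) _ hK'I hK').comp ψ.symm).mono
        fun z hz => ⟨z, hsK hz, rfl⟩
    · exact (hc p hp _ hK'I hK').tendsto_at ⟨z, hsK hz, rfl⟩
  -- The partial derivatives of a limit are limits belonging to other members of T, so the induction
  -- runs over all members at once.
  have hcd : ∀ m : ℕ, ∀ p ∈ T, ContDiffOn ℝ m (fun z => p.2 (ψ.symm z)) s := by
    intro m
    induction m with
    | zero =>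
      intro p hp
      exact contDiffOn_zero.2 fun z hz => (hlim p hp z hz).continuousWithinAt
    | succ m ih =>
      intro p hp
      push_cast
      refine (contDiffOn_succ_iff_hasFDerivWithinAt_of_uniqueDiffOn hsu).2
        ⟨fun h => absurd h (by simp), _, ?_, hlim p hp⟩
      exact (gradL n).contDiff.comp_contDiffOn (contDiffOn_pi.2 fun i => ih _ (hD p hp _ (hZ i)))
  have hsm : ContMDiffAt (Q n) 𝓘(ℝ, ℂ) ∞ p.2 x₀ := by
    have h1 : ContDiffOn ℝ ∞ (fun z => p.2 (ψ.symm z)) s := contDiffOn_infty.2 fun m => hcd m p hp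
    have hcψ : ContinuousOn ψ φ.source := by
      have := φ.continuousOn_extend (I := Q n)
      rwa [φ.extend_source] at this
    have hO : IsOpen (φ.source ∩ ψ ⁻¹' Metric.ball (ψ x₀) (r₀ / 2)) :=
      hcψ.isOpen_inter_preimage φ.open_source Metric.isOpen_ball
    have h2 := h1.contMDiffOn.comp ((φ.contMDiffOn_extend hφ).mono
      (inter_subset_left (t := ψ ⁻¹' Metric.ball (ψ x₀) (r₀ / 2)))) fun x hx =>
        ⟨φ.extend_target_subset_range (mapsTo_extend hx.1), hx.2⟩
    have hm : φ.source ∩ ψ ⁻¹' Metric.ball (ψ x₀) (r₀ / 2) ∈ 𝓝 x₀ :=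
      hO.mem_nhds ⟨hxφ, Metric.mem_ball_self (half_pos hr₀)⟩
    refine (h2.contMDiffAt hm).congr_of_eventuallyEq ?_
    filter_upwards [hm] with x hx
    exact congrArg p.2 (extend_symm_extend x hx.1).symm
  refine ⟨hsm, fun V => ?_⟩
  have hmem : x₀ ∈ ψ.symm '' K := ⟨ψ x₀, hsK hx₀s, extend_symm_extend x₀ hxφ⟩
  have hsum : ∀ f : X → ℂ, lie V f x₀ =
      ∑ i, (lieReal V (coordFun φ i) x₀ : ℂ) * lie (coordField φ i) f x₀ := by
    intro f
    have key : ∀ A : EuclideanSpace ℝ (Fin n) →L[ℝ] ℂ, A (V x₀) =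
        ∑ i, lieReal V (coordFun φ i) x₀ • A (coordField φ i x₀) := fun A =>
      (congrArg A (eq_sum_coordField hφ V hxφ)).trans (Collar.map_sum_smul A _ _ _)
    have := key (mfderiv (Q n) 𝓘(ℝ, ℂ) f x₀)
    simp only [Complex.real_smul] at this
    exact this
  have hlimi : ∀ i, lie (coordField φ i) p.2 x₀ = D p (Z i) x₀ := by
    intro i
    have h1 := mfderiv_coordField hφ i hxφ (hsm.mdifferentiableAt (by simp))
    have h2 : HasFDerivWithinAt (fun z => p.2 (ψ.symm z)) _ ψ.target (ψ x₀) :=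
      (hlim p hp _ hx₀s).mono_of_mem_nhdsWithin (by
        rw [hsdef, inter_comm]
        exact mem_of_superset (inter_mem_nhdsWithin _ (Metric.ball_mem_nhds _ (half_pos hr₀)))
          fun z hz => ⟨hz.2, φ.extend_target_subset_range hz.1⟩)
    refine h1.trans ?_
    rw [h2.fderivWithin (uniqueDiffOn_extend_target _ (mapsTo_extend hxφ))]
    change (∑ l, (coordCLM l).smulRight (D p (Z l) (ψ.symm (ψ x₀))))
      (EuclideanSpace.single i 1) = _
    rw [extend_symm_extend x₀ hxφ]
    simp
  simp only [hsum, hlimi]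
  refine tendsto_finsetSum _ fun i _ => Tendsto.const_mul _ ?_
  have h1 := (hc _ (hD p hp _ (hZ i)) _ hK'I hK').tendsto_at hmem
  refine h1.congr fun k => hZlie i _ _ hmem

end UniformLimits

/-! ### Limits along the fibres -/

section FibreLimits

variable {n d : ℕ} {ι : Type*} [Fintype ι] [DecidableEq ι]
  {M : Type*} [TopologicalSpace M] [ChartedSpace (EuclideanQuadrant n) M]
  [IsManifold (Q n) ∞ M] [CompactSpace M] [T2Space M]
  {ρ : ι → M → ℝ} {j : ι} [ChartedSpace (EuclideanQuadrant d) (face ρ j)]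
  [IsManifold (Q d) ∞ (face ρ j)] {c : Collar (n := n) (d := d) ρ j} {ε : ℝ} {η : M → ℝ}
  {μ : ι → ℝ}

theorem continuousOn_rp (hρ : IsBoundaryDefining (n := n) ρ) (m : {k // k ≠ j} → ℝ) :
    ContinuousOn (rp (onFace ρ j ρ) m) (inner (onFace ρ j ρ)) := by
  refine continuousOn_finsetProd _ fun i _ => ?_
  exact ContinuousOn.rpow_const ((hρ.continuous i).comp continuous_subtype_val).continuousOn
    fun y hy => Or.inl (hy i).ne'

namespace Collar

/-- The limit along the fibres. -/
def fibreLim (c : Collar (n := n) (d := d) ρ j) (h : M → ℂ) (y : face ρ j) : ℂ :=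
  limUnder (𝓝[>] (0 : ℝ)) fun t => h (c.emb (y, t))

/-- The functions in `𝒜^{μ-}` whose radial derivative is better by one order. -/
def limClass (c : Collar (n := n) (d := d) ρ j) (η : M → ℝ) (μ : ι → ℝ) : Set (M → ℂ) :=
  {h | h ∈ conormalMinus (n := n) ρ μ ∧
    lie (c.radial η) h ∈ conormalMinus (n := n) ρ (μ + Pi.single j 1)}

theorem shifted_zero (V : VField n M) (h : M → ℂ) : shifted V 0 h = lie V h := by
  funext x; simp [shifted]

/-- Extension of exponents from the face. -/
def extExp (j : ι) (m : {k // k ≠ j} → ℝ) (a : ℝ) (i : ι) : ℝ := if h : i = j then a else m ⟨i, h⟩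

theorem extExp_self (m : {k // k ≠ j} → ℝ) (a : ℝ) : extExp j m a j = a := by simp [extExp]

theorem restr_extExp (m : {k // k ≠ j} → ℝ) (a : ℝ) : restr j (extExp j m a) = m := by
  funext k
  simp [restr, extExp, k.2]

theorem extExp_lt {m : {k // k ≠ j} → ℝ} (hm : ∀ k, m k < restr j μ k) {a b : ℝ}
    (hab : a < μ j + b) (i : ι) : extExp j m a i < (μ + Pi.single j b : ι → ℝ) i := by
  by_cases h : i = j
  · subst h; rw [extExp_self]; simpa using hab
  · simpa [extExp, h] using hm ⟨i, h⟩

theorem IsCutoff.lie_mem_limClass (hρ : IsBoundaryDefining (n := n) ρ) (hε : 0 ≤ ε)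
    (hη : c.IsCutoff ε η) {h : M → ℂ} (hh : h ∈ c.limClass η μ) {W : VField n M}
    (hW : W ∈ bFields ρ) : lie W h ∈ c.limClass η μ := by
  refine ⟨conormalMinus.lie hρ.isOpen_inner hh.1 hW, ?_⟩
  have := hη.shifted_lie_mem hρ hε (k := 0) le_rfl hh.1 (by rw [shifted_zero]; exact hh.2) hW
  rwa [shifted_zero] at this

/-- The fibre estimate with k = 0. The radial derivative has any order below 1 at Y_j, and 1/2 is
chosen as a positive exponent for which the bound is integrable at 0. -/
theorem IsCutoff.exists_fibre_bound (hρ : IsBoundaryDefining (n := n) ρ) (hεc : ε < c.width)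
    (hη : c.IsCutoff ε η) (hμ : μ j = 0) {h : M → ℂ} (hh : h ∈ c.limClass η μ)
    {m : {k // k ≠ j} → ℝ} (hm : ∀ k, m k < restr j μ k) :
    ∃ C : ℝ, 0 ≤ C ∧ ∀ y ∈ inner (onFace ρ j ρ), ∀ s t, 0 < s → s ≤ t → t ≤ ε →
      ‖h (c.emb (y, t)) - h (c.emb (y, s))‖ ≤
        C * rp (onFace ρ j ρ) m y * t ^ (1 / 2 : ℝ) := by
  obtain ⟨B, -, hB⟩ := conormal.bound (hh.2 (extExp j m (1 / 2))
    (extExp_lt hm (by rw [hμ]; norm_num)))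
  obtain ⟨C, hC0, hC⟩ := hη.exists_fibre_estimate hρ hεc (conormalMinus.smooth hh.1)
    (k := 0) (σ := extExp j m (1 / 2)) (by rw [extExp_self]; norm_num)
    (by rw [Complex.ofReal_zero, shifted_zero]; exact hB)
  refine ⟨C * 2, by positivity, fun y hy s t hs hst ht => ?_⟩
  have h1 := hC y hy s t hs hst ht
  rw [restr_extExp, extExp_self, neg_zero, Real.rpow_zero, Real.rpow_zero, one_smul, one_smul,
    sub_zero] at h1
  refine h1.trans ?_
  have h2 := (Real.rpow_pos_of_pos hs (1 / 2)).le
  have h3 := mul_nonneg hC0 (rp_pos m hy).le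
  calc _ = C * rp (onFace ρ j ρ) m y * (2 * (t ^ (1 / 2 : ℝ) - s ^ (1 / 2 : ℝ))) := by ring
    _ ≤ C * rp (onFace ρ j ρ) m y * (2 * t ^ (1 / 2 : ℝ)) :=
        mul_le_mul_of_nonneg_left (by linarith) h3
    _ = _ := by ring

theorem tendsto_rpow_half : Tendsto (fun t : ℝ => t ^ (1 / 2 : ℝ)) (𝓝[>] 0) (𝓝 0) := by
  have h2 : Tendsto (fun t : ℝ => t ^ (1 / 2 : ℝ)) (𝓝 0) (𝓝 (0 ^ (1 / 2 : ℝ))) :=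
    (Real.continuousAt_rpow_const _ _ (Or.inr (by norm_num))).tendsto
  rw [Real.zero_rpow (by norm_num)] at h2
  exact h2.mono_left nhdsWithin_le_nhds

theorem IsCutoff.tendsto_fibreLim (hρ : IsBoundaryDefining (n := n) ρ) (hε : 0 < ε)
    (hεc : ε < c.width) (hη : c.IsCutoff ε η) (hμ : μ j = 0) {h : M → ℂ}
    (hh : h ∈ c.limClass η μ) {y : face ρ j} (hy : y ∈ inner (onFace ρ j ρ)) :
    Tendsto (fun t => h (c.emb (y, t))) (𝓝[>] 0) (𝓝 (c.fibreLim h y)) := by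
  obtain ⟨C, hC0, hC⟩ := hη.exists_fibre_bound hρ hεc hμ hh (m := fun k => restr j μ k - 1)
    (fun k => by simp)
  refine tendsto_nhds_limUnder (cauchy_map_iff_exists_tendsto.1 ?_)
  refine Metric.cauchy_iff.2 ⟨inferInstance, fun δ hδ => ?_⟩
  have h1 := tendsto_rpow_half.const_mul (C * rp (onFace ρ j ρ) (fun k => restr j μ k - 1) y)
  rw [mul_zero] at h1
  have h2 := (h1.eventually_lt_const hδ).and (Ioc_mem_nhdsGT hε)
  refine ⟨_, image_mem_map h2, ?_⟩
  have key : ∀ s t, 0 < s → s ≤ t → t ≤ ε →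
      C * rp (onFace ρ j ρ) (fun k => restr j μ k - 1) y * t ^ (1 / 2 : ℝ) < δ →
      dist (h (c.emb (y, t))) (h (c.emb (y, s))) < δ := fun s t hs hst ht hlt => by
    rw [dist_eq_norm]
    exact (hC y hy s t hs hst ht).trans_lt hlt
  rintro _ ⟨s, hs, rfl⟩ _ ⟨t, ht, rfl⟩
  rcases le_total s t with hst | hst
  · rw [dist_comm]; exact key s t hs.2.1 hst ht.2.2 ht.1
  · exact key t s ht.2.1 hst hs.2.2 hs.1

theorem IsCutoff.exists_fibreLim_bound (hρ : IsBoundaryDefining (n := n) ρ) (hε : 0 < ε)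
    (hεc : ε < c.width) (hη : c.IsCutoff ε η) (hμ : μ j = 0) {h : M → ℂ} (hh : h ∈ c.limClass η μ)
    {m : {k // k ≠ j} → ℝ} (hm : ∀ k, m k < restr j μ k) :
    ∃ C : ℝ, 0 ≤ C ∧ ∀ y ∈ inner (onFace ρ j ρ), ∀ t ∈ Ioc 0 ε,
      ‖h (c.emb (y, t)) - c.fibreLim h y‖ ≤ C * rp (onFace ρ j ρ) m y * t ^ (1 / 2 : ℝ) := by
  obtain ⟨C, hC0, hC⟩ := hη.exists_fibre_bound hρ hεc hμ hh hm
  refine ⟨C, hC0, fun y hy t ht => ?_⟩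
  refine le_of_tendsto (tendsto_const_nhds.sub
    (hη.tendsto_fibreLim hρ hε hεc hμ hh hy)).norm ?_
  filter_upwards [Ioc_mem_nhdsGT ht.1] with s hs
  exact hC y hy s t hs.1 hs.2 ht.2

theorem contMDiffOn_slice (hρ : IsBoundaryDefining (n := n) ρ) {h : M → ℂ} (hh : SmoothIn n ρ h)
    {t : ℝ} (ht : t ∈ Ioo 0 c.width) :
    ContMDiffOn (Q d) 𝓘(ℝ, ℂ) ∞ (fun y => h (c.emb (y, t))) (inner (onFace ρ j ρ)) := by
  have h1 : ContMDiff (Q d) ((Q d).prod 𝓘(ℝ, ℝ)) ∞ (fun y : face ρ j => (y, t)) :=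
    contMDiff_id.prodMk contMDiff_const
  have h2 : ContMDiffOn (Q d) (Q n) ∞ (fun y : face ρ j => c.emb (y, t))
      (inner (onFace ρ j ρ)) :=
    c.contMDiffOn_emb.comp h1.contMDiffOn fun y _ => ⟨mem_univ _, ht.1.le, ht.2⟩
  exact ContMDiffOn.comp hh h2 fun y hy => emb_mem_inner hρ hy ht

theorem IsCutoff.lie_slice (hρ : IsBoundaryDefining (n := n) ρ)
    (hεc : ε < c.width) (hη : c.IsCutoff ε η) {h : M → ℂ} (hh : SmoothIn n ρ h)
    (Z : VField d (face ρ j)) {y : face ρ j} (hy : y ∈ inner (onFace ρ j ρ)) {t : ℝ}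
    (ht : t ∈ Ioc 0 ε) :
    lie Z (fun z => h (c.emb (z, t))) y = lie (c.lift η Z 0) h (c.emb (y, t)) := by
  have htw : t ∈ Ioo 0 c.width := ⟨ht.1, ht.2.trans_lt hεc⟩
  rw [c.lie_slice hρ Z ⟨htw.1.le, htw.2⟩
    (SmoothIn.mdiff hρ.isOpen_inner hh (emb_mem_inner hρ hy htw))]
  exact lie_field_congr (hη.lift_eq Z 0 (c.emb_mem_slab hεc y ⟨ht.1.le, ht.2⟩)).symm _

/-- The restrictions to the slices t = ε/(k+1) converge locally uniformly. Their derivatives along Z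
are the restrictions of the derivative along the lift of Z, which stays in the class, so the theorem
on smooth limits applies and differentiation commutes with the limit. -/
theorem IsCutoff.fibreLim_smooth (hρ : IsBoundaryDefining (n := n) ρ) (hε : 0 < ε)
    (hεc : ε < c.width) (hη : c.IsCutoff ε η) (hμ : μ j = 0) {h : M → ℂ}
    (hh : h ∈ c.limClass η μ) :
    SmoothIn d (onFace ρ j ρ) (c.fibreLim h) ∧ ∀ Z : VField d (face ρ j),
      Z ∈ bFields (onFace ρ j ρ) →
      EqOn (lie Z (c.fibreLim h)) (c.fibreLim (lie (c.lift η Z 0) h)) (inner (onFace ρ j ρ)) := by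
  have hc : CompactSpace (face ρ j) := isCompact_iff_compactSpace.1 (hρ.isClosed_face j).isCompact
  have hIY := hρ.isOpen_inner_onFace j
  set t : ℕ → ℝ := fun k => ε / (k + 1) with ht
  have ht0 : ∀ k, t k ∈ Ioc 0 ε := fun k =>
    ⟨by positivity, div_le_self hε.le (by linarith [Nat.cast_nonneg (α := ℝ) k])⟩
  have htw : ∀ k, t k ∈ Ioo 0 c.width := fun k => ⟨(ht0 k).1, (ht0 k).2.trans_lt hεc⟩
  have htt : Tendsto t atTop (𝓝[>] 0) := by
    refine tendsto_nhdsWithin_iff.2 ⟨?_, Eventually.of_forall fun k => (ht0 k).1⟩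
    have := (tendsto_one_div_add_atTop_nhds_zero_nat (𝕜 := ℝ)).const_mul ε
    rw [mul_zero] at this
    refine this.congr fun k => ?_
    simp only [ht]; ring
  set T : Set ((ℕ → face ρ j → ℂ) × (face ρ j → ℂ)) := {p | ∃ h ∈ c.limClass η μ,
    (∀ k, EqOn (p.1 k) (fun y => h (c.emb (y, t k))) (inner (onFace ρ j ρ))) ∧
    EqOn p.2 (c.fibreLim h) (inner (onFace ρ j ρ))} with hT
  have hmain := smooth_limit (n := d) (ρ := onFace ρ j ρ) (T := T) hIY (fun p hp k => ?_) (fun p hp K hK hKc => ?_)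
    (fun p hp Z hZ => ?_) (p := (fun k y => h (c.emb (y, t k)), c.fibreLim h))
    ⟨h, hh, fun k => fun _ _ => rfl, fun _ _ => rfl⟩
  · refine ⟨hmain.1, fun Z hZ y hy => ?_⟩
    have h1 := hmain.2 y hy Z
    have h2 := ((hη.tendsto_fibreLim hρ hε hεc hμ (hη.lie_mem_limClass hρ hε.le hh
      (hη.lift_mem_bFields hρ hZ)) hy).comp htt)
    refine tendsto_nhds_unique h1 (h2.congr fun k => ?_)
    exact (hη.lie_slice hρ hεc (conormalMinus.smooth hh.1) Z hy (ht0 k)).symm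
  · obtain ⟨h, hh, h1, -⟩ := hp
    exact (contMDiffOn_slice hρ (conormalMinus.smooth hh.1) (htw k)).congr (h1 k)
  · obtain ⟨h, hh, h1, h2⟩ := hp
    obtain ⟨C, hC0, hC⟩ := hη.exists_fibreLim_bound hρ hε hεc hμ hh
      (m := fun k => restr j μ k - 1) (fun k => by simp)
    obtain ⟨B, hB⟩ := (hKc.image_of_continuousOn
      ((continuousOn_rp hρ (fun k => restr j μ k - 1)).mono hK)).bddAbove
    have h3 := (tendsto_rpow_half.comp htt).const_mul (C * max B 0)
    rw [mul_zero] at h3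
    refine Metric.tendstoUniformlyOn_iff.2 fun δ hδ => ?_
    filter_upwards [h3.eventually_lt_const hδ] with k hk y hy
    rw [h2 (hK hy), h1 k (hK hy), dist_comm, dist_eq_norm]
    refine (hC y (hK hy) _ (ht0 k)).trans_lt (lt_of_le_of_lt ?_ hk)
    refine mul_le_mul_of_nonneg_right ?_ (Real.rpow_pos_of_pos (ht0 k).1 _).le
    exact mul_le_mul_of_nonneg_left ((hB ⟨y, hy, rfl⟩).trans (le_max_left _ _)) hC0
  · obtain ⟨h, hh, h1, -⟩ := hp
    refine ⟨_, _, hη.lie_mem_limClass hρ hε.le hh (hη.lift_mem_bFields hρ hZ), fun k y hy => ?_,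
      fun _ _ => rfl⟩
    exact (lie_eqOn hIY Z (h1 k) hy).trans
      (hη.lie_slice hρ hεc (conormalMinus.smooth hh.1) Z hy (ht0 k))

theorem IsCutoff.fibreLim_mem (hρ : IsBoundaryDefining (n := n) ρ) (hε : 0 < ε)
    (hεc : ε < c.width) (hη : c.IsCutoff ε η) (hμ : μ j = 0) {h : M → ℂ}
    (hh : h ∈ c.limClass η μ) :
    c.fibreLim h ∈ conormalMinus (n := d) (onFace ρ j ρ) (restr j μ) := by
  have hIY := hρ.isOpen_inner_onFace j
  intro m hm
  refine subset_conormal (S := {b | ∃ h ∈ c.limClass η μ,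
    EqOn b (c.fibreLim h) (inner (onFace ρ j ρ))}) ?_ ?_ ?_ ⟨h, hh, fun _ _ => rfl⟩
  · rintro b ⟨h, hh, e⟩
    exact (hη.fibreLim_smooth hρ hε hεc hμ hh).1.congr e
  · rintro b ⟨h, hh, e⟩ Z hZ
    refine ⟨_, hη.lie_mem_limClass hρ hε.le hh (hη.lift_mem_bFields hρ hZ), fun y hy => ?_⟩
    exact (lie_eqOn hIY Z e hy).trans ((hη.fibreLim_smooth hρ hε hεc hμ hh).2 Z hZ hy)
  · rintro b ⟨h, hh, e⟩
    obtain ⟨C, hC0, hC⟩ := hη.exists_fibreLim_bound hρ hε hεc hμ hh hm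
    obtain ⟨A, hA0, hA⟩ := conormal.bound (hh.1 (extExp j m (-1)) fun i => by
      simpa using extExp_lt (b := 0) hm (by rw [hμ]; norm_num) i)
    obtain ⟨K, hK, hKe⟩ := exists_rp_emb_le (c := c) hρ hεc (extExp j m (-1))
    -- The limit is compared with the value at t = ε, where any exponent at Y_j gives the same
    -- weight on the face up to a constant. The value -1 is an admissible choice.
    refine ⟨A * (K * ε ^ (-1 : ℝ)) + C * ε ^ (1 / 2 : ℝ), fun y hy => ?_⟩
    rw [e hy]
    have h1 := hC y hy ε ⟨hε, le_rfl⟩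
    have h2 := hA _ (emb_mem_inner (c := c) hρ hy ⟨hε, hεc⟩)
    have h3 := (hKe y hy ε ⟨hε, le_rfl⟩).1
    rw [extExp_self, restr_extExp] at h3
    have h4 : ‖c.fibreLim h y‖ ≤ ‖h (c.emb (y, ε))‖ + ‖h (c.emb (y, ε)) - c.fibreLim h y‖ := by
      have := norm_sub_le (h (c.emb (y, ε))) (h (c.emb (y, ε)) - c.fibreLim h y)
      rwa [sub_sub_cancel] at this
    calc ‖c.fibreLim h y‖ ≤ A * (K * (ε ^ (-1 : ℝ) * rp (onFace ρ j ρ) m y)) +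
          C * rp (onFace ρ j ρ) m y * ε ^ (1 / 2 : ℝ) :=
        h4.trans (add_le_add (h2.trans (mul_le_mul_of_nonneg_left h3 hA0)) h1)
      _ = _ := by ring

/-- Functions in the class whose limits along the fibres vanish are better by one order. -/
theorem IsCutoff.mem_of_fibreLim_eq_zero (hρ : IsBoundaryDefining (n := n) ρ) (hε : 0 < ε)
    (hεc : ε < c.width) (hη : c.IsCutoff ε η) (hμ : μ j = 0) {h : M → ℂ}
    (hh : h ∈ c.limClass η μ) (h0 : EqOn (c.fibreLim h) 0 (inner (onFace ρ j ρ))) :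
    h ∈ conormalMinus (n := n) ρ (μ + Pi.single j 1) := by
  have hI := hρ.isOpen_inner
  have hIY := hρ.isOpen_inner_onFace j
  intro m hm
  refine subset_conormal (S := {h | h ∈ c.limClass η μ ∧
    EqOn (c.fibreLim h) 0 (inner (onFace ρ j ρ))}) (fun h hh => conormalMinus.smooth hh.1.1)
    ?_ ?_ ⟨hh, h0⟩
  · rintro h ⟨hh, h0⟩ X hX
    have hXh := hη.lie_mem_limClass hρ hε.le hh hX
    refine ⟨hXh, fun y hy => ?_⟩
    -- Vanishing of the limit passes to derivatives along 𝒱_b. Along lifts the limit is a derivative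
    -- of the zero function, the radial derivative is O(t^{1/2}), and the coefficients are
    -- continuous up to the face.
    obtain ⟨s, R, hR, hgen⟩ := hη.exists_slab_generators hρ hεc
    obtain ⟨A, A₀, hA, hA₀, e⟩ := hgen X hX
    refine tendsto_nhds_unique (hη.tendsto_fibreLim hρ hε hεc hμ hXh hy) ?_
    have hAt : ∀ {g : M → ℝ}, ContMDiff (Q n) 𝓘(ℝ, ℝ) ∞ g →
        Tendsto (fun t => (g (c.emb (y, t)) : ℂ)) (𝓝[>] 0) (𝓝 (g (c.emb (y, 0)))) := by
      intro g hg
      have h1 := (c.continuousOn_emb hεc y hg.continuous) 0 ⟨le_rfl, hε.le⟩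
      have h2 : 𝓝[>] (0 : ℝ) ≤ 𝓝[Icc 0 ε] 0 :=
        le_inf nhdsWithin_le_nhds (le_principal_iff.2
          (mem_of_superset (Ioc_mem_nhdsGT hε) Ioc_subset_Icc_self))
      exact (Complex.continuous_ofReal.tendsto _).comp (h1.tendsto.mono_left h2)
    have hRt : ∀ a, Tendsto (fun t => lie (c.lift η (R a) 0) h (c.emb (y, t))) (𝓝[>] 0) (𝓝 0) := by
      intro a
      have h1 := hη.tendsto_fibreLim hρ hε hεc hμ (hη.lie_mem_limClass hρ hε.le hh
        (hη.lift_mem_bFields hρ (hR a))) hy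
      have h2 := (hη.fibreLim_smooth hρ hε hεc hμ hh).2 (R a) (hR a) hy
      have h3 : lie (R a) (c.fibreLim h) y = 0 := by
        rw [lie_eqOn hIY (R a) h0 hy]
        exact lie_const 0 y
      rwa [← h2, h3] at h1
    have hDt : Tendsto (fun t => lie (c.radial η) h (c.emb (y, t))) (𝓝[>] 0) (𝓝 0) := by
      obtain ⟨B, hB0, hB⟩ := conormal.bound (hh.2 (extExp j (fun k => restr j μ k - 1) (1 / 2))
        (extExp_lt (fun k => by simp) (by rw [hμ]; norm_num)))
      obtain ⟨K, hK, hKe⟩ := exists_rp_emb_le (c := c) hρ hεc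
        (extExp j (fun k => restr j μ k - 1) (1 / 2))
      have h1 := tendsto_rpow_half.const_mul
        (B * (K * rp (onFace ρ j ρ) (fun k => restr j μ k - 1) y))
      rw [mul_zero] at h1
      refine squeeze_zero_norm' ?_ h1
      filter_upwards [Ioc_mem_nhdsGT hε] with t ht
      have h2 := hB _ (emb_mem_inner (c := c) hρ hy ⟨ht.1, ht.2.trans_lt hεc⟩)
      have h3 := (hKe y hy t ht).1
      rw [restr_extExp, extExp_self] at h3
      calc _ ≤ B * (K * (t ^ (1 / 2 : ℝ) * rp (onFace ρ j ρ) (fun k => restr j μ k - 1) y)) :=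
            h2.trans (mul_le_mul_of_nonneg_left h3 hB0)
        _ = _ := by ring
    have h1 : Tendsto (fun t => ∑ a ∈ s, (A a (c.emb (y, t)) : ℂ) *
        lie (c.lift η (R a) 0) h (c.emb (y, t)) +
        (A₀ (c.emb (y, t)) : ℂ) * lie (c.radial η) h (c.emb (y, t))) (𝓝[>] 0)
        (𝓝 (∑ a ∈ s, (A a (c.emb (y, 0)) : ℂ) * 0 + (A₀ (c.emb (y, 0)) : ℂ) * 0)) :=
      (tendsto_finsetSum _ fun a _ => (hAt (hA a)).mul (hRt a)).add ((hAt hA₀).mul hDt)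
    simp only [mul_zero, Finset.sum_const_zero, add_zero] at h1
    refine h1.congr' ?_
    filter_upwards [Ioc_mem_nhdsGT hε] with t ht
    have hx := c.emb_mem_slab hεc y ⟨ht.1.le, ht.2⟩
    rw [e _ hx (emb_mem_inner (c := c) hρ hy ⟨ht.1, ht.2.trans_lt hεc⟩) h]
    congr 1
    refine Finset.sum_congr rfl fun a _ => ?_
    rw [lie_field_congr (hη.lift_eq (R a) 0 hx)]
  · rintro h ⟨hh, h0⟩
    -- Raising m_j to at least 1/2 makes the exponent positive, which integration from 0 with k = 0
    -- requires.
    set σ : ι → ℝ := Function.update m j (max (m j) (1 / 2)) with hσ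
    have hσlt : ∀ i, σ i < (μ + Pi.single j 1 : ι → ℝ) i := fun i => by
      by_cases hi : i = j
      · subst hi
        have := hm i
        simp only [hσ, Function.update_self]
        refine max_lt this ?_
        simp only [Pi.add_apply, Pi.single_eq_same, hμ]; norm_num
      · simp only [hσ, Function.update_of_ne hi]; exact hm i
    have hmσ : m ≤ σ := fun i => by
      by_cases hi : i = j
      · subst hi; simp [hσ]
      · simp [hσ, hi]
    obtain ⟨A, -, hA⟩ := conormal.bound (hh.1 (σ - Pi.single j 1) fun i => by
      have := hσlt i
      simp only [Pi.add_apply, Pi.sub_apply] at this ⊢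
      linarith)
    obtain ⟨B, -, hB⟩ := conormal.bound (hh.2 σ hσlt)
    obtain ⟨C, hC⟩ := hη.bound_of_gt hρ hε hεc (conormalMinus.smooth hh.1) (k := 0) zero_le_one hA
      (by rw [Complex.ofReal_zero, shifted_zero]; exact hB)
      (by simp only [hσ, Function.update_self]; exact lt_max_of_lt_right (by norm_num))
      (fun y hy => by
        have h1 := hη.tendsto_fibreLim hρ hε hεc hμ hh hy
        rw [h0 hy] at h1
        simpa using h1)
    obtain ⟨R, hR, hRe⟩ := exists_rp_le hmσ hρ.bounded
    refine ⟨max C 0 * R, fun x hx => (hC x hx).trans ?_⟩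
    rw [mul_assoc]
    exact mul_le_mul (le_max_left _ _) (hRe x hx) (rp_pos _ hx).le (le_max_right _ _)

end Collar

end FibreLimits

/-! ### Commutation and linearity of the radial operators -/

section RadialAlgebra

variable {n : ℕ} {ι : Type*} [Fintype ι]
  {X : Type*} [TopologicalSpace X] [ChartedSpace (EuclideanQuadrant n) X]
  [IsManifold (Q n) ∞ X] {ρ : ι → X → ℝ} {V : VField n X}

theorem smoothIn_shifted_iterate (hI : IsOpen (inner ρ)) (hV : SmoothVField V) (a : ℂ) {f : X → ℂ}
    (hf : SmoothIn n ρ f) (i : ℕ) : SmoothIn n ρ ((shifted V a)^[i] f) := by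
  induction i with
  | zero => exact hf
  | succ i ih => rw [Function.iterate_succ_apply']; exact smoothIn_shifted hI hV a ih

theorem shifted_comm (hI : IsOpen (inner ρ)) (hV : SmoothVField V) (a a' : ℂ) {f : X → ℂ}
    (hf : SmoothIn n ρ f) :
    EqOn (shifted V a (shifted V a' f)) (shifted V a' (shifted V a f)) (inner ρ) := by
  intro x hx
  have h1 := SmoothIn.mdiff hI hf hx
  have h2 := SmoothIn.mdiff hI (hV.lie hI hf) hx
  have e1 := lie_shifted (Y := V) (c := a) h1 h2
  have e2 := lie_shifted (Y := V) (c := a') h1 h2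
  change lie V (shifted V a' f) x - a * shifted V a' f x =
    lie V (shifted V a f) x - a' * shifted V a f x
  rw [e1, e2]
  simp only [shifted]; ring

theorem shifted_iterate_comm (hI : IsOpen (inner ρ)) (hV : SmoothVField V) (a a' : ℂ) (i : ℕ)
    {f : X → ℂ} (hf : SmoothIn n ρ f) :
    EqOn (shifted V a ((shifted V a')^[i] f)) ((shifted V a')^[i] (shifted V a f)) (inner ρ) := by
  induction i with
  | zero => exact fun _ _ => rfl
  | succ i ih =>
    simp only [Function.iterate_succ_apply']
    exact (shifted_comm hI hV a a' (smoothIn_shifted_iterate hI hV a' hf i)).trans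
      (shifted_eqOn hI V a' ih)

theorem shifted_radialProd_comm (hI : IsOpen (inner ρ)) (hV : SmoothVField V) (a : ℂ) (q : ℕ)
    {f : X → ℂ} (hf : SmoothIn n ρ f) :
    EqOn (shifted V a (radialProd V q f)) (radialProd V q (shifted V a f)) (inner ρ) := by
  induction q with
  | zero => exact fun _ _ => rfl
  | succ q ih =>
    simp only [radialProd_succ]
    exact (shifted_iterate_comm hI hV a q (q + 1) (smoothIn_radialProd hI hV hf q)).trans
      (shifted_iterate_eqOn hI V _ ih _)

theorem iterate_radialProd_comm (hI : IsOpen (inner ρ)) (hV : SmoothVField V) (a : ℂ) (q i : ℕ)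
    {f : X → ℂ} (hf : SmoothIn n ρ f) :
    EqOn ((shifted V a)^[i] (radialProd V q f)) (radialProd V q ((shifted V a)^[i] f))
      (inner ρ) := by
  induction i with
  | zero => exact fun _ _ => rfl
  | succ i ih =>
    simp only [Function.iterate_succ_apply']
    exact (shifted_eqOn hI V a ih).trans
      (shifted_radialProd_comm hI hV a q (smoothIn_shifted_iterate hI hV a hf i))

theorem shifted_iterate_sub (hI : IsOpen (inner ρ)) (hV : SmoothVField V) (a : ℂ) (i : ℕ)
    {f g : X → ℂ} (hf : SmoothIn n ρ f) (hg : SmoothIn n ρ g) :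
    EqOn ((shifted V a)^[i] fun x => f x - g x)
      (fun x => (shifted V a)^[i] f x - (shifted V a)^[i] g x) (inner ρ) := by
  induction i with
  | zero => exact fun _ _ => rfl
  | succ i ih =>
    intro x hx
    simp only [Function.iterate_succ_apply']
    rw [shifted_eqOn hI V a ih hx]
    simp only [shifted]
    rw [lie_sub (SmoothIn.mdiff hI (smoothIn_shifted_iterate hI hV a hf i) hx)
      (SmoothIn.mdiff hI (smoothIn_shifted_iterate hI hV a hg i) hx)]
    ring

theorem radialProd_sub (hI : IsOpen (inner ρ)) (hV : SmoothVField V) (q : ℕ)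
    {f g : X → ℂ} (hf : SmoothIn n ρ f) (hg : SmoothIn n ρ g) :
    EqOn (radialProd V q fun x => f x - g x)
      (fun x => radialProd V q f x - radialProd V q g x) (inner ρ) := by
  induction q with
  | zero => exact fun _ _ => rfl
  | succ q ih =>
    simp only [radialProd_succ]
    exact (shifted_iterate_eqOn hI V _ ih _).trans
      (shifted_iterate_sub hI hV _ _ (smoothIn_radialProd hI hV hf q)
        (smoothIn_radialProd hI hV hg q))

theorem radialProd_zero_fun (V : VField n X) (q : ℕ) :
    radialProd V q (fun _ => 0) = fun _ => 0 := by
  have h : ∀ (a : ℂ) (i : ℕ), (shifted V a)^[i] (fun _ => 0) = fun _ => 0 := by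
    intro a i
    induction i with
    | zero => rfl
    | succ i ih =>
      rw [Function.iterate_succ_apply', ih]
      funext x
      simp only [shifted, mul_zero, sub_zero]
      exact lie_const 0 x
  induction q with
  | zero => rfl
  | succ q ih => rw [radialProd_succ, ih, h]

theorem radialProd_sum (hI : IsOpen (inner ρ)) (hV : SmoothVField V) (q : ℕ) {A : Type*}
    (s : Finset A) {f : A → X → ℂ} (hf : ∀ a ∈ s, SmoothIn n ρ (f a)) :
    EqOn (radialProd V q fun x => ∑ a ∈ s, f a x)
      (fun x => ∑ a ∈ s, radialProd V q (f a) x) (inner ρ) := by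
  classical
  have hsum : ∀ {t : Finset A} {f : A → X → ℂ}, (∀ a ∈ t, SmoothIn n ρ (f a)) →
      SmoothIn n ρ fun x => ∑ a ∈ t, f a x := fun h => contMDiffOn_finsetSum h
  induction s using Finset.induction_on with
  | empty => intro x _; simp [radialProd_zero_fun]
  | insert a s ha ih =>
    intro x hx
    have h2 := hsum fun i hi => hf i (Finset.mem_insert_of_mem hi)
    have h0 : SmoothIn n ρ (fun _ => (0 : ℂ)) := contMDiffOn_const
    -- The sum is written with differences, so that compatibility with subtraction suffices.
    have e1 : EqOn (fun x => ∑ i ∈ insert a s, f i x)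
        (fun x => f a x - (0 - ∑ i ∈ s, f i x)) (inner ρ) := fun x _ => by
      simp only [Finset.sum_insert ha]; ring
    have e2 := radialProd_sub hI hV q (hf a (Finset.mem_insert_self a s)) (h0.sub h2) hx
    have e3 := radialProd_sub hI hV q h0 h2 hx
    have e4 := ih (fun i hi => hf i (Finset.mem_insert_of_mem hi)) hx
    rw [radialProd_zero_fun] at e3
    simp only at e2 e3 e4
    rw [radialProd_eqOn hI V e1 q hx, e2]
    refine (congrArg (radialProd V q (f a) x - ·) e3).trans ?_
    simp only [e4, Finset.sum_insert ha]
    ring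

end RadialAlgebra

/-! ### The action of the radial operators on the terms of expansions -/

section Terms

variable {n d : ℕ} {ι : Type*} [Fintype ι] [DecidableEq ι]
  {M : Type*} [TopologicalSpace M] [ChartedSpace (EuclideanQuadrant n) M]
  [IsManifold (Q n) ∞ M] [CompactSpace M] [T2Space M]
  {ρ : ι → M → ℝ} {j : ι} [ChartedSpace (EuclideanQuadrant d) (face ρ j)]
  [IsManifold (Q d) ∞ (face ρ j)] {c : Collar (n := n) (d := d) ρ j} {ε : ℝ} {η : M → ℝ}
  {μ : ι → ℝ} {χ : ℝ → ℝ}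

theorem conormalMinus.of_eventually_inner (hρ : IsBoundaryDefining (n := n) ρ) {m : ι → ℝ}
    {w : M → ℂ} (hw : w ∈ conormalMinus (n := n) ρ m)
    (h0 : ∀ᶠ x in 𝓝ˢ (face ρ j), x ∈ inner ρ → w x = 0) (N : ℕ) :
    w ∈ conormalMinus (n := n) ρ (m + Pi.single j (N : ℝ)) := by
  classical
  have hI := hρ.isOpen_inner
  have e : EqOn ((inner ρ).indicator w) w (inner ρ) := fun x hx => indicator_of_mem hx w
  refine conormalMinus.congr hI (conormalMinus.of_eventually hρ (conormalMinus.congr hI hw e) ?_ N)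
    e.symm
  filter_upwards [h0] with x hx
  by_cases h : x ∈ inner ρ
  · rw [e h, hx h]
  · exact indicator_of_notMem h w

namespace Collar

open Polynomial in
/-- Near the face `f` is `ρ_j^k p(log ρ_j)` times the pull-back of `b`. -/
def TermLike (c : Collar (n := n) (d := d) ρ j) (k : ℕ) (p : ℝ[X]) (b : face ρ j → ℂ)
    (f : M → ℂ) : Prop :=
  ∀ᶠ x in 𝓝ˢ (face ρ j), x ∈ inner ρ →
    f x = ((ρ j x ^ k * p.eval (Real.log (ρ j x)) : ℝ) : ℂ) * b (c.proj x)

/-- The terms of the expansion. -/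
def term (c : Collar (n := n) (d := d) ρ j) (χ : ℝ → ℝ) (k l : ℕ) (b : face ρ j → ℂ) (x : M) : ℂ :=
  ((ρ j x ^ k * Real.log (ρ j x) ^ l : ℝ) : ℂ) * c.extend χ b x

theorem termLike_term (hρ : IsBoundaryDefining (n := n) ρ) (hε : 0 < ε)
    (hχ : IsProfile ε χ) (k l : ℕ) (b : face ρ j → ℂ) :
    c.TermLike k (Polynomial.X ^ l) b (c.term χ k l b) := by
  filter_upwards [eventually_bump_eq_one (c := c) hρ hε hχ] with x hx _
  simp [term, extend_eq, hx]

theorem term_mem (hρ : IsBoundaryDefining (n := n) ρ) (hεc : ε < c.width)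
    (hχ : IsProfile ε χ) (hμ : μ j = 0) {b : face ρ j → ℂ}
    (hb : b ∈ conormalMinus (n := d) (onFace ρ j ρ) (restr j μ)) (k l : ℕ) :
    c.term χ k l b ∈ conormalMinus (n := n) ρ (μ + Pi.single j (k : ℝ)) := by
  refine conormalMinus.congr hρ.isOpen_inner (conormalMinus.pow_mul hρ (conormalMinus.log_pow_mul hρ
    (extend_mem_conormalMinus hρ hεc hχ hμ hb) j l) j k) fun x _ => ?_
  simp only [term]
  push_cast; ring

theorem IsCutoff.lieReal_radial_rho (hρ : IsBoundaryDefining (n := n) ρ) (hη : c.IsCutoff ε η)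
    {x : M} (hx : x ∈ c.slab ε) : lieReal (c.radial η) (ρ j) x = ρ j x := by
  unfold radial
  rw [lieReal_field_smul, lieReal_field_congr (hη.lift_eq 0 1 hx), c.lieReal_push_rho hρ 0 1 hx.1,
    mul_one]

theorem IsCutoff.lie_radial_comp_proj (hρ : IsBoundaryDefining (n := n) ρ) (hη : c.IsCutoff ε η)
    {b : face ρ j → ℂ} (hb : SmoothIn d (onFace ρ j ρ) b)
    {x : M} (hx : x ∈ c.slab ε) (hxI : x ∈ inner ρ) :
    lie (c.radial η) (fun x => b (c.proj x)) x = 0 := by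
  rw [hη.lie_radial hx, lie_push_comp_proj hρ hb 0 1 hx.1 hxI, lie_zero_field, mul_zero]

open Polynomial in
-- D annihilates b ∘ π, acts on ρ_j^k as multiplication by k, and acts on p(log ρ_j) as
-- differentiation of p.
theorem TermLike.shifted (hρ : IsBoundaryDefining (n := n) ρ) (hε : 0 < ε) (hη : c.IsCutoff ε η)
    {k : ℕ} {p : ℝ[X]} {b : face ρ j → ℂ} (hb : SmoothIn d (onFace ρ j ρ) b) {f : M → ℂ}
    (hf : c.TermLike k p b f) (a : ℕ) :
    c.TermLike k (C ((k : ℝ) - a) * p + derivative p) b (shifted (c.radial η) (a : ℂ) f) := by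
  obtain ⟨W, hW, hsW, hWP⟩ := eventually_nhdsSet_iff_exists.1 hf
  filter_upwards [hW.mem_nhdsSet.2 hsW, slab_mem_nhdsSet (c := c) hρ hε] with x hxW hxs hxI
  have hev : f =ᶠ[𝓝 x] fun x =>
      ((ρ j x ^ k * p.eval (Real.log (ρ j x)) : ℝ) : ℂ) * b (c.proj x) := by
    filter_upwards [hW.mem_nhds hxW, hρ.isOpen_inner.mem_nhds hxI] with z hz hzI using hWP z hz hzI
  have hr := hxI j
  have hder : HasDerivAt (fun t : ℝ => t ^ k * p.eval (Real.log t))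
      ((k : ℝ) * ρ j x ^ (k - 1) * p.eval (Real.log (ρ j x)) +
        ρ j x ^ k * ((derivative p).eval (Real.log (ρ j x)) * (ρ j x)⁻¹)) (ρ j x) :=
    (hasDerivAt_pow k _).mul ((p.hasDerivAt _).comp _ (Real.hasDerivAt_log hr.ne'))
  have hm : MDifferentiableAt (Q n) 𝓘(ℝ, ℝ)
      (fun x => ρ j x ^ k * p.eval (Real.log (ρ j x))) x :=
    (hder.differentiableAt.mdifferentiableAt).comp x (contMDiff_mdiff (hρ.smooth j) x)
  have hb' : MDifferentiableAt (Q n) 𝓘(ℝ, ℂ) (fun x => b (c.proj x)) x :=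
    (SmoothIn.mdiff (hρ.isOpen_inner_onFace j) hb (proj_mem hρ hxs.1 hxI)).comp x
      (c.mdiff_proj hρ hxs.1)
  simp only [Corners.shifted]
  rw [lie_congr hev, hev.self_of_nhds, lie_real_mul hm hb', hη.lie_radial_comp_proj hρ hb hxs hxI,
    lieReal_comp (contMDiff_mdiff (hρ.smooth j) x) hder, hη.lieReal_radial_rho hρ hxs]
  have e1 : (k : ℝ) * ρ j x ^ (k - 1) * ρ j x = k * ρ j x ^ k := by
    rcases k with _ | k
    · simp
    · rw [Nat.add_sub_cancel, pow_succ]; ring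
  have e2 : ((k : ℝ) * ρ j x ^ (k - 1) * p.eval (Real.log (ρ j x)) +
        ρ j x ^ k * ((derivative p).eval (Real.log (ρ j x)) * (ρ j x)⁻¹)) * ρ j x =
      k * ρ j x ^ k * p.eval (Real.log (ρ j x)) +
        ρ j x ^ k * (derivative p).eval (Real.log (ρ j x)) := by
    have h3 : (ρ j x)⁻¹ * ρ j x = 1 := inv_mul_cancel₀ hr.ne'
    calc _ = (k : ℝ) * ρ j x ^ (k - 1) * ρ j x * p.eval (Real.log (ρ j x)) +
          ρ j x ^ k * (derivative p).eval (Real.log (ρ j x)) * ((ρ j x)⁻¹ * ρ j x) := by ring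
      _ = _ := by rw [e1, h3]; ring
  rw [e2]
  simp only [eval_add, eval_mul, eval_C]
  push_cast; ring

open Polynomial in
theorem TermLike.shifted_iterate (hρ : IsBoundaryDefining (n := n) ρ) (hε : 0 < ε)
    (hη : c.IsCutoff ε η) {k : ℕ} {p : ℝ[X]} {b : face ρ j → ℂ}
    (hb : SmoothIn d (onFace ρ j ρ) b) {f : M → ℂ} (hf : c.TermLike k p b f) (i : ℕ) :
    c.TermLike k (derivative^[i] p) b ((Corners.shifted (c.radial η) (k : ℂ))^[i] f) := by
  induction i with
  | zero => exact hf
  | succ i ih =>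
    rw [Function.iterate_succ_apply', Function.iterate_succ_apply']
    have := ih.shifted hρ hε hη hb k
    rwa [sub_self, C_0, zero_mul, zero_add] at this

open Polynomial in
theorem TermLike.exists_iterate (hρ : IsBoundaryDefining (n := n) ρ) (hε : 0 < ε)
    (hη : c.IsCutoff ε η) {k : ℕ} {p : ℝ[X]} {b : face ρ j → ℂ}
    (hb : SmoothIn d (onFace ρ j ρ) b) {f : M → ℂ} (hf : c.TermLike k p b f) (a i : ℕ) :
    ∃ p' : ℝ[X], p'.natDegree ≤ p.natDegree ∧
      c.TermLike k p' b ((Corners.shifted (c.radial η) (a : ℂ))^[i] f) := by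
  induction i with
  | zero => exact ⟨p, le_rfl, hf⟩
  | succ i ih =>
    obtain ⟨p', hp', h⟩ := ih
    rw [Function.iterate_succ_apply']
    refine ⟨_, ?_, h.shifted hρ hε hη hb a⟩
    refine (natDegree_add_le _ _).trans (max_le ((natDegree_C_mul_le _ _).trans hp') ?_)
    exact (natDegree_derivative_le p').trans ((Nat.sub_le _ _).trans hp')

open Polynomial in
-- The factors D - a with a ≠ k do not raise the degree of the polynomial in log ρ_j, and
-- (D-k)^{k+1} differentiates it k+1 times. So degree at most k is exactly what is annihilated.
theorem TermLike.radialProd (hρ : IsBoundaryDefining (n := n) ρ) (hε : 0 < ε)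
    (hη : c.IsCutoff ε η) {k : ℕ} {p : ℝ[X]} {b : face ρ j → ℂ}
    (hb : SmoothIn d (onFace ρ j ρ) b) {f : M → ℂ} (hf : c.TermLike k p b f)
    (hp : p.natDegree ≤ k) (q : ℕ) :
    ∃ p' : ℝ[X], p'.natDegree ≤ k ∧ (k < q → p' = 0) ∧
      c.TermLike k p' b (Corners.radialProd (c.radial η) q f) := by
  induction q with
  | zero => exact ⟨p, hp, fun h => absurd h (Nat.not_lt_zero k), hf⟩
  | succ q ih =>
    obtain ⟨p', hp', h0, h⟩ := ih
    rw [radialProd_succ]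
    rcases eq_or_ne k q with rfl | hkq
    · refine ⟨0, by simp, fun _ => rfl, ?_⟩
      have := h.shifted_iterate hρ hε hη hb (k + 1)
      rwa [iterate_derivative_eq_zero (Nat.lt_succ_of_le hp')] at this
    · by_cases hlt : k < q
      · rw [h0 hlt] at h
        refine ⟨0, by simp, fun _ => rfl, ?_⟩
        have : ∀ i, c.TermLike k 0 b ((Corners.shifted (c.radial η) (q : ℂ))^[i]
            (Corners.radialProd (c.radial η) q f)) := by
          intro i
          induction i with
          | zero => exact h
          | succ i ih =>
            rw [Function.iterate_succ_apply']
            have := ih.shifted hρ hε hη hb q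
            rwa [mul_zero, derivative_zero, add_zero] at this
        exact this _
      · obtain ⟨p'', h1, h2⟩ := h.exists_iterate hρ hε hη hb q (q + 1)
        exact ⟨p'', h1.trans hp', fun h => by omega, h2⟩

/-- The radial operators annihilate the terms of the expansion near the face. -/
theorem IsCutoff.radialProd_term_mem (hρ : IsBoundaryDefining (n := n) ρ) (hε : 0 < ε)
    (hεc : ε < c.width) (hη : c.IsCutoff ε η) (hχ : IsProfile ε χ) (hμ : μ j = 0)
    {b : face ρ j → ℂ} (hb : b ∈ conormalMinus (n := d) (onFace ρ j ρ) (restr j μ)) {k l q : ℕ}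
    (hlk : l ≤ k) (hkq : k < q) (N : ℕ) :
    radialProd (c.radial η) q (c.term χ k l b) ∈
      conormalMinus (n := n) ρ (μ + Pi.single j (N : ℝ)) := by
  obtain ⟨p', -, h0, h⟩ := (termLike_term (c := c) hρ hε hχ k l b).radialProd hρ hε hη
    (conormalMinus.smooth hb) ((Polynomial.natDegree_X_pow_le l).trans hlk) q
  rw [h0 hkq] at h
  -- Nothing is left near Y_j, where χ = 1. What the cutoff leaves away from the face has every
  -- order N.
  refine conormalMinus.of_eventually_inner hρ (j := j) (conormalMinus.radialProd hρ
    (conormalMinus.mono ?_ (term_mem hρ hεc hχ hμ hb k l)) (hη.isWeaklyRadial hρ hε.le).1 q) ?_ N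
  · exact le_add_of_nonneg_right (Pi.single_nonneg.2 (Nat.cast_nonneg k))
  · filter_upwards [h] with x hx hxI
    rw [hx hxI]; simp

end Collar

end Terms

/-! ### Construction of expansions -/

section Expansion

variable {n d : ℕ} {ι : Type*} [Fintype ι] [DecidableEq ι]
  {M : Type*} [TopologicalSpace M] [ChartedSpace (EuclideanQuadrant n) M]
  [IsManifold (Q n) ∞ M] [CompactSpace M] [T2Space M]
  {ρ : ι → M → ℝ} {j : ι} [ChartedSpace (EuclideanQuadrant d) (face ρ j)]
  [IsManifold (Q d) ∞ (face ρ j)] {c : Collar (n := n) (d := d) ρ j} {ε : ℝ} {η : M → ℝ}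
  {μ : ι → ℝ} {χ : ℝ → ℝ}

namespace Collar

theorem term_emb {t : ℝ} (ht : t ∈ Ico 0 c.width) (k l : ℕ) (b : face ρ j → ℂ) (y : face ρ j) :
    c.term χ k l b (c.emb (y, t)) = ((t ^ k * Real.log t ^ l * χ t : ℝ) : ℂ) * b y := by
  simp only [term, extend_eq, c.rho_emb y t ht, c.proj_emb y t ht, bump_emb χ y ht]
  push_cast; ring

theorem IsCutoff.tendsto_term (hε : 0 < ε) (hεc : ε < c.width) (hχ : IsProfile ε χ)
    (b : face ρ j → ℂ) (y : face ρ j) :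
    Tendsto (fun t => c.term χ 0 0 b (c.emb (y, t))) (𝓝[>] 0) (𝓝 (b y)) := by
  refine tendsto_const_nhds.congr' ?_
  filter_upwards [Ioc_mem_nhdsGT (half_pos hε)] with t ht
  have htw : t ∈ Ico 0 c.width :=
    ⟨ht.1.le, (ht.2.trans (half_le_self hε.le)).trans_lt hεc⟩
  rw [term_emb htw, hχ.one t ⟨ht.1.le, ht.2⟩]
  simp

/-- Extraction of the leading coefficient. -/
theorem IsCutoff.exists_coefficient (hρ : IsBoundaryDefining (n := n) ρ) (hε : 0 < ε)
    (hεc : ε < c.width) (hη : c.IsCutoff ε η) (hχ : IsProfile ε χ) (hμ : μ j = 0) {q : ℕ}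
    {G : M → ℂ} (hG : G ∈ conormalMinus (n := n) ρ (μ + Pi.single j (q : ℝ)))
    (hG' : shifted (c.radial η) (q : ℂ) G ∈
      conormalMinus (n := n) ρ (μ + Pi.single j ((q + 1 : ℕ) : ℝ))) :
    ∃ b ∈ conormalMinus (n := d) (onFace ρ j ρ) (restr j μ),
      (fun x => G x - c.term χ q 0 b x) ∈
        conormalMinus (n := n) ρ (μ + Pi.single j ((q + 1 : ℕ) : ℝ)) := by
  have hI := hρ.isOpen_inner
  have hD := hη.isWeaklyRadial hρ hε.le
  obtain ⟨k, hk, ek⟩ := hD.exists_lieReal_rho hρ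
  -- After division by ρ_j^q the equation for D - q becomes one for D: Dh = ρ_j^{-q}(D-q)G up to an
  -- error with one factor ρ_j. So h has a limit along the fibres, which is the coefficient.
  set h : M → ℂ := fun x => ((ρ j x ^ (-(q : ℝ)) : ℝ) : ℂ) * G x with hh
  have hGs := conormalMinus.smooth hG
  have eμ : μ + Pi.single j (q : ℝ) + Pi.single j (-(q : ℝ)) = μ := by
    rw [add_assoc, ← Pi.single_add, add_neg_cancel, Pi.single_zero, add_zero]
  have eμ1 : μ + Pi.single j ((q + 1 : ℕ) : ℝ) + Pi.single j (-(q : ℝ)) = μ + Pi.single j 1 := by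
    rw [add_assoc, ← Pi.single_add]; congr 2; push_cast; ring
  have eμ2 : μ + Pi.single j 1 + Pi.single j (q : ℝ) = μ + Pi.single j ((q + 1 : ℕ) : ℝ) := by
    rw [add_assoc, ← Pi.single_add]; congr 2; push_cast; ring
  have h1 : h ∈ conormalMinus (n := n) ρ μ := by
    have := conormalMinus.rpow_mul hρ hG j (-(q : ℝ))
    rwa [eμ] at this
  have h2 : lie (c.radial η) h ∈ conormalMinus (n := n) ρ (μ + Pi.single j 1) := by
    have e1 := conormalMinus.rpow_mul hρ hG' j (-(q : ℝ))
    rw [eμ1] at e1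
    have e2 := conormalMinus.const_mul hI (conormalMinus.rho_mul hρ
      (conormalMinus.ofReal_mul hρ h1 hk) j) (-(q : ℂ))
    refine conormalMinus.congr hI (conormalMinus.add hI e1 e2) fun x hx => ?_
    have hr := hx j
    rw [hh, lie_real_mul (mdiffAt_of_contMDiffOn hI (contMDiffOn_rpow hρ j _) hx)
      (SmoothIn.mdiff hI hGs hx), lieReal_rpow hρ _ j _ hx, ek]
    have e3 : -(q : ℝ) * ρ j x ^ (-(q : ℝ) - 1) * (ρ j x + ρ j x ^ 2 * k x) =
        -(q : ℝ) * ρ j x ^ (-(q : ℝ)) * (1 + ρ j x * k x) := by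
      rw [Real.rpow_sub_one hr.ne']
      field_simp
    rw [e3]
    simp only [shifted]
    push_cast; ring
  have hhc : h ∈ c.limClass η μ := ⟨h1, h2⟩
  have hb := hη.fibreLim_mem hρ hε hεc hμ hhc
  set b := c.fibreLim h with hbdef
  have ht := term_mem hρ hεc hχ hμ hb 0 0
  rw [Nat.cast_zero, Pi.single_zero, add_zero] at ht
  have htD : lie (c.radial η) (c.term χ 0 0 b) ∈
      conormalMinus (n := n) ρ (μ + Pi.single j 1) := by
    have h3 := (termLike_term (c := c) hρ hε hχ 0 0 b).shifted hρ hε hη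
      (conormalMinus.smooth hb) 0
    rw [show ((0 : ℕ) : ℂ) = 0 from Nat.cast_zero, shifted_zero] at h3
    have := conormalMinus.of_eventually_inner hρ (j := j) (conormalMinus.lie hI ht hD.1) ?_ 1
    · rwa [Nat.cast_one] at this
    · filter_upwards [h3] with x hx hxI
      rw [hx hxI]; simp
  have hh' : (fun x => h x - c.term χ 0 0 b x) ∈ c.limClass η μ :=
    ⟨conormalMinus.sub hI h1 ht, conormalMinus.congr hI (conormalMinus.sub hI h2 htD) fun x hx =>
      lie_sub (SmoothIn.mdiff hI (conormalMinus.smooth h1) hx)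
        (SmoothIn.mdiff hI (conormalMinus.smooth ht) hx)⟩
  -- Subtracting the extension of the limit leaves a function with limit 0, which gains one order at
  -- Y_j. Multiplication by ρ_j^q then returns to G.
  have h3 := hη.mem_of_fibreLim_eq_zero hρ hε hεc hμ hh' fun y hy => by
    refine tendsto_nhds_unique (hη.tendsto_fibreLim hρ hε hεc hμ hh' hy) ?_
    have := (hη.tendsto_fibreLim hρ hε hεc hμ hhc hy).sub
      (IsCutoff.tendsto_term (c := c) hε hεc hχ b y)
    rwa [← hbdef, sub_self] at this
  refine ⟨b, hb, ?_⟩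
  have h4 := conormalMinus.pow_mul hρ h3 j q
  rw [eμ2] at h4
  refine conormalMinus.congr hI h4 fun x hx => ?_
  have e : ρ j x ^ q * ρ j x ^ (-(q : ℝ)) = 1 := by
    rw [← Real.rpow_natCast, ← Real.rpow_add (hx j), add_neg_cancel, Real.rpow_zero]
  have e' : ((ρ j x ^ q : ℝ) : ℂ) * ((ρ j x ^ (-(q : ℝ)) : ℝ) : ℂ) = 1 := by
    rw [← Complex.ofReal_mul, e, Complex.ofReal_one]
  simp only [hh, term]
  push_cast at e' ⊢
  linear_combination (-G x) * e'

/-- Extraction of all the coefficients of order `q`. -/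
theorem IsCutoff.exists_coefficients (hρ : IsBoundaryDefining (n := n) ρ) (hε : 0 < ε)
    (hεc : ε < c.width) (hη : c.IsCutoff ε η) (hχ : IsProfile ε χ) (hμ : μ j = 0) {q : ℕ} (L : ℕ)
    {e : M → ℂ} (he : e ∈ conormalMinus (n := n) ρ (μ + Pi.single j (q : ℝ)))
    (he' : (shifted (c.radial η) (q : ℂ))^[L] e ∈
      conormalMinus (n := n) ρ (μ + Pi.single j ((q + 1 : ℕ) : ℝ))) :
    ∃ b : ℕ → face ρ j → ℂ, (∀ l, b l ∈ conormalMinus (n := d) (onFace ρ j ρ) (restr j μ)) ∧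
      (fun x => e x - ∑ l ∈ Finset.range L, c.term χ q l (b l) x) ∈
        conormalMinus (n := n) ρ (μ + Pi.single j ((q + 1 : ℕ) : ℝ)) := by
  have hI := hρ.isOpen_inner
  have hIY := hρ.isOpen_inner_onFace j
  have hD := (hη.isWeaklyRadial hρ hε.le).1
  induction L generalizing e with
  | zero => exact ⟨fun _ _ => 0, fun _ => zero_mem_conormalMinus _, by simpa using he'⟩
  | succ L ih =>
    rw [Function.iterate_succ_apply'] at he'
    obtain ⟨b, hb, h⟩ := hη.exists_coefficient hρ hε hεc hχ hμ
      (conormalMinus.shifted_iterate hρ he hD _ L) he'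
    -- Near the face (D-q)^L maps ρ_j^q (log ρ_j)^L to L! ρ_j^q. The coefficient b found for (D-q)^L
    -- e is therefore that of L! times the highest logarithmic term, whose removal lowers L by one.
    set a : ℂ := ((L.factorial : ℂ))⁻¹ with ha
    have hab := conormalMinus.const_mul hIY hb a
    have ht := term_mem hρ hεc hχ hμ hab q L
    have hdiff : (fun x => (shifted (c.radial η) (q : ℂ))^[L] (c.term χ q L fun y => a * b y) x -
        c.term χ q 0 b x) ∈ conormalMinus (n := n) ρ (μ + Pi.single j ((q + 1 : ℕ) : ℝ)) := by
      have h1 := (termLike_term (c := c) hρ hε hχ q L fun y => a * b y).shifted_iterate hρ hε hη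
        (conormalMinus.smooth hab) L
      have h2 := termLike_term (c := c) hρ hε hχ q 0 b
      have h3 := conormalMinus.of_eventually_inner hρ (j := j) (conormalMinus.sub hI
        (conormalMinus.shifted_iterate hρ ht hD (q : ℂ) L) (term_mem hρ hεc hχ hμ hb q 0)) ?_ 1
      · rwa [add_assoc, ← Pi.single_add, ← Nat.cast_add] at h3
      · filter_upwards [h1, h2] with x hx1 hx2 hxI
        rw [hx1 hxI, hx2 hxI, Polynomial.iterate_derivative_X_pow_eq_natCast_mul]
        have hL : (L.factorial : ℂ) ≠ 0 := by exact_mod_cast L.factorial_ne_zero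
        simp only [Nat.descFactorial_self, Nat.sub_self, pow_zero, mul_one, Polynomial.eval_natCast,
          Polynomial.eval_one, ha]
        push_cast
        field_simp
        ring
    have hstep : (shifted (c.radial η) (q : ℂ))^[L]
        (fun x => e x - c.term χ q L (fun y => a * b y) x) ∈
        conormalMinus (n := n) ρ (μ + Pi.single j ((q + 1 : ℕ) : ℝ)) := by
      refine conormalMinus.congr hI (conormalMinus.sub hI h hdiff) fun x hx => ?_
      rw [shifted_iterate_sub hI hD.1 _ L (conormalMinus.smooth he) (conormalMinus.smooth ht) hx]
      ring
    obtain ⟨b', hb', h'⟩ := ih (conormalMinus.sub hI he ht) hstep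
    refine ⟨Function.update b' L fun y => a * b y, fun l => ?_, ?_⟩
    · by_cases hl : l = L
      · subst hl; rw [Function.update_self]; exact hab
      · rw [Function.update_of_ne hl]; exact hb' l
    · refine conormalMinus.congr hI h' fun x _ => ?_
      simp only [Finset.sum_range_succ, Function.update_self]
      have : ∑ l ∈ Finset.range L, c.term χ q l (Function.update b' L (fun y => a * b y) l) x =
          ∑ l ∈ Finset.range L, c.term χ q l (b' l) x :=
        Finset.sum_congr rfl fun l hl => by
          rw [Function.update_of_ne (Finset.mem_range.1 hl).ne]
      rw [this]; ring

/-- The partial sums of the expansion. -/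
def partialSum (c : Collar (n := n) (d := d) ρ j) (χ : ℝ → ℝ) (b : ℕ → ℕ → face ρ j → ℂ) (q : ℕ)
    (x : M) : ℂ := ∑ k ∈ Finset.range q, ∑ l ∈ Finset.range (k + 1), c.term χ k l (b k l) x

theorem smoothIn_term (hρ : IsBoundaryDefining (n := n) ρ) (hεc : ε < c.width)
    (hχ : IsProfile ε χ) (hμ : μ j = 0) {b : face ρ j → ℂ}
    (hb : b ∈ conormalMinus (n := d) (onFace ρ j ρ) (restr j μ)) (k l : ℕ) :
    SmoothIn n ρ (c.term χ k l b) := conormalMinus.smooth (term_mem hρ hεc hχ hμ hb k l)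

theorem IsCutoff.radialProd_partialSum_mem (hρ : IsBoundaryDefining (n := n) ρ) (hε : 0 < ε)
    (hεc : ε < c.width) (hη : c.IsCutoff ε η) (hχ : IsProfile ε χ) (hμ : μ j = 0)
    {b : ℕ → ℕ → face ρ j → ℂ} {q r : ℕ}
    (hb : ∀ k < q, ∀ l ≤ k, b k l ∈ conormalMinus (n := d) (onFace ρ j ρ) (restr j μ))
    (hqr : q ≤ r) (N : ℕ) :
    SmoothIn n ρ (c.partialSum χ b q) ∧ radialProd (c.radial η) r (c.partialSum χ b q) ∈
      conormalMinus (n := n) ρ (μ + Pi.single j (N : ℝ)) := by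
  have hI := hρ.isOpen_inner
  have hD := (hη.isWeaklyRadial hρ hε.le).1.1
  have hs : ∀ k ∈ Finset.range q, ∀ l ∈ Finset.range (k + 1),
      SmoothIn n ρ (c.term χ k l (b k l)) := fun k hk l hl =>
    smoothIn_term hρ hεc hχ hμ (hb k (Finset.mem_range.1 hk) l
      (Nat.lt_succ_iff.1 (Finset.mem_range.1 hl))) k l
  have hs' : ∀ k ∈ Finset.range q,
      SmoothIn n ρ (fun x => ∑ l ∈ Finset.range (k + 1), c.term χ k l (b k l) x) := fun k hk =>
    contMDiffOn_finsetSum (hs k hk)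
  refine ⟨contMDiffOn_finsetSum hs', ?_⟩
  refine conormalMinus.congr hI (conormalMinus.sum hI (Finset.range q)
    (f := fun k x => ∑ l ∈ Finset.range (k + 1),
      radialProd (c.radial η) r (c.term χ k l (b k l)) x) fun k hk => conormalMinus.sum hI _
    fun l hl => ?_) fun x hx => ?_
  · have hk' := Finset.mem_range.1 hk
    have hl' := Nat.lt_succ_iff.1 (Finset.mem_range.1 hl)
    exact hη.radialProd_term_mem hρ hε hεc hχ hμ (hb k hk' l hl') hl' (hk'.trans_le hqr) N
  · refine (radialProd_sum hI hD r (Finset.range q) hs' hx).trans (Finset.sum_congr rfl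
      fun k hk => ?_)
    exact radialProd_sum hI hD r (Finset.range (k + 1)) (hs k hk) hx

/-- Functions with radial decay at a face have an expansion there. -/
theorem IsCutoff.exists_expansion (hρ : IsBoundaryDefining (n := n) ρ) (hε : 0 < ε)
    (hεc : ε < c.width) (hη : c.IsCutoff ε η) (hχ : IsProfile ε χ) (hμ : μ j = 0) {f : M → ℂ}
    (hf : RadialDecay ρ j (c.radial η) μ f) :
    ∃ b : ℕ → ℕ → face ρ j → ℂ,
      (∀ k l, b k l ∈ conormalMinus (n := d) (onFace ρ j ρ) (restr j μ)) ∧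
      ∀ q : ℕ, (fun x => f x - c.partialSum χ b q x) ∈
        conormalMinus (n := n) ρ (μ + Pi.single j (q : ℝ)) := by
  have hI := hρ.isOpen_inner
  have hD := (hη.isWeaklyRadial hρ hε.le).1
  have hfs : SmoothIn n ρ f := conormalMinus.smooth (hf 0)
  -- P_{q+1} is P_q composed with (D-q)^{q+1}. The factors D-i of P_q have i < q, below the order
  -- that is already known at Y_j, so they are removed by integration from 0.
  have key : ∀ (q : ℕ) (e : M → ℂ), e ∈ conormalMinus (n := n) ρ (μ + Pi.single j (q : ℝ)) →
      radialProd (c.radial η) (q + 1) e ∈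
        conormalMinus (n := n) ρ (μ + Pi.single j ((q + 1 : ℕ) : ℝ)) →
      (shifted (c.radial η) (q : ℂ))^[q + 1] e ∈
        conormalMinus (n := n) ρ (μ + Pi.single j ((q + 1 : ℕ) : ℝ)) := by
    intro q e he h
    have hes := conormalMinus.smooth he
    set g := (shifted (c.radial η) (q : ℂ))^[q + 1] e with hg
    have hgm : g ∈ conormalMinus (n := n) ρ (μ + Pi.single j (q : ℝ)) :=
      conormalMinus.shifted_iterate hρ he hD _ _
    have eμ : μ + Pi.single j ((q + 1 : ℕ) : ℝ) = μ + Pi.single j (q : ℝ) + Pi.single j 1 := by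
      rw [add_assoc, ← Pi.single_add]; push_cast; rfl
    have h1 : ∀ i ≤ q, radialProd (c.radial η) i g ∈
        conormalMinus (n := n) ρ (μ + Pi.single j ((q + 1 : ℕ) : ℝ)) → g ∈
        conormalMinus (n := n) ρ (μ + Pi.single j ((q + 1 : ℕ) : ℝ)) := by
      intro i
      induction i with
      | zero => exact fun _ h => h
      | succ i ih =>
        intro hi h
        refine ih (Nat.le_of_succ_le hi) ?_
        rw [eμ] at h ⊢
        refine hη.mem_of_iterate_shifted_mem hρ hε hεc (k := (i : ℝ)) zero_le_one le_rfl
          (Or.inr ?_) (i + 1) (conormalMinus.radialProd hρ hgm hD i) ?_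
        · simp only [Pi.add_apply, hμ, Pi.single_eq_same, zero_add]
          exact_mod_cast hi
        · simpa only [radialProd_succ, Complex.ofReal_natCast] using h
    refine h1 q le_rfl (conormalMinus.congr hI h ?_)
    exact (iterate_radialProd_comm hI hD.1 _ q (q + 1) hes).symm
  have hstep : ∀ (q : ℕ) (b : ℕ → ℕ → face ρ j → ℂ),
      (∀ k l, b k l ∈ conormalMinus (n := d) (onFace ρ j ρ) (restr j μ)) →
      (fun x => f x - c.partialSum χ b q x) ∈
        conormalMinus (n := n) ρ (μ + Pi.single j (q : ℝ)) →
      ∃ b' : ℕ → face ρ j → ℂ,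
        (∀ l, b' l ∈ conormalMinus (n := d) (onFace ρ j ρ) (restr j μ)) ∧
        (fun x => f x - c.partialSum χ b q x -
          ∑ l ∈ Finset.range (q + 1), c.term χ q l (b' l) x) ∈
          conormalMinus (n := n) ρ (μ + Pi.single j ((q + 1 : ℕ) : ℝ)) := by
    intro q b hb he
    obtain ⟨h1, h2⟩ := hη.radialProd_partialSum_mem hρ hε hεc hχ hμ (b := b) (q := q)
      (fun k _ l _ => hb k l) (Nat.le_succ q) (q + 1)
    refine hη.exists_coefficients hρ hε hεc hχ hμ (q + 1) he (key q _ he ?_)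
    exact conormalMinus.congr hI (conormalMinus.sub hI (hf (q + 1)) h2)
      (radialProd_sub hI hD.1 (q + 1) hfs h1)
  choose! next hnext1 hnext2 using hstep
  -- B q is the table of coefficients after q steps. Step q fills row q and leaves the others
  -- unchanged, so row k is final in B (k+1).
  let B : ℕ → ℕ → ℕ → face ρ j → ℂ := fun q => Nat.rec (fun _ _ _ => 0)
    (fun q b => Function.update b q (next q b)) q
  have hB0 : B 0 = fun _ _ _ => 0 := rfl
  have hBs : ∀ q, B (q + 1) = Function.update (B q) q (next q (B q)) := fun q => rfl
  have hinv : ∀ q, (∀ k l, B q k l ∈ conormalMinus (n := d) (onFace ρ j ρ) (restr j μ)) ∧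
      (fun x => f x - c.partialSum χ (B q) q x) ∈
        conormalMinus (n := n) ρ (μ + Pi.single j (q : ℝ)) := by
    intro q
    induction q with
    | zero =>
      refine ⟨fun k l => zero_mem_conormalMinus _, ?_⟩
      refine conormalMinus.congr hI (hf 0) fun x _ => ?_
      simp [partialSum, radialProd]
    | succ q ih =>
      have h1 := hnext1 q (B q) ih.1 ih.2
      have h2 := hnext2 q (B q) ih.1 ih.2
      refine ⟨fun k l => ?_, ?_⟩
      · rw [hBs]
        by_cases hk : k = q
        · subst hk; rw [Function.update_self]; exact h1 l
        · rw [Function.update_of_ne hk]; exact ih.1 k l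
      · refine conormalMinus.congr hI h2 fun x _ => ?_
        simp only [partialSum, Finset.sum_range_succ _ q, hBs, Function.update_self]
        have : ∑ k ∈ Finset.range q, ∑ l ∈ Finset.range (k + 1),
            c.term χ k l (Function.update (B q) q (next q (B q)) k l) x =
            ∑ k ∈ Finset.range q, ∑ l ∈ Finset.range (k + 1), c.term χ k l (B q k l) x :=
          Finset.sum_congr rfl fun k hk => by
            rw [Function.update_of_ne (Finset.mem_range.1 hk).ne]
        rw [this]
        ring
  have hstab : ∀ k q, k < q → B q k = B (k + 1) k := by
    intro k q hkq
    induction q with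
    | zero => omega
    | succ q ih =>
      rcases Nat.lt_succ_iff_lt_or_eq.1 hkq with h | h
      · rw [hBs, Function.update_of_ne h.ne, ih h]
      · rw [h]
  refine ⟨fun k => B (k + 1) k, fun k l => (hinv (k + 1)).1 k l, fun q => ?_⟩
  refine conormalMinus.congr hI (hinv q).2 fun x _ => ?_
  simp only [partialSum]
  congr 1
  refine Finset.sum_congr rfl fun k hk => ?_
  rw [hstab k q (Finset.mem_range.1 hk)]

end Collar

end Expansion

/-- Polynomials in `t` and `log t` that vanish to infinite order at `0` are zero. -/
theorem coeff_eq_zero {a : ℕ → ℕ → ℂ} {δ : ℝ} (hδ : 0 < δ)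
    (h : ∀ q : ℕ, ∃ C : ℝ, ∀ t ∈ Ioc 0 δ,
      ‖∑ k ∈ Finset.range q, ∑ l ∈ Finset.range (k + 1),
        ((t ^ k * Real.log t ^ l : ℝ) : ℂ) * a k l‖ ≤ C * t ^ ((q : ℝ) - 1 / 2)) (k : ℕ) :
    ∀ l ≤ k, a k l = 0 := by
  induction k using Nat.strong_induction_on with
  | _ k ih =>
  set P : Polynomial ℂ := ∑ l ∈ Finset.range (k + 1), Polynomial.monomial l (a k l) with hP
  have hPe : ∀ z, P.eval z = ∑ l ∈ Finset.range (k + 1), a k l * z ^ l := fun z => by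
    simp [hP, Polynomial.eval_finsetSum]
  have hPc : ∀ l ≤ k, P.coeff l = a k l := fun l hl => by
    simp only [hP, Polynomial.finsetSum_coeff, Polynomial.coeff_monomial]
    rw [Finset.sum_ite_eq' , if_pos (Finset.mem_range.2 (Nat.lt_succ_of_le hl))]
  obtain ⟨C, hC⟩ := h (k + 1)
  -- The rows below k vanish by induction, and only t^k times a polynomial in log t remains.
  have hsum : ∀ t : ℝ, ∑ k ∈ Finset.range (k + 1), ∑ l ∈ Finset.range (k + 1),
        ((t ^ k * Real.log t ^ l : ℝ) : ℂ) * a k l =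
      ((t ^ k : ℝ) : ℂ) * P.eval (Real.log t : ℂ) := fun t => by
    rw [Finset.sum_range_succ, Finset.sum_eq_zero fun k' hk' => Finset.sum_eq_zero fun l hl => by
      rw [ih k' (Finset.mem_range.1 hk') l (Nat.lt_succ_iff.1 (Finset.mem_range.1 hl)), mul_zero],
      zero_add, hPe, Finset.mul_sum]
    refine Finset.sum_congr rfl fun l _ => ?_
    push_cast; ring
  have hb : ∀ t ∈ Ioc 0 δ, ‖P.eval (Real.log t : ℂ)‖ ≤ C * t ^ (1 / 2 : ℝ) := fun t ht => by
    have h1 := hC t ht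
    rw [hsum, norm_mul, Complex.norm_real, Real.norm_of_nonneg (pow_pos ht.1 k).le] at h1
    have h2 : t ^ (((k + 1 : ℕ) : ℝ) - 1 / 2) = t ^ k * t ^ (1 / 2 : ℝ) := by
      rw [← Real.rpow_natCast, ← Real.rpow_add ht.1]; congr 1; push_cast; ring
    rw [h2, mul_left_comm] at h1
    exact le_of_mul_le_mul_left h1 (pow_pos ht.1 k)
  have hlim : Tendsto (fun t : ℝ => ‖P.eval (Real.log t : ℂ)‖) (𝓝[>] 0) (𝓝 0) := by
    have h1 := Collar.tendsto_rpow_half.const_mul C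
    rw [mul_zero] at h1
    refine squeeze_zero' (Eventually.of_forall fun _ => norm_nonneg _) ?_ h1
    filter_upwards [Ioc_mem_nhdsGT hδ] with t ht using hb t ht
  have hlog : Tendsto (fun t : ℝ => ‖(Real.log t : ℂ)‖) (𝓝[>] 0) atTop := by
    have := tendsto_abs_atBot_atTop.comp Real.tendsto_log_nhdsGT_zero
    refine this.congr fun t => ?_
    rw [Complex.norm_real]; rfl
  -- A nonconstant polynomial would be unbounded as |log t| → ∞, whereas P(log t) = O(t^{1/2}). The
  -- same bound makes the constant zero.
  have hdeg : P.degree ≤ 0 := by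
    by_contra hd
    have h1 := Polynomial.tendsto_norm_atTop P (not_le.1 hd) hlog
    exact not_tendsto_nhds_of_tendsto_atTop h1 0 hlim
  have hP0 : P = 0 := by
    rw [Polynomial.eq_C_of_degree_le_zero hdeg] at hlim ⊢
    simp only [Polynomial.eval_C] at hlim
    have := tendsto_nhds_unique tendsto_const_nhds hlim
    rw [norm_eq_zero.1 this, Polynomial.C_0]
  intro l hl
  rw [← hPc l hl, hP0, Polynomial.coeff_zero]

/-! ### Linear operators on functions on the interior -/

section InnerOp

variable {n : ℕ} {ι : Type*} [Fintype ι]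
  {X : Type*} [TopologicalSpace X] [ChartedSpace (EuclideanQuadrant n) X]
  [IsManifold (Q n) ∞ X] {ρ : ι → X → ℝ}

/-- Linear operators on the smooth functions on the interior. -/
structure IsInnerOp (n : ℕ) {ι : Type*} {X : Type*} [TopologicalSpace X]
    [ChartedSpace (EuclideanQuadrant n) X] (ρ : ι → X → ℝ) (T : (X → ℂ) → X → ℂ) : Prop where
  smooth : ∀ {f}, SmoothIn n ρ f → SmoothIn n ρ (T f)
  congr : ∀ {f g}, EqOn f g (inner ρ) → EqOn (T f) (T g) (inner ρ)
  sub_sum : ∀ {A : Type} (s : Finset A) (a : A → ℂ) (g : A → X → ℂ) {f : X → ℂ}, SmoothIn n ρ f →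
    (∀ i ∈ s, SmoothIn n ρ (g i)) → EqOn (T fun x => f x - ∑ i ∈ s, a i * g i x)
      (fun x => T f x - ∑ i ∈ s, a i * T (g i) x) (inner ρ)

namespace IsInnerOp

variable {T T' : (X → ℂ) → X → ℂ}

theorem id : IsInnerOp n ρ (fun f => f) :=
  ⟨fun h => h, fun h => h, fun _ _ _ _ _ _ => fun _ _ => rfl⟩

theorem comp (hT : IsInnerOp n ρ T) (hT' : IsInnerOp n ρ T') :
    IsInnerOp n ρ (fun f => T (T' f)) where
  smooth h := hT.smooth (hT'.smooth h)
  congr h := hT.congr (hT'.congr h)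
  sub_sum s a g _ hf hg := (hT.congr (hT'.sub_sum s a g hf hg)).trans
    (hT.sub_sum s a (fun i => T' (g i)) (hT'.smooth hf) fun i hi => hT'.smooth (hg i hi))

theorem shifted (hI : IsOpen (inner ρ)) {V : VField n X} (hV : SmoothVField V) (b : ℂ) :
    IsInnerOp n ρ (shifted V b) where
  smooth h := smoothIn_shifted hI hV b h
  congr h := shifted_eqOn hI V b h
  sub_sum s a g f hf hg := by
    classical
    intro x hx
    have hm : ∀ {t : Finset _}, t ⊆ s → SmoothIn n ρ fun x => ∑ i ∈ t, a i * g i x := fun ht =>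
      contMDiffOn_finsetSum fun i hi => contMDiffOn_mul_complex contMDiffOn_const (hg i (ht hi))
    have key : ∀ t : Finset _, t ⊆ s →
        lie V (fun x => ∑ i ∈ t, a i * g i x) x = ∑ i ∈ t, a i * lie V (g i) x := by
      intro t
      induction t using Finset.induction_on with
      | empty => intro _; simp only [Finset.sum_empty]; exact lie_const 0 x
      | insert i t hi ih =>
        intro ht
        have hgi := hg i (ht (Finset.mem_insert_self i t))
        have ht' := (Finset.subset_insert i t).trans ht
        simp only [Finset.sum_insert hi]
        rw [lie_add (SmoothIn.mdiff hI (contMDiffOn_mul_complex contMDiffOn_const hgi) hx)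
          (SmoothIn.mdiff hI (hm ht') hx), ih ht',
          lie_mul mdifferentiableAt_const (SmoothIn.mdiff hI hgi hx), lie_const]
        ring
    simp only [Corners.shifted]
    rw [lie_sub (SmoothIn.mdiff hI hf hx) (SmoothIn.mdiff hI (hm subset_rfl) hx), key s subset_rfl,
      mul_sub, Finset.mul_sum]
    have : ∑ i ∈ s, a i * (lie V (g i) x - b * g i x) =
        ∑ i ∈ s, a i * lie V (g i) x - ∑ i ∈ s, b * (a i * g i x) := by
      rw [← Finset.sum_sub_distrib]
      exact Finset.sum_congr rfl fun i _ => by ring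
    rw [this]; ring

theorem iterate (hT : IsInnerOp n ρ T) (i : ℕ) : IsInnerOp n ρ (T^[i]) := by
  induction i with
  | zero => exact id
  | succ i ih => exact ih.comp hT

theorem radialProd (hI : IsOpen (inner ρ)) {V : VField n X} (hV : SmoothVField V) (q : ℕ) :
    IsInnerOp n ρ (radialProd V q) := by
  induction q with
  | zero => exact id
  | succ q ih => exact ((shifted hI hV (q : ℂ)).iterate (q + 1)).comp ih

theorem foldr_radialProd (hI : IsOpen (inner ρ)) {A : Type*} {V : A → VField n X} (m : A → ℕ)
    (L : List A) (hV : ∀ l ∈ L, SmoothVField (V l)) :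
    IsInnerOp n ρ (fun f => L.foldr (fun l f => Corners.radialProd (V l) (m l) f) f) := by
  induction L with
  | nil => exact id
  | cons i L ih =>
    exact (radialProd hI (hV i List.mem_cons_self) (m i)).comp
      (ih fun l hl => hV l (List.mem_cons_of_mem i hl))

end IsInnerOp

end InnerOp

/-! ### Slicewise operators and uniqueness of coefficients -/

section Slices

variable {n d : ℕ} {ι : Type*} [Fintype ι] [DecidableEq ι]
  {M : Type*} [TopologicalSpace M] [ChartedSpace (EuclideanQuadrant n) M]
  [IsManifold (Q n) ∞ M] [CompactSpace M] [T2Space M]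
  {ρ : ι → M → ℝ} {j : ι} [ChartedSpace (EuclideanQuadrant d) (face ρ j)]
  [IsManifold (Q d) ∞ (face ρ j)] {c : Collar (n := n) (d := d) ρ j} {ε : ℝ} {η : M → ℝ}
  {μ : ι → ℝ} {χ : ℝ → ℝ}

namespace Collar

/-- Uniqueness of coefficients is a statement about a single fibre, so the constant may depend on y.
The loss 1/2 is one choice below the gap 1 between consecutive orders. -/
theorem exists_fibre_decay (hρ : IsBoundaryDefining (n := n) ρ) (hεc : ε < c.width) (hμ : μ j = 0)
    {q : ℕ} {g : M → ℂ} (hg : g ∈ conormalMinus (n := n) ρ (μ + Pi.single j (q : ℝ)))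
    {y : face ρ j} (hy : y ∈ inner (onFace ρ j ρ)) :
    ∃ C : ℝ, ∀ t ∈ Ioc 0 ε, ‖g (c.emb (y, t))‖ ≤ C * t ^ ((q : ℝ) - 1 / 2) := by
  set σ := extExp j (fun k => restr j μ k - 1) ((q : ℝ) - 1 / 2) with hσ
  obtain ⟨B, hB0, hB⟩ := conormal.bound (hg σ (extExp_lt (fun k => by simp) (by
    rw [hμ]; linarith)))
  obtain ⟨K, hK, hKe⟩ := exists_rp_emb_le (c := c) hρ hεc σ
  refine ⟨B * (K * rp (onFace ρ j ρ) (restr j σ) y), fun t ht => ?_⟩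
  have h2 := hB _ (emb_mem_inner (c := c) hρ hy ⟨ht.1, ht.2.trans_lt hεc⟩)
  have h3 := (hKe y hy t ht).1
  rw [hσ, extExp_self] at h3
  calc _ ≤ B * (K * (t ^ ((q : ℝ) - 1 / 2) * rp (onFace ρ j ρ) (restr j σ) y)) :=
        h2.trans (mul_le_mul_of_nonneg_left h3 hB0)
    _ = _ := by ring

/-- The operator `T` on the manifold induces the operator `S` on the slices `ρ_j = t`, `t ≤ ε`. -/
def IsSliceOp (c : Collar (n := n) (d := d) ρ j) (ε : ℝ) (T : (M → ℂ) → M → ℂ)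
    (S : (face ρ j → ℂ) → face ρ j → ℂ) : Prop :=
  ∀ f, SmoothIn n ρ f → ∀ t ∈ Ioc 0 ε, EqOn (fun y => T f (c.emb (y, t)))
    (S fun y => f (c.emb (y, t))) (inner (onFace ρ j ρ))

theorem IsSliceOp.comp {T T' : (M → ℂ) → M → ℂ} {S S' : (face ρ j → ℂ) → face ρ j → ℂ}
    (h : c.IsSliceOp ε T S) (h' : c.IsSliceOp ε T' S') (hT' : IsInnerOp n ρ T')
    (hS : IsInnerOp d (onFace ρ j ρ) S) :
    c.IsSliceOp ε (fun f => T (T' f)) (fun f => S (S' f)) := fun f hf t ht =>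
  (h (T' f) (hT'.smooth hf) t ht).trans (hS.congr (h' f hf t ht))

theorem isSliceOp_shifted (hρ : IsBoundaryDefining (n := n) ρ) (hεc : ε < c.width)
    (hη : c.IsCutoff ε η) {Z : VField d (face ρ j)} {V : VField n M} {ε' : ℝ} (hε' : ε' ≤ ε)
    (hV : ∀ x ∈ c.slab ε', V x = c.lift η Z 0 x) (b : ℂ) :
    c.IsSliceOp ε' (shifted V b) (shifted Z b) := by
  intro f hf t ht y hy
  have ht' : t ∈ Ioc 0 ε := ⟨ht.1, ht.2.trans hε'⟩
  simp only [Corners.shifted]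
  rw [hη.lie_slice hρ hεc hf Z hy ht',
    lie_field_congr (hV _ (c.emb_mem_slab (hε'.trans_lt hεc) y ⟨ht.1.le, ht.2⟩)) f]

theorem isSliceOp_radialProd (hρ : IsBoundaryDefining (n := n) ρ) (hεc : ε < c.width)
    (hη : c.IsCutoff ε η) {Z : VField d (face ρ j)} (hZ : SmoothVField Z) {V : VField n M}
    (hVs : SmoothVField V) {ε' : ℝ} (hε' : ε' ≤ ε)
    (hV : ∀ x ∈ c.slab ε', V x = c.lift η Z 0 x) (q : ℕ) :
    c.IsSliceOp ε' (radialProd V q) (radialProd Z q) := by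
  have hI := hρ.isOpen_inner
  have hIY := hρ.isOpen_inner_onFace j
  have h0 : c.IsSliceOp ε' (fun f => f) (fun f => f) := fun _ _ _ _ _ _ => rfl
  have hit : ∀ (b : ℂ) (i : ℕ), c.IsSliceOp ε' ((shifted V b)^[i]) ((shifted Z b)^[i]) := by
    intro b i
    induction i with
    | zero => exact h0
    | succ i ih =>
      exact ih.comp (isSliceOp_shifted hρ hεc hη hε' hV b) (.shifted hI hVs b)
        ((IsInnerOp.shifted hIY hZ b).iterate i)
  induction q with
  | zero => exact h0
  | succ q ih =>
    exact (hit q (q + 1)).comp ih (.radialProd hI hVs q)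
      ((IsInnerOp.shifted hIY hZ (q : ℂ)).iterate (q + 1))

theorem isSliceOp_foldr (hρ : IsBoundaryDefining (n := n) ρ) (hεc : ε < c.width)
    (hη : c.IsCutoff ε η) {W : {k // k ≠ j} → VField d (face ρ j)}
    (hW : ∀ k, SmoothVField (W k)) {V : ι → VField n M} (hVs : ∀ i, SmoothVField (V i))
    {ε' : ℝ} (hε' : ε' ≤ ε)
    (hV : ∀ k : {k // k ≠ j}, ∀ x ∈ c.slab ε', V k x = c.lift η (W k) 0 x)
    (m : ι → ℕ) (L : List {k // k ≠ j}) :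
    c.IsSliceOp ε' (fun f => (L.map Subtype.val).foldr (fun l f => radialProd (V l) (m l) f) f)
      (fun f => L.foldr (fun l f => radialProd (W l) (m l) f) f) := by
  have hI := hρ.isOpen_inner
  have hIY := hρ.isOpen_inner_onFace j
  induction L with
  | nil => exact fun _ _ _ _ _ _ => rfl
  | cons i L ih =>
    exact (isSliceOp_radialProd hρ hεc hη (hW i) (hVs i) hε' (hV i) (m i)).comp ih
      (.foldr_radialProd hI m _ fun l _ => hVs l) (.radialProd hIY (hW i) (m i))

/-- An operator that acts along the slices acts on the coefficients of expansions. -/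
theorem coefficient_eq (hρ : IsBoundaryDefining (n := n) ρ) (hε : 0 < ε) (hεc : ε < c.width)
    (hχ : IsProfile ε χ) {T : (M → ℂ) → M → ℂ} {S : (face ρ j → ℂ) → face ρ j → ℂ}
    (hS : IsInnerOp d (onFace ρ j ρ) S) (hTS : c.IsSliceOp (ε / 2) T S)
    {w : M → ℂ} (hw : SmoothIn n ρ w) {b b' : ℕ → ℕ → face ρ j → ℂ}
    (hb : ∀ k l, SmoothIn d (onFace ρ j ρ) (b k l)) {ν ν' : ι → ℝ} (hν : ν j = 0) (hν' : ν' j = 0)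
    (h0 : ∀ q, SmoothIn n ρ (fun x => w x - c.partialSum χ b q x))
    (h1 : ∀ q : ℕ, T (fun x => w x - c.partialSum χ b q x) ∈
      conormalMinus (n := n) ρ (ν + Pi.single j (q : ℝ)))
    (h2 : ∀ q : ℕ, (fun x => T w x - c.partialSum χ b' q x) ∈
      conormalMinus (n := n) ρ (ν' + Pi.single j (q : ℝ))) {k l : ℕ} (hlk : l ≤ k) :
    EqOn (b' k l) (S (b k l)) (inner (onFace ρ j ρ)) := by
  intro y hy
  have hps : ∀ (b : ℕ → ℕ → face ρ j → ℂ) (q : ℕ) (z : face ρ j) (t : ℝ), t ∈ Ioc 0 (ε / 2) →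
      c.partialSum χ b q (c.emb (z, t)) = ∑ k ∈ Finset.range q, ∑ l ∈ Finset.range (k + 1),
        ((t ^ k * Real.log t ^ l : ℝ) : ℂ) * b k l z := fun b q z t ht => by
    have htw : t ∈ Ico 0 c.width := ⟨ht.1.le, (ht.2.trans (half_le_self hε.le)).trans_lt hεc⟩
    refine Finset.sum_congr rfl fun k _ => Finset.sum_congr rfl fun l _ => ?_
    rw [term_emb htw, hχ.one t ⟨ht.1.le, ht.2⟩, mul_one]
  have hεc' : ε / 2 < c.width := (half_le_self hε.le).trans_lt hεc
  -- On the fibre over y there are two expansions of Tw, one with the coefficients S b and one with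
  -- b'. Their difference vanishes to every order, so the coefficients agree.
  refine sub_eq_zero.1 (coeff_eq_zero (a := fun k l => b' k l y - S (b k l) y) (half_pos hε)
    (fun q => ?_) k l hlk)
  obtain ⟨C, hC⟩ := exists_fibre_decay (c := c) hρ hεc' hν (h1 q) hy
  obtain ⟨C', hC'⟩ := exists_fibre_decay (c := c) hρ hεc' hν' (h2 q) hy
  refine ⟨C + C', fun t ht => ?_⟩
  have htw : t ∈ Ioo 0 c.width := ⟨ht.1, (ht.2.trans (half_le_self hε.le)).trans_lt hεc⟩
  have e1 : T (fun x => w x - c.partialSum χ b q x) (c.emb (y, t)) = T w (c.emb (y, t)) -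
      ∑ k ∈ Finset.range q, ∑ l ∈ Finset.range (k + 1),
        ((t ^ k * Real.log t ^ l : ℝ) : ℂ) * S (b k l) y := by
    have h4 := hTS _ (h0 q) t ht hy
    have h5 := hTS w hw t ht hy
    simp only at h4 h5
    rw [h4, h5]
    -- On a slice the powers of t and log t are constants, so linearity of S suffices to act on the
    -- partial sum.
    have h3 := hS.sub_sum ((Finset.range q).sigma fun k => Finset.range (k + 1))
      (fun p => ((t ^ p.1 * Real.log t ^ p.2 : ℝ) : ℂ)) (fun p => b p.1 p.2)
      (contMDiffOn_slice (c := c) hρ hw htw) (fun p _ => hb p.1 p.2) hy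
    simp only [Finset.sum_sigma] at h3
    rw [← h3]
    refine hS.congr (fun z _ => ?_) hy
    simp only [hps b q z t ht]
  have h3 := norm_sub_le (T (fun x => w x - c.partialSum χ b q x) (c.emb (y, t)))
    (T w (c.emb (y, t)) - c.partialSum χ b' q (c.emb (y, t)))
  rw [add_mul]
  refine le_trans (le_of_eq ?_) (h3.trans (add_le_add (hC t ht) (hC' t ht)))
  rw [e1, hps b' q y t ht]
  congr 1
  simp only [mul_sub, Finset.sum_sub_distrib]
  ring

end Collar

end Slices

/-! ### Radial fields adapted to the product decomposition -/

section Gluing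

theorem smul_add_smul_eq {E : Type*} [AddCommGroup E] [Module ℝ E] {a b g : ℝ} {w s v t : E}
    (hw : w = (b * g) • s ∨ a = 0) (hv : v = b • t) :
    a • w + (1 - a) • v = b • ((a * g) • s + (1 - a) • t) := by
  rcases hw with rfl | rfl <;> subst hv <;> module

theorem one_smul_add_smul_eq {E : Type*} [AddCommGroup E] [Module ℝ E] {a : ℝ} (ha : a = 1)
    (w v : E) : a • w + (1 - a) • v = w := by
  subst ha; module

variable {n d : ℕ} {ι : Type*} [Fintype ι] [DecidableEq ι]
  {M : Type*} [TopologicalSpace M] [ChartedSpace (EuclideanQuadrant n) M]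
  [IsManifold (Q n) ∞ M] [CompactSpace M] [T2Space M]
  {ρ : ι → M → ℝ} {j : ι} [ChartedSpace (EuclideanQuadrant d) (face ρ j)]
  [IsManifold (Q d) ∞ (face ρ j)] {c : Collar (n := n) (d := d) ρ j} {ε : ℝ} {η : M → ℝ}
  {χ : ℝ → ℝ}

namespace Collar

theorem push_congr {Z Z' : VField d (face ρ j)} (τ : ℝ) {x : M} (h : Z (c.proj x) = Z' (c.proj x)) :
    c.push Z τ x = c.push Z' τ x := by
  unfold push; rw [h]

theorem lift_smul {Z Z' : VField d (face ρ j)} {a : ℝ} {x : M}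
    (h : Z (c.proj x) = a • Z' (c.proj x)) : c.lift η Z 0 x = a • c.lift η Z' 0 x := by
  unfold lift
  rw [c.push_congr (Z' := a • Z') 0 h]
  have h1 := c.push_smul a Z' 0 x
  rw [mul_zero] at h1
  rw [h1]
  exact smul_comm (η x) a (c.push Z' 0 x)

/-- A radial field that equals the lift of a radial field of the face near that face. -/
theorem IsCutoff.exists_isWeaklyRadial_eq_lift (hρ : IsBoundaryDefining (n := n) ρ)
    (hεc : ε < c.width) (hη : c.IsCutoff ε η) (hχ : IsProfile ε χ) (i : {k // k ≠ j})
    {V : VField n M} (hV : IsWeaklyRadial ρ (i : ι) V) {W : VField d (face ρ j)}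
    (hW : IsWeaklyRadial (n := d) (onFace ρ j ρ) i W) :
    ∃ V' : VField n M, IsWeaklyRadial ρ (i : ι) V' ∧
      ∀ x ∈ c.slab (ε / 2), V' x = c.lift η W 0 x := by
  obtain ⟨hVb, T, hT, hVT, hT1⟩ := hV
  obtain ⟨hWb, S, hS, hWS, hS1⟩ := hW
  obtain ⟨g, hg, hg1⟩ := c.exists_rho_proj hρ hεc i.2
  have hκ := contMDiff_bump (c := c) hρ hεc hχ
  have hκ' : ContMDiff (Q n) 𝓘(ℝ, ℝ) ∞ (fun x => 1 - c.bump χ x) := contMDiff_const.sub hκ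
  have hκg := hκ.mul hg
  have hLS := hη.smooth_lift hρ hS 0
  refine ⟨fun x => c.bump χ x • c.lift η W 0 x + (1 - c.bump χ x) • V x,
    ⟨add_mem_bFields (smul_mem_bFields (hη.lift_mem_bFields hρ hWb) hκ)
      (smul_mem_bFields hVb hκ'),
      -- Near the i-th face of Y_j, W is ρ_i S, so its lift is (ρ_i ∘ π) times the lift of S, that
      -- is ρ_i g times it. The quotient by ρ_i of the glued field is therefore this combination of
      -- transversal fields.
      fun x => (c.bump χ x * g x) • c.lift η S 0 x + (1 - c.bump χ x) • T x,
      (hLS.smul hκg).add (hT.smul hκ'), ?_, ?_⟩, ?_⟩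
  · refine eventually_nhdsSet_iff_forall.2 fun x hx => ?_
    have hVT' := eventually_nhdsSet_iff_forall.1 hVT x hx
    by_cases hxs : x ∈ c.slab ε
    · have h1 := eventually_nhdsSet_iff_forall.1 hg1 x hxs
      have hxY : c.proj x ∈ face (onFace ρ j ρ) i := by
        change ρ i (c.proj x) = 0
        rw [h1.self_of_nhds.1, show ρ i x = 0 from hx, zero_mul]
      have hcont : ContinuousAt c.proj x :=
        (c.contMDiffOn_proj.contMDiffAt (c.isOpen_dom.mem_nhds hxs.1)).continuousAt
      have h2 := hcont.eventually (eventually_nhdsSet_iff_forall.1 hWS _ hxY)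
      filter_upwards [h1, h2, hVT'] with z hz1 hz2 hz3
      have h3 : c.lift η W 0 z = (ρ i z * g z) • c.lift η S 0 z := by
        refine c.lift_smul ?_
        rw [hz2, ← hz1.1]; rfl
      exact smul_add_smul_eq (E := EuclideanSpace ℝ (Fin n)) (Or.inl h3) hz3
    · filter_upwards [(isCompact_slab hρ hεc).isClosed.isOpen_compl.mem_nhds hxs, hVT']
        with z hz1 hz2
      exact smul_add_smul_eq (E := EuclideanSpace ℝ (Fin n)) (Or.inr (bump_eq_zero hχ hz1)) hz2
  · intro x hx
    rw [lieReal_field_add, lieReal_field_smul (fun x => c.bump χ x * g x),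
      lieReal_field_smul (fun x => 1 - c.bump χ x), hT1 x hx]
    -- On Y_i the lift of S differentiates ρ_i g to 1, so g times its derivative of ρ_i is 1. The
    -- two parts of the combination then add up to 1.
    by_cases hxs : x ∈ c.slab ε
    · have h1 := eventually_nhdsSet_iff_forall.1 hg1 x hxs
      have hxY : c.proj x ∈ face (onFace ρ j ρ) i := by
        change ρ i (c.proj x) = 0
        rw [h1.self_of_nhds.1, show ρ i x = 0 from hx, zero_mul]
      have hsm : ContMDiff (Q d) 𝓘(ℝ, ℝ) ∞ (fun y : face ρ j => ρ i y) :=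
        (hρ.smooth i).comp c.contMDiff_coe
      have e1 := c.lieReal_push_proj hρ S 0 hxs.1 (b := fun y : face ρ j => ρ i y)
        (contMDiff_mdiff hsm _)
      have e2 : lieReal S (fun y : face ρ j => ρ i y) (c.proj x) = 1 := hS1 (c.proj x) hxY
      rw [e2, lieReal_congr (h1.mono fun z hz => hz.1),
        lieReal_mul (contMDiff_mdiff (hρ.smooth i) x) (contMDiff_mdiff hg x),
        show ρ i x = 0 from hx, zero_mul, add_zero] at e1
      rw [lieReal_field_congr (hη.lift_eq S 0 hxs)]
      linear_combination (c.bump χ x) * e1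
    · rw [bump_eq_zero hχ hxs]; ring
  · intro x hx
    have : c.bump χ x = 1 := by
      unfold bump
      rw [if_pos hx.1, hχ.one _ ⟨hρ.nonneg j x, hx.2⟩]
    exact one_smul_add_smul_eq (E := EuclideanSpace ℝ (Fin n)) this _ _

end Collar

end Gluing

/-! ### Variable weights and manifolds without faces -/

section Weights

variable {n : ℕ} {ι : Type*} [Fintype ι]
  {X : Type*} [TopologicalSpace X] [ChartedSpace (EuclideanQuadrant n) X]
  [IsManifold (Q n) ∞ X] {ρ : ι → X → ℝ}

theorem smoothIn_rhoPow (hρ : ∀ k, ContMDiff (Q n) 𝓘(ℝ, ℝ) ∞ (ρ k)) {b : ι → X → ℝ}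
    (hb : ∀ k, ContMDiff (Q n) 𝓘(ℝ, ℝ) ∞ (b k)) :
    SmoothIn n ρ (fun x => (rhoPow ρ b x : ℂ)) := by
  refine Complex.ofRealCLM.contMDiff.comp_contMDiffOn (contMDiffOn_finsetProd fun k _ x hx => ?_)
  have h1 : ContMDiffAt 𝓘(ℝ, ℝ × ℝ) 𝓘(ℝ, ℝ) ∞ (fun p : ℝ × ℝ => p.1 ^ p.2) (ρ k x, b k x) :=
    (Real.contDiffAt_rpow_of_ne (ρ k x, b k x) (hx k).ne').contMDiffAt
  exact (h1.comp x ((hρ k x).prodMk_space (hb k x))).contMDiffWithinAt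

theorem rhoPow_neg_mul (b : ι → X → ℝ) {x : X} (hx : x ∈ inner ρ) :
    (rhoPow ρ (fun k y => -b k y) x : ℂ) * (rhoPow ρ b x : ℂ) = 1 := by
  rw [← Complex.ofReal_mul, rhoPow, rhoPow, ← Finset.prod_mul_distrib,
    Finset.prod_eq_one fun k _ => ?_, Complex.ofReal_one]
  rw [← Real.rpow_add (hx k), neg_add_cancel, Real.rpow_zero]

/-- Without faces there is no expansion to use. All conormal spaces then coincide with the smooth
functions, by compactness. -/
theorem mem_conormalMinus_of_isEmpty [IsEmpty ι] [CompactSpace X] {w : X → ℂ}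
    (hw : SmoothIn n ρ w) (m : ι → ℝ) : w ∈ conormalMinus (n := n) ρ m := by
  have hu : inner ρ = univ := eq_univ_of_forall fun x k => isEmptyElim k
  intro m' _
  refine subset_conormal (S := {f | SmoothIn n ρ f}) (fun f hf => hf) ?_ ?_ hw
  · intro f hf V hV
    exact hV.1.lie (by rw [hu]; exact isOpen_univ) hf
  · intro f hf
    have hf' : ContinuousOn f (inner ρ) := ContMDiffOn.continuousOn hf
    rw [hu, continuousOn_univ] at hf'
    obtain ⟨C, hC⟩ := (isCompact_range hf'.norm).bddAbove
    refine ⟨C, fun x _ => ?_⟩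
    simpa [rhoPow] using hC ⟨x, rfl⟩

end Weights

/-! ### The two directions for functions with weight removed -/

section Main

variable {n d : ℕ} {ι : Type*} [Fintype ι] [DecidableEq ι]
  {M : Type*} [TopologicalSpace M] [ChartedSpace (EuclideanQuadrant n) M]
  [IsManifold (Q n) ∞ M] [CompactSpace M] [T2Space M]
  {ρ : ι → M → ℝ} [∀ j, ChartedSpace (EuclideanQuadrant d) (face ρ j)]
  [∀ j, IsManifold (Q d) ∞ (face ρ j)] {ε : ℝ} {χ : ℝ → ℝ}

theorem conormalMinus.foldr_radialProd (hρ : IsBoundaryDefining (n := n) ρ) {μ : ι → ℝ} {f : M → ℂ}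
    (hf : f ∈ conormalMinus (n := n) ρ μ) {V : ι → VField n M} (hV : ∀ i, V i ∈ bFields ρ)
    (m : ι → ℕ) (L : List ι) :
    L.foldr (fun l f => Corners.radialProd (V l) (m l) f) f ∈ conormalMinus (n := n) ρ μ := by
  induction L with
  | nil => exact hf
  | cons i L ih => exact conormalMinus.radialProd hρ ih (hV i) (m i)

/-- Polyhomogeneous functions have expansions with polyhomogeneous coefficients. -/
theorem exists_polyhomogeneous_coefficients (hρ : IsBoundaryDefining (n := n) ρ)
    (c : ∀ j, Collar (n := n) (d := d) ρ j) (hε : 0 < ε) (hεc : ∀ j, ε < (c j).width)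
    (hχ : IsProfile ε χ) {V : ι → VField n M} (hV : ∀ j, IsWeaklyRadial ρ j (V j)) {w : M → ℂ}
    (hw0 : w ∈ conormalMinus (n := n) ρ 0) (hw : ∀ j, RadialDecay ρ j (V j) 0 w) (j : ι)
    [LinearOrder {k // k ≠ j}] {W : {k // k ≠ j} → VField d (face ρ j)}
    (hW : ∀ k, IsWeaklyRadial (n := d) (onFace ρ j ρ) k (W k)) :
    ∃ b : ℕ → ℕ → face ρ j → ℂ, (∀ k l, SmoothIn d (onFace ρ j ρ) (b k l)) ∧
      (∀ k l, l ≤ k → ∀ m : {k // k ≠ j} → ℕ,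
        radialOp W m (b k l) ∈ conormalMinus (n := d) (onFace ρ j ρ) fun k => (m k : ℝ)) ∧
      ∀ q : ℕ, (fun x => w x - (c j).partialSum χ b q x) ∈
        conormalMinus (n := n) ρ (0 + Pi.single j (q : ℝ)) := by
  have hI := hρ.isOpen_inner
  have hIY := hρ.isOpen_inner_onFace j
  obtain ⟨η, hη⟩ := Collar.exists_isCutoff (c := c j) hρ (hεc j)
  have hD := hη.isWeaklyRadial hρ hε.le
  obtain ⟨b, hb, he⟩ := hη.exists_expansion hρ hε (hεc j) hχ (μ := 0) rfl
    ((hw j).of_radial hρ (hV j) hD)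
  refine ⟨b, fun k l => conormalMinus.smooth (hb k l), fun k l hlk m => ?_, he⟩
  -- The operator on M must act along the slices near Y_j. So the radial fields of the other faces
  -- are replaced by ones that are lifts of the given fields W there. Decay does not depend on this
  -- choice.
  choose V' hV' hV'W using fun i => hη.exists_isWeaklyRadial_eq_lift hρ (hεc j) hχ i
    (hV i) (hW i)
  set V'' : ι → VField n M := fun i => if h : i = j then (c j).radial η else V' ⟨i, h⟩ with hV''
  have eD : V'' j = (c j).radial η := dif_pos rfl
  have eV : ∀ i : {k // k ≠ j}, V'' i = V' i := fun i => dif_neg i.2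
  have hV''r : ∀ i, IsWeaklyRadial ρ i (V'' i) := fun i => by
    by_cases h : i = j
    · subst h; rw [eD]; exact hD
    · rw [eV ⟨i, h⟩]; exact hV' ⟨i, h⟩
  obtain ⟨m', rfl⟩ : ∃ m' : ι → ℕ, (fun i : {k // k ≠ j} => m' i) = m :=
    ⟨fun i => if h : i = j then 0 else m ⟨i, h⟩, funext fun i => dif_neg i.2⟩
  set L := (Finset.univ : Finset {k // k ≠ j}).sort (· ≤ ·) with hL
  -- The operator in all directions except j is applied to w. The result has exponents m' at the
  -- other faces and still decays at Y_j, and so do its coefficients on Y_j.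
  obtain ⟨h1, h2⟩ := foldr_radialProd_mem hρ c hV''r hw0
    (fun i => (hw i).of_radial hρ (hV i) (hV''r i)) m' (L.map Subtype.val)
    ((Finset.sort_nodup _ _).map Subtype.val_injective)
  set μ : ι → ℝ := fun i => if i ∈ L.map Subtype.val then (m' i : ℝ) else 0 with hμ
  have hμj : μ j = 0 := if_neg (by simp)
  have hμr : Collar.restr j μ = fun i : {k // k ≠ j} => (m' i : ℝ) := funext fun i => if_pos (by
    rw [List.mem_map]; exact ⟨i, by simp [hL], rfl⟩)
  have h2j := h2 j
  rw [eD] at h2j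
  have h3 := hη.radialDecay hρ hε (hεc j)
    (fun k => by simp only [hμ, Pi.zero_apply]; split_ifs <;> simp) hμj h1 h2j
  obtain ⟨b', hb', he'⟩ := hη.exists_expansion hρ hε (hεc j) hχ hμj h3
  have h4 := Collar.coefficient_eq (c := c j) hρ hε (hεc j) hχ
    (IsInnerOp.foldr_radialProd hIY (fun i : {k // k ≠ j} => m' i) L fun i _ => (hW i).1.1)
    (Collar.isSliceOp_foldr hρ (hεc j) hη (fun i => (hW i).1.1) (fun i => (hV''r i).1.1)
      (half_le_self hε.le) (fun i x hx => by rw [eV i]; exact hV'W i x hx) m' L)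
    (conormalMinus.smooth hw0) (b := b) (b' := b') (fun k l => conormalMinus.smooth (hb k l))
    (ν := 0) rfl hμj (fun q => conormalMinus.smooth (he q))
    (fun q => conormalMinus.foldr_radialProd hρ (he q) (fun i => (hV''r i).1) m' _) he' hlk
  have h5 := conormalMinus.congr hIY (hb' k l) h4.symm
  rw [hμr] at h5
  exact h5

/-- Functions with expansions at all faces are polyhomogeneous. -/
theorem radialDecay_of_expansion (hρ : IsBoundaryDefining (n := n) ρ)
    (c : ∀ j, Collar (n := n) (d := d) ρ j) (hε : 0 < ε) (hεc : ∀ j, ε < (c j).width)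
    (hχ : IsProfile ε χ) {V : ι → VField n M} (hV : ∀ j, IsWeaklyRadial ρ j (V j)) {w : M → ℂ}
    (hw : SmoothIn n ρ w) {b : ∀ j, ℕ → ℕ → face ρ j → ℂ}
    (hb : ∀ j, ∀ k l, l ≤ k → b j k l ∈ conormalMinus (n := d) (onFace ρ j ρ) 0)
    (h : ∀ j, ∀ q : ℕ, 0 < q → (fun x => w x - (c j).partialSum χ (b j) q x) ∈
      conormalMinus (n := n) ρ (0 + Pi.single j (q : ℝ))) :
    w ∈ conormalMinus (n := n) ρ 0 ∧ ∀ j, RadialDecay ρ j (V j) 0 w := by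
  have hI := hρ.isOpen_inner
  have hw0 : w ∈ conormalMinus (n := n) ρ 0 := by
    -- The expansion at a single face, to order one, already shows w ∈ 𝒜^{0-} globally, since the
    -- leading term lies in 𝒜^{0-}.
    rcases isEmpty_or_nonempty ι with hι | ⟨⟨j⟩⟩
    · exact mem_conormalMinus_of_isEmpty hw 0
    · have h1 := conormalMinus.mono (m' := 0)
        (by rw [zero_add]; exact Pi.single_nonneg.2 (Nat.cast_nonneg _)) (h j 1 one_pos)
      have h2 : (c j).partialSum χ (b j) 1 ∈ conormalMinus (n := n) ρ 0 := by
        have := Collar.term_mem (c := c j) hρ (hεc j) hχ (μ := 0) rfl (hb j 0 0 le_rfl) 0 0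
        rw [Nat.cast_zero, Pi.single_zero, add_zero] at this
        exact conormalMinus.congr hI this fun x _ => by simp [Collar.partialSum]
      exact conormalMinus.congr hI (conormalMinus.add hI h1 h2) fun x _ => by ring
  refine ⟨hw0, fun j => ?_⟩
  obtain ⟨η, hη⟩ := Collar.exists_isCutoff (c := c j) hρ (hεc j)
  have hD := hη.isWeaklyRadial hρ hε.le
  refine RadialDecay.of_radial hρ hD (hV j) fun q => ?_
  rcases Nat.eq_zero_or_pos q with rfl | hq
  · rw [Nat.cast_zero, Pi.single_zero, add_zero]
    exact hw0
  -- P_q annihilates the partial sum of the terms k < q near Y_j, and it keeps the remainder in its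
  -- space of order q.
  · obtain ⟨h1, h2⟩ := hη.radialProd_partialSum_mem hρ hε (hεc j) hχ (μ := 0) rfl (b := b j)
      (q := q) (fun k _ l hl => hb j k l hl) le_rfl q
    have h3 := conormalMinus.radialProd hρ (h j q hq) hD.1 q
    refine conormalMinus.congr hI (conormalMinus.add hI h3 h2) fun x hx => ?_
    have h4 := radialProd_sub hI hD.1.1 q hw h1 hx
    simp only at h4
    rw [h4]; ring

end Main

end Corners

end

theorem proposition2p2 {n d p : ℕ}
    {M : Type*} [TopologicalSpace M] [T2Space M] [CompactSpace M]
    [ChartedSpace (EuclideanQuadrant n) M] [IsManifold (Q n) ∞ M]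
    (ρ : Fin p → M → ℝ) (hρ : IsBoundaryDefining (n := n) ρ)
    [∀ j, ChartedSpace (EuclideanQuadrant d) (face ρ j)] [∀ j, IsManifold (Q d) ∞ (face ρ j)]
    (c : ∀ j, Collar (n := n) (d := d) ρ j)
    (ε : ℝ) (hε : 0 < ε) (hεc : ∀ j, ε < (c j).width)
    (χ : ℝ → ℝ) (hχ : ContDiffOn ℝ ∞ χ (Set.Ici 0))
    (hχ_one : ∀ t ∈ Set.Icc 0 (ε / 2), χ t = 1) (hχ_zero : ∀ t ∈ Set.Ici ε, χ t = 0)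
    (V : Fin p → VField n M) (hV : ∀ j, IsRadial ρ j (V j))
    (W : ∀ j : Fin p, {k // k ≠ j} → VField d (face ρ j))
    (hW : ∀ j k, IsRadial (onFace ρ j ρ) k (W j k))
    (β : Fin p → M → ℝ) (hβ : ∀ j, ContMDiff (Q n) 𝓘(ℝ, ℝ) ∞ (β j))
    (u : M → ℂ) (hu : ContMDiffOn (Q n) 𝓘(ℝ, ℂ) ∞ u (Corners.inner ρ)) :
    u ∈ polyhom ρ V β ↔
      ∀ j, ∃ a : ℕ → ℕ → face ρ j → ℂ,
        (∀ k l, l ≤ k → a k l ∈ polyhom (onFace ρ j ρ) (W j) (onFace ρ j β)) ∧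
        HasExpansion (c j) χ β u a := by
  have hIM := hρ.isOpen_inner
  have hprof : IsProfile ε χ := ⟨hχ, hχ_one, hχ_zero⟩
  have hVr := fun j => (hV j).isWeaklyRadial
  have hWr := fun j k => (hW j k).isWeaklyRadial
  have hρY : ∀ j k, ContMDiff (Q d) 𝓘(ℝ, ℝ) ∞ (onFace ρ j ρ k) := fun j k =>
    (hρ.smooth k).comp (c j).contMDiff_coe
  have hβY : ∀ j k, ContMDiff (Q d) 𝓘(ℝ, ℝ) ∞ (onFace ρ j β k) := fun j k =>
    (hβ k).comp (c j).contMDiff_coe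
  have hws : SmoothIn n ρ (fun x => (rhoPow ρ (fun k y => -β k y) x : ℂ) * u x) :=
    contMDiffOn_mul_complex (smoothIn_rhoPow hρ.smooth fun k => (hβ k).neg) hu
  have hq : ∀ (j : Fin p) (q : ℕ), (fun i => if i = j then (q : ℝ) else 0) =
      0 + Pi.single j (q : ℝ) := fun j q => by
    funext i
    simp [Pi.single_apply]
  constructor
  · intro h j
    obtain ⟨hw0, hw⟩ := (radialOp_mem_iff hρ c hVr).1 h.2
    obtain ⟨b, hbs, hb, he⟩ := exists_polyhomogeneous_coefficients hρ c hε hεc hprof hVr hw0 hw j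
      (hWr j)
    have hIY := hρ.isOpen_inner_onFace j
    have hab : ∀ k l, EqOn (fun y => (rhoPow (onFace ρ j ρ) (fun i z => -onFace ρ j β i z) y : ℂ) *
        ((rhoPow (onFace ρ j ρ) (onFace ρ j β) y : ℂ) * b k l y)) (b k l)
        (Corners.inner (onFace ρ j ρ)) := fun k l y hy => by
      simp only
      rw [← mul_assoc, rhoPow_neg_mul _ hy, one_mul]
    -- The weight of the face is put back: a = ρ^{β^{(j)}} b, while b are the coefficients of
    -- ρ^{-β}u.
    refine ⟨fun k l y => (rhoPow (onFace ρ j ρ) (onFace ρ j β) y : ℂ) * b k l y,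
      fun k l hlk => ⟨contMDiffOn_mul_complex (smoothIn_rhoPow (hρY j) (hβY j)) (hbs k l),
        fun m => ?_⟩, fun q _ => ?_⟩
    · exact conormalMinus.congr hIY (hb k l hlk m)
        ((IsInnerOp.foldr_radialProd hIY m _ fun i _ => (hWr j i).1.1).congr (hab k l))
    · rw [hq]
      refine conormalMinus.congr hIM (he q) fun x hx => ?_
      refine congrArg (_ - ·) (Finset.sum_congr rfl fun k _ => Finset.sum_congr rfl fun l _ => ?_)
      simp only [Collar.term, Collar.extend]
      split_ifs with hxd
      · rw [← mul_assoc (rhoPow (onFace ρ j ρ) (fun i z => -onFace ρ j β i z) _ : ℂ),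
          rhoPow_neg_mul _ ((c j).proj_mem hρ hxd hx), one_mul]
      · rfl
  · intro h
    choose a ha he using h
    refine ⟨hu, (radialOp_mem_iff hρ c hVr).2 (radialDecay_of_expansion hρ c hε hεc hprof hVr hws
      (b := fun j k l y => (rhoPow (onFace ρ j ρ) (fun i z => -onFace ρ j β i z) y : ℂ) * a j k l y)
      (fun j k l hlk => ?_) fun j q hq0 => ?_)⟩
    -- With m = 0 no operator is applied. The converse uses only that the coefficients without their
    -- weight lie in 𝒜^{0-}.
    · have := (ha j k l hlk).2 0
      rw [radialOp_zero] at this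
      simp only [Pi.zero_apply, Nat.cast_zero] at this
      exact this
    · have := he j q hq0
      rw [hq] at this
      exact this
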